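/- Let $m>0$ and $0<q^2\le m^2$, and let $(\tilde{\mathcal M},\tilde{\boldsymbol g})$ be the maximally extended Reissner–Nordström spacetime of mass $m$ and charge $q$, with signature $(+,-,-,-)$, whose domain of outer communication is the exterior region $\{t\in\mathbb R,\ r>r_+\}$ with $$\tilde{\boldsymbol g}=D(r)\,dt^2-D(r)^{-1}dr^2-r^2(d\theta^2+\sin^2\theta\,d\varphi^2),\qquad D(r)=1-\frac{2m}{r}+\frac{q^2}{r^2},\qquad r_\pm=m\pm\sqrt{m^2-q^2}.$$ Put $r_\circledast=\tfrac54 m+\tfrac14\sqrt{25m^2-24q^2}$. A conformal curve (with $\tilde{\boldsymbol H}=0$) is a curve $x(\tau)$ with a 1-form $b(\tau)$ along it such that $$\tilde\nabla_{\dot x}\dot x=-2\langle b,\dot x\rangle\dot x+\tilde{\boldsymbol g}(\dot x,\dot x)\,b^\sharp,\qquad \tilde\nabla_{\dot x}b=\langle b,\dot x\rangle b-\tfrac12\tilde{\boldsymbol g}^\sharp(b,b)\,\dot x^\flat .$$ Consider the congruence of timelike conformal curves that start at $\tau=0$ from the points of the slice $\{t=0,\ r=r_*\}$, $r_*\in(r_+,\infty)$,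 of the domain of outer communication, with $$\Theta_*\,\dot x(0)=D(r_*)^{-1/2}\,\partial_t,\qquad b(0)=-\frac{2}{r_*}\,dr,\qquad \Theta_*=\frac1{r_*^2},$$ so that they are orthogonal to the slice. The parameter $\tau$ is the conformal proper time, and $\bar\tau=\int_0^\tau\sqrt{\tilde{\boldsymbol g}(\dot x,\dot x)}\,ds$ is the physical proper time. Then: (a) Each curve of the congruence exists for all $\bar\tau\in\mathbb R$, and this corresponds to a bounded interval $(-T,T)$ of conformal proper time, with $T$ depending on $r_*$. Moreover: (i) the curves with $r_*\in(r_\circledast,\infty)$ reach future and past null infinity as $\tau\to T$ and $\tau\to -T$, that is, in an infinite amount of physical proper time but a finite amount of conformal proper time; (ii) the curves with $r_*=r_\circledast$ reach future and past timelike infinity as $\tau\to T$ and $\tau\to-T$, that is, in an infinite amount of physical proper time but a finite amount of conformal proper time; (iii) the curves with $r_*\in(r_+,r_\circledast)$ reach the event horizon $r=r_+$, towards the future and towards the past, in a finite amount of both physical and conformal proper time. (b) A point of a curve of the congruence is a conjugate point if the tangent vector and the deviation vectors (the derivatives of the congruence with respect to $\tau$, and to $r_*$ and the angles labelling the curves)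 are linearly dependent there. (i) If $q^2\le\tfrac89m^2$, the congruence is free of conjugate points in the domain of outer communication. (ii) In the extremal case $q^2=m^2$, there exists $r_\star\in(r_+,r_\circledast)$ such that the subcongruence defined by $r_*\in(r_\star,\infty)$ is free of conjugate points in the domain of outer communication. -/

import Mathlib

open Filter Topology

noncomputable section

namespace RN

/-! ### Constants and functions of the Reissner-Nordström family (mass `m`, charge `q`) -/

/-- `D(r) = 1 - 2m/r + q²/r²`. -/
def D (m q r : ℝ) : ℝ := 1 - 2 * m / r + q ^ 2 / r ^ 2

/-- The radius of the event horizon. -/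
def rPlus (m q : ℝ) : ℝ := m + √(m ^ 2 - q ^ 2)

/-- The radius of the Cauchy horizon. -/
def rMinus (m q : ℝ) : ℝ := m - √(m ^ 2 - q ^ 2)

/-- The critical radius `r_⊛`. -/
def rCrit (m q : ℝ) : ℝ := 5 / 4 * m + 1 / 4 * √(25 * m ^ 2 - 24 * q ^ 2)

open Classical in
/-- A primitive of `1 / D(r)` (the tortoise coordinate), so that `u = t - tortoise r` and
`v = t + tortoise r` are the Eddington-Finkelstein null coordinates. -/
def tortoise (m q r : ℝ) : ℝ :=
  if q ^ 2 = m ^ 2 then r - m ^ 2 / (r - m) + 2 * m * Real.log |r - m|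
  else r + rPlus m q ^ 2 / (rPlus m q - rMinus m q) * Real.log |r - rPlus m q|
    - rMinus m q ^ 2 / (rPlus m q - rMinus m q) * Real.log |r - rMinus m q|

/-! ### The maximal analytic extension

It is glued from explicit coordinate patches of the two-dimensional quotient by the rotations.

* `static`: the coordinates `(t, r)`, `r > r₊`, of one exterior region, with quotient metric
  `D dt² - dr² / D`.
* `strip k`: Eddington-Finkelstein coordinates `(v, r)`, `r > 0`, with quotient metric
  `D dv² - 2 dv dr`; the static patch is the part `r > r₊` of `strip 0`, through `v = t + r^#`
  (`r^#` is the tortoise coordinate).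
* `saddle k` (non-extremal case only): coordinates `(X, Y)` around a bifurcation sphere, at the
  event horizon radius for even `k` and at the Cauchy horizon radius for odd `k`. With `ρ` this
  radius and `κ = D'(ρ) / 2`, the area radius is `r = ρ + X Y`, and on `X ≠ 0` the patch is related
  to the two neighbouring strips `k - 1` and `k` through `v = log |X| / κ`.

In the non-extremal case the strips are joined by the saddle patches. In the extremal case there
are no bifurcation spheres; consecutive strips `(v, r)`, `(v', r)` overlap in a block where
`r < m` or `r > m`, in turn, with `v + v' = 2 r^#` (so `-v'` is the other Eddington-Finkelstein
null coordinate of that block). -/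

/-- The labels of the coordinate patches. -/
inductive Patch where
  | static : Patch
  | strip : ℤ → Patch
  | saddle : ℤ → Patch

open Classical in
/-- The horizon radius at the centre of `saddle k`. -/
def saddleRadius (m q : ℝ) (k : ℤ) : ℝ := if Even k then rPlus m q else rMinus m q

open Classical in
/-- The other horizon radius. -/
def oppositeRadius (m q : ℝ) (k : ℤ) : ℝ := if Even k then rMinus m q else rPlus m q

/-- `κ = D'(ρ) / 2` for `ρ` the horizon radius at the centre of `saddle k`. -/
def surfaceGravity (m q : ℝ) (k : ℤ) : ℝ :=
  (saddleRadius m q k - oppositeRadius m q k) / (2 * saddleRadius m q k ^ 2)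

/-- The area radius in terms of the coordinates of a patch. -/
def patchRadius (m q : ℝ) : Patch → ℝ → ℝ → ℝ
  | .static, _, b => b
  | .strip _, _, b => b
  | .saddle k, a, b => saddleRadius m q k + a * b

/-- The range of the coordinates of a patch. -/
def InPatch (m q : ℝ) : Patch → ℝ → ℝ → Prop
  | .static, _, b => rPlus m q < b
  | .strip _, _, b => 0 < b
  | .saddle k, a, b => q ^ 2 < m ^ 2 ∧ 0 < saddleRadius m q k + a * b

/-- A point of the disjoint union of the patches. -/
structure PatchPoint (m q : ℝ) where
  patch : Patch
  a : ℝ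
  b : ℝ
  mem : InPatch m q patch a b

/-- The identifications between the patches. -/
inductive Glue (m q : ℝ) : PatchPoint m q → PatchPoint m q → Prop
  | static_strip (t r : ℝ) (h : InPatch m q .static t r)
      (h' : InPatch m q (.strip 0) (t + tortoise m q r) r) :
      Glue m q ⟨.static, t, r, h⟩ ⟨.strip 0, t + tortoise m q r, r, h'⟩
  | saddle_strip (k j : ℤ) (hj : j = k - 1 ∨ j = k) (X Y : ℝ) (hX : X ≠ 0)
      (hside : 0 < X ↔ Even j) (h : InPatch m q (.saddle k) X Y)
      (h' : InPatch m q (.strip j) (Real.log |X| / surfaceGravity m q k)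
        (saddleRadius m q k + X * Y)) :
      Glue m q ⟨.saddle k, X, Y, h⟩
        ⟨.strip j, Real.log |X| / surfaceGravity m q k, saddleRadius m q k + X * Y, h'⟩
  | strip_strip (k : ℤ) (v r : ℝ) (hext : q ^ 2 = m ^ 2)
      (hr : Even k ∧ r < m ∨ Odd k ∧ m < r) (h : InPatch m q (.strip k) v r)
      (h' : InPatch m q (.strip (k + 1)) (2 * tortoise m q r - v) r) :
      Glue m q ⟨.strip k, v, r, h⟩ ⟨.strip (k + 1), 2 * tortoise m q r - v, r, h'⟩

/-- The quotient of the extended spacetime by the rotations. -/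
def Base (m q : ℝ) : Type := Quot (Glue m q)

/-- The ambient space of the unit sphere. -/
abbrev E3 : Type := EuclideanSpace ℝ (Fin 3)

/-- The unit sphere. -/
abbrev S2 : Type := Metric.sphere (0 : E3) 1

/-- The set of points of the (maximally extended) Reissner-Nordström spacetime. -/
abbrev Spacetime (m q : ℝ) : Type := Base m q × S2

/-- The area radius of a point of the quotient. -/
def baseRadius (m q : ℝ) : Base m q → ℝ :=
  Quot.lift (fun p => patchRadius m q p.patch p.a p.b) (by
    rintro _ _ (_ | _ | _) <;> rfl)

/-- The area radius of a point of the spacetime. -/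
def radius (m q : ℝ) (p : Spacetime m q) : ℝ := baseRadius m q p.1

/-- The domain of outer communication: the exterior region covered by the static patch. -/
def domainOfOuterCommunication (m q : ℝ) : Set (Spacetime m q) :=
  {p | ∃ (t r : ℝ) (h : InPatch m q .static t r), p.1 = Quot.mk _ ⟨.static, t, r, h⟩}

/-! ### Coordinates and metric -/

/-- Coordinates `(a, b, θ, φ)`, where `(a, b)` are the coordinates of a patch. -/
abbrev Coord : Type := Fin 4 → ℝ

/-- The unit vector with spherical coordinates `(θ, φ)`. -/
def sph (θ φ : ℝ) : E3 :=
  !₂[Real.sin θ * Real.cos φ, Real.sin θ * Real.sin φ, Real.cos θ]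

/-- `p` has the coordinates `y` in the patch `P`, with the spherical coordinates `(θ, φ)` taken
with respect to the axes rotated by `R`. (Rotated axes are needed to reach the poles. The angle
`φ` is not restricted to a period: only local coordinates are needed.) -/
def HasCoords (m q : ℝ) (P : Patch) (R : E3 ≃ₗᵢ[ℝ] E3) (p : Spacetime m q) (y : Coord) : Prop :=
  (∃ h : InPatch m q P (y 0) (y 1), p.1 = Quot.mk _ ⟨P, y 0, y 1, h⟩) ∧
    0 < y 2 ∧ y 2 < Real.pi ∧ (p.2 : E3) = R (sph (y 2) (y 3))

/-- The spacetime metric, of signature `(+,-,-,-)`, in the coordinates of a patch. In a saddle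
patch the quotient metric is `-(2 / κ) dX dY + (G / κ²) Y² dX²` with
`G(r) = (D(r) - D'(ρ) (r - ρ)) / (r - ρ)²`, written without the removable singularity. -/
def metric (m q : ℝ) : Patch → Coord → Matrix (Fin 4) (Fin 4) ℝ
  | .static, y =>
      !![D m q (y 1), 0, 0, 0;
         0, -(D m q (y 1))⁻¹, 0, 0;
         0, 0, -(y 1) ^ 2, 0;
         0, 0, 0, -((y 1) ^ 2 * Real.sin (y 2) ^ 2)]
  | .strip _, y =>
      !![D m q (y 1), -1, 0, 0;
         -1, 0, 0, 0;
         0, 0, -(y 1) ^ 2, 0;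
         0, 0, 0, -((y 1) ^ 2 * Real.sin (y 2) ^ 2)]
  | .saddle k, y =>
      let ρ := saddleRadius m q k
      let ρ' := oppositeRadius m q k
      let κ := surfaceGravity m q k
      let r := ρ + y 0 * y 1
      let G := ((ρ' - ρ) * r + ρ * ρ') / (r ^ 2 * ρ ^ 2)
      !![G / κ ^ 2 * (y 1) ^ 2, -(1 / κ), 0, 0;
         -(1 / κ), 0, 0, 0;
         0, 0, -r ^ 2, 0;
         0, 0, 0, -(r ^ 2 * Real.sin (y 2) ^ 2)]

/-! ### Conformal curves in coordinates -/

/-- A metric (or any matrix-valued function) in coordinates. -/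
abbrev CoordMetric : Type := Coord → Matrix (Fin 4) (Fin 4) ℝ

/-- The partial derivative with respect to the coordinate `μ`. -/
def partialDeriv (μ : Fin 4) (f : Coord → ℝ) (y : Coord) : ℝ :=
  deriv (fun s => f (Function.update y μ s)) (y μ)

/-- The Christoffel symbols `Γ^l_{μ ν}` of the Levi-Civita connection of `g`. -/
def christoffel (g : CoordMetric) (y : Coord) (l μ ν : Fin 4) : ℝ :=
  1 / 2 * ∑ ρ, (g y)⁻¹ l ρ *
    (partialDeriv μ (fun z => g z ρ ν) y + partialDeriv ν (fun z => g z ρ μ) y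
      - partialDeriv ρ (fun z => g z μ ν) y)

/-- The covariant derivative of the vector field `V` along the curve `ξ`. -/
def covDerivVec (g : CoordMetric) (ξ V : ℝ → Coord) (s : ℝ) : Coord := fun l =>
  deriv V s l + ∑ μ, ∑ ν, christoffel g (ξ s) l μ ν * deriv ξ s μ * V s ν

/-- The covariant derivative of the 1-form `b` along the curve `ξ`. -/
def covDerivForm (g : CoordMetric) (ξ b : ℝ → Coord) (s : ℝ) : Coord := fun μ =>
  deriv b s μ - ∑ l, ∑ ν, christoffel g (ξ s) l ν μ * deriv ξ s ν * b s l

/-- The metric on vectors. -/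
def gVec (g : CoordMetric) (y v w : Coord) : ℝ := ∑ μ, ∑ ν, g y μ ν * v μ * w ν

/-- The metric on 1-forms. -/
def gForm (g : CoordMetric) (y b c : Coord) : ℝ := ∑ μ, ∑ ν, (g y)⁻¹ μ ν * b μ * c ν

/-- The pairing of a 1-form and a vector. -/
def pairing (b v : Coord) : ℝ := ∑ μ, b μ * v μ

/-- The vector `b^♯`. -/
def sharp (g : CoordMetric) (y b : Coord) : Coord := fun μ => ∑ ν, (g y)⁻¹ μ ν * b ν

/-- The 1-form `v^♭`. -/
def flat (g : CoordMetric) (y v : Coord) : Coord := fun μ => ∑ ν, g y μ ν * v ν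

/-- The conformal curve equations, with vanishing tensor `H`, for the curve `ξ` and the 1-form `b`
along it, at the parameter `s`:
`∇_ẋ ẋ = -2⟨b, ẋ⟩ ẋ + g(ẋ, ẋ) b^♯` and `∇_ẋ b = ⟨b, ẋ⟩ b - ½ g^♯(b, b) ẋ^♭`. -/
structure ConformalCurveEq (g : CoordMetric) (ξ b : ℝ → Coord) (s : ℝ) : Prop where
  contDiffAt_curve : ContDiffAt ℝ 2 ξ s
  contDiffAt_form : ContDiffAt ℝ 1 b s
  eq_curve : covDerivVec g ξ (deriv ξ) s =
    (-2 * pairing (b s) (deriv ξ s)) • deriv ξ s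
      + gVec g (ξ s) (deriv ξ s) (deriv ξ s) • sharp g (ξ s) (b s)
  eq_form : covDerivForm g ξ b s =
    pairing (b s) (deriv ξ s) • b s
      - (1 / 2 * gForm g (ξ s) (b s) (b s)) • flat g (ξ s) (deriv ξ s)

/-! ### Conformal curves in the spacetime -/

/-- Near the parameter `τ`, the curve `x` has the coordinates `ξ` in the patch `P` (with axes `R`),
it is timelike, it satisfies the conformal curve equations with the 1-form of components `b`, and
`σ` is its proper time for the spacetime metric, `σ' = √(g(ẋ, ẋ))`. -/
def LocalConformalCurve (m q : ℝ) (x : ℝ → Spacetime m q) (σ : ℝ → ℝ)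
    (P : Patch) (R : E3 ≃ₗᵢ[ℝ] E3) (ξ b : ℝ → Coord) (τ : ℝ) : Prop :=
  ∀ᶠ s in 𝓝 τ, HasCoords m q P R (x s) (ξ s) ∧
    0 < gVec (metric m q P) (ξ s) (deriv ξ s) (deriv ξ s) ∧
    ConformalCurveEq (metric m q P) ξ b s ∧
    HasDerivAt σ √(gVec (metric m q P) (ξ s) (deriv ξ s) (deriv ξ s)) s

/-- `x` is a timelike conformal curve on `I` and `σ` is a physical proper time along it. The first
conformal curve equation determines the 1-form from a timelike curve, so that the local 1-forms
are the components of one 1-form along `x`. -/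
def IsTimelikeConformalCurveOn (m q : ℝ) (I : Set ℝ) (x : ℝ → Spacetime m q) (σ : ℝ → ℝ) : Prop :=
  ∀ τ ∈ I, ∃ (P : Patch) (R : E3 ≃ₗᵢ[ℝ] E3) (ξ b : ℝ → Coord), LocalConformalCurve m q x σ P R ξ b τ

/-- The value `Θ_* = 1 / r_*²` of the conformal factor on the time symmetric slice `t = 0`. -/
def initialConformalFactor (rStar : ℝ) : ℝ := 1 / rStar ^ 2

/-- The curve `x` of conformal proper time `τ ∈ (-T, T)` is the curve of the congruence that starts
at `τ = 0` from the point of the slice `t = 0` with radius `rStar` and angular position `ω`: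
its physical unit tangent `Θ_* ẋ` is there the future unit normal `D_*^(-1/2) ∂_t` of the slice, and
`b = Θ_*⁻¹ dΘ_* = -(2 / rStar) dr`. Here `σ` is the physical proper time from the slice. -/
structure IsCongruenceCurve (m q rStar : ℝ) (ω : S2) (T : ℝ) (x : ℝ → Spacetime m q)
    (σ : ℝ → ℝ) : Prop where
  pos : 0 < T
  conformalCurve : IsTimelikeConformalCurveOn m q (Set.Ioo (-T) T) x σ
  properTime_zero : σ 0 = 0
  angular_zero : (x 0).2 = ω
  initial : ∃ (R : E3 ≃ₗᵢ[ℝ] E3) (ξ b : ℝ → Coord), LocalConformalCurve m q x σ .static R ξ b 0 ∧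
    ξ 0 0 = 0 ∧ ξ 0 1 = rStar ∧
    initialConformalFactor rStar • deriv ξ 0 = ![1 / √(D m q rStar), 0, 0, 0] ∧
    b 0 = ![0, -(2 / rStar), 0, 0]

/-! ### Asymptotic behaviour -/

/-- Along the filter `l`, the curve `x` lies in the domain of outer communication, with static
coordinates `t`, `r`. -/
def HasStaticCoordsAlong (m q : ℝ) (x : ℝ → Spacetime m q) (l : Filter ℝ) (t r : ℝ → ℝ) : Prop :=
  ∀ᶠ τ in l, ∃ h : InPatch m q .static (t τ) (r τ), (x τ).1 = Quot.mk _ ⟨.static, t τ, r τ, h⟩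

/-- `x` reaches future null infinity along `l`: in the coordinates `(u, 1 / r, angles)`, in which
future null infinity is `1 / r = 0`, it has a limit there. -/
def ReachesFutureNullInfinity (m q : ℝ) (x : ℝ → Spacetime m q) (l : Filter ℝ) : Prop :=
  ∃ t r : ℝ → ℝ, HasStaticCoordsAlong m q x l t r ∧ Tendsto r l atTop ∧
    (∃ u : ℝ, Tendsto (fun τ => t τ - tortoise m q (r τ)) l (𝓝 u)) ∧
    ∃ ω : S2, Tendsto (fun τ => (x τ).2) l (𝓝 ω)

/-- `x` reaches past null infinity along `l`. -/
def ReachesPastNullInfinity (m q : ℝ) (x : ℝ → Spacetime m q) (l : Filter ℝ) : Prop :=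
  ∃ t r : ℝ → ℝ, HasStaticCoordsAlong m q x l t r ∧ Tendsto r l atTop ∧
    (∃ v : ℝ, Tendsto (fun τ => t τ + tortoise m q (r τ)) l (𝓝 v)) ∧
    ∃ ω : S2, Tendsto (fun τ => (x τ).2) l (𝓝 ω)

/-- `x` reaches future timelike infinity along `l`: both null coordinates tend to `+∞`. -/
def ReachesFutureTimelikeInfinity (m q : ℝ) (x : ℝ → Spacetime m q) (l : Filter ℝ) : Prop :=
  ∃ t r : ℝ → ℝ, HasStaticCoordsAlong m q x l t r ∧
    Tendsto (fun τ => t τ - tortoise m q (r τ)) l atTop ∧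
    Tendsto (fun τ => t τ + tortoise m q (r τ)) l atTop

/-- `x` reaches past timelike infinity along `l`: both null coordinates tend to `-∞`. -/
def ReachesPastTimelikeInfinity (m q : ℝ) (x : ℝ → Spacetime m q) (l : Filter ℝ) : Prop :=
  ∃ t r : ℝ → ℝ, HasStaticCoordsAlong m q x l t r ∧
    Tendsto (fun τ => t τ - tortoise m q (r τ)) l atBot ∧
    Tendsto (fun τ => t τ + tortoise m q (r τ)) l atBot

/-! ### Conjugate points -/

/-- The family `x rStar ω τ` is not conjugate at the parameters `(rStar, ω, τ)`: in local
coordinates it is continuously differentiable in `(τ, rStar, θ, φ)` there, `(θ, φ)` being spherical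
coordinates of the label `ω`, and the tangent vector `∂x/∂τ` and the deviation vectors
`∂x/∂rStar`, `∂x/∂θ`, `∂x/∂φ` are linearly independent. -/
def NotConjugateAt (m q : ℝ) (x : ℝ → S2 → ℝ → Spacetime m q)
    (rStar : ℝ) (ω : S2) (τ : ℝ) : Prop :=
  ∃ (P : Patch) (R : E3 ≃ₗᵢ[ℝ] E3) (Ξ : Coord → Coord) (p : Coord),
    p 0 = τ ∧ p 1 = rStar ∧ 0 < p 2 ∧ p 2 < Real.pi ∧ (ω : E3) = R (sph (p 2) (p 3)) ∧
    (∀ᶠ p' in 𝓝 p, ∀ ω' : S2, (ω' : E3) = R (sph (p' 2) (p' 3)) →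
      HasCoords m q P R (x (p' 1) ω' (p' 0)) (Ξ p')) ∧
    ContDiffAt ℝ 1 Ξ p ∧
    LinearIndependent ℝ (fun i : Fin 4 => fderiv ℝ Ξ p (Pi.single i 1))

end RN

end

/-!
# Conformal curves in the Reissner-Nordström spacetime

Along a curve of the congruence the conformal curve equations can be integrated once. In a
rotation invariant two-dimensional problem they say that the curve, in its physical proper time
`σ`, has an acceleration of constant length `β`, and that the 1-form is `β N - (β τ / T) U`, with
`U` and `N` dual to the unit tangent and the unit normal
(`UniformlyAccelerated.conformalCurveEq`). The relation between the two parameters is then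
`σ = (2 / β) artanh (τ / T)`, whatever the geometry; so a bounded interval of conformal proper
time corresponds to all physical proper times (`bijOn_properTime`). The initial data with radius
`s` give `β = 2 √D(s) / s` and `T = 1 / (s √D(s))`.

The static Killing vector makes the energy `E = D dt/dσ` an affine function of the radius,
`E = β r - √D(s)`, and `(dr/dσ)² = E² - D = (r - s) M(r) / (r² s²)` with a cubic `M`. The sign of
`M(s)` is that of `s - r_⊛`. For `s > r_⊛` the radius increases to infinity, and the retarded time
converges, because its rate `1 / (E + v)` is dominated by `(-1 / r)'`; for `s = r_⊛` the radius is
constant; for `s < r_⊛` the motion is an oscillation `r = s - b sin² χ` between `s` and a radius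
inside the Cauchy horizon, with a phase `χ` that runs from `-∞` to `∞`
(`exists_radialMotion_of_ge`, `exists_radialMotion_of_lt`).

An oscillating curve crosses infinitely many patches of the extension. Since `(E - v)(E + v) = D`,
the horizons it crosses are the zeros of the factors `E ∓ v`. Without extremality, each zero of
`E - v` is covered by a saddle patch, in which the coordinates of the curve are explicit in terms
of `Q = (r - ρ) / (E - v)`; in the extremal case strips suffice. The integration constants of the
patches are fixed one after the other by the overlaps (`RadialMotion.exists_saddle_curve`,
`RadialMotion.exists_strip_curve`).

For the conjugate points, write `r = s + c z²`, with `c` the radial force at the start. The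
parameter `z` obeys a first-order equation that is regular at the turning point, which shows that
the exterior part of the congruence depends smoothly on `(σ, s)`. In static coordinates the
determinant of the tangent and deviation vectors is `dσ/dτ` times the Jacobian `W` of `(t, r)`
with respect to `(σ, s)`, and `W` solves `W'' = (β² - D''(r) / 2) W + dβ/ds` with
`W(0) = 1 / √D(s)`, `W'(0) = 0` (`HasRadialMotions.hasDerivAt_deviation`). Where `D'' ≤ 0`, that
is `3 q² ≤ 2 m r`, this keeps `W` above its initial value; `q² ≤ 8 m² / 9` makes it so in the
whole exterior region, and in the extremal case it is so for `s ≥ r_⊛`. For the other extremal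
curves with `s > 29 m / 20`, the coefficient `β² - D'' / 2` is still nonnegative down to
`r = 13 m / 10`, and from there on a first integral of the equation shows that `W / (-v)`
increases (`DeviationMotion.pos_of_extremal`).
-/

noncomputable section

namespace RN

/-! ### Conformal curves from uniformly accelerated curves -/

/-- Along the curve `γ` the vector `n` is a unit normal (of square `-1`) to the unit tangent, `U`
and `N` are the 1-forms dual to the tangent and to `n`, and the frame rotates hyperbolically at the
rate `β`: the acceleration is `β n`, and `∇ U = β N`, `∇ N = β U`. -/
structure UniformlyAccelerated (g : CoordMetric) (β : ℝ) (γ n U N : ℝ → Coord) (s : ℝ) :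
    Prop where
  contDiffAt_curve : ContDiffAt ℝ 2 γ s
  contDiffAt_tangentForm : ContDiffAt ℝ 1 U s
  contDiffAt_normalForm : ContDiffAt ℝ 1 N s
  sharp_tangentForm : sharp g (γ s) (U s) = deriv γ s
  sharp_normalForm : sharp g (γ s) (N s) = n s
  flat_tangent : flat g (γ s) (deriv γ s) = U s
  pairing_tangent : pairing (U s) (deriv γ s) = 1
  pairing_normal_tangent : pairing (N s) (deriv γ s) = 0
  pairing_tangent_normal : pairing (U s) (n s) = 0
  pairing_normal : pairing (N s) (n s) = -1
  covDerivVec_tangent : covDerivVec g γ (deriv γ) s = β • n s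
  covDerivForm_tangentForm : covDerivForm g γ U s = β • N s
  covDerivForm_normalForm : covDerivForm g γ N s = β • U s

theorem gVec_eq_pairing_flat (g : CoordMetric) (y v : Coord) :
    gVec g y v v = pairing (flat g y v) v := by
  simp only [gVec, pairing, flat, Finset.sum_mul]
  exact Finset.sum_congr rfl fun μ _ => Finset.sum_congr rfl fun ν _ => by ring

theorem gForm_eq_pairing_sharp (g : CoordMetric) (y b c : Coord) :
    gForm g y b c = pairing b (sharp g y c) := by
  simp only [gForm, pairing, sharp, Finset.mul_sum]
  exact Finset.sum_congr rfl fun μ _ => Finset.sum_congr rfl fun ν _ => by ring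

theorem sharp_add_smul (g : CoordMetric) (y b c : Coord) (k l : ℝ) :
    sharp g y (k • b + l • c) = k • sharp g y b + l • sharp g y c := by
  ext μ
  simp only [sharp, Pi.add_apply, Pi.smul_apply, smul_eq_mul, Finset.mul_sum,
    ← Finset.sum_add_distrib]
  exact Finset.sum_congr rfl fun ν _ => by ring

theorem flat_smul (g : CoordMetric) (y v : Coord) (k : ℝ) :
    flat g y (k • v) = k • flat g y v := by
  ext μ
  simp only [flat, Pi.smul_apply, smul_eq_mul, Finset.mul_sum]
  exact Finset.sum_congr rfl fun ν _ => by ring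

theorem pairing_smul_right (b v : Coord) (k : ℝ) : pairing b (k • v) = k * pairing b v := by
  simp only [pairing, Pi.smul_apply, smul_eq_mul, Finset.mul_sum]
  exact Finset.sum_congr rfl fun ν _ => by ring

theorem pairing_add_smul (b c v : Coord) (k l : ℝ) :
    pairing (k • b + l • c) v = k * pairing b v + l * pairing c v := by
  simp only [pairing, Pi.add_apply, Pi.smul_apply, smul_eq_mul, Finset.mul_sum,
    ← Finset.sum_add_distrib]
  exact Finset.sum_congr rfl fun ν _ => by ring

theorem pairing_add_right (b v w : Coord) : pairing b (v + w) = pairing b v + pairing b w := by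
  simp only [pairing, Pi.add_apply, ← Finset.sum_add_distrib]
  exact Finset.sum_congr rfl fun ν _ => by ring

/-- Reparametrizing a uniformly accelerated curve by a parameter `τ` with `dσ/dτ = ν`, and adding to
`β N` the tangential 1-form `α U`, gives a conformal curve as soon as `ν' = -α ν²` (the tangential
part of the first equation) and `α' = ν (α² - β²) / 2` (the tangential part of the second). -/
theorem UniformlyAccelerated.conformalCurveEq {g : CoordMetric} {β : ℝ} {γ n U N : ℝ → Coord}
    {σ ν α : ℝ → ℝ} {τ : ℝ} (h : UniformlyAccelerated g β γ n U N (σ τ))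
    (hσ : ∀ᶠ τ' in 𝓝 τ, HasDerivAt σ (ν τ') τ') (hσ2 : ContDiffAt ℝ 2 σ τ)
    (hα1 : ContDiffAt ℝ 1 α τ)
    (hν : HasDerivAt ν (-(α τ) * ν τ ^ 2) τ)
    (hα : HasDerivAt α (ν τ * (α τ ^ 2 - β ^ 2) / 2) τ) :
    gVec g (γ (σ τ)) (deriv (fun τ' => γ (σ τ')) τ) (deriv (fun τ' => γ (σ τ')) τ) = ν τ ^ 2 ∧
    ConformalCurveEq g (fun τ' => γ (σ τ')) (fun τ' => α τ' • U (σ τ') + β • N (σ τ')) τ := by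
  have hσc : ContinuousAt σ τ := hσ.self_of_nhds.continuousAt
  have hγev : ∀ᶠ s in 𝓝 (σ τ), HasDerivAt γ (deriv γ s) s := by
    have := h.contDiffAt_curve.eventually (by simp)
    exact this.mono fun s hs => (hs.differentiableAt (by simp)).hasDerivAt
  have hd : ∀ᶠ τ' in 𝓝 τ, deriv (fun τ' => γ (σ τ')) τ' = ν τ' • deriv γ (σ τ') := by
    filter_upwards [hσ, hσc.eventually hγev] with τ' h1 h2
    exact (HasDerivAt.scomp τ' h2 h1).deriv
  have hd0 := hd.self_of_nhds
  have hγ2 : HasDerivAt (deriv γ) (deriv (deriv γ) (σ τ)) (σ τ) := by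
    have h1 : ContDiffAt ℝ 1 (deriv γ) (σ τ) := h.contDiffAt_curve.derivWithin (by norm_num)
    exact (h1.differentiableAt (by simp)).hasDerivAt
  have hdd : deriv (deriv (fun τ' => γ (σ τ'))) τ =
      (-(α τ) * ν τ ^ 2) • deriv γ (σ τ) + (ν τ ^ 2) • deriv (deriv γ) (σ τ) := by
    rw [Filter.EventuallyEq.deriv_eq hd]
    have h2 := hν.smul (HasDerivAt.scomp τ hγ2 hσ.self_of_nhds)
    refine h2.deriv.trans ?_
    simp only [Function.comp, smul_smul, sq]
    abel
  have hU := (h.contDiffAt_tangentForm.differentiableAt (by simp)).hasDerivAt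
  have hN := (h.contDiffAt_normalForm.differentiableAt (by simp)).hasDerivAt
  have hb : deriv (fun τ' => α τ' • U (σ τ') + β • N (σ τ')) τ =
      (ν τ * (α τ ^ 2 - β ^ 2) / 2) • U (σ τ) + (α τ * ν τ) • deriv U (σ τ)
        + (β * ν τ) • deriv N (σ τ) := by
    have h2 := (hα.smul (HasDerivAt.scomp τ hU hσ.self_of_nhds)).add
      ((HasDerivAt.scomp τ hN hσ.self_of_nhds).const_smul β)
    refine h2.deriv.trans ?_
    simp only [Function.comp, smul_smul]
    abel
  have hg : gVec g (γ (σ τ)) (deriv (fun τ' => γ (σ τ')) τ) (deriv (fun τ' => γ (σ τ')) τ)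
      = ν τ ^ 2 := by
    rw [hd0, gVec_eq_pairing_flat, flat_smul, h.flat_tangent, pairing_smul_right]
    have := pairing_add_smul (U (σ τ)) 0 (deriv γ (σ τ)) (ν τ) 0
    rw [smul_zero, add_zero, zero_mul, add_zero, h.pairing_tangent] at this
    rw [this]; ring
  have hp : pairing (α τ • U (σ τ) + β • N (σ τ)) (deriv (fun τ' => γ (σ τ')) τ) = α τ * ν τ := by
    rw [hd0, pairing_smul_right, pairing_add_smul, h.pairing_tangent, h.pairing_normal_tangent]
    ring
  refine ⟨hg, ?_, ?_, ?_, ?_⟩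
  · exact h.contDiffAt_curve.comp τ hσ2
  · have hσ1 : ContDiffAt ℝ 1 σ τ := hσ2.of_le (by norm_num)
    exact (hα1.smul (h.contDiffAt_tangentForm.comp τ hσ1)).add
      ((h.contDiffAt_normalForm.comp τ hσ1).const_smul β)
  · rw [hg, hp, sharp_add_smul, h.sharp_tangentForm, h.sharp_normalForm]
    have key : covDerivVec g (fun τ' => γ (σ τ')) (deriv fun τ' => γ (σ τ')) τ =
        (-(α τ) * ν τ ^ 2) • deriv γ (σ τ) + (ν τ ^ 2) • covDerivVec g γ (deriv γ) (σ τ) := by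
      ext l
      simp only [covDerivVec, hdd, hd0, Pi.add_apply, Pi.smul_apply, smul_eq_mul, mul_add,
        Finset.mul_sum, add_assoc]
      congr 2
      exact Finset.sum_congr rfl fun μ _ => Finset.sum_congr rfl fun κ _ => by ring
    rw [key, h.covDerivVec_tangent, hd0]
    ext l
    simp only [Pi.add_apply, Pi.smul_apply, smul_eq_mul]
    ring
  · rw [hp, gForm_eq_pairing_sharp, sharp_add_smul, h.sharp_tangentForm, h.sharp_normalForm,
      pairing_add_right, pairing_smul_right, pairing_smul_right, pairing_add_smul,
      pairing_add_smul, h.pairing_tangent, h.pairing_normal_tangent, h.pairing_tangent_normal,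
      h.pairing_normal, hd0, flat_smul, h.flat_tangent]
    have key : covDerivForm g (fun τ' => γ (σ τ')) (fun τ' => α τ' • U (σ τ') + β • N (σ τ')) τ =
        (ν τ * (α τ ^ 2 - β ^ 2) / 2) • U (σ τ) + (α τ * ν τ) • covDerivForm g γ U (σ τ)
          + (β * ν τ) • covDerivForm g γ N (σ τ) := by
      ext l
      simp only [covDerivForm, hb, hd0, Pi.add_apply, Pi.smul_apply, smul_eq_mul, mul_sub,
        Finset.mul_sum]
      have : ∀ a b c S1 S2 S3 : ℝ, S1 = S2 + S3 → a + b + c - S1 = a + (b - S2) + (c - S3) := by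
        intros; linarith
      apply this
      rw [← Finset.sum_add_distrib]
      refine Finset.sum_congr rfl fun μ _ => ?_
      rw [← Finset.sum_add_distrib]
      exact Finset.sum_congr rfl fun κ _ => by ring
    rw [key, h.covDerivForm_tangentForm, h.covDerivForm_normalForm]
    ext l
    simp only [Pi.add_apply, Pi.sub_apply, Pi.smul_apply, smul_eq_mul]
    ring

/-! ### Block metrics -/

/-- The metric of a warped product of a two-dimensional metric `A da² + 2 B da db + C db²`, with
constant `B`, and of the (negative definite) sphere of radius `R`. -/
def blockMetric (A : ℝ → ℝ → ℝ) (B : ℝ) (C R : ℝ → ℝ → ℝ) : CoordMetric := fun y =>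
  !![A (y 0) (y 1), B, 0, 0;
     B, C (y 0) (y 1), 0, 0;
     0, 0, -(R (y 0) (y 1)) ^ 2, 0;
     0, 0, 0, -((R (y 0) (y 1)) ^ 2 * Real.sin (y 2) ^ 2)]

section

variable {A : ℝ → ℝ → ℝ} {B : ℝ} {C R : ℝ → ℝ → ℝ} {y : Coord}

theorem blockMetric_inv (hΔ : A (y 0) (y 1) * C (y 0) (y 1) - B ^ 2 ≠ 0)
    (hR : R (y 0) (y 1) ≠ 0) (hs : Real.sin (y 2) ≠ 0) :
    (blockMetric A B C R y)⁻¹ =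
      !![C (y 0) (y 1) / (A (y 0) (y 1) * C (y 0) (y 1) - B ^ 2),
          -B / (A (y 0) (y 1) * C (y 0) (y 1) - B ^ 2), 0, 0;
         -B / (A (y 0) (y 1) * C (y 0) (y 1) - B ^ 2),
          A (y 0) (y 1) / (A (y 0) (y 1) * C (y 0) (y 1) - B ^ 2), 0, 0;
         0, 0, -1 / (R (y 0) (y 1)) ^ 2, 0;
         0, 0, 0, -1 / ((R (y 0) (y 1)) ^ 2 * Real.sin (y 2) ^ 2)] := by
  apply Matrix.inv_eq_right_inv
  ext i j
  fin_cases i <;> fin_cases j <;>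
    simp [blockMetric, Matrix.mul_apply, Fin.sum_univ_four] <;> field_simp <;> ring

variable (A B C y) in
/-- The Christoffel symbols of the two-dimensional part of a block metric. -/
def blockChristoffel (l μ ν : Fin 2) : ℝ :=
  let a := A (y 0) (y 1)
  let c := C (y 0) (y 1)
  let a0 := deriv (fun s => A s (y 1)) (y 0)
  let a1 := deriv (fun s => A (y 0) s) (y 1)
  let c0 := deriv (fun s => C s (y 1)) (y 0)
  let c1 := deriv (fun s => C (y 0) s) (y 1)
  let k0 := ![c, -B] l / (a * c - B ^ 2) / 2
  let k1 := ![-B, a] l / (a * c - B ^ 2) / 2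
  ![![k0 * a0 - k1 * a1, k0 * a1 + k1 * c0], ![k0 * a1 + k1 * c0, -(k0 * c0) + k1 * c1]] μ ν

theorem christoffel_blockMetric (hΔ : A (y 0) (y 1) * C (y 0) (y 1) - B ^ 2 ≠ 0)
    (hR : R (y 0) (y 1) ≠ 0) (hs : Real.sin (y 2) ≠ 0) (l μ ν : Fin 2) :
    christoffel (blockMetric A B C R) y (Fin.castAdd 2 l) (Fin.castAdd 2 μ) (Fin.castAdd 2 ν) =
      blockChristoffel A B C y l μ ν := by
  rw [christoffel, blockMetric_inv hΔ hR hs]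
  fin_cases l <;> fin_cases μ <;> fin_cases ν <;>
    simp [blockChristoffel, partialDeriv, blockMetric, Fin.sum_univ_four, Function.update] <;> ring

theorem christoffel_blockMetric_zero (hΔ : A (y 0) (y 1) * C (y 0) (y 1) - B ^ 2 ≠ 0)
    (hR : R (y 0) (y 1) ≠ 0) (hs : Real.sin (y 2) ≠ 0) (l μ ν : Fin 2) :
    christoffel (blockMetric A B C R) y (Fin.natAdd 2 l) (Fin.castAdd 2 μ) (Fin.castAdd 2 ν) = 0 ∧
    christoffel (blockMetric A B C R) y (Fin.castAdd 2 l) (Fin.castAdd 2 μ) (Fin.natAdd 2 ν) = 0 :=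
      by
  rw [christoffel, christoffel, blockMetric_inv hΔ hR hs]
  fin_cases l <;> fin_cases μ <;> fin_cases ν <;>
    simp [partialDeriv, blockMetric, Fin.sum_univ_four, Function.update]

end

/-- The coordinate curve `(a, b)` in the two-dimensional part, at fixed angles. -/
def planarCurve (a b : ℝ → ℝ) (θ φ : ℝ) : ℝ → Coord := fun t => ![a t, b t, θ, φ]

theorem hasDerivAt_planarCurve {a b : ℝ → ℝ} {a' b' t : ℝ} (θ φ : ℝ) (ha : HasDerivAt a a' t)
    (hb : HasDerivAt b b' t) : HasDerivAt (planarCurve a b θ φ) ![a', b', 0, 0] t := by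
  rw [hasDerivAt_pi]
  intro i
  fin_cases i
  · exact ha
  · exact hb
  · exact hasDerivAt_const t θ
  · exact hasDerivAt_const t φ

theorem contDiffAt_planarCurve {a b : ℝ → ℝ} {t : ℝ} {n : WithTop ℕ∞} (θ φ : ℝ)
    (ha : ContDiffAt ℝ n a t) (hb : ContDiffAt ℝ n b t) :
    ContDiffAt ℝ n (planarCurve a b θ φ) t := by
  rw [contDiffAt_pi]
  intro i
  fin_cases i
  · exact ha
  · exact hb
  · exact contDiffAt_const
  · exact contDiffAt_const

section

variable {A : ℝ → ℝ → ℝ} {B : ℝ} {C R : ℝ → ℝ → ℝ} {a b : ℝ → ℝ} {θ φ t : ℝ}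

theorem covDerivVec_blockMetric
    (hΔ : A (a t) (b t) * C (a t) (b t) - B ^ 2 ≠ 0)
    (hR : R (a t) (b t) ≠ 0) (hs : Real.sin θ ≠ 0)
    {a' b' v0' v1' : ℝ} {V : ℝ → Coord} {v0 v1 : ℝ} (hVt : V t = ![v0, v1, 0, 0])
    (ha : HasDerivAt a a' t) (hb : HasDerivAt b b' t) (hV : HasDerivAt V ![v0', v1', 0, 0] t) :
    covDerivVec (blockMetric A B C R) (planarCurve a b θ φ) V t =
      let Γ := blockChristoffel A B C (planarCurve a b θ φ t)
      ![v0' + (Γ 0 0 0 * a' * v0 + Γ 0 0 1 * a' * v1 + Γ 0 1 0 * b' * v0 + Γ 0 1 1 * b' * v1),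
        v1' + (Γ 1 0 0 * a' * v0 + Γ 1 0 1 * a' * v1 + Γ 1 1 0 * b' * v0 + Γ 1 1 1 * b' * v1),
        0, 0] := by
  have h1 := christoffel_blockMetric (A := A) (B := B) (C := C) (R := R)
    (y := planarCurve a b θ φ t) hΔ hR hs
  have h2 := christoffel_blockMetric_zero (A := A) (B := B) (C := C) (R := R)
    (y := planarCurve a b θ φ t) hΔ hR hs
  simp only [Fin.forall_fin_two] at h1 h2
  ext l
  simp only [covDerivVec, hV.deriv, (hasDerivAt_planarCurve θ φ ha hb).deriv, hVt,
    Fin.sum_univ_four]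
  fin_cases l <;> simp [← h1] <;> grind

theorem covDerivForm_blockMetric
    (hΔ : A (a t) (b t) * C (a t) (b t) - B ^ 2 ≠ 0)
    (hR : R (a t) (b t) ≠ 0) (hs : Real.sin θ ≠ 0)
    {a' b' v0' v1' : ℝ} {V : ℝ → Coord} {v0 v1 : ℝ} (hVt : V t = ![v0, v1, 0, 0])
    (ha : HasDerivAt a a' t) (hb : HasDerivAt b b' t) (hV : HasDerivAt V ![v0', v1', 0, 0] t) :
    covDerivForm (blockMetric A B C R) (planarCurve a b θ φ) V t =
      let Γ := blockChristoffel A B C (planarCurve a b θ φ t)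
      ![v0' - (Γ 0 0 0 * a' * v0 + Γ 1 0 0 * a' * v1 + Γ 0 1 0 * b' * v0 + Γ 1 1 0 * b' * v1),
        v1' - (Γ 0 0 1 * a' * v0 + Γ 1 0 1 * a' * v1 + Γ 0 1 1 * b' * v0 + Γ 1 1 1 * b' * v1),
        0, 0] := by
  have h1 := christoffel_blockMetric (A := A) (B := B) (C := C) (R := R)
    (y := planarCurve a b θ φ t) hΔ hR hs
  have h2 := christoffel_blockMetric_zero (A := A) (B := B) (C := C) (R := R)
    (y := planarCurve a b θ φ t) hΔ hR hs
  simp only [Fin.forall_fin_two] at h1 h2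
  ext l
  simp only [covDerivForm, hV.deriv, (hasDerivAt_planarCurve θ φ ha hb).deriv, hVt,
    Fin.sum_univ_four]
  fin_cases l <;> simp [← h1] <;> grind

theorem sharp_blockMetric {y : Coord} (hΔ : A (y 0) (y 1) * C (y 0) (y 1) - B ^ 2 ≠ 0)
    (hR : R (y 0) (y 1) ≠ 0) (hs : Real.sin (y 2) ≠ 0) (u v : ℝ) :
    sharp (blockMetric A B C R) y ![u, v, 0, 0] =
      ![(C (y 0) (y 1) * u - B * v) / (A (y 0) (y 1) * C (y 0) (y 1) - B ^ 2),
        (A (y 0) (y 1) * v - B * u) / (A (y 0) (y 1) * C (y 0) (y 1) - B ^ 2), 0, 0] := by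
  ext l
  rw [sharp, blockMetric_inv hΔ hR hs]
  fin_cases l <;> simp [Fin.sum_univ_four] <;> ring

theorem flat_blockMetric {y : Coord} (u v : ℝ) :
    flat (blockMetric A B C R) y ![u, v, 0, 0] =
      ![A (y 0) (y 1) * u + B * v, B * u + C (y 0) (y 1) * v, 0, 0] := by
  ext l
  fin_cases l <;> simp [flat, blockMetric, Fin.sum_univ_four]

theorem pairing_planar (u v u' v' : ℝ) :
    pairing ![u, v, 0, 0] ![u', v', 0, 0] = u * u' + v * v' := by
  simp [pairing, Fin.sum_univ_four]

/-- A criterion in a chart in which the second coordinate lines are null: the normalization of the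
tangent and the first component of the acceleration equation suffice. -/
theorem uniformlyAccelerated_null {β : ℝ} {a1 b1 : ℝ → ℝ} {a2 b2 A0 A1 : ℝ} (hB : B ≠ 0)
    (hR : R (a t) (b t) ≠ 0) (hs : Real.sin θ ≠ 0)
    (ha : ContDiffAt ℝ 2 a t) (hb : ContDiffAt ℝ 2 b t)
    (hA : ContDiffAt ℝ 1 (fun t' => A (a t') (b t')) t)
    (ha1 : ∀ᶠ t' in 𝓝 t, HasDerivAt a (a1 t') t') (hb1 : ∀ᶠ t' in 𝓝 t, HasDerivAt b (b1 t') t')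
    (ha2 : HasDerivAt a1 a2 t) (hb2 : HasDerivAt b1 b2 t)
    (hA0 : HasDerivAt (fun s => A s (b t)) A0 (a t))
      (hA1 : HasDerivAt (fun s => A (a t) s) A1 (b t))
    (hA' : HasDerivAt (fun t' => A (a t') (b t')) (A0 * a1 t + A1 * b1 t) t)
    (hnorm : ∀ᶠ t' in 𝓝 t, A (a t') (b t') * a1 t' ^ 2 + 2 * B * (a1 t' * b1 t') = 1)
    (hacc : a2 = A1 / (2 * B) * a1 t ^ 2 + β * a1 t) :
    UniformlyAccelerated (blockMetric A B (fun _ _ => 0) R) β (planarCurve a b θ φ)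
      (fun t' => ![a1 t', -(A (a t') (b t') * a1 t' + B * b1 t') / B, 0, 0])
      (fun t' => ![A (a t') (b t') * a1 t' + B * b1 t', B * a1 t', 0, 0])
      (fun t' => ![-(B * b1 t'), B * a1 t', 0, 0]) t := by
  have hn0 := hnorm.self_of_nhds
  have hne : a1 t ≠ 0 := by
    rintro h
    simp [h] at hn0
  have hnd : (A0 * a1 t + A1 * b1 t) * a1 t ^ 2 + A (a t) (b t) * (2 * a1 t * a2)
      + 2 * B * (a2 * b1 t + a1 t * b2) = 0 := by
    have e : (fun t' => A (a t') (b t') * a1 t' ^ 2 + 2 * B * (a1 t' * b1 t')) =ᶠ[𝓝 t]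
      fun _ => (1 : ℝ) := hnorm
    have h1 := ((hA'.mul (ha2.pow 2)).add ((ha2.mul hb2).const_mul (2 * B)))
    have h2 := h1.congr_of_eventuallyEq (f₁ := fun _ => (1 : ℝ)) (by
      filter_upwards [e] with t' ht'
      simpa using ht'.symm)
    have := h2.unique (hasDerivAt_const t (1 : ℝ))
    simp at this
    linarith
  have hb2' : b2 = -((A0 * a1 t + A1 * b1 t) * a1 t ^ 2 + A (a t) (b t) * (2 * a1 t * a2)
      + 2 * B * (a2 * b1 t)) / (2 * B * a1 t) := by
    field_simp
    linarith
  have hΔ : A (a t) (b t) * (fun _ _ => (0 : ℝ)) (a t) (b t) - B ^ 2 ≠ 0 := by simpa using hB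
  have hγ := hasDerivAt_planarCurve θ φ ha1.self_of_nhds hb1.self_of_nhds
  have ca1 : ContDiffAt ℝ 1 a1 t := by
    have h1 : ContDiffAt ℝ 1 (deriv a) t := ha.derivWithin (by norm_num)
    exact h1.congr_of_eventuallyEq (ha1.mono fun _ h => h.deriv.symm)
  have cb1 : ContDiffAt ℝ 1 b1 t := by
    have h1 : ContDiffAt ℝ 1 (deriv b) t := hb.derivWithin (by norm_num)
    exact h1.congr_of_eventuallyEq (hb1.mono fun _ h => h.deriv.symm)
  have hdγ : ∀ᶠ t' in 𝓝 t, deriv (planarCurve a b θ φ) t' = ![a1 t', b1 t', 0, 0] := by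
    filter_upwards [ha1, hb1] with t' h1 h2
    exact (hasDerivAt_planarCurve θ φ h1 h2).deriv
  have hV : HasDerivAt (deriv (planarCurve a b θ φ)) ![a2, b2, 0, 0] t :=
    (hasDerivAt_planarCurve 0 0 ha2 hb2).congr_of_eventuallyEq hdγ
  have hU : HasDerivAt (fun t' => (![A (a t') (b t') * a1 t' + B * b1 t', B * a1 t', 0, 0] : Coord))
      ![(A0 * a1 t + A1 * b1 t) * a1 t + A (a t) (b t) * a2 + B * b2, B * a2, 0, 0] t :=
    hasDerivAt_planarCurve 0 0 ((hA'.mul ha2).add (hb2.const_mul B)) (ha2.const_mul B)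
  have hN : HasDerivAt (fun t' => (![-(B * b1 t'), B * a1 t', 0, 0] : Coord))
      ![-(B * b2), B * a2, 0, 0] t :=
    hasDerivAt_planarCurve 0 0 (hb2.const_mul B).neg (ha2.const_mul B)
  have hd0 := hdγ.self_of_nhds
  have eA0 : deriv (fun s => A s (b t)) (a t) = A0 := hA0.deriv
  have eA1 : deriv (fun s => A (a t) s) (b t) = A1 := hA1.deriv
  have e0 : planarCurve a b θ φ t 0 = a t := rfl
  have e1 : planarCurve a b θ φ t 1 = b t := rfl
  constructor
  · exact contDiffAt_planarCurve θ φ ha hb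
  · have c1 : ContDiffAt ℝ 1 (fun t' => A (a t') (b t') * a1 t' + B * b1 t') t :=
      (hA.mul ca1).add (contDiffAt_const.mul cb1)
    exact contDiffAt_planarCurve (a := fun t' => A (a t') (b t') * a1 t' + B * b1 t')
      (b := fun t' => B * a1 t') 0 0 c1 (contDiffAt_const.mul ca1)
  · have c0 : ContDiffAt ℝ 1 (fun t' => B * b1 t') t := contDiffAt_const.mul cb1
    exact contDiffAt_planarCurve (a := fun t' => -(B * b1 t'))
      (b := fun t' => B * a1 t') 0 0 c0.neg (contDiffAt_const.mul ca1)
  · rw [hd0, sharp_blockMetric (y := planarCurve a b θ φ t) hΔ hR hs, e0, e1]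
    ext l
    fin_cases l <;> simp <;> field_simp <;> ring
  · rw [sharp_blockMetric (y := planarCurve a b θ φ t) hΔ hR hs, e0, e1]
    ext l
    fin_cases l <;> simp <;> field_simp <;> ring
  · rw [hd0, flat_blockMetric, e0, e1]
    ext l
    fin_cases l <;> simp
  · rw [hd0, pairing_planar]
    linarith
  · rw [hd0, pairing_planar]
    ring
  · rw [pairing_planar]
    field_simp
    ring
  · rw [pairing_planar]
    field_simp
    linarith
  · rw [covDerivVec_blockMetric hΔ hR hs hd0 ha1.self_of_nhds hb1.self_of_nhds hV]
    ext l
    simp only [blockChristoffel, e0, e1, eA0, eA1]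
    fin_cases l
    · simp [hacc]; field_simp; ring
    · simp [hb2', hacc]; field_simp; ring
    · simp
    · simp
  · rw [covDerivForm_blockMetric hΔ hR hs rfl ha1.self_of_nhds hb1.self_of_nhds hU]
    ext l
    simp only [blockChristoffel, e0, e1, eA0, eA1]
    fin_cases l
    · simp [hb2', hacc]; field_simp; ring
    · simp [hacc]; field_simp; ring
    · simp
    · simp
  · rw [covDerivForm_blockMetric hΔ hR hs rfl ha1.self_of_nhds hb1.self_of_nhds hN]
    ext l
    simp only [blockChristoffel, e0, e1, eA0, eA1]
    fin_cases l
    · simp [hb2', hacc]; field_simp; ring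
    · simp [hacc]; field_simp; ring
    · simp
    · simp

end

section

variable {R : ℝ → ℝ → ℝ} {a b : ℝ → ℝ} {θ φ t : ℝ}

/-- A criterion in a static chart with metric `f(b) da² - db² / f(b)`: the tangent is normalized,
the energy `f a'` grows at the rate `β b'`, and `b'' = β f a' - f' / 2`. -/
theorem uniformlyAccelerated_static {f : ℝ → ℝ} {β : ℝ} {a1 b1 : ℝ → ℝ} {a2 b2 f' : ℝ}
    (hf0 : f (b t) ≠ 0) (hR : R (a t) (b t) ≠ 0) (hs : Real.sin θ ≠ 0)
    (ha : ContDiffAt ℝ 2 a t) (hb : ContDiffAt ℝ 2 b t) (hfc : ContDiffAt ℝ 1 f (b t))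
    (ha1 : ∀ᶠ t' in 𝓝 t, HasDerivAt a (a1 t') t') (hb1 : ∀ᶠ t' in 𝓝 t, HasDerivAt b (b1 t') t')
    (ha2 : HasDerivAt a1 a2 t) (hb2 : HasDerivAt b1 b2 t)
    (hf' : HasDerivAt f f' (b t))
    (hnorm : f (b t) ^ 2 * a1 t ^ 2 - b1 t ^ 2 = f (b t))
    (hacc : f (b t) * a2 = β * b1 t - f' * b1 t * a1 t)
    (hacc' : b2 = β * (f (b t) * a1 t) - f' / 2) :
    UniformlyAccelerated (blockMetric (fun _ s => f s) 0 (fun _ s => -(f s)⁻¹) R) β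
      (planarCurve a b θ φ)
      (fun t' => ![b1 t' / f (b t'), f (b t') * a1 t', 0, 0])
      (fun t' => ![f (b t') * a1 t', -(b1 t' / f (b t')), 0, 0])
      (fun t' => ![b1 t', -a1 t', 0, 0]) t := by
  have hΔ : (fun _ s => f s) (a t) (b t) * (fun _ s => -(f s)⁻¹) (a t) (b t) - (0 : ℝ) ^ 2 ≠ 0 := by
    simp [hf0]
  have ca1 : ContDiffAt ℝ 1 a1 t := by
    have h1 : ContDiffAt ℝ 1 (deriv a) t := ha.derivWithin (by norm_num)
    exact h1.congr_of_eventuallyEq (ha1.mono fun _ h => h.deriv.symm)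
  have cb1 : ContDiffAt ℝ 1 b1 t := by
    have h1 : ContDiffAt ℝ 1 (deriv b) t := hb.derivWithin (by norm_num)
    exact h1.congr_of_eventuallyEq (hb1.mono fun _ h => h.deriv.symm)
  have cf : ContDiffAt ℝ 1 (fun t' => f (b t')) t := hfc.comp t (hb.of_le (by norm_num))
  have hdγ : ∀ᶠ t' in 𝓝 t, deriv (planarCurve a b θ φ) t' = ![a1 t', b1 t', 0, 0] := by
    filter_upwards [ha1, hb1] with t' h1 h2
    exact (hasDerivAt_planarCurve θ φ h1 h2).deriv
  have hV : HasDerivAt (deriv (planarCurve a b θ φ)) ![a2, b2, 0, 0] t :=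
    (hasDerivAt_planarCurve 0 0 ha2 hb2).congr_of_eventuallyEq hdγ
  have hfb : HasDerivAt (fun t' => f (b t')) (f' * b1 t) t := hf'.comp t hb1.self_of_nhds
  have hU : HasDerivAt (fun t' => (![f (b t') * a1 t', -(b1 t' / f (b t')), 0, 0] : Coord))
      ![f' * b1 t * a1 t + f (b t) * a2,
        -((b2 * f (b t) - b1 t * (f' * b1 t)) / f (b t) ^ 2), 0, 0] t :=
    hasDerivAt_planarCurve 0 0 (hfb.mul ha2) (hb2.div hfb hf0).neg
  have hN : HasDerivAt (fun t' => (![b1 t', -a1 t', 0, 0] : Coord)) ![b2, -a2, 0, 0] t :=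
    hasDerivAt_planarCurve 0 0 hb2 ha2.neg
  have hd0 := hdγ.self_of_nhds
  have e0 : planarCurve a b θ φ t 0 = a t := rfl
  have e1 : planarCurve a b θ φ t 1 = b t := rfl
  have dC : HasDerivAt (fun s => -(f s)⁻¹) (f' / f (b t) ^ 2) (b t) := by
    exact (hf'.inv hf0).neg.congr_deriv (by ring)
  have edC := dC.deriv
  have edA := hf'.deriv
  have ha2' : a2 = (β * b1 t - f' * b1 t * a1 t) / f (b t) := by field_simp; linarith
  have hb1' : b1 t ^ 2 = f (b t) ^ 2 * a1 t ^ 2 - f (b t) := by linarith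
  constructor
  · exact contDiffAt_planarCurve θ φ ha hb
  · have c0 : ContDiffAt ℝ 1 (fun t' => f (b t') * a1 t') t := cf.mul ca1
    have c1 : ContDiffAt ℝ 1 (fun t' => b1 t' / f (b t')) t := cb1.div cf hf0
    exact contDiffAt_planarCurve (a := fun t' => f (b t') * a1 t')
      (b := fun t' => -(b1 t' / f (b t'))) 0 0 c0 c1.neg
  · exact contDiffAt_planarCurve (a := b1) (b := fun t' => -a1 t') 0 0 cb1 ca1.neg
  · rw [hd0, sharp_blockMetric (y := planarCurve a b θ φ t) hΔ hR hs]
    simp only [e1]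
    ext l
    fin_cases l <;> simp <;> field_simp
  · rw [sharp_blockMetric (y := planarCurve a b θ φ t) hΔ hR hs]
    simp only [e1]
    ext l
    fin_cases l <;> simp <;> field_simp
  · rw [hd0, flat_blockMetric]
    simp only [e1]
    ext l
    fin_cases l <;> simp; field_simp
  · rw [hd0, pairing_planar]
    field_simp
    linarith
  · rw [hd0, pairing_planar]
    ring
  · rw [pairing_planar]
    field_simp
    ring
  · rw [pairing_planar]
    field_simp
    linarith
  · rw [covDerivVec_blockMetric (θ := θ) hΔ hR hs hd0 ha1.self_of_nhds hb1.self_of_nhds hV]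
    ext l
    simp only [blockChristoffel, e0, e1, edA, edC]
    fin_cases l
    · simp [ha2']; field_simp; ring
    · simp [hacc']; field_simp; rw [hb1']; ring
    · simp
    · simp
  · rw [covDerivForm_blockMetric (θ := θ) hΔ hR hs rfl ha1.self_of_nhds hb1.self_of_nhds hU]
    ext l
    simp only [blockChristoffel, e0, e1, edA, edC]
    fin_cases l
    · simp [ha2']; field_simp; ring
    · simp [hacc']; field_simp; ring_nf; rw [hb1']; ring
    · simp
    · simp
  · rw [covDerivForm_blockMetric (θ := θ) hΔ hR hs rfl ha1.self_of_nhds hb1.self_of_nhds hN]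
    ext l
    simp only [blockChristoffel, e0, e1, edA, edC]
    fin_cases l
    · simp [hacc']; field_simp; ring_nf; rw [hb1']; ring
    · simp [ha2']; field_simp; ring
    · simp
    · simp

end

/-! ### Physical proper time as a function of conformal proper time -/

/-- The physical proper time `(2 / β) artanh (τ / T)`. -/
def properTime (β T τ : ℝ) : ℝ := (Real.log (T + τ) - Real.log (T - τ)) / β

/-- The derivative of the physical proper time, the inverse of the conformal factor. -/
def properTimeRate (β T τ : ℝ) : ℝ := 2 * T / (β * (T ^ 2 - τ ^ 2))

section

variable {β T τ : ℝ}

theorem hasDerivAt_properTime (hβ : 0 < β) (h1 : -T < τ) (h2 : τ < T) :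
    HasDerivAt (properTime β T) (properTimeRate β T τ) τ := by
  have p1 : T + τ ≠ 0 := by linarith
  have p2 : T - τ ≠ 0 := by linarith
  have p3 : T ^ 2 - τ ^ 2 ≠ 0 := by
    rw [sq_sub_sq]; exact mul_ne_zero p1 p2
  have h := ((((hasDerivAt_id τ).const_add T).log p1).sub
    (((hasDerivAt_id τ).const_sub T).log p2)).div_const β
  refine h.congr_deriv ?_
  simp only [properTimeRate, id]
  field_simp
  ring

theorem properTimeRate_pos (hβ : 0 < β) (h1 : -T < τ) (h2 : τ < T) :
    0 < properTimeRate β T τ := by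
  have : 0 < T ^ 2 - τ ^ 2 := by nlinarith
  have : 0 < T := by linarith
  unfold properTimeRate
  positivity

theorem hasDerivAt_properTimeRate (hβ : 0 < β) (h1 : -T < τ) (h2 : τ < T) :
    HasDerivAt (properTimeRate β T) (-(-(β / T * τ)) * properTimeRate β T τ ^ 2) τ := by
  have p3 : T ^ 2 - τ ^ 2 ≠ 0 := by nlinarith
  have hT : T ≠ 0 := by linarith
  have h := (hasDerivAt_const τ (2 * T)).div
    ((((hasDerivAt_id τ).pow 2).const_sub (T ^ 2)).const_mul β) (mul_ne_zero hβ.ne' p3)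
  refine h.congr_deriv ?_
  simp only [properTimeRate, id, Pi.pow_apply]
  field_simp
  ring

theorem properTime_zero (β T : ℝ) : properTime β T 0 = 0 := by simp [properTime]

theorem tendsto_properTime_right (hβ : 0 < β) (hT : 0 < T) :
    Tendsto (properTime β T) (𝓝[<] T) atTop := by
  have h1 : Tendsto (fun τ => Real.log (T + τ)) (𝓝[<] T) (𝓝 (Real.log (T + T))) := by
    have : ContinuousAt (fun τ => Real.log (T + τ)) T :=
      ContinuousAt.log (by fun_prop) (by positivity)
    exact this.tendsto.mono_left nhdsWithin_le_nhds
  have h2 : Tendsto (fun τ => Real.log (T - τ)) (𝓝[<] T) atBot := by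
    refine Real.tendsto_log_nhdsGT_zero.comp ?_
    refine tendsto_nhdsWithin_iff.2 ⟨?_, ?_⟩
    · have : ContinuousAt (fun τ => T - τ) T := by fun_prop
      simpa using this.tendsto.mono_left nhdsWithin_le_nhds
    · filter_upwards [self_mem_nhdsWithin] with τ hτ
      simpa using hτ
  have h3 := (h1.add_atTop (tendsto_neg_atBot_atTop.comp h2)).atTop_div_const hβ
  refine h3.congr fun τ => ?_
  simp [properTime, sub_eq_add_neg]

theorem properTime_neg (β T τ : ℝ) : properTime β T (-τ) = -properTime β T τ := by
  simp only [properTime, sub_neg_eq_add, ← sub_eq_add_neg]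
  ring

theorem tendsto_properTime_left (hβ : 0 < β) (hT : 0 < T) :
    Tendsto (properTime β T) (𝓝[>] (-T)) atBot := by
  have h : Tendsto (fun τ : ℝ => -τ) (𝓝[>] (-T)) (𝓝[<] T) := by
    refine tendsto_nhdsWithin_iff.2 ⟨?_, ?_⟩
    · have : ContinuousAt (fun τ : ℝ => -τ) (-T) := by fun_prop
      simpa using this.tendsto.mono_left nhdsWithin_le_nhds
    · filter_upwards [self_mem_nhdsWithin] with τ hτ
      simp only [Set.mem_Ioi, Set.mem_Iio] at *
      linarith
  refine (tendsto_neg_atTop_atBot.comp ((tendsto_properTime_right hβ hT).comp h)).congr fun τ => ?_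
  simp [properTime_neg]

theorem strictMonoOn_properTime (hβ : 0 < β) :
    StrictMonoOn (properTime β T) (Set.Ioo (-T) T) := by
  refine strictMonoOn_of_deriv_pos (convex_Ioo _ _) (fun τ hτ =>
    (hasDerivAt_properTime hβ hτ.1 hτ.2).continuousAt.continuousWithinAt) fun τ hτ => ?_
  rw [interior_Ioo] at hτ
  rw [(hasDerivAt_properTime hβ hτ.1 hτ.2).deriv]
  exact properTimeRate_pos hβ hτ.1 hτ.2

theorem bijOn_properTime (hβ : 0 < β) (hT : 0 < T) :
    Set.BijOn (properTime β T) (Set.Ioo (-T) T) Set.univ := by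
  have hc : ContinuousOn (properTime β T) (Set.Ioo (-T) T) := fun τ hτ =>
    (hasDerivAt_properTime hβ hτ.1 hτ.2).continuousAt.continuousWithinAt
  refine ⟨fun _ _ => trivial, (strictMonoOn_properTime hβ).injOn, ?_⟩
  · refine hc.surjOn_of_tendsto (s := Set.Ioo (-T) T) ⟨0, by simp [hT]⟩ ?_ ?_
    · rw [tendsto_comp_coe_Ioo_atBot (by linarith)]
      exact tendsto_properTime_left hβ hT
    · rw [tendsto_comp_coe_Ioo_atTop (by linarith)]
      exact tendsto_properTime_right hβ hT

end

/-! ### Charts along a curve -/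

/-- Near the proper time `t₀` the base curve `x` has the coordinates `(a, b)` in the patch `P`, and
is there uniformly accelerated. -/
def HasAccelChart (m q β : ℝ) (x : ℝ → Base m q) (P : Patch) (a b : ℝ → ℝ) (t₀ : ℝ) : Prop :=
  ∃ n U N : ℝ → Coord, ∀ᶠ t in 𝓝 t₀,
    (∃ h : InPatch m q P (a t) (b t), x t = Quot.mk _ ⟨P, a t, b t, h⟩) ∧
    UniformlyAccelerated (metric m q P) β (planarCurve a b (Real.pi / 2) 0) n U N t

/-- In its conformal proper time, a uniformly accelerated curve at a fixed angular position is a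
conformal curve, with the 1-form `-(β τ / T) U + β N`. The axes are chosen such that the position is
the point `θ = π / 2`, `φ = 0`, where the spherical coordinates are regular. -/
theorem HasAccelChart.localConformalCurve {m q β : ℝ} {x : ℝ → Base m q} {P : Patch}
    {a b : ℝ → ℝ} {T τ : ℝ} (hβ : 0 < β) (h1 : -T < τ) (h2 : τ < T)
    {n U N : ℝ → Coord}
    (h : ∀ᶠ t in 𝓝 (properTime β T τ),
      (∃ h : InPatch m q P (a t) (b t), x t = Quot.mk _ ⟨P, a t, b t, h⟩) ∧
      UniformlyAccelerated (metric m q P) β (planarCurve a b (Real.pi / 2) 0) n U N t)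
    {ω : S2} {R : E3 ≃ₗᵢ[ℝ] E3} (hω : (ω : E3) = R (sph (Real.pi / 2) 0)) :
    LocalConformalCurve m q (fun τ => (x (properTime β T τ), ω)) (properTime β T) P R
      (fun τ => planarCurve a b (Real.pi / 2) 0 (properTime β T τ))
      (fun τ => -(β / T * τ) • U (properTime β T τ) + β • N (properTime β T τ)) τ := by
  have hT : T ≠ 0 := by linarith
  have hI : ∀ᶠ s in 𝓝 τ, -T < s ∧ s < T := (lt_mem_nhds h1).and (gt_mem_nhds h2)
  have hc : ContinuousAt (properTime β T) τ := (hasDerivAt_properTime hβ h1 h2).continuousAt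
  filter_upwards [hc.eventually h, hI] with s ⟨⟨hp, hx⟩, hacc⟩ ⟨hs1, hs2⟩
  have hIs : ∀ᶠ s' in 𝓝 s, -T < s' ∧ s' < T := (lt_mem_nhds hs1).and (gt_mem_nhds hs2)
  have hd : ∀ᶠ s' in 𝓝 s, HasDerivAt (properTime β T) (properTimeRate β T s') s' :=
    hIs.mono fun s' hs' => hasDerivAt_properTime hβ hs'.1 hs'.2
  have hσ2 : ContDiffAt ℝ 2 (properTime β T) s := by
    have p1 : T + s ≠ 0 := by linarith
    have p2 : T - s ≠ 0 := by linarith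
    unfold properTime
    exact ((ContDiffAt.log (by fun_prop) p1).sub (ContDiffAt.log (by fun_prop) p2)).div_const β
  have hα : HasDerivAt (fun s => -(β / T * s))
      (properTimeRate β T s * ((-(β / T * s)) ^ 2 - β ^ 2) / 2) s := by
    have := ((hasDerivAt_id s).const_mul (β / T)).neg
    refine this.congr_deriv ?_
    have p3 : T ^ 2 - s ^ 2 ≠ 0 := by nlinarith
    simp only [properTimeRate]
    field_simp
    ring
  obtain ⟨hg, hcc⟩ := hacc.conformalCurveEq (α := fun s => -(β / T * s)) hd hσ2 (by fun_prop)
    (hasDerivAt_properTimeRate hβ hs1 hs2) hα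
  have hν := properTimeRate_pos hβ hs1 hs2
  refine ⟨⟨⟨hp, hx⟩, ?_, ?_, hω⟩, ?_, hcc, ?_⟩
  · change 0 < Real.pi / 2
    positivity
  · change Real.pi / 2 < Real.pi
    linarith [Real.pi_pos]
  · rw [hg]; positivity
  · rw [hg, Real.sqrt_sq hν.le]
    exact hasDerivAt_properTime hβ hs1 hs2

/-- Every point of the sphere lies on the equator of suitable axes. -/
theorem exists_axes (ω : S2) : ∃ R : E3 ≃ₗᵢ[ℝ] E3, (ω : E3) = R (sph (Real.pi / 2) 0) := by
  have h1 : ‖(ω : E3)‖ = 1 := by simp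
  have h2 : ‖sph (Real.pi / 2) 0‖ = 1 := by
    simp [sph, EuclideanSpace.norm_eq, Fin.sum_univ_three]
  have hr := Submodule.reflection_sub (v := (ω : E3)) (w := sph (Real.pi / 2) 0) (by rw [h1, h2])
  refine ⟨(ℝ ∙ ((ω : E3) - sph (Real.pi / 2) 0))ᗮ.reflection, ?_⟩
  have := congrArg (ℝ ∙ ((ω : E3) - sph (Real.pi / 2) 0))ᗮ.reflection hr
  rwa [Submodule.reflection_reflection] at this

theorem metric_static (m q : ℝ) : metric m q .static =
    blockMetric (fun _ s => D m q s) 0 (fun _ s => -(D m q s)⁻¹) (fun _ s => s) := rfl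

theorem metric_strip (m q : ℝ) (k : ℤ) : metric m q (.strip k) =
    blockMetric (fun _ s => D m q s) (-1) (fun _ _ => 0) (fun _ s => s) := rfl

/-- The function `G(r) = (D(r) - D'(ρ) (r - ρ)) / (r - ρ)²` of a saddle patch. -/
def saddleG (ρ ρ' r : ℝ) : ℝ := ((ρ' - ρ) * r + ρ * ρ') / (r ^ 2 * ρ ^ 2)

theorem metric_saddle (m q : ℝ) (k : ℤ) : metric m q (.saddle k) =
    blockMetric (fun x y => saddleG (saddleRadius m q k) (oppositeRadius m q k)
        (saddleRadius m q k + x * y) / surfaceGravity m q k ^ 2 * y ^ 2)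
      (-(1 / surfaceGravity m q k)) (fun _ _ => 0) (fun x y => saddleRadius m q k + x * y) := rfl

/-! ### Radial motion -/

/-- The derivative of `D`. -/
def dD (m q r : ℝ) : ℝ := 2 * m / r ^ 2 - 2 * q ^ 2 / r ^ 3

theorem hasDerivAt_D (m q : ℝ) {r : ℝ} (hr : r ≠ 0) : HasDerivAt (D m q) (dD m q r) r := by
  have h := (((hasDerivAt_const r (1 : ℝ)).sub
    ((hasDerivAt_const r (2 * m)).div (hasDerivAt_id r) hr)).add
    ((hasDerivAt_const r (q ^ 2)).div ((hasDerivAt_id r).pow 2) (pow_ne_zero 2 hr)))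
  refine h.congr_deriv ?_
  simp only [dD, id, Pi.pow_apply]
  field_simp
  ring

theorem contDiffAt_D (m q : ℝ) {r : ℝ} (hr : r ≠ 0) {n : WithTop ℕ∞} :
    ContDiffAt ℝ n (D m q) r := by
  unfold D
  have h2 : r ^ 2 ≠ 0 := pow_ne_zero 2 hr
  fun_prop (disch := assumption)

theorem contDiffAt_dD (m q : ℝ) {r : ℝ} (hr : r ≠ 0) {n : WithTop ℕ∞} :
    ContDiffAt ℝ n (dD m q) r := by
  unfold dD
  have h2 : r ^ 2 ≠ 0 := pow_ne_zero 2 hr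
  have h3 : r ^ 3 ≠ 0 := pow_ne_zero 3 hr
  fun_prop (disch := assumption)

/-- The radial part of a motion of constant acceleration `β` in proper time: `γ + β r` is the energy
`D dt/dσ`, so that `(dr/dσ)² = (γ + β r)² - D(r)`. -/
structure RadialMotion (m q β γ : ℝ) (r v : ℝ → ℝ) : Prop where
  pos : ∀ t, 0 < r t
  deriv_r : ∀ t, HasDerivAt r (v t) t
  deriv_v : ∀ t, HasDerivAt v (β * (γ + β * r t) - dD m q (r t) / 2) t
  sq : ∀ t, v t ^ 2 = (γ + β * r t) ^ 2 - D m q (r t)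

namespace RadialMotion

variable {m q β γ : ℝ} {r v : ℝ → ℝ}

/-- The equations of motion improve the regularity of `r` and `v` step by step. -/
theorem contDiff_nat (h : RadialMotion m q β γ r v) (n : ℕ) :
    ContDiff ℝ n r ∧ ContDiff ℝ n v := by
  have hr : Differentiable ℝ r := fun t => (h.deriv_r t).differentiableAt
  have hv : Differentiable ℝ v := fun t => (h.deriv_v t).differentiableAt
  induction n with
  | zero => exact ⟨contDiff_zero.2 hr.continuous, contDiff_zero.2 hv.continuous⟩
  | succ n ih =>
    have e1 : deriv r = v := funext fun t => (h.deriv_r t).deriv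
    have e2 : deriv v = fun t => β * (γ + β * r t) - dD m q (r t) / 2 :=
      funext fun t => (h.deriv_v t).deriv
    have c : ContDiff ℝ n (fun t => dD m q (r t)) := contDiff_iff_contDiffAt.2 fun t =>
      (contDiffAt_dD m q (h.pos t).ne').comp t ih.1.contDiffAt
    have c2 : ContDiff ℝ n (deriv v) := by
      rw [e2]
      exact (contDiff_const.mul (contDiff_const.add (contDiff_const.mul ih.1))).sub
        (c.div_const 2)
    push_cast
    rw [contDiff_succ_iff_deriv, contDiff_succ_iff_deriv, e1]
    exact ⟨⟨hr, by simp, ih.2⟩, hv, by simp, c2⟩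

theorem contDiff_r (h : RadialMotion m q β γ r v) : ContDiff ℝ ((⊤ : ℕ∞) : WithTop ℕ∞) r :=
  contDiff_infty.2 fun n => (h.contDiff_nat n).1

theorem contDiff_v (h : RadialMotion m q β γ r v) : ContDiff ℝ ((⊤ : ℕ∞) : WithTop ℕ∞) v :=
  contDiff_infty.2 fun n => (h.contDiff_nat n).2

theorem continuous_r (h : RadialMotion m q β γ r v) : Continuous r := h.contDiff_r.continuous

theorem continuous_v (h : RadialMotion m q β γ r v) : Continuous v := h.contDiff_v.continuous

/-- The product of `E - v` and `E + v`, for `E` the energy. -/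
theorem mul_eq (h : RadialMotion m q β γ r v) (t : ℝ) :
    (γ + β * r t - v t) * (γ + β * r t + v t) = D m q (r t) := by
  have := h.sq t
  linarith

theorem deriv_energy (h : RadialMotion m q β γ r v) (t : ℝ) :
    HasDerivAt (fun t => γ + β * r t) (β * v t) t :=
  ((h.deriv_r t).const_mul β).const_add γ

/-- Time reversal. -/
theorem reverse (h : RadialMotion m q β γ r v) :
    RadialMotion m q β γ (fun t => r (-t)) (fun t => -v (-t)) where
  pos t := h.pos _
  deriv_r t := by
    have := (h.deriv_r (-t)).scomp t (hasDerivAt_neg t)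
    exact this.congr_deriv (by simp)
  deriv_v t := by
    have := ((h.deriv_v (-t)).scomp t (hasDerivAt_neg t)).neg
    exact this.congr_deriv (by simp)
  sq t := by simpa using h.sq (-t)

theorem deriv_outgoing (h : RadialMotion m q β γ r v) (t : ℝ) :
    HasDerivAt (fun t => γ + β * r t - v t)
      (-(β * (γ + β * r t - v t)) + dD m q (r t) / 2) t :=
  ((h.deriv_energy t).sub (h.deriv_v t)).congr_deriv (by ring)

theorem deriv_ingoing (h : RadialMotion m q β γ r v) (t : ℝ) :
    HasDerivAt (fun t => γ + β * r t + v t)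
      (β * (γ + β * r t + v t) - dD m q (r t) / 2) t :=
  ((h.deriv_energy t).add (h.deriv_v t)).congr_deriv (by ring)

end RadialMotion

/-! ### Charts along a radial motion -/

theorem sin_half_pi_ne_zero : Real.sin (Real.pi / 2) ≠ 0 := by simp

theorem UniformlyAccelerated.neg {g : CoordMetric} {β : ℝ} {γ n U N : ℝ → Coord} {t : ℝ}
    (h : UniformlyAccelerated g β γ n U N t) :
    UniformlyAccelerated g (-β) γ (fun t => (-1 : ℝ) • n t) U (fun t => (-1 : ℝ) • N t) t := by
  have hs : ∀ y b, sharp g y ((-1 : ℝ) • b) = (-1 : ℝ) • sharp g y b := fun y b => by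
    simpa using sharp_add_smul g y b 0 (-1) 0
  have hp : ∀ b v, pairing ((-1 : ℝ) • b) v = -pairing b v := fun b v => by
    simpa using pairing_add_smul b 0 v (-1) 0
  refine ⟨h.contDiffAt_curve, h.contDiffAt_tangentForm, h.contDiffAt_normalForm.const_smul _,
    h.sharp_tangentForm, ?_, h.flat_tangent, h.pairing_tangent, ?_, ?_, ?_, ?_, ?_, ?_⟩
  · rw [hs, h.sharp_normalForm]
  · rw [hp, h.pairing_normal_tangent, neg_zero]
  · rw [pairing_smul_right, h.pairing_tangent_normal, mul_zero]
  · rw [hp, pairing_smul_right, h.pairing_normal]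
    norm_num
  · rw [h.covDerivVec_tangent, smul_smul]
    congr 1; ring
  · rw [h.covDerivForm_tangentForm, smul_smul]
    congr 1; ring
  · have hd : deriv (fun t => (-1 : ℝ) • N t) t = (-1 : ℝ) • deriv N t :=
      (((h.contDiffAt_normalForm.differentiableAt (by simp)).hasDerivAt).const_smul (-1 : ℝ)).deriv
    have key : covDerivForm g γ (fun t => (-1 : ℝ) • N t) t =
        (-1 : ℝ) • covDerivForm g γ N t := by
      ext l
      simp only [covDerivForm, hd, Pi.smul_apply, smul_eq_mul, mul_sub, Finset.mul_sum]
      congr 1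
      exact Finset.sum_congr rfl fun μ _ => Finset.sum_congr rfl fun κ _ => by ring
    rw [key, h.covDerivForm_normalForm, smul_smul]
    congr 1; ring

section

variable {m q β γ : ℝ} {r v : ℝ → ℝ} {x : ℝ → Base m q} {t₀ : ℝ}

theorem contDiffAt_of_eventually_hasDerivAt {a a' : ℝ → ℝ} {t : ℝ} {n : ℕ}
    (h : ∀ᶠ t' in 𝓝 t, HasDerivAt a (a' t') t') (h' : ContDiffAt ℝ n a' t) :
    ContDiffAt ℝ ((n + 1 : ℕ) : WithTop ℕ∞) a t := by
  push_cast
  rw [contDiffAt_succ_iff_hasFDerivAt]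
  refine ⟨fun t' => ContinuousLinearMap.toSpanSingleton ℝ (a' t'), ⟨_, h, fun t' ht' => ?_⟩, ?_⟩
  · exact ht'.hasFDerivAt
  · exact ((ContinuousLinearMap.toSpanSingletonCLE (𝕜 := ℝ) (E := ℝ)).contDiff.contDiffAt).comp t h'

/-- The motion in the static patch, with `dt/dσ = E / D`. -/
theorem RadialMotion.hasAccelChart_static (h : RadialMotion m q β γ r v) {a : ℝ → ℝ}
    (ha : ∀ᶠ t in 𝓝 t₀, HasDerivAt a ((γ + β * r t) / D m q (r t)) t) (hD : D m q (r t₀) ≠ 0)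
    (hx : ∀ᶠ t in 𝓝 t₀, ∃ h : InPatch m q .static (a t) (r t),
      x t = Quot.mk _ ⟨.static, a t, r t, h⟩) :
    ∃ n U N : ℝ → Coord, (∀ᶠ t in 𝓝 t₀,
      (∃ h : InPatch m q .static (a t) (r t), x t = Quot.mk _ ⟨.static, a t, r t, h⟩) ∧
      UniformlyAccelerated (metric m q .static) β (planarCurve a r (Real.pi / 2) 0) n U N t) ∧
      N t₀ = ![v t₀, -((γ + β * r t₀) / D m q (r t₀)), 0, 0] := by
  have hcD : ∀ t, ContinuousAt (fun t => D m q (r t)) t := fun t =>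
    ((hasDerivAt_D m q (h.pos t).ne').continuousAt).comp (h.deriv_r t).continuousAt
  refine ⟨fun t => ![v t / D m q (r t), D m q (r t) * ((γ + β * r t) / D m q (r t)), 0, 0],
    fun t => ![D m q (r t) * ((γ + β * r t) / D m q (r t)), -(v t / D m q (r t)), 0, 0],
    fun t => ![v t, -((γ + β * r t) / D m q (r t)), 0, 0], ?_, rfl⟩
  rw [metric_static]
  filter_upwards [hx, ha.eventually_nhds, (hcD t₀).eventually_ne hD] with t h1 h2 h3
  refine ⟨h1, ?_⟩
  have hDt := (hasDerivAt_D m q (h.pos t).ne')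
  have hDr : HasDerivAt (fun t => D m q (r t)) (dD m q (r t) * v t) t := hDt.comp t (h.deriv_r t)
  have ha2 : HasDerivAt (fun t => (γ + β * r t) / D m q (r t)) _ t :=
    (h.deriv_energy t).div hDr h3
  have hcE : ContDiffAt ℝ ((1 : ℕ) : WithTop ℕ∞) (fun t => (γ + β * r t) / D m q (r t)) t :=
    (contDiffAt_const.add (contDiffAt_const.mul
      (h.contDiff_nat 1).1.contDiffAt)).div
        ((contDiffAt_D m q (h.pos t).ne').comp t (h.contDiff_nat 1).1.contDiffAt) h3
  refine uniformlyAccelerated_static (f := D m q) h3 (h.pos t).ne' sin_half_pi_ne_zero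
    (contDiffAt_of_eventually_hasDerivAt h2 hcE)
    (h.contDiff_nat 2).1.contDiffAt (contDiffAt_D m q (h.pos t).ne') h2
    (Eventually.of_forall h.deriv_r) ha2 (h.deriv_v t) hDt ?_ ?_ ?_
  · have := h.sq t
    field_simp
    linarith
  · field_simp
  · field_simp

/-- The motion in a strip, where the null coordinate has the rate `1 / (E - v)`. -/
theorem RadialMotion.hasAccelChart_strip (h : RadialMotion m q β γ r v) (k : ℤ) {a : ℝ → ℝ}
    (ha : ∀ᶠ t in 𝓝 t₀, HasDerivAt a (1 / (γ + β * r t - v t)) t)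
    (hw : γ + β * r t₀ - v t₀ ≠ 0)
    (hx : ∀ᶠ t in 𝓝 t₀, ∃ h : InPatch m q (.strip k) (a t) (r t),
      x t = Quot.mk _ ⟨.strip k, a t, r t, h⟩) :
    HasAccelChart m q β x (.strip k) a r t₀ := by
  let w := fun t => 1 / (γ + β * r t - v t)
  refine ⟨fun t => ![w t, -(D m q (r t) * w t + -1 * v t) / -1, 0, 0],
    fun t => ![D m q (r t) * w t + -1 * v t, -1 * w t, 0, 0],
    fun t => ![-(-1 * v t), -1 * w t, 0, 0], ?_⟩
  rw [metric_strip]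
  have hcw : Continuous fun t => γ + β * r t - v t :=
    (continuous_const.add (continuous_const.mul h.continuous_r)).sub h.continuous_v
  filter_upwards [hx, ha.eventually_nhds, hcw.continuousAt.eventually_ne hw] with t h1 h2 h3
  refine ⟨h1, ?_⟩
  have hDt := (hasDerivAt_D m q (h.pos t).ne')
  have hDr : HasDerivAt (fun t => D m q (r t)) (dD m q (r t) * v t) t := hDt.comp t (h.deriv_r t)
  have ha2 := (hasDerivAt_const t (1 : ℝ)).div (h.deriv_outgoing t) h3
  have hcE : ContDiffAt ℝ ((1 : ℕ) : WithTop ℕ∞) (fun t => 1 / (γ + β * r t - v t)) t :=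
    contDiffAt_const.div ((contDiffAt_const.add (contDiffAt_const.mul
      (h.contDiff_nat 1).1.contDiffAt)).sub (h.contDiff_nat 1).2.contDiffAt) h3
  have hcD : ContDiffAt ℝ 1 (fun t => D m q (r t)) t :=
    (contDiffAt_D m q (h.pos t).ne').comp t (by exact_mod_cast (h.contDiff_nat 1).1.contDiffAt)
  refine uniformlyAccelerated_null (A := fun _ s => D m q s) (by norm_num) (h.pos t).ne'
    sin_half_pi_ne_zero
    (contDiffAt_of_eventually_hasDerivAt h2 hcE)
    (h.contDiff_nat 2).1.contDiffAt hcD h2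
    (Eventually.of_forall h.deriv_r) ha2 (h.deriv_v t) (hasDerivAt_const _ _) hDt
    (hDr.congr_deriv (by ring)) ?_ ?_
  · filter_upwards [hcw.continuousAt.eventually_ne h3] with t' ht'
    simp only [w]
    rw [← h.mul_eq t']
    field_simp
    ring
  · simp only [w]
    field_simp
    ring

/-- The motion in a strip, where the null coordinate has the rate `-1 / (E + v)`. -/
theorem RadialMotion.hasAccelChart_strip_ingoing (h : RadialMotion m q β γ r v) (k : ℤ)
    {a : ℝ → ℝ} (ha : ∀ᶠ t in 𝓝 t₀, HasDerivAt a (-1 / (γ + β * r t + v t)) t)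
    (hw : γ + β * r t₀ + v t₀ ≠ 0)
    (hx : ∀ᶠ t in 𝓝 t₀, ∃ h : InPatch m q (.strip k) (a t) (r t),
      x t = Quot.mk _ ⟨.strip k, a t, r t, h⟩) :
    HasAccelChart m q β x (.strip k) a r t₀ := by
  let w := fun t => -1 / (γ + β * r t + v t)
  refine ⟨fun t => (-1 : ℝ) • ![w t, -(D m q (r t) * w t + -1 * v t) / -1, 0, 0],
    fun t => ![D m q (r t) * w t + -1 * v t, -1 * w t, 0, 0],
    fun t => (-1 : ℝ) • ![-(-1 * v t), -1 * w t, 0, 0], ?_⟩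
  rw [metric_strip]
  have hcw : Continuous fun t => γ + β * r t + v t :=
    (continuous_const.add (continuous_const.mul h.continuous_r)).add h.continuous_v
  filter_upwards [hx, ha.eventually_nhds, hcw.continuousAt.eventually_ne hw] with t h1 h2 h3
  refine ⟨h1, ?_⟩
  have hDt := (hasDerivAt_D m q (h.pos t).ne')
  have hDr : HasDerivAt (fun t => D m q (r t)) (dD m q (r t) * v t) t := hDt.comp t (h.deriv_r t)
  have ha2 := (hasDerivAt_const t (-1 : ℝ)).div (h.deriv_ingoing t) h3
  have hcE : ContDiffAt ℝ ((1 : ℕ) : WithTop ℕ∞) (fun t => -1 / (γ + β * r t + v t)) t :=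
    contDiffAt_const.div ((contDiffAt_const.add (contDiffAt_const.mul
      (h.contDiff_nat 1).1.contDiffAt)).add (h.contDiff_nat 1).2.contDiffAt) h3
  have hcD : ContDiffAt ℝ 1 (fun t => D m q (r t)) t :=
    (contDiffAt_D m q (h.pos t).ne').comp t (by exact_mod_cast (h.contDiff_nat 1).1.contDiffAt)
  -- the strip is traversed towards decreasing `v`, which reverses its orientation
  rw [← neg_neg β]
  refine UniformlyAccelerated.neg ?_
  refine uniformlyAccelerated_null (A := fun _ s => D m q s) (by norm_num) (h.pos t).ne'
    sin_half_pi_ne_zero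
    (contDiffAt_of_eventually_hasDerivAt h2 hcE)
    (h.contDiff_nat 2).1.contDiffAt hcD h2
    (Eventually.of_forall h.deriv_r) ha2 (h.deriv_v t) (hasDerivAt_const _ _) hDt
    (hDr.congr_deriv (by ring)) ?_ ?_
  · filter_upwards [hcw.continuousAt.eventually_ne h3] with t' ht'
    simp only [w]
    rw [← h.mul_eq t']
    field_simp
    ring
  · simp only [w]
    field_simp
    ring

/-- The derivative of `saddleG`. -/
def dSaddleG (ρ ρ' r : ℝ) : ℝ :=
  (ρ' - ρ) / (r ^ 2 * ρ ^ 2) - 2 * ((ρ' - ρ) * r + ρ * ρ') / (r ^ 3 * ρ ^ 2)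

theorem hasDerivAt_saddleG {ρ : ℝ} (ρ' : ℝ) {r : ℝ} (hρ : ρ ≠ 0) (hr : r ≠ 0) :
    HasDerivAt (saddleG ρ ρ') (dSaddleG ρ ρ' r) r := by
  have h := (((hasDerivAt_id r).const_mul (ρ' - ρ)).add_const (ρ * ρ')).div
    (((hasDerivAt_id r).pow 2).mul_const (ρ ^ 2)) (by simp [hρ, hr])
  refine h.congr_deriv ?_
  simp only [dSaddleG, id, Pi.pow_apply]
  field_simp
  ring

/-- The quotient of `κ - D'(r) / 2` by `r - ρ`. -/
def saddleK (ρ ρ' r : ℝ) : ℝ := -(dSaddleG ρ ρ' r * (r - ρ) + 2 * saddleG ρ ρ' r) / 2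

theorem contDiffAt_saddleG {ρ : ℝ} (ρ' : ℝ) {r : ℝ} (hρ : ρ ≠ 0) (hr : r ≠ 0) {n : WithTop ℕ∞} :
    ContDiffAt ℝ n (saddleG ρ ρ') r := by
  unfold saddleG
  have h2 : r ^ 2 * ρ ^ 2 ≠ 0 := by simp [hρ, hr]
  fun_prop (disch := assumption)

theorem contDiffAt_saddleK {ρ : ℝ} (ρ' : ℝ) {r : ℝ} (hρ : ρ ≠ 0) (hr : r ≠ 0) {n : WithTop ℕ∞} :
    ContDiffAt ℝ n (saddleK ρ ρ') r := by
  unfold saddleK dSaddleG saddleG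
  have h2 : r ^ 2 * ρ ^ 2 ≠ 0 := by simp [hρ, hr]
  have h3 : r ^ 3 * ρ ^ 2 ≠ 0 := by simp [hρ, hr]
  fun_prop (disch := assumption)

/-- The derivative `Q'` of `Q = (r - ρ) / w`, from differentiating `Q w = r - ρ` where `w = E - v`
does not vanish. -/
theorem saddle_deriv_of_ne_zero {Q Q' v w β r ρ ρ' d E u : ℝ}
    (hw : w = E - v) (hu : u = E + v) (hd : d * r ^ 3 = (2 * r - ρ - ρ') * r - 2 *
      ((r - ρ) * (r - ρ')))
   (e1 : Q' * w + Q * (-(β * w) + d / 2) = v)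
   (f1 : Q * w = r - ρ) (f2 : Q * (r - ρ') = u * r ^ 2) (h0 : w ≠ 0) :
   2 * Q' * r ^ 3 = Q ^ 2 * (r - 2 * ρ') + (2 * Q * β - 1) * r ^ 3 := by
  apply mul_right_cancel₀ h0
  subst hw hu
  linear_combination (2 * r^3) * e1 - Q * hd - Q * (r - 2 * ρ') * f1 - r * f2

/-- The derivative `Q'` of `Q = (r - ρ) / w`, from differentiating `Q (r - ρ') = u r²` where
`r ≠ ρ'`. -/
theorem saddle_deriv_of_radius_ne {Q Q' v w β r ρ ρ' d E u : ℝ}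
    (hw : w = E - v) (hu : u = E + v) (hd : d * r ^ 3 = (2 * r - ρ - ρ') * r - 2 *
      ((r - ρ) * (r - ρ')))
   (e2 : Q' * (r - ρ') + Q * v = (β * u - d / 2) * r ^ 2 + u * (2 * r * v))
   (f1 : Q * w = r - ρ) (f2 : Q * (r - ρ') = u * r ^ 2) (f3 : w * u * r ^ 2 = (r - ρ) * (r - ρ'))
     (h0 : r - ρ' ≠ 0) :
   2 * Q' * r ^ 3 = Q ^ 2 * (r - 2 * ρ') + (2 * Q * β - 1) * r ^ 3 := by
  apply mul_right_cancel₀ h0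
  subst hw hu
  linear_combination (2 * r^3) * e2 - r^2*hd + (-Q*(r-2*ρ') - 2 * β * r^3 - 2 * (E + v) * r^2) * f2
    + r^3 * f1  - 2 * r ^ 2 * f3

/-- The motion in a saddle patch. With `Q = (r - ρ) / (E - v)`, extended smoothly through the zero
of `E - v`, the coordinates are `X = μ (E - v)` and `Y = Q / μ`, where `dX/dσ = κ μ`. -/
theorem RadialMotion.hasAccelChart_saddle (h : RadialMotion m q β γ r v) (k : ℤ) {Q F : ℝ → ℝ}
    {ρ ρ' κ : ℝ} (eρ : saddleRadius m q k = ρ) (eρ' : oppositeRadius m q k = ρ')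
    (eκ : surfaceGravity m q k = κ) (hρ : ρ ≠ 0) (hκ : κ = (ρ - ρ') / (2 * ρ ^ 2)) (hκ0 : κ ≠ 0)
    (hm : 2 * m = ρ + ρ') (hq : q ^ 2 = ρ * ρ')
    (hQ : ContDiffAt ℝ 3 Q t₀)
    (hF : ∀ᶠ t in 𝓝 t₀, HasDerivAt F (β + Q t * saddleK ρ ρ' (r t)) t)
    (hQw : ∀ᶠ t in 𝓝 t₀, Q t * (γ + β * r t - v t) = r t - ρ)
    (hQu : ∀ᶠ t in 𝓝 t₀, Q t * (r t - ρ') = (γ + β * r t + v t) * r t ^ 2)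
    (hreg : ∀ᶠ t in 𝓝 t₀, γ + β * r t - v t ≠ 0 ∨ r t ≠ ρ')
    (hx : ∀ᶠ t in 𝓝 t₀, ∃ h : InPatch m q (.saddle k) (Real.exp (F t) * (γ + β * r t - v t))
        (Q t * Real.exp (-F t)), x t = Quot.mk _ ⟨.saddle k, _, _, h⟩) :
    HasAccelChart m q β x (.saddle k) (fun t => Real.exp (F t) * (γ + β * r t - v t))
      (fun t => Q t * Real.exp (-F t)) t₀ := by
  set X : ℝ → ℝ := fun t => Real.exp (F t) * (γ + β * r t - v t) with hX
  set Y : ℝ → ℝ := fun t => Q t * Real.exp (-F t) with hY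
  set X1 : ℝ → ℝ := fun t => κ * Real.exp (F t) with hX1
  set Y1 : ℝ → ℝ := fun t => (deriv Q t - Q t * (β + Q t * saddleK ρ ρ' (r t))) * Real.exp (-F t)
    with hY1
  set A : ℝ → ℝ → ℝ := fun x y => saddleG ρ ρ' (ρ + x * y) / κ ^ 2 * y ^ 2 with hA
  refine ⟨fun t => ![X1 t, -(A (X t) (Y t) * X1 t + -(1 / κ) * Y1 t) / -(1 / κ), 0, 0],
    fun t => ![A (X t) (Y t) * X1 t + -(1 / κ) * Y1 t, -(1 / κ) * X1 t, 0, 0],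
    fun t => ![-(-(1 / κ) * Y1 t), -(1 / κ) * X1 t, 0, 0], ?_⟩
  rw [metric_saddle, eρ, eρ', eκ]
  filter_upwards [hx, hF.eventually_nhds, hQw.eventually_nhds, hQu.eventually_nhds,
    hreg.eventually_nhds, (hQ.eventually (by simp)).eventually_nhds] with t h1 hF hQw hQu hreg hQ
  refine ⟨h1, ?_⟩
  have hr := fun t => (h.pos t).ne'
  have eXY : ∀ t, X t * Y t = Q t * (γ + β * r t - v t) := fun t => by
    simp only [hX, hY, Real.exp_neg]
    field_simp
  have hXY : ∀ᶠ t' in 𝓝 t, ρ + X t' * Y t' = r t' := by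
    filter_upwards [hQw] with t' ht'
    rw [eXY, ht']; ring
  have hDf : ∀ t, D m q (r t) = (r t - ρ) * (r t - ρ') / r t ^ 2 := fun t => by
    have := hr t
    rw [D, hm, hq]
    field_simp
    ring
  have hdD : ∀ t, dD m q (r t) = ((2 * r t - ρ - ρ') * r t - 2 * ((r t - ρ) * (r t - ρ'))) / r t ^
    3 :=
    fun t => by
      have := hr t
      rw [dD, hm, mul_div_assoc 2 (q ^ 2), hq]
      field_simp
      ring
  -- the derivative of `Q`
  have hQ1 : ∀ᶠ t' in 𝓝 t, 2 * deriv Q t' = saddleG ρ ρ' (r t') * Q t' ^ 2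
      + 2 * Q t' * (β + Q t' * saddleK ρ ρ' (r t')) - 1 := by
    filter_upwards [hQw.eventually_nhds, hQu.eventually_nhds, hreg, hQ] with t' hw hu hreg hQ'
    have dQ : HasDerivAt Q (deriv Q t') t' := (hQ'.differentiableAt (by simp)).hasDerivAt
    have e1 := ((dQ.mul (h.deriv_outgoing t')).congr_of_eventuallyEq (f₁ := fun t => r t - ρ)
      (by filter_upwards [hw] with s hs using hs.symm)).unique ((h.deriv_r t').sub_const ρ)
    have e2 := ((dQ.mul ((h.deriv_r t').sub_const ρ')).congr_of_eventuallyEq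
      (f₁ := fun t => (γ + β * r t + v t) * r t ^ 2)
      (by filter_upwards [hu] with s hs using hs.symm)).unique
      ((h.deriv_ingoing t').mul ((h.deriv_r t').pow 2))
    have f1 := hw.self_of_nhds
    have f2 := hu.self_of_nhds
    have f3 := h.mul_eq t'
    simp only [Pi.pow_apply] at e2
    rw [hdD] at e1 e2
    rw [hDf] at f3
    have hr' := hr t'
    have hd : dD m q (r t') * r t' ^ 3 =
        (2 * r t' - ρ - ρ') * r t' - 2 * ((r t' - ρ) * (r t' - ρ')) := by
      rw [hdD]; field_simp
    rw [← hdD] at e1 e2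
    have key : 2 * deriv Q t' * r t' ^ 3 =
        Q t' ^ 2 * (r t' - 2 * ρ') + (2 * Q t' * β - 1) * r t' ^ 3 := by
      rcases hreg with h0 | h0
      · exact saddle_deriv_of_ne_zero rfl rfl hd e1 f1 f2 h0
      · refine saddle_deriv_of_radius_ne rfl rfl hd ?_ f1 f2 ?_ (sub_ne_zero.2 h0)
        · rw [e2]; push_cast; ring
        · rw [f3]; field_simp
    have : 2 * deriv Q t' = Q t' ^ 2 * (r t' - 2 * ρ') / r t' ^ 3 + (2 * Q t' * β - 1) := by
      field_simp
      linarith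
    rw [this]
    simp only [saddleK, saddleG, dSaddleG]
    field_simp
    ring
  have hKκ : ∀ t, saddleK ρ ρ' (r t) * (r t - ρ) + dD m q (r t) / 2 = κ := fun t => by
    have := hr t
    rw [hdD, hκ]
    simp only [saddleK, saddleG, dSaddleG]
    field_simp
    ring
  have hrc : ∀ {n : ℕ}, ContDiffAt ℝ n r t := (h.contDiff_nat _).1.contDiffAt
  have hvc : ∀ {n : ℕ}, ContDiffAt ℝ n v t := (h.contDiff_nat _).2.contDiffAt
  have hQc := hQ.self_of_nhds
  have hQ2 : ContDiffAt ℝ ((2 : ℕ) : WithTop ℕ∞) Q t := hQc.of_le (by norm_num)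
  have hF2 : ContDiffAt ℝ ((3 : ℕ) : WithTop ℕ∞) F t := by
    refine contDiffAt_of_eventually_hasDerivAt hF ?_
    exact contDiffAt_const.add (hQ2.mul ((contDiffAt_saddleK ρ' hρ (hr t)).comp t hrc))
  have hF2' : ContDiffAt ℝ ((2 : ℕ) : WithTop ℕ∞) F t := hF2.of_le (by norm_num)
  have hwc : ContDiffAt ℝ ((2 : ℕ) : WithTop ℕ∞) (fun t => γ + β * r t - v t) t :=
    (contDiffAt_const.add (contDiffAt_const.mul hrc)).sub hvc
  have hXc : ContDiffAt ℝ ((2 : ℕ) : WithTop ℕ∞) X t := hF2'.exp.mul hwc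
  have hYc : ContDiffAt ℝ ((2 : ℕ) : WithTop ℕ∞) Y t := hQ2.mul hF2'.neg.exp
  have dQ1 : ContDiffAt ℝ 1 (deriv Q) t := by
    have := hQc.derivWithin (m := 1) (by norm_num)
    exact this
  have hX' : ∀ᶠ t' in 𝓝 t, HasDerivAt X (X1 t') t' := by
    filter_upwards [hF, hQw] with t' hF hQw
    have := (hF.exp.mul (h.deriv_outgoing t'))
    refine this.congr_deriv ?_
    simp only [hX1]
    linear_combination Real.exp (F t') * saddleK ρ ρ' (r t') * hQw + Real.exp (F t') * hKκ t'
  have hY' : ∀ᶠ t' in 𝓝 t, HasDerivAt Y (Y1 t') t' := by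
    filter_upwards [hF, hQ] with t' hF hQ
    have := ((hQ.differentiableAt (by simp)).hasDerivAt.mul hF.neg.exp)
    refine this.congr_deriv ?_
    simp only [hY1, Pi.neg_apply]
    ring
  have hX2 : HasDerivAt X1 (κ * (Real.exp (F t) * (β + Q t * saddleK ρ ρ' (r t)))) t :=
    hF.self_of_nhds.exp.const_mul κ
  have hY2 : HasDerivAt Y1 (deriv Y1 t) t := by
    refine DifferentiableAt.hasDerivAt ?_
    have c1 : DifferentiableAt ℝ (fun t => saddleK ρ ρ' (r t)) t :=
      ((contDiffAt_saddleK (n := 1) ρ' hρ (hr t)).differentiableAt (by simp)).comp t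
        (h.deriv_r t).differentiableAt
    have c2 := dQ1.differentiableAt (by simp)
    have c3 := hQc.differentiableAt (by simp)
    have c4 := hF.self_of_nhds.differentiableAt
    simp only [hY1]
    fun_prop
  have eR : ρ + X t * Y t = r t := hXY.self_of_nhds
  have dG := hasDerivAt_saddleG ρ' hρ (hr t)
  have hA0 :
      HasDerivAt (fun s => A s (Y t)) (dSaddleG ρ ρ' (r t) * Y t / κ ^ 2 * Y t ^ 2) (X t) := by
    have d1 : HasDerivAt (fun s => ρ + s * Y t) (Y t) (X t) := by
      simpa using ((hasDerivAt_id (X t)).mul_const (Y t)).const_add ρ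
    rw [← eR] at dG ⊢
    exact ((dG.comp (X t) d1).div_const _).mul_const _
  have hA1 : HasDerivAt (fun s => A (X t) s) (dSaddleG ρ ρ' (r t) * X t / κ ^ 2 * Y t ^ 2
      + saddleG ρ ρ' (r t) / κ ^ 2 * (2 * Y t)) (Y t) := by
    have d1 : HasDerivAt (fun s => ρ + X t * s) (X t) (Y t) := by
      simpa using ((hasDerivAt_id (Y t)).const_mul (X t)).const_add ρ
    rw [← eR] at dG ⊢
    refine (((dG.comp (Y t) d1).div_const _).mul ((hasDerivAt_id (Y t)).pow 2)).congr_deriv ?_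
    simp
  have eA :
      (fun t' => A (X t') (Y t')) =ᶠ[𝓝 t] fun t' => saddleG ρ ρ' (r t') / κ ^ 2 * Y t' ^ 2 := by
    filter_upwards [hXY] with t' ht'
    simp only [hA, ht']
  have hA' : HasDerivAt (fun t' => A (X t') (Y t'))
      (dSaddleG ρ ρ' (r t) * Y t / κ ^ 2 * Y t ^ 2 * X1 t +
        (dSaddleG ρ ρ' (r t) * X t / κ ^ 2 * Y t ^ 2
          + saddleG ρ ρ' (r t) / κ ^ 2 * (2 * Y t)) * Y1 t) t := by
    have d1 : HasDerivAt r (X1 t * Y t + X t * Y1 t) t := by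
      refine ((hX'.self_of_nhds.mul hY'.self_of_nhds).const_add ρ).congr_of_eventuallyEq ?_
      filter_upwards [hXY] with t' ht' using ht'.symm
    have := ((dG.comp t d1).div_const (κ ^ 2)).mul (hY'.self_of_nhds.pow 2)
    refine (this.congr_of_eventuallyEq eA).congr_deriv ?_
    simp
    ring
  have hAc : ContDiffAt ℝ 1 (fun t' => A (X t') (Y t')) t := by
    have c0 : ContDiffAt ℝ 1 (fun t => saddleG ρ ρ' (r t)) t :=
      (contDiffAt_saddleG ρ' hρ (hr t)).comp t (by exact_mod_cast hrc (n := 1))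
    have c1 : ContDiffAt ℝ 1 Y t := hYc.of_le (by norm_num)
    exact ((c0.div_const _).mul (c1.pow 2)).congr_of_eventuallyEq eA
  refine uniformlyAccelerated_null (A := A) (by simpa using hκ0) (by rw [eR]; exact hr t)
    sin_half_pi_ne_zero hXc hYc hAc hX' hY' hX2 hY2 hA0 hA1 hA' ?_ ?_
  · filter_upwards [eA, hQ1] with t' e1 e2
    rw [e1]
    simp only [hX1, hY1, hY, Real.exp_neg]
    field_simp
    linarith
  · have e1 := eXY t
    rw [hQw.self_of_nhds] at e1
    have e3 : Y t = Q t * (Real.exp (F t))⁻¹ := by simp only [hY, Real.exp_neg]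
    have e2 : X1 t * Y t = κ * Q t := by
      rw [e3]; simp only [hX1]; field_simp
    have e4 : κ * (Real.exp (F t) * (β + Q t * saddleK ρ ρ' (r t))) =
        β * X1 t + saddleK ρ ρ' (r t) * (κ * Q t) * X1 t / κ := by
      simp only [hX1]
      field_simp
    rw [e4, ← e2, saddleK]
    have e5 : (dSaddleG ρ ρ' (r t) * X t / κ ^ 2 * Y t ^ 2 + saddleG ρ ρ' (r t) / κ ^ 2 * (2 * Y t))
        = (dSaddleG ρ ρ' (r t) * (X t * Y t) + 2 * saddleG ρ ρ' (r t)) * Y t / κ ^ 2 := by ring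
    rw [e5, e1]
    field_simp
    ring

end

/-! ### Analytic tools -/

section ParametricIntegral

open MeasureTheory

variable {E : Type} [NormedAddCommGroup E]

theorem continuousOn_slice {F : Type} [NormedAddCommGroup F] {f : E × ℝ → F}
    {W : Set (E × ℝ)} (hf : ContinuousOn f W) {x : E} (hx : ∀ t ∈ Set.Icc (0 : ℝ) 1, (x, t) ∈ W) :
    ContinuousOn (fun t => f (x, t)) (Set.Icc 0 1) :=
  hf.comp (by fun_prop) fun t ht => hx t ht

theorem exists_bound_slices [ProperSpace E] {F : Type} [NormedAddCommGroup F] {f : E × ℝ → F}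
    {W : Set (E × ℝ)} (hf : ContinuousOn f W) {U : Set E} (hU : IsOpen U)
    (hUW : ∀ x ∈ U, ∀ t ∈ Set.Icc (0 : ℝ) 1, (x, t) ∈ W) {x₀ : E} (hx₀ : x₀ ∈ U) :
    ∃ s ∈ 𝓝 x₀, s ⊆ U ∧ ∃ C, ∀ x ∈ s, ∀ t ∈ Set.Icc (0 : ℝ) 1, ‖f (x, t)‖ ≤ C := by
  obtain ⟨ε, hε, hsub⟩ := Metric.nhds_basis_closedBall.mem_iff.1 (hU.mem_nhds hx₀)
  have hK : IsCompact (Metric.closedBall x₀ ε ×ˢ Set.Icc (0 : ℝ) 1) :=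
    (isCompact_closedBall x₀ ε).prod isCompact_Icc
  obtain ⟨C, hC⟩ := hK.exists_bound_of_continuousOn
    (hf.mono fun p hp => hUW p.1 (hsub hp.1) p.2 hp.2)
  exact ⟨_, Metric.closedBall_mem_nhds x₀ hε, hsub, C, fun x hx t ht => hC (x, t) ⟨hx, ht⟩⟩

theorem continuousOn_integral_slice [ProperSpace E] {F : Type} [NormedAddCommGroup F]
    [NormedSpace ℝ F]
    {f : E × ℝ → F} {W : Set (E × ℝ)} (hf : ContinuousOn f W) {U : Set E}
    (hU : IsOpen U) (hUW : ∀ x ∈ U, ∀ t ∈ Set.Icc (0 : ℝ) 1, (x, t) ∈ W) (hW : IsOpen W) :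
    ContinuousOn (fun x => ∫ t in (0 : ℝ)..1, f (x, t)) U := by
  intro x₀ hx₀
  obtain ⟨s, hs, hsU, C, hC⟩ := exists_bound_slices hf hU hUW hx₀
  refine (intervalIntegral.continuousAt_of_dominated_interval (bound := fun _ => C)
    ?_ ?_ intervalIntegrable_const ?_).continuousWithinAt
  · filter_upwards [hU.mem_nhds hx₀] with x hx
    have := continuousOn_slice hf (hUW x hx)
    refine (this.mono ?_).aestronglyMeasurable measurableSet_uIoc
    rw [Set.uIoc_of_le zero_le_one]
    exact Set.Ioc_subset_Icc_self
  · filter_upwards [hs] with x hx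
    refine Eventually.of_forall fun t ht => hC x hx t ?_
    rw [Set.uIoc_of_le zero_le_one] at ht
    exact Set.Ioc_subset_Icc_self ht
  · refine Eventually.of_forall fun t ht => ?_
    rw [Set.uIoc_of_le zero_le_one] at ht
    have : ContinuousAt f (x₀, t) :=
      hf.continuousAt (hW.mem_nhds (hUW x₀ hx₀ t (Set.Ioc_subset_Icc_self ht)))
    exact this.comp (f := fun x : E => (x, t)) (by fun_prop)

/-- The integral over `[0, 1]` of a function that is `C^n` in all its variables is `C^n` in the
parameter. -/
theorem contDiffOn_integral_slice [NormedSpace ℝ E] [ProperSpace E] (n : ℕ) : ∀ {F : Type}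
    [NormedAddCommGroup F] [NormedSpace ℝ F]
    {f : E × ℝ → F} {W : Set (E × ℝ)} (_ : IsOpen W) (_ : ContDiffOn ℝ n f W)
    {U : Set E} (_ : IsOpen U) (_ : ∀ x ∈ U, ∀ t ∈ Set.Icc (0 : ℝ) 1, (x, t) ∈ W),
    ContDiffOn ℝ n (fun x => ∫ t in (0 : ℝ)..1, f (x, t)) U := by
  induction n with
  | zero =>
    intro F _ _ f W hW hf U hU hUW
    exact contDiffOn_zero.2 (continuousOn_integral_slice hf.continuousOn hU hUW hW)
  | succ n ih =>
    intro F _ _ f W hW hf U hU hUW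
    push_cast at hf ⊢
    have hf' : ContDiffOn ℝ n (fderiv ℝ f) W :=
      ((contDiffOn_succ_iff_fderiv_of_isOpen hW).1 hf).2.2
    set f' : E × ℝ → E →L[ℝ] F := fun p => (fderiv ℝ f p).comp (ContinuousLinearMap.inl ℝ E ℝ)
      with hf'def
    have hf'c : ContDiffOn ℝ n f' W := hf'.clm_comp contDiffOn_const
    have hd : ∀ x ∈ U, HasFDerivAt (fun x => ∫ t in (0 : ℝ)..1, f (x, t))
        (∫ t in (0 : ℝ)..1, f' (x, t)) x := by
      intro x₀ hx₀
      obtain ⟨s, hs, hsU, C, hC⟩ := exists_bound_slices hf'c.continuousOn hU hUW hx₀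
      have hI : Set.uIoc (0 : ℝ) 1 ⊆ Set.Icc 0 1 := by
        rw [Set.uIoc_of_le zero_le_one]
        exact Set.Ioc_subset_Icc_self
      refine intervalIntegral.hasFDerivAt_integral_of_dominated_of_fderiv_le (𝕜 := ℝ)
        (F := fun x t => f (x, t)) (F' := fun x t => f' (x, t)) (bound := fun _ => C) hs
        ?_ ?_ ?_ ?_ intervalIntegrable_const ?_
      · filter_upwards [hU.mem_nhds hx₀] with x hx
        exact ((continuousOn_slice hf.continuousOn (hUW x hx)).mono hI).aestronglyMeasurable
          measurableSet_uIoc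
      · refine ContinuousOn.intervalIntegrable ?_
        rw [Set.uIcc_of_le zero_le_one]
        exact continuousOn_slice hf.continuousOn (hUW x₀ hx₀)
      · exact ((continuousOn_slice hf'c.continuousOn (hUW x₀ hx₀)).mono
          hI).aestronglyMeasurable measurableSet_uIoc
      · exact Eventually.of_forall fun t ht x hx => hC x hx t (hI ht)
      · refine Eventually.of_forall fun t ht x hx => ?_
        have h1 : DifferentiableAt ℝ f (x, t) :=
          ((hf.contDiffAt (hW.mem_nhds (hUW x (hsU hx) t (hI ht)))).differentiableAt (by simp))
        have h2 : HasFDerivAt (fun x : E => (x, t)) (ContinuousLinearMap.inl ℝ E ℝ) x :=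
          hasFDerivAt_prodMk_left x t
        exact h1.hasFDerivAt.comp x h2
    rw [contDiffOn_succ_iff_fderiv_of_isOpen hU]
    refine ⟨fun x hx => (hd x hx).differentiableAt.differentiableWithinAt, by simp, ?_⟩
    exact (ih hW hf'c hU hUW).congr fun x hx => (hd x hx).fderiv

end ParametricIntegral

/-- A function that becomes smooth after composition with a local diffeomorphism is smooth. -/
theorem contDiffAt_of_comp_localDiffeo {E F G : Type} [NormedAddCommGroup E] [NormedSpace ℝ E]
    [CompleteSpace E] [NormedAddCommGroup F] [NormedSpace ℝ F] [NormedAddCommGroup G]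
    [NormedSpace ℝ G] {Φ : E → F} {Φ' : E ≃L[ℝ] F} {u : E} {f : F → G} {g : E → G}
    {n : WithTop ℕ∞} (hn : n ≠ 0) (hΦ : ContDiffAt ℝ n Φ u)
    (hΦ' : HasFDerivAt Φ (Φ' : E →L[ℝ] F) u) (hg : ContDiffAt ℝ n g u)
    (hfg : ∀ᶠ w in 𝓝 u, f (Φ w) = g w) : ContDiffAt ℝ n f (Φ u) := by
  have h1 := hΦ.to_localInverse hΦ' hn
  have h2 := hΦ.localInverse_apply_image hΦ' hn
  have h3 : ∀ᶠ y in 𝓝 (Φ u), Φ (hΦ.localInverse hΦ' hn y) = y :=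
    (hΦ.hasStrictFDerivAt' hΦ' hn).eventually_right_inverse
  have h4 : ContDiffAt ℝ n (fun y => g (hΦ.localInverse hΦ' hn y)) (Φ u) := by
    refine ContDiffAt.comp _ ?_ h1
    rwa [h2]
  refine h4.congr_of_eventuallyEq ?_
  have h5 : Tendsto (hΦ.localInverse hΦ' hn) (𝓝 (Φ u)) (𝓝 u) := by
    have := h1.continuousAt.tendsto
    rwa [h2] at this
  filter_upwards [h3, h5.eventually hfg] with y hy hy'
  rw [← hy', hy]

theorem exists_primitive_Ioo {f : ℝ → ℝ} {a b c : ℝ} (hc : c ∈ Set.Ioo a b)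
    (hf : ContinuousOn f (Set.Ioo a b)) :
    ∃ F : ℝ → ℝ, F c = 0 ∧ ∀ x ∈ Set.Ioo a b, HasDerivAt F (f x) x := by
  refine ⟨fun x => ∫ y in c..x, f y, by simp, fun x hx => ?_⟩
  have hsub : Set.uIcc c x ⊆ Set.Ioo a b := Set.OrdConnected.uIcc_subset inferInstance hc hx
  refine intervalIntegral.integral_hasDerivAt_right ((hf.mono hsub).intervalIntegrable)
    ?_ (hf.continuousAt (isOpen_Ioo.mem_nhds hx))
  exact hf.stronglyMeasurableAtFilter isOpen_Ioo x hx

/-- A scalar autonomous equation with positive right hand side of at most linear growth has a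
global solution, the inverse function of a primitive of `1 / H`. -/
theorem exists_global_solution {H : ℝ → ℝ} (hc : Continuous H) (hpos : ∀ x, 0 < H x) {C : ℝ}
    (hC : ∀ x, H x ≤ C * (1 + |x|)) :
    ∃ x : ℝ → ℝ, x 0 = 0 ∧ (∀ t, HasDerivAt x (H (x t)) t) ∧ StrictMono x ∧
      Tendsto x atTop atTop ∧ Tendsto x atBot atBot := by
  have hC0 : 0 < C := by
    have := hC 0
    have := hpos 0
    simp at *
    linarith
  have hci : Continuous fun x => 1 / H x := continuous_const.div hc fun x => (hpos x).ne'
  set F : ℝ → ℝ := fun y => ∫ x in (0 : ℝ)..y, 1 / H x with hF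
  have hd : ∀ y, HasDerivAt F (1 / H y) y := fun y =>
    intervalIntegral.integral_hasDerivAt_right (hci.intervalIntegrable _ _)
      (hci.stronglyMeasurableAtFilter _ _) hci.continuousAt
  have hF0 : F 0 = 0 := by simp [hF]
  have hmono : StrictMono F := strictMono_of_hasDerivAt_pos hd fun y => by
    have := hpos y
    positivity
  have hFc : Continuous F := continuous_iff_continuousAt.2 fun y => (hd y).continuousAt
  have hpt : ∀ y, 1 / (C * (1 + |y|)) ≤ 1 / H y := fun y =>
    one_div_le_one_div_of_le (hpos y) (hC y)
  have hlogt : Tendsto (fun y => Real.log (1 + y) / C) atTop atTop :=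
    (Real.tendsto_log_atTop.comp (tendsto_atTop_add_const_left _ 1 tendsto_id)).atTop_div_const hC0
  have hderiv : ∀ y : ℝ, 0 ≤ y → HasDerivAt (fun y => Real.log (1 + y) / C)
      (1 / (C * (1 + y))) y := fun y hy => by
    have h1 : (1 : ℝ) + y ≠ 0 := by positivity
    refine ((((hasDerivAt_id y).const_add 1).log h1).div_const C).congr_deriv ?_
    simp only [id]
    field_simp
  have hge : ∀ y : ℝ, 0 ≤ y → Real.log (1 + y) / C ≤ F y := by
    intro y hy
    have hm : MonotoneOn (fun y => F y - Real.log (1 + y) / C) (Set.Ici 0) := by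
      refine monotoneOn_of_deriv_nonneg (convex_Ici 0) ?_ ?_ ?_
      · exact fun z hz => ((hd z).sub (hderiv z hz)).continuousAt.continuousWithinAt
      · intro z hz
        rw [interior_Ici] at hz
        exact ((hd z).sub (hderiv z (le_of_lt hz))).differentiableAt.differentiableWithinAt
      · intro z hz
        rw [interior_Ici] at hz
        have hz' : (0 : ℝ) < z := hz
        have := ((hd z).sub (hderiv z hz'.le)).deriv
        have h2 := hpt z
        rw [abs_of_pos hz'] at h2
        rw [show (fun y => F y - Real.log (1 + y) / C) = F - fun y => Real.log (1 + y) / C from rfl,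
          this]
        linarith
    have := hm (Set.self_mem_Ici) (Set.mem_Ici.2 hy) hy
    simp [hF0] at this
    linarith
  have hle : ∀ y : ℝ, 0 ≤ y → F (-y) ≤ -(Real.log (1 + y) / C) := by
    intro y hy
    have hm : MonotoneOn (fun y => -F (-y) - Real.log (1 + y) / C) (Set.Ici 0) := by
      have hd' : ∀ z, HasDerivAt (fun y => -F (-y)) (1 / H (-z)) z := fun z =>
        ((hd (-z)).scomp z (hasDerivAt_neg z)).neg.congr_deriv (by simp)
      refine monotoneOn_of_deriv_nonneg (convex_Ici 0) ?_ ?_ ?_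
      · exact fun z hz => ((hd' z).sub (hderiv z hz)).continuousAt.continuousWithinAt
      · intro z hz
        rw [interior_Ici] at hz
        exact ((hd' z).sub (hderiv z (le_of_lt hz))).differentiableAt.differentiableWithinAt
      · intro z hz
        rw [interior_Ici] at hz
        have hz' : (0 : ℝ) < z := hz
        have := ((hd' z).sub (hderiv z hz'.le)).deriv
        have h2 := hpt (-z)
        rw [abs_neg, abs_of_pos hz'] at h2
        rw [show (fun y => -F (-y) - Real.log (1 + y) / C) =
          (fun y => -F (-y)) - fun y => Real.log (1 + y) / C from rfl, this]
        linarith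
    have := hm (Set.self_mem_Ici) (Set.mem_Ici.2 hy) hy
    simp [hF0] at this
    linarith
  have htop : Tendsto F atTop atTop := by
    refine tendsto_atTop_mono' _ ?_ hlogt
    filter_upwards [eventually_ge_atTop 0] with y hy using hge y hy
  have hbot : Tendsto F atBot atBot := by
    have h1 : Tendsto (fun y => F (-y)) atTop atBot := by
      refine tendsto_atBot_mono' _ ?_ (tendsto_neg_atTop_atBot.comp hlogt)
      filter_upwards [eventually_ge_atTop 0] with y hy using hle y hy
    refine (h1.comp tendsto_neg_atBot_atTop).congr fun y => ?_
    simp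
  have hsurj : Function.Surjective F := hFc.surjective htop hbot
  let e := hmono.orderIsoOfSurjective F hsurj
  have he : ∀ y, e y = F y := fun _ => rfl
  refine ⟨e.symm, ?_, fun t => ?_, e.symm.strictMono, e.symm.tendsto_atTop, e.symm.tendsto_atBot⟩
  · rw [OrderIso.symm_apply_eq, he, hF0]
  · have h1 : HasDerivAt F (1 / H (e.symm t)) (e.symm t) := hd _
    have h2 := h1.of_local_left_inverse (f := F) (g := e.symm) (a := t)
      e.symm.continuous.continuousAt (one_div_ne_zero (hpos _).ne')
      (Eventually.of_forall fun y => e.apply_symm_apply y)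
    simpa using h2

/-- If the second derivative of `f` is positive as long as `f` is at least its initial value, and
`f` starts at rest, then `f` never drops below its initial value. -/
theorem le_of_second_deriv_pos {f g h : ℝ → ℝ} {b f₀ : ℝ} (hf0 : f₀ ≤ f 0) (hg0 : 0 ≤ g 0)
    (hf : ∀ t ∈ Set.Icc 0 b, HasDerivAt f (g t) t) (hg : ∀ t ∈ Set.Icc 0 b, HasDerivAt g (h t) t)
    (hpos : ∀ t ∈ Set.Icc 0 b, f₀ ≤ f t → 0 < h t) : ∀ t ∈ Set.Icc 0 b, f₀ ≤ f t := by
  have hfc : ContinuousOn f (Set.Icc 0 b) := fun t ht => (hf t ht).continuousAt.continuousWithinAt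
  have hgc : ContinuousOn g (Set.Icc 0 b) := fun t ht => (hg t ht).continuousAt.continuousWithinAt
  have hcl : IsClosed ({t | f₀ ≤ f t ∧ 0 ≤ g t} ∩ Set.Icc 0 b) := by
    have h1 := hfc.preimage_isClosed_of_isClosed isClosed_Icc (isClosed_Ici (a := f₀))
    have h2 := hgc.preimage_isClosed_of_isClosed isClosed_Icc (isClosed_Ici (a := (0 : ℝ)))
    convert h1.inter h2 using 1
    ext t
    simp only [Set.mem_inter_iff, Set.mem_ofPred_eq, Set.mem_preimage, Set.mem_Ici]
    tauto
  have key := hcl.Icc_subset_of_forall_exists_gt (a := 0) (b := b) ⟨hf0, hg0⟩ ?_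
  · exact fun t ht => (key ht).1
  rintro t ⟨⟨h1, h2⟩, ht⟩ y hy
  have htI : t ∈ Set.Icc 0 b := ⟨ht.1, ht.2.le⟩
  have hgt : ∀ᶠ x in 𝓝[>] t, g t < g x := by
    have := (hg t htI).tendsto_slope.mono_left (nhdsGT_le_nhdsNE t)
    filter_upwards [this.eventually (lt_mem_nhds (hpos t htI h1)), self_mem_nhdsWithin] with x hx
      hx'
    have hx'' : 0 < x - t := sub_pos.2 hx'
    rw [slope_def_field] at hx
    have := (div_pos_iff_of_pos_right hx'').1 hx
    linarith
  obtain ⟨u, hu, hsub⟩ := mem_nhdsGT_iff_exists_Ioo_subset.1 hgt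
  have hu' : t < u := hu
  obtain ⟨x, hx1, hx2⟩ := exists_between (lt_min (lt_min hu' hy) ht.2)
  have hxu : x < u := hx2.trans_le ((min_le_left _ _).trans (min_le_left _ _))
  have hxy : x < y := hx2.trans_le ((min_le_left _ _).trans (min_le_right _ _))
  have hxb : x < b := hx2.trans_le (min_le_right _ _)
  have hsubI : Set.Icc t x ⊆ Set.Icc 0 b := Set.Icc_subset_Icc ht.1 hxb.le
  refine ⟨x, ⟨?_, ?_⟩, hx1, hxy.le⟩
  · have hm : MonotoneOn f (Set.Icc t x) := by
      refine monotoneOn_of_deriv_nonneg (convex_Icc t x) (hfc.mono hsubI) ?_ ?_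
      · rw [interior_Icc]
        exact fun z hz => (hf z (hsubI ⟨hz.1.le, hz.2.le⟩)).differentiableAt.differentiableWithinAt
      · rw [interior_Icc]
        intro z hz
        rw [(hf z (hsubI ⟨hz.1.le, hz.2.le⟩)).deriv]
        have := hsub ⟨hz.1, hz.2.trans hxu⟩
        simp only [Set.mem_ofPred_eq] at this
        linarith
    exact h1.trans (hm ⟨le_rfl, hx1.le⟩ ⟨hx1.le, le_rfl⟩ hx1.le)
  · have := hsub ⟨hx1, hxu⟩
    simp only [Set.mem_ofPred_eq] at this
    linarith

theorem eventually_lt_of_hasDerivAt_neg {w : ℝ → ℝ} {w' t : ℝ} (h : HasDerivAt w w' t)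
    (hw' : w' < 0) : (∀ᶠ x in 𝓝[>] t, w x < w t) ∧ ∀ᶠ x in 𝓝[<] t, w t < w x := by
  have hs := h.tendsto_slope.eventually (gt_mem_nhds hw')
  constructor
  · filter_upwards [nhdsGT_le_nhdsNE t hs, self_mem_nhdsWithin] with x hx hx'
    have hx'' : 0 < x - t := sub_pos.2 hx'
    rw [slope_def_field, div_lt_iff₀ hx''] at hx
    linarith
  · filter_upwards [nhdsLT_le_nhdsNE t hs, self_mem_nhdsWithin] with x hx hx'
    have hx'' : x - t < 0 := sub_neg.2 hx'
    rw [slope_def_field, div_lt_iff_of_neg hx''] at hx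
    linarith

/-- A function all of whose zeros in an interval are strict down-crossings, and that takes both
signs, has exactly one zero there. -/
theorem exists_unique_downcrossing {w w' : ℝ → ℝ} {a b c d : ℝ} (hd : ∀ t ∈ Set.Ioo a b,
    HasDerivAt w (w' t) t) (hneg : ∀ t ∈ Set.Ioo a b, w t = 0 → w' t < 0)
    (hc : c ∈ Set.Ioo a b) (hcw : 0 < w c) (hd' : d ∈ Set.Ioo a b) (hdw : w d < 0) :
    ∃ z ∈ Set.Ioo a b, w z = 0 ∧ c < z ∧ (∀ t ∈ Set.Ioo a z, 0 < w t) ∧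
      ∀ t ∈ Set.Ioo z b, w t < 0 := by
  have hcont : ContinuousOn w (Set.Ioo a b) := fun t ht =>
    (hd t ht).continuousAt.continuousWithinAt
  have key : ∀ x ∈ Set.Ioo a b, ∀ y ∈ Set.Ioo a b, x < y → w x ≤ 0 → w y < 0 := by
    intro x hx y hy hxy hwx
    have hsub : Set.Icc x y ⊆ Set.Ioo a b := Set.Icc_subset_Ioo hx.1 hy.2
    have hcl : IsClosed ({t | w t ≤ 0} ∩ Set.Icc x y) := by
      have h1 := (hcont.mono hsub).preimage_isClosed_of_isClosed isClosed_Icc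
        (isClosed_Iic (a := (0 : ℝ)))
      rwa [Set.inter_comm] at h1
    have hall := hcl.Icc_subset_of_forall_mem_nhdsWithin (a := x) (b := y) hwx (by
      rintro t ⟨ht, htI⟩
      have htI' := hsub ⟨htI.1, htI.2.le⟩
      rcases lt_or_eq_of_le (show w t ≤ 0 from ht) with h0 | h0
      · have := (hd t htI').continuousAt.eventually (gt_mem_nhds h0)
        exact nhdsWithin_le_nhds (this.mono fun z hz => hz.le)
      · have := (eventually_lt_of_hasDerivAt_neg (hd t htI') (hneg t htI' h0)).1
        rw [h0] at this
        exact this.mono fun z hz => hz.le)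
    rcases lt_or_eq_of_le (show w y ≤ 0 from hall ⟨hxy.le, le_rfl⟩) with h0 | h0
    · exact h0
    · exfalso
      have h1 := (eventually_lt_of_hasDerivAt_neg (hd y hy) (hneg y hy h0)).2
      have h2 : ∀ᶠ z in 𝓝[<] y, z ∈ Set.Ioo x y := Ioo_mem_nhdsLT hxy
      obtain ⟨z, hz1, hz2⟩ := (h1.and h2).exists
      have h3 := hall ⟨hz2.1.le, hz2.2.le⟩
      simp only [Set.mem_ofPred_eq] at h3
      linarith
  have hcd : c < d := by
    rcases lt_trichotomy c d with h | h | h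
    · exact h
    · rw [h] at hcw; linarith
    · have := key d hd' c hc h hdw.le
      linarith
  obtain ⟨z, hz, hwz⟩ := intermediate_value_Icc' hcd.le
    (hcont.mono (Set.Icc_subset_Ioo hc.1 hd'.2)) (show (0 : ℝ) ∈ Set.Icc (w d) (w c) from
      ⟨hdw.le, hcw.le⟩)
  have hzI : z ∈ Set.Ioo a b := Set.Icc_subset_Ioo hc.1 hd'.2 hz
  refine ⟨z, hzI, hwz, ?_, fun t ht => ?_, fun t ht => ?_⟩
  · rcases lt_or_eq_of_le hz.1 with h | h
    · exact h
    · rw [h, hwz] at hcw; exact absurd hcw (lt_irrefl _)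
  · by_contra hcon
    have := key t ⟨ht.1, ht.2.trans hzI.2⟩ z hzI ht.2 (not_lt.1 hcon)
    linarith
  · exact key z hzI t ⟨hzI.1.trans ht.1, ht.2⟩ ht.1 hwz.le

/-- A strictly increasing unbounded sequence of reals cuts the line into half-open intervals. -/
theorem exists_int_lt_le {s : ℤ → ℝ} (hs : StrictMono s) (htop : Tendsto s atTop atTop)
    (hbot : Tendsto s atBot atBot) (t : ℝ) : ∃ k, s k < t ∧ t ≤ s (k + 1) := by
  obtain ⟨N, hN⟩ := (htop.eventually_ge_atTop t).exists
  obtain ⟨M, hM⟩ := (hbot.eventually_lt_atBot t).exists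
  obtain ⟨k, hk, hmax⟩ := Int.exists_greatest_of_bdd (P := fun k => s k < t)
    ⟨N, fun z hz => by
      by_contra hcon
      have := hs (not_le.1 hcon)
      linarith⟩ ⟨M, hM⟩
  refine ⟨k, hk, ?_⟩
  by_contra hcon
  have := hmax (k + 1) (not_le.1 hcon)
  linarith

/-- Functions given on the overlapping intervals `(s k, s (k + 2))` glue. -/
theorem exists_glued {α : Type*} {s : ℤ → ℝ} (hs : StrictMono s) (htop : Tendsto s atTop atTop)
    (hbot : Tendsto s atBot atBot) (f : ℤ → ℝ → α)
    (hf : ∀ k, ∀ t ∈ Set.Ioo (s (k + 1)) (s (k + 2)), f k t = f (k + 1) t) :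
    ∃ x : ℝ → α, ∀ k, ∀ t ∈ Set.Ioo (s k) (s (k + 2)), x t = f k t := by
  have hex := exists_int_lt_le hs htop hbot
  choose κ hκ1 hκ2 using hex
  refine ⟨fun t => f (κ t) t, fun k t ht => ?_⟩
  change f (κ t) t = f k t
  have h1 : k < κ t + 1 := hs.lt_iff_lt.1 (ht.1.trans_le (hκ2 t))
  have h2 : κ t < k + 2 := hs.lt_iff_lt.1 ((hκ1 t).trans ht.2)
  rcases (by omega : κ t = k ∨ κ t = k + 1) with h | h
  · rw [h]
  · have h3 := hκ1 t
    rw [h] at h3 ⊢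
    exact (hf k t ⟨h3, ht.2⟩).symm

/-- Recursion in both directions. -/
theorem exists_int_recursion (δ : ℤ → ℝ) (c₀ : ℝ) :
    ∃ c : ℤ → ℝ, c 0 = c₀ ∧ ∀ k, c (k + 1) = c k + δ k := by
  refine ⟨fun k => c₀ + ∑ i ∈ Finset.range k.toNat, δ i
    - ∑ i ∈ Finset.range (-k).toNat, δ (-((i : ℤ) + 1)), by simp, fun k => ?_⟩
  rcases le_or_gt 0 k with h | h
  · have h1 : (k + 1).toNat = k.toNat + 1 := by omega
    have h2 : (-k).toNat = 0 := by omega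
    have h3 : (-(k + 1)).toNat = 0 := by omega
    have h4 : ((k.toNat : ℕ) : ℤ) = k := by omega
    simp only [h1, h2, h3, Finset.sum_range_succ, h4, Finset.range_zero, Finset.sum_empty]
    ring
  · have h1 : (k + 1).toNat = 0 := by omega
    have h2 : k.toNat = 0 := by omega
    have h3 : (-k).toNat = (-(k + 1)).toNat + 1 := by omega
    have h4 : -((((-(k + 1)).toNat : ℕ) : ℤ) + 1) = k := by omega
    simp only [h1, h2, h3, Finset.sum_range_succ, h4, Finset.range_zero, Finset.sum_empty]
    ring

/-! ### The radial potential of the congruence -/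

/-- The acceleration of the curve of the congruence that starts at the radius `s`. -/
def accel (m q s : ℝ) : ℝ := 2 * √(D m q s) / s

/-- The energy `D dt/dσ` at the radius `r` of the curve of the congruence that starts at the radius
`s`; it is written as an affine function of `r` with slope `accel`. -/
def energy (m q s r : ℝ) : ℝ := -√(D m q s) + accel m q s * r

/-- The cubic factor of `(dr/dσ)² = (r - s) M(r) / (r² s²)`. -/
def radialCubic (m q s r : ℝ) : ℝ := 4 * D m q s * r ^ 3 - (2 * m * s - q ^ 2) * r + q ^ 2 * s

/-- The derivative of `(dr/dσ)²` with respect to `r` at the starting radius `r = s`; its sign is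
that of `s - r_⊛`. -/
def initialForce (m q s : ℝ) : ℝ := (4 * s ^ 2 - 10 * m * s + 6 * q ^ 2) / s ^ 3

/-- The second order remainder in `(dr/dσ)² = (r - s) (c + (r - s) Q₂)`, for `c` the initial force.
-/
def remainder (m q s r : ℝ) : ℝ :=
  (s ^ 2 * (4 * D m q s * (r ^ 2 + r * s + s ^ 2) - (2 * m * s - q ^ 2))
    - s ^ 4 * initialForce m q s * (r + s)) / (r ^ 2 * s ^ 4)

section

variable {m q s : ℝ}

theorem rPlus_add_rMinus (m q : ℝ) : rPlus m q + rMinus m q = 2 * m := by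
  unfold rPlus rMinus; ring

theorem rPlus_mul_rMinus (hqm : q ^ 2 ≤ m ^ 2) : rPlus m q * rMinus m q = q ^ 2 := by
  unfold rPlus rMinus
  have := Real.sq_sqrt (sub_nonneg.2 hqm)
  linarith

theorem rMinus_le_rPlus (m q : ℝ) : rMinus m q ≤ rPlus m q := by
  unfold rPlus rMinus
  have := Real.sqrt_nonneg (m ^ 2 - q ^ 2)
  linarith

theorem m_le_rPlus (m q : ℝ) : m ≤ rPlus m q := by
  unfold rPlus
  have := Real.sqrt_nonneg (m ^ 2 - q ^ 2)
  linarith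

theorem rMinus_pos (hm : 0 < m) (hq : q ≠ 0) (hqm : q ^ 2 ≤ m ^ 2) : 0 < rMinus m q := by
  have h1 := rPlus_mul_rMinus hqm
  have h2 := m_le_rPlus m q
  have h3 : 0 < q ^ 2 := by positivity
  by_contra h
  nlinarith

theorem D_eq (hqm : q ^ 2 ≤ m ^ 2) {r : ℝ} (hr : r ≠ 0) :
    D m q r = (r - rPlus m q) * (r - rMinus m q) / r ^ 2 := by
  have h1 := rPlus_mul_rMinus hqm
  have h2 := rPlus_add_rMinus m q
  rw [D]
  field_simp
  linear_combination r * h2 - h1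

theorem D_pos (hm : 0 < m) (hqm : q ^ 2 ≤ m ^ 2) {r : ℝ} (hr : rPlus m q < r) : 0 < D m q r := by
  have h1 := m_le_rPlus m q
  have h2 := rMinus_le_rPlus m q
  rw [D_eq hqm (by linarith)]
  have h3 : 0 < r - rPlus m q := by linarith
  have h4 : 0 < r - rMinus m q := by linarith
  have h5 : 0 < r := by linarith
  positivity

theorem accel_pos (hm : 0 < m) (hqm : q ^ 2 ≤ m ^ 2) (hs : rPlus m q < s) : 0 < accel m q s := by
  have h1 := m_le_rPlus m q
  have h2 := Real.sqrt_pos.2 (D_pos hm hqm hs)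
  have h5 : 0 < s := by linarith
  unfold accel
  positivity

/-- The square of the radial velocity in factorized form. -/
theorem energy_sq_sub (hs : 0 < s) (hD : 0 ≤ D m q s) {r : ℝ} (hr : r ≠ 0) :
    energy m q s r ^ 2 - D m q r = (r - s) * radialCubic m q s r / (r ^ 2 * s ^ 2) := by
  have h1 : energy m q s r ^ 2 = D m q s * (2 * r / s - 1) ^ 2 := by
    rw [energy, accel]
    have := Real.sq_sqrt hD
    linear_combination (2 * r / s - 1) ^ 2 * this
  rw [h1, radialCubic, D, D]
  field_simp
  ring

theorem initialForce_add_remainder (hs : 0 < s) {r : ℝ} (hr : r ≠ 0) :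
    initialForce m q s + (r - s) * remainder m q s r = radialCubic m q s r / (r ^ 2 * s ^ 2) := by
  rw [remainder, radialCubic, initialForce, D]
  field_simp
  ring

theorem radialCubic_self (hs : 0 < s) : radialCubic m q s s = s ^ 4 * initialForce m q s := by
  rw [radialCubic, initialForce, D]
  field_simp
  ring

theorem le_sqrt_rCrit (hqm : q ^ 2 ≤ m ^ 2) :
    m ≤ √(25 * m ^ 2 - 24 * q ^ 2) := by
  apply Real.le_sqrt_of_sq_le
  linarith

theorem rCrit_ge (hqm : q ^ 2 ≤ m ^ 2) : 3 / 2 * m ≤ rCrit m q := by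
  have := le_sqrt_rCrit hqm
  unfold rCrit
  linarith

theorem initialForce_eq (hqm : q ^ 2 ≤ m ^ 2) (s : ℝ) : initialForce m q s =
    4 * (s - rCrit m q) * (s - 5 / 4 * m + 1 / 4 * √(25 * m ^ 2 - 24 * q ^ 2)) / s ^ 3 := by
  have h : (0 : ℝ) ≤ 25 * m ^ 2 - 24 * q ^ 2 := by nlinarith [sq_nonneg m]
  have := Real.sq_sqrt h
  rw [initialForce, rCrit]
  congr 1
  linear_combination 1 / 4 * this

theorem initialForce_factor_pos (hm : 0 < m) (hqm : q ^ 2 ≤ m ^ 2) (hs : rPlus m q < s) :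
    0 < s ∧ 0 < 4 * (s - 5 / 4 * m + 1 / 4 * √(25 * m ^ 2 - 24 * q ^ 2)) / s ^ 3 := by
  have h1 := m_le_rPlus m q
  have h2 := le_sqrt_rCrit hqm
  have h3 : 0 < s := by linarith
  refine ⟨h3, ?_⟩
  have : 0 < s - 5 / 4 * m + 1 / 4 * √(25 * m ^ 2 - 24 * q ^ 2) := by linarith
  positivity

theorem initialForce_pos (hm : 0 < m) (hqm : q ^ 2 ≤ m ^ 2) (hs : rPlus m q < s)
    (h : rCrit m q < s) : 0 < initialForce m q s := by
  obtain ⟨h1, h2⟩ := initialForce_factor_pos hm hqm hs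
  have := mul_pos (sub_pos.2 h) h2
  rw [initialForce_eq hqm, mul_assoc, mul_left_comm, mul_div_assoc]
  exact this

theorem initialForce_neg (hm : 0 < m) (hqm : q ^ 2 ≤ m ^ 2) (hs : rPlus m q < s)
    (h : s < rCrit m q) : initialForce m q s < 0 := by
  obtain ⟨h1, h2⟩ := initialForce_factor_pos hm hqm hs
  have := mul_neg_of_neg_of_pos (sub_neg.2 h) h2
  rw [initialForce_eq hqm, mul_assoc, mul_left_comm, mul_div_assoc]
  exact this

theorem initialForce_rCrit (hqm : q ^ 2 ≤ m ^ 2) : initialForce m q (rCrit m q) = 0 := by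
  rw [initialForce_eq hqm]
  simp

theorem rCrit_lt_two_rPlus (hm : 0 < m) (hqm : q ^ 2 ≤ m ^ 2) : rCrit m q < 2 * rPlus m q := by
  have h1 := Real.sqrt_nonneg (m ^ 2 - q ^ 2)
  have h2 := Real.sq_sqrt (sub_nonneg.2 hqm)
  have h3 : √(25 * m ^ 2 - 24 * q ^ 2) < 3 * m + 8 * √(m ^ 2 - q ^ 2) := by
    rw [Real.sqrt_lt' (by positivity)]
    nlinarith [mul_nonneg hm.le h1, pow_pos hm 2]
  unfold rCrit rPlus
  linarith

/-- The energy at the event horizon is positive for the infalling curves. -/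
theorem energy_rPlus_pos (hm : 0 < m) (hqm : q ^ 2 ≤ m ^ 2) (hs : rPlus m q < s)
    (h : s < rCrit m q) : 0 < energy m q s (rPlus m q) := by
  have h1 := m_le_rPlus m q
  have h2 := rCrit_lt_two_rPlus hm hqm
  have h3 := Real.sqrt_pos.2 (D_pos hm hqm hs)
  have h4 : 0 < s := by linarith
  have h5 : energy m q s (rPlus m q) = √(D m q s) * ((2 * rPlus m q - s) / s) := by
    rw [energy, accel]; field_simp; ring
  rw [h5]
  have : 0 < 2 * rPlus m q - s := by linarith
  positivity

/-- At the event horizon the square of the radial velocity is `E² > 0`. -/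
theorem radialCubic_rPlus_neg (hm : 0 < m) (hqm : q ^ 2 ≤ m ^ 2) (hs : rPlus m q < s)
    (h : s < rCrit m q) : radialCubic m q s (rPlus m q) < 0 := by
  have h1 := m_le_rPlus m q
  have h4 : 0 < s := by linarith
  have h5 : 0 < rPlus m q := by linarith
  have e := energy_sq_sub h4 (D_pos hm hqm hs).le h5.ne' (m := m) (q := q)
  have h6 : D m q (rPlus m q) = 0 := by rw [D_eq hqm h5.ne']; simp
  rw [h6, sub_zero] at e
  have h7 := pow_pos (energy_rPlus_pos hm hqm hs h) 2
  rw [e] at h7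
  by_contra hcon
  have h8 : (rPlus m q - s) * radialCubic m q s (rPlus m q) / (rPlus m q ^ 2 * s ^ 2) ≤ 0 :=
    div_nonpos_of_nonpos_of_nonneg
      (mul_nonpos_of_nonpos_of_nonneg (by linarith) (not_lt.1 hcon)) (by positivity)
  linarith

theorem radialCubic_neg (hm : 0 < m) (hqm : q ^ 2 ≤ m ^ 2) (hs : rPlus m q < s)
    (h : s < rCrit m q) {r : ℝ} (h1 : rPlus m q ≤ r) (h2 : r ≤ s) : radialCubic m q s r < 0 := by
  have hr := m_le_rPlus m q
  have h4 : 0 < s := by linarith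
  have ha := radialCubic_rPlus_neg hm hqm hs h
  have hb : radialCubic m q s s < 0 := by
    rw [radialCubic_self h4]
    exact mul_neg_of_pos_of_neg (by positivity) (initialForce_neg hm hqm hs h)
  have hd := (D_pos hm hqm hs).le
  -- the cubic is convex on the positive half-line
  have key : radialCubic m q s (rPlus m q) * (s - r) + radialCubic m q s s * (r - rPlus m q)
      - radialCubic m q s r * (s - rPlus m q) =
      (r - rPlus m q) * (s - r) * (s - rPlus m q) * (4 * D m q s * (r + rPlus m q + s)) := by
    simp only [radialCubic]; ring
  have h5 : 0 ≤ (r - rPlus m q) * (s - r) * (s - rPlus m q)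
      * (4 * D m q s * (r + rPlus m q + s)) := by
    have e1 : 0 ≤ r - rPlus m q := by linarith
    have e2 : 0 ≤ s - r := by linarith
    have e3 : 0 ≤ s - rPlus m q := by linarith
    have e4 : 0 ≤ r + rPlus m q + s := by linarith
    positivity
  by_contra hcon
  have h6 := mul_nonneg (not_lt.1 hcon) (sub_nonneg.2 hs.le)
  rcases eq_or_lt_of_le h2 with e | e
  · rw [e] at hcon; exact hcon hb
  · have h7 := mul_neg_of_neg_of_pos ha (sub_pos.2 e)
    have h8 := mul_nonpos_of_nonpos_of_nonneg hb.le (sub_nonneg.2 h1)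
    linarith

/-- The quotient of `radialCubic r - radialCubic s` by `r - s` is positive. -/
theorem diff_quotient_pos (hm : 0 < m) (hqm : q ^ 2 ≤ m ^ 2) (hs : rCrit m q ≤ s)
    (hs' : rPlus m q < s) {r : ℝ} (hr : s ≤ r) :
    0 < 4 * D m q s * (r ^ 2 + r * s + s ^ 2) - (2 * m * s - q ^ 2) := by
  have h1 := rCrit_ge hqm
  have h4 : 0 < s := by linarith
  have h5 : 0 ≤ initialForce m q s := by
    rcases eq_or_lt_of_le hs with h | h
    · rw [← h, initialForce_rCrit hqm]
    · exact (initialForce_pos hm hqm hs' h).le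
  rw [initialForce, le_div_iff₀ (by positivity), zero_mul] at h5
  have h6 : D m q s * s ^ 2 = s ^ 2 - 2 * m * s + q ^ 2 := by
    rw [D]; field_simp
  have h7 : s ^ 2 ≤ r * s := by nlinarith
  have h8 : s ^ 2 ≤ r ^ 2 := by nlinarith
  have h9 : 3 * s ^ 2 ≤ r ^ 2 + r * s + s ^ 2 := by linarith
  have h10 := mul_le_mul_of_nonneg_left h9 (D_pos hm hqm hs').le
  nlinarith

/-- Positivity of `(dr/dσ)² / (c (r - s))` in the exterior region, in the form that has no
singularity at the starting radius `r = s`, and none at `s = r_⊛`, where the initial force `c`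
vanishes. -/
theorem one_add_remainder_pos (hm : 0 < m) (hqm : q ^ 2 ≤ m ^ 2) (hs : rPlus m q < s) {z : ℝ}
    (hr : rPlus m q < s + initialForce m q s * z ^ 2) :
    0 < 1 + z ^ 2 * remainder m q s (s + initialForce m q s * z ^ 2) := by
  have hmr := m_le_rPlus m q
  have h4 : 0 < s := by linarith
  have hrpos : 0 < s + initialForce m q s * z ^ 2 := by linarith
  have key := initialForce_add_remainder (m := m) (q := q) h4 hrpos.ne'
  set c := initialForce m q s with hc
  set r := s + c * z ^ 2 with hrdef
  have key' : c * (1 + z ^ 2 * remainder m q s r) = radialCubic m q s r / (r ^ 2 * s ^ 2) := by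
    rw [← key, hrdef]; ring
  rcases lt_trichotomy s (rCrit m q) with h | h | h
  · have hcneg := initialForce_neg hm hqm hs h
    rw [← hc] at hcneg
    have hrs : r ≤ s := by
      have := mul_nonpos_of_nonpos_of_nonneg hcneg.le (sq_nonneg z)
      linarith
    have h5 : radialCubic m q s r / (r ^ 2 * s ^ 2) < 0 :=
      div_neg_of_neg_of_pos (radialCubic_neg hm hqm hs h hr.le hrs) (by positivity)
    rw [← key'] at h5
    by_contra hcon
    have := mul_nonneg_of_nonpos_of_nonpos hcneg.le (not_lt.1 hcon)
    linarith
  · have hc0 : c = 0 := by rw [hc, h, initialForce_rCrit hqm]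
    have hrs : r = s := by rw [hrdef, hc0]; ring
    have h5 := diff_quotient_pos hm hqm h.ge hs (le_refl s)
    have : 0 < remainder m q s r := by
      rw [hrs, remainder, ← hc, hc0]
      apply div_pos _ (by positivity)
      have := mul_pos (pow_pos h4 2) h5
      linarith
    positivity
  · have hcpos := initialForce_pos hm hqm hs h
    rw [← hc] at hcpos
    have hrs : s ≤ r := by
      have := mul_nonneg hcpos.le (sq_nonneg z)
      linarith
    have h5 := diff_quotient_pos hm hqm h.le hs hrs
    have h6 : radialCubic m q s r = radialCubic m q s s
        + (r - s) * (4 * D m q s * (r ^ 2 + r * s + s ^ 2) - (2 * m * s - q ^ 2)) := by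
      simp only [radialCubic]; ring
    have h7 : 0 < radialCubic m q s r := by
      rw [h6, radialCubic_self h4, ← hc]
      have := mul_nonneg (sub_nonneg.2 hrs) h5.le
      positivity
    have h8 : 0 < c * (1 + z ^ 2 * remainder m q s r) := by rw [key']; positivity
    exact (pos_iff_pos_of_mul_pos h8).1 hcpos

end

/-! ### Radial motion of the congruence -/

/-- With `r = s + c z²`, for `c` the initial force, the radial motion is `dz/dσ = chartSpeed z s`.
This first-order equation has no singularity at the turning point `z = 0`, uniformly in `s`. -/
def chartSpeed (m q z s : ℝ) : ℝ :=
  √(1 + z ^ 2 * remainder m q s (s + initialForce m q s * z ^ 2)) / 2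

/-- The radial motion of the curve of the congruence that starts at the radius `s`. -/
abbrev CongruenceMotion (m q s : ℝ) (r v : ℝ → ℝ) : Prop :=
  RadialMotion m q (accel m q s) (-√(D m q s)) r v

section

variable {m q s : ℝ}

theorem hasDerivAt_velocity_sq {r : ℝ} (hr : r ≠ 0) :
    HasDerivAt (fun r => energy m q s r ^ 2 - D m q r)
      (2 * (accel m q s * energy m q s r) - dD m q r) r := by
  have h1 : HasDerivAt (energy m q s) (accel m q s) r := by
    exact (((hasDerivAt_id r).const_mul (accel m q s)).const_add (-√(D m q s))).congr_deriv
      (mul_one _)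
  refine ((h1.pow 2).sub (hasDerivAt_D m q hr)).congr_deriv ?_
  push_cast
  ring

theorem contDiffAt_remainder {r : ℝ} (hs : 0 < s) (hr : r ≠ 0) {n : WithTop ℕ∞} :
    ContDiffAt ℝ n (remainder m q s) r := by
  unfold remainder
  have h2 : r ^ 2 * s ^ 4 ≠ 0 := by positivity
  fun_prop (disch := assumption)

theorem remainder_le (hm : 0 < m) (hqm : q ^ 2 ≤ m ^ 2) (hs : rPlus m q < s)
    (hc : 0 ≤ initialForce m q s) {r : ℝ} (hr : s ≤ r) :
    remainder m q s r ≤ 12 * D m q s / s ^ 2 := by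
  have hmr := m_le_rPlus m q
  have h4 : 0 < s := by linarith
  have h5 : 0 < r := by linarith
  have hd := (D_pos hm hqm hs).le
  rw [remainder, div_le_div_iff₀ (by positivity) (by positivity)]
  have e1 : 0 ≤ 2 * m * s - q ^ 2 := by nlinarith
  have e2 : 0 ≤ s ^ 4 * initialForce m q s * (r + s) := by positivity
  have e3 : r ^ 2 + r * s + s ^ 2 ≤ 3 * r ^ 2 := by nlinarith
  have e4 := mul_le_mul_of_nonneg_left e3 hd
  have e5 : s ^ 2 * (4 * D m q s * (r ^ 2 + r * s + s ^ 2) - (2 * m * s - q ^ 2))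
      - s ^ 4 * initialForce m q s * (r + s) ≤ s ^ 2 * (12 * D m q s * r ^ 2) := by
    have := mul_le_mul_of_nonneg_left (show 4 * D m q s * (r ^ 2 + r * s + s ^ 2)
      - (2 * m * s - q ^ 2) ≤ 12 * D m q s * r ^ 2 by linarith) (pow_pos h4 2).le
    linarith
  have := mul_le_mul_of_nonneg_right e5 (pow_pos h4 2).le
  linarith

/-- A curve of the congruence that does not fall in: `r = s + c Z²`, with `c ≥ 0` the initial force
and `Z` increasing from `-∞` to `∞`. For `c = 0` the radius is constant. -/
theorem exists_radialMotion_of_ge (hm : 0 < m) (hqm : q ^ 2 ≤ m ^ 2) (hs : rPlus m q < s)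
    (hc : 0 ≤ initialForce m q s) :
    ∃ r v Z : ℝ → ℝ, CongruenceMotion m q s r v ∧ Z 0 = 0 ∧
      (∀ t, HasDerivAt Z (chartSpeed m q (Z t) s) t) ∧ StrictMono Z ∧
      Tendsto Z atTop atTop ∧ Tendsto Z atBot atBot ∧
      (∀ t, r t = s + initialForce m q s * Z t ^ 2) ∧
      ∀ t, v t = 2 * initialForce m q s * Z t * chartSpeed m q (Z t) s := by
  have hmr := m_le_rPlus m q
  have h4 : 0 < s := by linarith
  set c := initialForce m q s with hcdef
  have hrs : ∀ z : ℝ, s ≤ s + c * z ^ 2 := fun z => by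
    have := mul_nonneg hc (sq_nonneg z)
    linarith
  have hpos : ∀ z : ℝ, 0 < 1 + z ^ 2 * remainder m q s (s + c * z ^ 2) := fun z =>
    one_add_remainder_pos hm hqm hs (hs.trans_le (hrs z))
  have hd := D_pos hm hqm hs
  have hne : ∀ z : ℝ, s + c * z ^ 2 ≠ 0 := fun z => (h4.trans_le (hrs z)).ne'
  have hrd : ∀ z : ℝ, HasDerivAt (remainder m q s) (deriv (remainder m q s) (s + c * z ^ 2))
      (s + c * z ^ 2) := fun z =>
    ((contDiffAt_remainder (n := 1) h4 (hne z)).differentiableAt (by simp)).hasDerivAt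
  have hfd : ∀ z : ℝ, HasDerivAt (fun z => s + c * z ^ 2) (2 * c * z) z := fun z => by
    refine (((hasDerivAt_pow 2 z).const_mul c).const_add s).congr_deriv ?_
    push_cast; ring
  -- `N` is the square of `dz/dσ`, up to the factor `1 / 4`
  set N : ℝ → ℝ := fun z => 1 + z ^ 2 * remainder m q s (s + c * z ^ 2) with hN
  have hNd : ∀ z, HasDerivAt N (2 * z * remainder m q s (s + c * z ^ 2)
      + z ^ 2 * (deriv (remainder m q s) (s + c * z ^ 2) * (2 * c * z))) z := fun z => by
    refine (((hasDerivAt_pow 2 z).mul ((hrd z).comp z (hfd z))).const_add 1).congr_deriv ?_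
    simp
  have hspeed : ∀ z, chartSpeed m q z s = √(N z) / 2 := fun z => rfl
  have hNc : Continuous N := continuous_iff_continuousAt.2 fun z => (hNd z).continuousAt
  obtain ⟨Z, hZ0, hZd, hZm, hZt, hZb⟩ := exists_global_solution (H := fun z => chartSpeed m q z s)
    (by simp only [hspeed]; fun_prop)
    (fun z => by rw [hspeed]; have := Real.sqrt_pos.2 (hpos z); positivity)
    (C := 1 + 12 * D m q s / s ^ 2) (fun z => by
      have hK : 0 ≤ 12 * D m q s / s ^ 2 := by positivity
      have h1 := remainder_le hm hqm hs hc (hrs z)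
      have h2 := mul_le_mul_of_nonneg_left h1 (sq_nonneg z)
      have h3 : √(N z) ≤ (1 + 12 * D m q s / s ^ 2) * (1 + |z|) := by
        rw [Real.sqrt_le_left (by positivity)]
        simp only [hN]
        set K := 12 * D m q s / s ^ 2
        have h6 : 0 ≤ |z| := abs_nonneg z
        have h7 : z ^ 2 = |z| ^ 2 := (sq_abs z).symm
        rw [h7] at h2 ⊢
        nlinarith [mul_nonneg hK h6, mul_nonneg hK (sq_nonneg |z|), mul_nonneg hK hK,
          mul_nonneg (mul_nonneg hK hK) (sq_nonneg (1 + |z|))]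
      change chartSpeed m q z s ≤ _
      rw [hspeed]
      have := Real.sqrt_nonneg (N z)
      linarith)
  have hZ' : ∀ t, HasDerivAt (fun t => √(N (Z t)) / 2) ((2 * Z t * remainder m q s (s + c * Z t ^ 2)
      + Z t ^ 2 * (deriv (remainder m q s) (s + c * Z t ^ 2) * (2 * c * Z t))) / 8) t := fun t => by
    have h1 := ((hNd (Z t)).comp t (hZd t)).sqrt (hpos (Z t)).ne'
    refine (h1.div_const 2).congr_deriv ?_
    have h2 : √(N (Z t)) ≠ 0 := (Real.sqrt_pos.2 (hpos (Z t))).ne'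
    simp only [Function.comp, hspeed]
    field_simp
    ring
  have hP : ∀ r : ℝ, 0 < r → energy m q s r ^ 2 - D m q r =
      (r - s) * (c + (r - s) * remainder m q s r) := fun r hr => by
    rw [energy_sq_sub h4 hd.le hr.ne', initialForce_add_remainder h4 hr.ne']
    ring
  have hP' : ∀ z, 2 * (accel m q s * energy m q s (s + c * z ^ 2)) - dD m q (s + c * z ^ 2) =
      (c + c * z ^ 2 * remainder m q s (s + c * z ^ 2)) + c * z ^ 2 *
        (remainder m q s (s + c * z ^ 2) + c * z ^ 2 * deriv (remainder m q s) (s + c * z ^ 2)) :=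
          by
    intro z
    have hr : 0 < s + c * z ^ 2 := h4.trans_le (hrs z)
    have h1 := hasDerivAt_velocity_sq (m := m) (q := q) (s := s) (hne z)
    have h2 : HasDerivAt (fun r => (r - s) * (c + (r - s) * remainder m q s r)) _ (s + c * z ^ 2) :=
      ((hasDerivAt_id _).sub_const s).mul ((((hasDerivAt_id _).sub_const s).mul (hrd z)).const_add
        c)
    have h3 := h1.unique (h2.congr_of_eventuallyEq (by
      filter_upwards [lt_mem_nhds hr] with r hr using hP r hr))
    rw [h3]
    simp
  refine ⟨fun t => s + c * Z t ^ 2, fun t => 2 * c * Z t * chartSpeed m q (Z t) s, Z,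
    ⟨fun t => h4.trans_le (hrs _), fun t => ?_, fun t => ?_, fun t => ?_⟩,
    hZ0, hZd, hZm, hZt, hZb, fun t => rfl, fun t => rfl⟩
  · exact (hfd (Z t)).comp t (hZd t)
  · refine (((hZd t).const_mul (2 * c)).mul (hZ' t)).congr_deriv ?_
    have h1 := hP' (Z t)
    have h2 := Real.sq_sqrt (hpos (Z t)).le
    simp only [hspeed, hN] at h2 ⊢
    rw [energy] at h1
    linear_combination (-1 / 2) * h1 + (1 / 2) * c * h2
  · have h1 := hP (s + c * Z t ^ 2) (h4.trans_le (hrs _))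
    have h2 := Real.sq_sqrt (hpos (Z t)).le
    change _ = energy m q s (s + c * Z t ^ 2) ^ 2 - _
    rw [h1]
    simp only [hspeed, hN] at h2 ⊢
    linear_combination c ^ 2 * Z t ^ 2 * h2

/-- The radial motion of an infalling curve is periodic: `r` oscillates between the starting radius
`s` and a root `r₀` of the cubic inside the Cauchy horizon, `r = s - (s - r₀) sin² χ` with an angle
`χ` that increases from `-∞` to `∞`. The square `S` of the rate of `χ` depends on `sin² χ` only. -/
theorem exists_radialMotion_of_lt (hm : 0 < m) (hq : q ≠ 0) (hqm : q ^ 2 ≤ m ^ 2)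
    (hs : rPlus m q < s) (hsc : s < rCrit m q) :
    ∃ (r v χ S : ℝ → ℝ) (r₀ : ℝ), CongruenceMotion m q s r v ∧ 0 < r₀ ∧ r₀ ≤ rMinus m q ∧
      r₀ < rPlus m q ∧
      χ 0 = 0 ∧ (∀ t, 0 < S t) ∧ (∀ t, HasDerivAt χ (√(S t)) t) ∧ StrictMono χ ∧
      Tendsto χ atTop atTop ∧ Tendsto χ atBot atBot ∧
      (∀ t, r t = s - (s - r₀) * Real.sin (χ t) ^ 2) ∧
      (∀ t, v t = -(2 * (s - r₀) * Real.sin (χ t) * Real.cos (χ t) * √(S t))) ∧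
      (∀ t, 4 * (r t - r₀) * S t = -(radialCubic m q s (r t) / (r t ^ 2 * s ^ 2))) ∧
      ∃ S' : ℝ → ℝ, ∀ t, S t = S' (Real.sin (χ t) ^ 2) := by
  have hmr := m_le_rPlus m q
  have h4 : 0 < s := by linarith
  have hp : 0 < rPlus m q := by linarith
  have hd := D_pos hm hqm hs
  -- the cubic is positive at `0` and negative at the event horizon
  obtain ⟨r₀, hr0, hroot⟩ : ∃ r₀ ∈ Set.Ioo 0 (rPlus m q), radialCubic m q s r₀ = 0 := by
    have hcont : ContinuousOn (radialCubic m q s) (Set.Icc 0 (rPlus m q)) := by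
      unfold radialCubic; fun_prop
    have h0 : 0 < radialCubic m q s 0 := by
      unfold radialCubic; simp; positivity
    have h1 := radialCubic_rPlus_neg hm hqm hs hsc
    obtain ⟨x, hx, hx'⟩ := intermediate_value_Ioo' hp.le hcont (⟨h1, h0⟩ : (0 : ℝ) ∈ Set.Ioo _ _)
    exact ⟨x, hx, hx'⟩
  -- at the root `D = E² ≥ 0`, so it does not lie between the horizons
  have hr0m : r₀ ≤ rMinus m q := by
    have h1 := energy_sq_sub (m := m) (q := q) h4 hd.le hr0.1.ne'
    rw [hroot, mul_zero, zero_div, D_eq hqm hr0.1.ne'] at h1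
    have h2 : 0 ≤ (r₀ - rPlus m q) * (r₀ - rMinus m q) := by
      have h3 := sq_nonneg (energy m q s r₀)
      have h5 : (r₀ - rPlus m q) * (r₀ - rMinus m q) =
          (r₀ - rPlus m q) * (r₀ - rMinus m q) / r₀ ^ 2 * r₀ ^ 2 := by
        have := hr0.1.ne'
        field_simp
      rw [h5]
      exact mul_nonneg (by linarith) (sq_nonneg _)
    by_contra hcon
    have := mul_neg_of_neg_of_pos (sub_neg.2 hr0.2) (sub_pos.2 (not_le.1 hcon))
    linarith
  set L : ℝ → ℝ := fun r => 4 * D m q s * (r ^ 2 + r * r₀ + r₀ ^ 2) - (2 * m * s - q ^ 2) with hL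
  have hML : ∀ r, radialCubic m q s r = (r - r₀) * L r := fun r => by
    have : radialCubic m q s r = radialCubic m q s r - radialCubic m q s
      r₀ := by rw [hroot, sub_zero]
    rw [this]
    simp only [radialCubic, hL]; ring
  have hrs0 : r₀ < s := hr0.2.trans hs
  have hLs : L s < 0 := by
    have h1 : radialCubic m q s s < 0 := by
      rw [radialCubic_self h4]
      exact mul_neg_of_pos_of_neg (by positivity) (initialForce_neg hm hqm hs hsc)
    rw [hML] at h1
    by_contra hcon
    exact absurd h1 (not_lt.2 (mul_nonneg (sub_pos.2 hrs0).le (not_lt.1 hcon)))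
  have hLneg : ∀ r, 0 ≤ r → r ≤ s → L r < 0 := fun r h0 h1 => by
    refine lt_of_le_of_lt ?_ hLs
    have : r ^ 2 + r * r₀ + r₀ ^ 2 ≤ s ^ 2 + s * r₀ + r₀ ^ 2 := by nlinarith [hr0.1]
    have := mul_le_mul_of_nonneg_left this (show 0 ≤ 4 * D m q s by positivity)
    simp only [hL]
    linarith
  set b := s - r₀ with hb
  have hb0 : 0 < b := by rw [hb]; linarith
  set f : ℝ → ℝ := fun x => s - b * Real.sin x ^ 2 with hf
  have hfle : ∀ x, f x ≤ s := fun x => by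
    have := mul_nonneg hb0.le (sq_nonneg (Real.sin x))
    simp only [hf]; linarith
  have hfge : ∀ x, r₀ ≤ f x := fun x => by
    have := mul_le_mul_of_nonneg_left (Real.sin_sq_le_one x) hb0.le
    simp only [hf]; linarith
  have hfpos : ∀ x, 0 < f x := fun x => hr0.1.trans_le (hfge x)
  have hfd : ∀ x, HasDerivAt f (-(2 * b * Real.sin x * Real.cos x)) x := fun x => by
    refine ((((Real.hasDerivAt_sin x).pow 2).const_mul b).const_sub s).congr_deriv ?_
    push_cast; ring
  set S : ℝ → ℝ := fun r => -L r / (4 * r ^ 2 * s ^ 2) with hS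
  have hSpos : ∀ x, 0 < S (f x) := fun x => by
    have h1 := hLneg (f x) (hfpos x).le (hfle x)
    have h2 := hfpos x
    simp only [hS]
    apply div_pos (by linarith) (by positivity)
  have hSd : ∀ r : ℝ, 0 < r → HasDerivAt S (deriv S r) r := fun r hr => by
    refine DifferentiableAt.hasDerivAt ?_
    have : 4 * r ^ 2 * s ^ 2 ≠ 0 := by positivity
    simp only [hS, hL]
    fun_prop (disch := assumption)
  have hSfc : Continuous fun x => S (f x) := continuous_iff_continuousAt.2 fun x =>
    ((hSd (f x) (hfpos x)).comp x (hfd x)).continuousAt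
  have hbound : ∀ x, S (f x) ≤ 2 * m * s / (4 * r₀ ^ 2 * s ^ 2) := fun x => by
    have h1 := hfpos x
    simp only [hS]
    apply div_le_div₀ (by positivity) _ (by have := hr0.1; positivity)
    · have := pow_le_pow_left₀ hr0.1.le (hfge x) 2
      have := mul_le_mul_of_nonneg_right this (show 0 ≤ 4 * s ^ 2 by positivity)
      linarith
    · have h2 : 0 ≤ 4 * D m q s * (f x ^ 2 + f x * r₀ + r₀ ^ 2) := by
        have := hr0.1
        positivity
      simp only [hL]
      nlinarith [sq_nonneg q]
  obtain ⟨χ, hχ0, hχd, hχm, hχt, hχb⟩ := exists_global_solution (H := fun x => √(S (f x)))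
    hSfc.sqrt (fun x => Real.sqrt_pos.2 (hSpos x))
    (C := 1 + 2 * m * s / (4 * r₀ ^ 2 * s ^ 2)) (fun x => by
      have hK : 0 ≤ 2 * m * s / (4 * r₀ ^ 2 * s ^ 2) := by positivity
      have h1 := hbound x
      have h2 : √(S (f x)) ≤ 1 + 2 * m * s / (4 * r₀ ^ 2 * s ^ 2) := by
        rw [Real.sqrt_le_left (by positivity)]
        nlinarith
      have := mul_nonneg (show 0 ≤ 1 + 2 * m * s /
        (4 * r₀ ^ 2 * s ^ 2) by positivity) (abs_nonneg x)
      linarith)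
  have hχ' : ∀ t, HasDerivAt (fun t => √(S (f (χ t))))
      (deriv S (f (χ t)) * (-(2 * b * Real.sin (χ t) * Real.cos (χ t))) / 2) t := fun t => by
    have h1 := ((((hSd (f (χ t)) (hfpos _)).comp (χ t) (hfd _)).comp t (hχd t))).sqrt
      (hSpos (χ t)).ne'
    refine h1.congr_deriv ?_
    have := Real.sqrt_pos.2 (hSpos (χ t))
    simp only [Function.comp]
    field_simp
  have hP : ∀ r : ℝ, 0 < r → energy m q s r ^ 2 - D m q r = 4 * (s - r) * (r - r₀) * S r :=
    fun r hr => by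
      rw [energy_sq_sub h4 hd.le hr.ne', hML]
      simp only [hS]
      field_simp
      ring
  have hP' : ∀ r : ℝ, 0 < r → 2 * (accel m q s * energy m q s r) - dD m q r =
      4 * ((s - r) - (r - r₀)) * S r + 4 * (s - r) * (r - r₀) * deriv S r := by
    intro r hr
    have h1 := hasDerivAt_velocity_sq (m := m) (q := q) (s := s) hr.ne'
    have h2 := ((((hasDerivAt_id r).const_sub s).const_mul 4).mul
      ((hasDerivAt_id r).sub_const r₀)).mul (hSd r hr)
    have h3 := h1.unique (h2.congr_of_eventuallyEq (by
      filter_upwards [lt_mem_nhds hr] with r hr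
      rw [hP r hr]; rfl))
    rw [h3]
    simp only [id, Pi.mul_apply]
    ring
  have hcs : ∀ x, Real.cos x ^ 2 = 1 - Real.sin x ^ 2 := fun x => Real.cos_sq' x
  refine ⟨fun t => f (χ t), fun t => -(2 * b * Real.sin (χ t) * Real.cos (χ t) * √(S (f (χ t)))), χ,
    fun t => S (f (χ t)), r₀, ⟨fun t => hfpos _, fun t => ?_, fun t => ?_, fun t => ?_⟩,
    hr0.1, hr0m, hr0.2, hχ0, fun t => hSpos _, hχd, hχm, hχt, hχb, fun t => rfl, fun t => rfl,
      fun t => ?_,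
    fun y => S (s - b * y), fun t => rfl⟩
  · exact ((hfd (χ t)).comp t (hχd t)).congr_deriv (by ring)
  · have h1 := ((((((Real.hasDerivAt_sin (χ t)).comp t (hχd t)).const_mul (2 * b)).mul
      ((Real.hasDerivAt_cos (χ t)).comp t (hχd t))).mul (hχ' t)).neg)
    refine h1.congr_deriv ?_
    have h2 := hP' (f (χ t)) (hfpos _)
    have h3 := Real.sq_sqrt (hSpos (χ t)).le
    have h5 : s - f (χ t) = b * Real.sin (χ t) ^ 2 := by simp only [hf]; ring
    have h6 : f (χ t) - r₀ = b * Real.cos (χ t) ^ 2 := by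
      rw [hcs]; simp only [hf, hb]; ring
    rw [energy] at h2
    rw [h5, h6] at h2
    simp only [Function.comp, Pi.mul_apply]
    linear_combination (-1 / 2) * h2
      - 2 * b * (Real.cos (χ t) ^ 2 - Real.sin (χ t) ^ 2) * h3
  · have h1 := hP (f (χ t)) (hfpos _)
    have h3 := Real.sq_sqrt (hSpos (χ t)).le
    have h5 : s - f (χ t) = b * Real.sin (χ t) ^ 2 := by simp only [hf]; ring
    have h6 : f (χ t) - r₀ = b * Real.cos (χ t) ^ 2 := by
      rw [hcs]; simp only [hf, hb]; ring
    change _ = energy m q s (f (χ t)) ^ 2 - _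
    rw [h1, h5, h6]
    linear_combination 4 * b ^ 2 * Real.sin (χ t) ^ 2 * Real.cos (χ t) ^ 2 * h3
  · have h1 := (hfpos (χ t)).ne'
    rw [hML]
    simp only [hS]
    field_simp

end

/-! ### Smooth dependence on the starting radius -/

/-- The primitive `∫₀^z f(x, s) dx`, written as an integral over a fixed interval so that its
smoothness in `(z, s)` is plain. -/
def slicePrimitive (f : ℝ × ℝ → ℝ) (p : ℝ × ℝ) : ℝ := ∫ σ in (0 : ℝ)..1, p.1 * f (σ * p.1, p.2)

section

variable {f : ℝ × ℝ → ℝ} {U : Set (ℝ × ℝ)}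

theorem slicePrimitive_zero (f : ℝ × ℝ → ℝ) (s : ℝ) : slicePrimitive f (0, s) = 0 := by
  simp [slicePrimitive]

theorem contDiffOn_slicePrimitive (n : ℕ) (hU : IsOpen U) (hf : ContDiffOn ℝ n f U)
    (hstar : ∀ p ∈ U, ∀ σ ∈ Set.Icc (0 : ℝ) 1, (σ * p.1, p.2) ∈ U) :
    ContDiffOn ℝ n (slicePrimitive f) U := by
  have hmap : ContDiff ℝ n fun y : (ℝ × ℝ) × ℝ => ((y.2 * y.1.1, y.1.2) : ℝ × ℝ) := by fun_prop
  have hW : IsOpen ((fun y : (ℝ × ℝ) × ℝ => ((y.2 * y.1.1, y.1.2) : ℝ × ℝ)) ⁻¹' U) :=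
    hU.preimage hmap.continuous
  refine contDiffOn_integral_slice n (f := fun y : (ℝ × ℝ) × ℝ => y.1.1 * f (y.2 * y.1.1, y.1.2))
    hW ?_ hU hstar
  have h1 : ContDiff ℝ n fun y : (ℝ × ℝ) × ℝ => y.1.1 := by fun_prop
  exact h1.contDiffOn.mul (hf.comp hmap.contDiffOn fun y hy => hy)

theorem hasDerivAt_slicePrimitive (hU : IsOpen U) (hf : ContinuousOn f U)
    (hstar : ∀ p ∈ U, ∀ σ ∈ Set.Icc (0 : ℝ) 1, (σ * p.1, p.2) ∈ U) {z s : ℝ} (h : (z, s) ∈ U) :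
    HasDerivAt (fun z => slicePrimitive f (z, s)) (f (z, s)) z := by
  have h1 : (fun z => slicePrimitive f (z, s)) = fun z => ∫ x in (0 : ℝ)..z, f (x, s) := by
    funext z
    have := intervalIntegral.mul_integral_comp_mul_right (a := 0) (b := 1)
      (f := fun x => f (x, s)) (c := z)
    simp only [zero_mul, one_mul] at this
    rw [← this, slicePrimitive, intervalIntegral.integral_const_mul]
  have hs : IsOpen {x : ℝ | (x, s) ∈ U} := hU.preimage (f := fun x : ℝ => (x, s)) (by fun_prop)
  have hfs : ContinuousOn (fun x => f (x, s)) {x : ℝ | (x, s) ∈ U} :=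
    hf.comp (by fun_prop) fun x hx => hx
  rw [h1]
  refine intervalIntegral.integral_hasDerivAt_right ((hfs.mono ?_).intervalIntegrable)
    (hfs.stronglyMeasurableAtFilter hs z h) (hfs.continuousAt (hs.mem_nhds h))
  intro x hx
  rcases eq_or_ne z 0 with hz | hz
  · subst hz
    rw [Set.uIcc_self] at hx
    rwa [Set.mem_singleton_iff.1 hx]
  · have h2 : x / z ∈ Set.Icc (0 : ℝ) 1 := by
      rcases le_total 0 z with hz' | hz'
      · rw [Set.uIcc_of_le hz'] at hx
        exact ⟨div_nonneg hx.1 hz', div_le_one_of_le₀ hx.2 hz'⟩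
      · rw [Set.uIcc_of_ge hz'] at hx
        exact ⟨div_nonneg_of_nonpos hx.2 hz', div_le_one_of_ge hx.1 hz'⟩
    have := hstar (z, s) h _ h2
    simpa [div_mul_cancel₀ _ hz] using this

end

/-- The area radius `s + c z²` in the parameters `(z, s)`. -/
def chartRadius (m q : ℝ) (p : ℝ × ℝ) : ℝ := p.2 + initialForce m q p.2 * p.1 ^ 2

/-- The parameters `(z, s)` of the points of the congruence in the exterior region. -/
def chartDomain (m q : ℝ) : Set (ℝ × ℝ) := {p | rPlus m q < p.2 ∧ rPlus m q < chartRadius m q p}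

/-- The proper time `∫ dz / chartSpeed` from the initial slice. -/
def travelTime (m q : ℝ) : ℝ × ℝ → ℝ := slicePrimitive fun p => 1 / chartSpeed m q p.1 p.2

/-- The static time `∫ (E / D) dz / chartSpeed` from the initial slice. -/
def staticTime (m q : ℝ) : ℝ × ℝ → ℝ := slicePrimitive fun p =>
  energy m q p.2 (chartRadius m q p) / D m q (chartRadius m q p) / chartSpeed m q p.1 p.2

section

variable {m q : ℝ}

theorem contDiffAt_initialForce {s : ℝ} (hs : s ≠ 0) {n : WithTop ℕ∞} :
    ContDiffAt ℝ n (initialForce m q) s := by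
  unfold initialForce
  have : s ^ 3 ≠ 0 := pow_ne_zero 3 hs
  fun_prop (disch := assumption)

theorem contDiffAt_chartRadius {p : ℝ × ℝ} (hs : p.2 ≠ 0) {n : WithTop ℕ∞} :
    ContDiffAt ℝ n (chartRadius m q) p :=
  contDiffAt_snd.add (((contDiffAt_initialForce hs).comp p contDiffAt_snd).mul
    (contDiffAt_fst.pow 2))

theorem isOpen_chartDomain (hm : 0 < m) : IsOpen (chartDomain m q) := by
  rw [isOpen_iff_mem_nhds]
  rintro p ⟨h1, h2⟩
  have h3 : p.2 ≠ 0 := by linarith [m_le_rPlus m q]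
  have h4 : ContinuousAt (chartRadius m q) p := (contDiffAt_chartRadius (n := 0) h3).continuousAt
  filter_upwards [continuousAt_snd.eventually (lt_mem_nhds h1), h4.eventually (lt_mem_nhds h2)]
    with p' h5 h6 using ⟨h5, h6⟩

theorem chartDomain_of_sq_le {z z' s : ℝ} (h : (z, s) ∈ chartDomain m q) (hz : z' ^ 2 ≤ z ^ 2) :
    (z', s) ∈ chartDomain m q := by
  obtain ⟨h1, h2⟩ := h
  refine ⟨h1, ?_⟩
  simp only [chartRadius] at *
  rcases le_or_gt 0 (initialForce m q s) with h3 | h3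
  · have := mul_nonneg h3 (sq_nonneg z')
    linarith
  · have := mul_le_mul_of_nonpos_left hz h3.le
    linarith

theorem chartDomain_star : ∀ p ∈ chartDomain m q, ∀ σ ∈ Set.Icc (0 : ℝ) 1,
    (σ * p.1, p.2) ∈ chartDomain m q := fun p hp σ hσ => by
  refine chartDomain_of_sq_le (z := p.1) hp ?_
  rw [mul_pow]
  exact mul_le_of_le_one_left (sq_nonneg _) (pow_le_one₀ hσ.1 hσ.2)

theorem mem_chartDomain_zero {s : ℝ} (hs : rPlus m q < s) : (0, s) ∈ chartDomain m q :=
  ⟨hs, by simpa [chartRadius] using hs⟩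

theorem chartSpeed_pos (hm : 0 < m) (hqm : q ^ 2 ≤ m ^ 2) {p : ℝ × ℝ} (hp : p ∈ chartDomain m q) :
    0 < chartSpeed m q p.1 p.2 :=
  half_pos (Real.sqrt_pos.2 (one_add_remainder_pos hm hqm hp.1 hp.2))

theorem contDiffAt_chartSpeed (hm : 0 < m) (hqm : q ^ 2 ≤ m ^ 2) {p : ℝ × ℝ}
    (hp : p ∈ chartDomain m q) {n : WithTop ℕ∞} :
    ContDiffAt ℝ n (fun p : ℝ × ℝ => chartSpeed m q p.1 p.2) p := by
  have hmr := m_le_rPlus m q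
  have h1 : p.2 ≠ 0 := by linarith [hp.1]
  have h2 : chartRadius m q p ≠ 0 := by linarith [hp.2]
  have h3 : (1 + p.1 ^ 2 * remainder m q p.2 (chartRadius m q p)) ≠ 0 :=
    (one_add_remainder_pos hm hqm hp.1 hp.2).ne'
  have e1 : ContDiffAt ℝ n (fun p : ℝ × ℝ => initialForce m q p.2) p :=
    (contDiffAt_initialForce h1).comp p contDiffAt_snd
  have e2 : ContDiffAt ℝ n (fun p : ℝ × ℝ => D m q p.2) p :=
    (contDiffAt_D m q h1).comp p contDiffAt_snd
  have e3 : ContDiffAt ℝ n (chartRadius m q) p := contDiffAt_chartRadius h1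
  have h4 : chartRadius m q p ^ 2 * p.2 ^ 4 ≠ 0 := by positivity
  have e4 : ContDiffAt ℝ n (fun p : ℝ × ℝ => remainder m q p.2 (chartRadius m q p)) p := by
    unfold remainder
    fun_prop (disch := assumption)
  have e5 : ContDiffAt ℝ n
      (fun p : ℝ × ℝ => 1 + p.1 ^ 2 * remainder m q p.2 (chartRadius m q p)) p := by fun_prop
  exact (e5.sqrt h3).div_const 2

theorem contDiffOn_travelTime (hm : 0 < m) (hqm : q ^ 2 ≤ m ^ 2) (n : ℕ) :
    ContDiffOn ℝ n (travelTime m q) (chartDomain m q) :=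
  contDiffOn_slicePrimitive n (isOpen_chartDomain hm) (fun _ hp =>
    (contDiffAt_const.div (contDiffAt_chartSpeed hm hqm hp)
      (chartSpeed_pos hm hqm hp).ne').contDiffWithinAt) chartDomain_star

theorem hasDerivAt_travelTime (hm : 0 < m) (hqm : q ^ 2 ≤ m ^ 2) {z s : ℝ}
    (h : (z, s) ∈ chartDomain m q) :
    HasDerivAt (fun z => travelTime m q (z, s)) (1 / chartSpeed m q z s) z :=
  hasDerivAt_slicePrimitive (isOpen_chartDomain hm) (fun _ hp =>
    (contDiffAt_const.div (contDiffAt_chartSpeed hm hqm hp (n := 0))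
      (chartSpeed_pos hm hqm hp).ne').continuousAt.continuousWithinAt) chartDomain_star h

theorem contDiffAt_staticTimeRate (hm : 0 < m) (hqm : q ^ 2 ≤ m ^ 2) {p : ℝ × ℝ}
    (hp : p ∈ chartDomain m q) {n : WithTop ℕ∞} : ContDiffAt ℝ n (fun p : ℝ × ℝ =>
      energy m q p.2 (chartRadius m q p) / D m q (chartRadius m q p) / chartSpeed m q p.1 p.2) p :=
        by
  have hmr := m_le_rPlus m q
  have h1 : p.2 ≠ 0 := by linarith [hp.1]
  have h2 : chartRadius m q p ≠ 0 := by linarith [hp.2]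
  have e2 : ContDiffAt ℝ n (fun p : ℝ × ℝ => √(D m q p.2)) p :=
    ((contDiffAt_D m q h1).comp p contDiffAt_snd).sqrt (D_pos hm hqm hp.1).ne'
  have e3 : ContDiffAt ℝ n (chartRadius m q) p := contDiffAt_chartRadius h1
  have e4 : ContDiffAt ℝ n (fun p => D m q (chartRadius m q p)) p :=
    (contDiffAt_D m q h2).comp p e3
  refine ContDiffAt.div (ContDiffAt.div ?_ e4 (D_pos hm hqm hp.2).ne')
    (contDiffAt_chartSpeed hm hqm hp) (chartSpeed_pos hm hqm hp).ne'
  unfold energy accel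
  fun_prop (disch := assumption)

theorem contDiffOn_staticTime (hm : 0 < m) (hqm : q ^ 2 ≤ m ^ 2) (n : ℕ) :
    ContDiffOn ℝ n (staticTime m q) (chartDomain m q) :=
  contDiffOn_slicePrimitive n (isOpen_chartDomain hm) (fun _ hp =>
    (contDiffAt_staticTimeRate hm hqm hp).contDiffWithinAt) chartDomain_star

theorem hasDerivAt_staticTime (hm : 0 < m) (hqm : q ^ 2 ≤ m ^ 2) {z s : ℝ}
    (h : (z, s) ∈ chartDomain m q) :
    HasDerivAt (fun z => staticTime m q (z, s)) (energy m q s (chartRadius m q (z, s)) /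
      D m q (chartRadius m q (z, s)) / chartSpeed m q z s) z :=
  hasDerivAt_slicePrimitive (isOpen_chartDomain hm) (fun _ hp =>
    (contDiffAt_staticTimeRate hm hqm hp (n := 0)).continuousAt.continuousWithinAt)
    chartDomain_star h

theorem travelTime_injective (hm : 0 < m) (hqm : q ^ 2 ≤ m ^ 2) {z z' s : ℝ}
    (h : (z, s) ∈ chartDomain m q) (h' : (z', s) ∈ chartDomain m q)
    (he : travelTime m q (z, s) = travelTime m q (z', s)) : z = z' := by
  have hconv : Convex ℝ {x : ℝ | (x, s) ∈ chartDomain m q} := by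
    rw [convex_iff_ordConnected]
    refine ⟨fun x hx y hy w hw => ?_⟩
    rcases le_total 0 w with h0 | h0
    · exact chartDomain_of_sq_le hy (pow_le_pow_left₀ h0 hw.2 2)
    · exact chartDomain_of_sq_le hx (by nlinarith [hw.1])
  have hopen : IsOpen {x : ℝ | (x, s) ∈ chartDomain m q} :=
    (isOpen_chartDomain hm).preimage (f := fun x : ℝ => (x, s)) (by fun_prop)
  have hmono :
      StrictMonoOn (fun z => travelTime m q (z, s)) {x : ℝ | (x, s) ∈ chartDomain m q} := by
    refine strictMonoOn_of_deriv_pos hconv (fun x hx =>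
      (hasDerivAt_travelTime hm hqm hx).continuousAt.continuousWithinAt) fun x hx => ?_
    rw [hopen.interior_eq] at hx
    rw [(hasDerivAt_travelTime hm hqm hx).deriv]
    exact one_div_pos.2 (chartSpeed_pos hm hqm hx)
  exact hmono.injOn h h' he

/-- The pairs `(t, s)` of a proper time and a starting radius for which the curve is in the exterior
region. -/
def exteriorDomain (m q : ℝ) : Set (ℝ × ℝ) :=
  (fun p => (travelTime m q p, p.2)) '' chartDomain m q

open Classical in
/-- The parameter `z` as a function of the proper time and the starting radius. -/
def chartZ (m q : ℝ) (w : ℝ × ℝ) : ℝ :=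
  if h : w ∈ exteriorDomain m q then h.choose.1 else 0

theorem chartZ_travelTime (hm : 0 < m) (hqm : q ^ 2 ≤ m ^ 2) {z s : ℝ}
    (h : (z, s) ∈ chartDomain m q) : chartZ m q (travelTime m q (z, s), s) = z := by
  have hw : (travelTime m q (z, s), s) ∈ exteriorDomain m q := ⟨(z, s), h, rfl⟩
  rw [chartZ, dif_pos hw]
  obtain ⟨h1, h2⟩ := hw.choose_spec
  rw [Prod.ext_iff] at h2
  simp only at h2
  have h3 : hw.choose = (hw.choose.1, s) := Prod.ext rfl h2.2
  rw [h3] at h1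
  refine travelTime_injective hm hqm h1 h ?_
  rw [← h3]
  exact h2.1

/-- The map `(z, s) ↦ (σ, s)` is a local diffeomorphism: its derivative is triangular, with the
nonzero entry `1 / chartSpeed`. -/
theorem exists_equiv_travelTime (hm : 0 < m) (hqm : q ^ 2 ≤ m ^ 2) {p : ℝ × ℝ}
    (hp : p ∈ chartDomain m q) : ∃ A : (ℝ × ℝ) ≃L[ℝ] ℝ × ℝ,
      HasFDerivAt (fun p => (travelTime m q p, p.2)) (A : ℝ × ℝ →L[ℝ] ℝ × ℝ) p := by
  have hd : HasFDerivAt (travelTime m q) (fderiv ℝ (travelTime m q) p) p :=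
    (((contDiffOn_travelTime hm hqm 1).contDiffAt ((isOpen_chartDomain hm).mem_nhds hp)
      ).differentiableAt (by simp)).hasFDerivAt
  set B := fderiv ℝ (travelTime m q) p
  have h1 : HasDerivAt (fun z => travelTime m q (z, p.2)) (B (1, 0)) p.1 :=
    hd.comp_hasDerivAt p.1 ((hasDerivAt_id p.1).prodMk (hasDerivAt_const p.1 p.2))
  have h2 : B (1, 0) ≠ 0 := by
    rw [h1.unique (hasDerivAt_travelTime hm hqm hp)]
    exact (one_div_pos.2 (chartSpeed_pos hm hqm hp)).ne'
  have hB : ∀ x : ℝ × ℝ, B x = x.1 * B (1, 0) + x.2 * B (0, 1) := fun x => by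
    have : x = x.1 • ((1, 0) : ℝ × ℝ) + x.2 • ((0, 1) : ℝ × ℝ) := by ext <;> simp
    conv_lhs => rw [this, map_add, map_smul, map_smul, smul_eq_mul, smul_eq_mul]
  refine ⟨ContinuousLinearEquiv.equivOfInverse (B.prod (ContinuousLinearMap.snd ℝ ℝ ℝ))
    (((B (1, 0))⁻¹ • (ContinuousLinearMap.fst ℝ ℝ ℝ - B (0, 1) • ContinuousLinearMap.snd ℝ ℝ
      ℝ)).prod
      (ContinuousLinearMap.snd ℝ ℝ ℝ)) ?_ ?_, hd.prodMk hasFDerivAt_snd⟩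
  · intro x
    ext
    · simp [hB x]; field_simp; ring
    · simp
  · intro x
    ext
    · simp [hB ((B (1, 0))⁻¹ * (x.1 - B (0, 1) * x.2), x.2)]; field_simp; ring
    · simp

theorem contDiffAt_travelTime_prod (hm : 0 < m) (hqm : q ^ 2 ≤ m ^ 2) {p : ℝ × ℝ}
    (hp : p ∈ chartDomain m q) (n : ℕ) :
    ContDiffAt ℝ n (fun p => (travelTime m q p, p.2)) p :=
  ((contDiffOn_travelTime hm hqm n).contDiffAt ((isOpen_chartDomain hm).mem_nhds hp)).prodMk
    contDiffAt_snd

theorem isOpen_exteriorDomain (hm : 0 < m) (hqm : q ^ 2 ≤ m ^ 2) : IsOpen (exteriorDomain m q) := by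
  rw [isOpen_iff_mem_nhds]
  rintro _ ⟨p, hp, rfl⟩
  obtain ⟨A, hA⟩ := exists_equiv_travelTime hm hqm hp
  have h1 := (contDiffAt_travelTime_prod hm hqm hp 1).hasStrictFDerivAt' hA (by simp)
  rw [← h1.map_nhds_eq_of_equiv]
  exact image_mem_map ((isOpen_chartDomain hm).mem_nhds hp)

theorem contDiffAt_chartZ (hm : 0 < m) (hqm : q ^ 2 ≤ m ^ 2) {w : ℝ × ℝ}
    (hw : w ∈ exteriorDomain m q) (n : ℕ) : ContDiffAt ℝ n (chartZ m q) w := by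
  suffices h : ContDiffAt ℝ ((n + 1 : ℕ) : WithTop ℕ∞) (chartZ m q) w from
    h.of_le (by exact_mod_cast Nat.le_succ n)
  obtain ⟨p, hp, rfl⟩ := hw
  obtain ⟨A, hA⟩ := exists_equiv_travelTime hm hqm hp
  refine contDiffAt_of_comp_localDiffeo (g := Prod.fst) (by exact_mod_cast Nat.succ_ne_zero n)
    (contDiffAt_travelTime_prod hm hqm hp _) hA contDiffAt_fst ?_
  filter_upwards [(isOpen_chartDomain hm).mem_nhds hp] with p' hp'
  exact chartZ_travelTime hm hqm hp'

theorem chartZ_mem (hm : 0 < m) (hqm : q ^ 2 ≤ m ^ 2) {w : ℝ × ℝ} (hw : w ∈ exteriorDomain m q) :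
    (chartZ m q w, w.2) ∈ chartDomain m q ∧ travelTime m q (chartZ m q w, w.2) = w.1 := by
  obtain ⟨p, hp, rfl⟩ := hw
  have : chartZ m q (travelTime m q p, p.2) = p.1 := chartZ_travelTime hm hqm hp
  simp only [this]
  exact ⟨hp, trivial⟩

/-- The area radius at the proper time `w.1` of the curve from the radius `w.2`. -/
def extRadius (m q : ℝ) (w : ℝ × ℝ) : ℝ := chartRadius m q (chartZ m q w, w.2)

/-- The static time at the proper time `w.1` of the curve from the radius `w.2`. -/
def extTime (m q : ℝ) (w : ℝ × ℝ) : ℝ := staticTime m q (chartZ m q w, w.2)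

theorem extRadius_gt (hm : 0 < m) (hqm : q ^ 2 ≤ m ^ 2) {w : ℝ × ℝ} (hw : w ∈ exteriorDomain m q) :
    rPlus m q < extRadius m q w := (chartZ_mem hm hqm hw).1.2

theorem contDiffAt_extRadius (hm : 0 < m) (hqm : q ^ 2 ≤ m ^ 2) {w : ℝ × ℝ}
    (hw : w ∈ exteriorDomain m q) (n : ℕ) : ContDiffAt ℝ n (extRadius m q) w := by
  have h := (chartZ_mem hm hqm hw).1
  have h3 : w.2 ≠ 0 := by linarith [m_le_rPlus m q, h.1]
  exact (contDiffAt_chartRadius (p := (chartZ m q w, w.2)) h3).comp w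
    ((contDiffAt_chartZ hm hqm hw n).prodMk contDiffAt_snd)

theorem contDiffAt_extTime (hm : 0 < m) (hqm : q ^ 2 ≤ m ^ 2) {w : ℝ × ℝ}
    (hw : w ∈ exteriorDomain m q) (n : ℕ) : ContDiffAt ℝ n (extTime m q) w := by
  have h := (chartZ_mem hm hqm hw).1
  exact ((contDiffOn_staticTime hm hqm n).contDiffAt ((isOpen_chartDomain hm).mem_nhds h)).comp w
    ((contDiffAt_chartZ hm hqm hw n).prodMk contDiffAt_snd)

theorem mem_exteriorDomain_zero {s : ℝ} (hs : rPlus m q < s) : (0, s) ∈ exteriorDomain m q :=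
  ⟨(0, s), mem_chartDomain_zero hs, by simp [travelTime, slicePrimitive_zero]⟩

theorem chartZ_zero (hm : 0 < m) (hqm : q ^ 2 ≤ m ^ 2) {s : ℝ} (hs : rPlus m q < s) :
    chartZ m q (0, s) = 0 := by
  have := chartZ_travelTime hm hqm (mem_chartDomain_zero (m := m) (q := q) hs)
  simpa [travelTime, slicePrimitive_zero] using this

theorem extRadius_zero (hm : 0 < m) (hqm : q ^ 2 ≤ m ^ 2) {s : ℝ} (hs : rPlus m q < s) :
    extRadius m q (0, s) = s := by
  simp [extRadius, chartZ_zero hm hqm hs, chartRadius]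

theorem extTime_zero (hm : 0 < m) (hqm : q ^ 2 ≤ m ^ 2) {s : ℝ} (hs : rPlus m q < s) :
    extTime m q (0, s) = 0 := by
  simp [extTime, chartZ_zero hm hqm hs, staticTime, slicePrimitive_zero]

/-- A solution `z` of `dz/dσ = chartSpeed` is the parameter `chartZ`. -/
theorem chartZ_eq_of_hasDerivAt (hm : 0 < m) (hqm : q ^ 2 ≤ m ^ 2) {s : ℝ} {I : Set ℝ}
    (hI : IsOpen I)
    (hconv : Convex ℝ I) (h0 : (0 : ℝ) ∈ I) {z : ℝ → ℝ}
    (hz0 : z 0 = 0) (hz : ∀ t ∈ I, HasDerivAt z (chartSpeed m q (z t) s) t)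
    (hU : ∀ t ∈ I, (z t, s) ∈ chartDomain m q) {t : ℝ} (ht : t ∈ I) :
    (t, s) ∈ exteriorDomain m q ∧ chartZ m q (t, s) = z t := by
  have h1 : travelTime m q (z t, s) = t := by
    have hd : ∀ x ∈ I, HasDerivAt (fun t => travelTime m q (z t, s) - t) 0 x := fun x hx => by
      refine (((hasDerivAt_travelTime hm hqm (hU x hx)).comp x (hz x hx)).sub
        (hasDerivAt_id x)).congr_deriv ?_
      have := (chartSpeed_pos hm hqm (hU x hx)).ne'
      simp only at this
      field_simp
      simp
    have := hconv.is_const_of_fderivWithin_eq_zero (𝕜 := ℝ)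
      (f := fun t => travelTime m q (z t, s) - t)
      (fun x hx => (hd x hx).differentiableAt.differentiableWithinAt) (fun x hx => by
        rw [fderivWithin_of_isOpen hI hx]
        have := (hd x hx).hasFDerivAt.fderiv
        rw [this]
        ext
        simp) ht h0
    simp only [hz0, travelTime, slicePrimitive_zero] at this ⊢
    linarith
  have h2 := chartZ_travelTime hm hqm (hU t ht)
  rw [h1] at h2
  exact ⟨⟨(z t, s), hU t ht, by simp only [h1]⟩, h2⟩

theorem hasDerivAt_chartZ (hm : 0 < m) (hqm : q ^ 2 ≤ m ^ 2) {t s : ℝ}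
    (h : (t, s) ∈ exteriorDomain m q) :
    HasDerivAt (fun t => chartZ m q (t, s)) (chartSpeed m q (chartZ m q (t, s)) s) t := by
  have h1 : HasDerivAt (fun t => chartZ m q (t, s)) (deriv (fun t => chartZ m q (t, s)) t) t := by
    have h2 : DifferentiableAt ℝ (chartZ m q) (t, s) :=
      (contDiffAt_chartZ hm hqm h 1).differentiableAt (by simp)
    exact (h2.comp t (f := fun t => (t, s)) (by fun_prop)).hasDerivAt
  have h3 := (chartZ_mem hm hqm h).1
  have h4 : HasDerivAt (fun t => travelTime m q (chartZ m q (t, s), s)) 1 t := by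
    refine (hasDerivAt_id t).congr_of_eventuallyEq ?_
    have : ∀ᶠ t' in 𝓝 t, (t', s) ∈ exteriorDomain m q :=
      ((isOpen_exteriorDomain hm hqm).preimage (f := fun t : ℝ => (t, s)) (by fun_prop)).mem_nhds h
    filter_upwards [this] with t' ht'
    exact (chartZ_mem hm hqm ht').2
  have h5 : 1 / chartSpeed m q (chartZ m q (t, s)) s * deriv (fun t => chartZ m q (t, s)) t = 1 :=
    (HasDerivAt.comp (h₂ := fun z => travelTime m q (z, s)) t
      (hasDerivAt_travelTime hm hqm h3) h1).unique h4
  have h6 := (chartSpeed_pos hm hqm h3).ne'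
  simp only at h6
  rw [one_div, inv_mul_eq_one₀ h6] at h5
  rwa [← h5] at h1

theorem hasDerivAt_extTime (hm : 0 < m) (hqm : q ^ 2 ≤ m ^ 2) {t s : ℝ}
    (h : (t, s) ∈ exteriorDomain m q) : HasDerivAt (fun t => extTime m q (t, s))
      (energy m q s (extRadius m q (t, s)) / D m q (extRadius m q (t, s))) t := by
  have h3 := (chartZ_mem hm hqm h).1
  refine ((hasDerivAt_staticTime hm hqm h3).comp t (hasDerivAt_chartZ hm hqm h)).congr_deriv ?_
  have h6 := (chartSpeed_pos hm hqm h3).ne'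
  simp only at h6
  rw [div_mul_cancel₀ _ h6]
  rfl

end

section

variable {m q s : ℝ}

/-- The radial motion of a curve that does not fall in agrees with the smooth family `extRadius`. -/
theorem extRadius_of_ge (hm : 0 < m) (hqm : q ^ 2 ≤ m ^ 2) (hs : rPlus m q < s)
    (hc : 0 ≤ initialForce m q s) {r Z : ℝ → ℝ} (hZ0 : Z 0 = 0)
    (hZ : ∀ t, HasDerivAt Z (chartSpeed m q (Z t) s) t)
    (hr : ∀ t, r t = s + initialForce m q s * Z t ^ 2) (t : ℝ) :
    (t, s) ∈ exteriorDomain m q ∧ extRadius m q (t, s) = r t := by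
  obtain ⟨h1, h2⟩ := chartZ_eq_of_hasDerivAt hm hqm isOpen_univ convex_univ trivial hZ0
    (fun t _ => hZ t) (fun t _ => ⟨hs, by
      have := mul_nonneg hc (sq_nonneg (Z t))
      simp only [chartRadius]
      linarith⟩) (Set.mem_univ t)
  exact ⟨h1, by rw [extRadius, h2, hr]; rfl⟩

/-- The radial motion of an infalling curve agrees with the smooth family `extRadius` in the
exterior region; the phase and the parameter `z` are related by `c z² = -(s - r₀) sin² χ`. -/
theorem extRadius_of_lt (hm : 0 < m) (hqm : q ^ 2 ≤ m ^ 2) (hs : rPlus m q < s)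
    (hsc : s < rCrit m q) {r χ S : ℝ → ℝ} {r₀ a b : ℝ} (hr₀ : 0 < r₀) (hr₀s : r₀ < s)
      (hχ0 : χ 0 = 0)
    (hS : ∀ t, 0 < S t) (hχ : ∀ t, HasDerivAt χ (√(S t)) t)
    (hr : ∀ t, r t = s - (s - r₀) * Real.sin (χ t) ^ 2)
    (hM : ∀ t, 4 * (r t - r₀) * S t = -(radialCubic m q s (r t) / (r t ^ 2 * s ^ 2)))
    (h0 : (0 : ℝ) ∈ Set.Ioo a b) (hab : ∀ t ∈ Set.Ioo a b, rPlus m q < r t)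
    (hcos : ∀ t ∈ Set.Ioo a b, 0 < Real.cos (χ t)) {t : ℝ} (ht : t ∈ Set.Ioo a b) :
    (t, s) ∈ exteriorDomain m q ∧ extRadius m q (t, s) = r t := by
  have hc := initialForce_neg hm hqm hs hsc
  have h4 : 0 < s := by linarith
  set c := initialForce m q s with hcdef
  set A := √((s - r₀) / -c)
  have hA : A ^ 2 = (s - r₀) / -c := Real.sq_sqrt (div_nonneg (by linarith) (by linarith))
  have hA' : c * A ^ 2 = -(s - r₀) := by
    rw [hA]
    field_simp [hc.ne]
  have hrz : ∀ t, s + c * (A * Real.sin (χ t)) ^ 2 = r t := fun t => by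
    rw [hr]
    linear_combination Real.sin (χ t) ^ 2 * hA'
  obtain ⟨h1, h2⟩ := chartZ_eq_of_hasDerivAt hm hqm isOpen_Ioo (convex_Ioo a b) h0
    (z := fun t => A * Real.sin (χ t)) (s := s) (by simp [hχ0]) (fun t ht => by
      refine (((Real.hasDerivAt_sin (χ t)).comp t (hχ t)).const_mul A).congr_deriv ?_
      have hrpos : r t ≠ 0 := by
        have := Real.sin_sq_le_one (χ t)
        rw [hr]
        nlinarith
      have h5 := initialForce_add_remainder (m := m) (q := q) h4 hrpos
      have h6 : 1 + (A * Real.sin (χ t)) ^ 2 * remainder m q s (s + c * (A * Real.sin (χ t)) ^ 2) =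
          (2 * A * Real.cos (χ t) * √(S t)) ^ 2 := by
        rw [hrz]
        apply mul_left_cancel₀ hc.ne
        have h7 := hM t
        have h8 := Real.sq_sqrt (hS t).le
        have h9 := Real.sin_sq_add_cos_sq (χ t)
        have h10 : r t - s = -(s - r₀) * Real.sin (χ t) ^ 2 := by rw [hr]; ring
        have h11 : r t - r₀ = (s - r₀) * Real.cos (χ t) ^ 2 := by
          rw [hr]; linear_combination -(s - r₀) * h9
        rw [h11, ← h5, h10] at h7
        linear_combination (Real.sin (χ t) ^ 2 * remainder m q s (r t)
          - 4 * Real.cos (χ t) ^ 2 * √(S t) ^ 2) * hA' + h7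
          + 4 * (s - r₀) * Real.cos (χ t) ^ 2 * h8
      simp only [chartSpeed]
      rw [← hcdef, h6, Real.sqrt_sq (by have := (hcos t ht).le; positivity)]
      ring) (fun t ht => ⟨hs, by
        simp only [chartRadius]
        rw [← hcdef, hrz]
        exact hab t ht⟩) ht
  exact ⟨h1, by rw [extRadius, h2]; simp only [chartRadius]; rw [← hcdef, hrz]⟩

/-! ### The tortoise coordinate -/

theorem hasDerivAt_tortoise (hqm : q ^ 2 ≤ m ^ 2) {r : ℝ} (hr : 0 < r)
    (h1 : r ≠ rPlus m q) (h2 : r ≠ rMinus m q) :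
    HasDerivAt (tortoise m q) (1 / D m q r) r := by
  rw [D_eq hqm hr.ne']
  have h3 := sub_ne_zero.2 h1
  have h4 := sub_ne_zero.2 h2
  by_cases he : q ^ 2 = m ^ 2
  · have e1 : rPlus m q = m := by simp [rPlus, he]
    have e2 : rMinus m q = m := by simp [rMinus, he]
    rw [e1] at h3
    have e3 : tortoise m q = fun r => r - m ^ 2 / (r - m) + 2 * m * Real.log |r - m| := by
      funext r
      rw [tortoise, if_pos he]
    simp only [e1, e2]
    have hd := (hasDerivAt_id r).sub_const m
    rw [e3]
    simp only [Real.log_abs]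
    refine (((hasDerivAt_id r).sub ((hasDerivAt_const r (m ^ 2)).div hd h3)).add
      ((hd.log h3).const_mul (2 * m))).congr_deriv ?_
    simp only [id]
    field_simp
    ring
  · have e0 : rPlus m q - rMinus m q ≠ 0 := by
      have : 0 < √(m ^ 2 - q ^ 2) := Real.sqrt_pos.2 (sub_pos.2 (lt_of_le_of_ne hqm he))
      simp only [rPlus, rMinus]
      intro h
      linarith
    have e3 : tortoise m q = fun r => r + rPlus m q ^ 2 / (rPlus m q - rMinus m q) *
        Real.log |r - rPlus m q| - rMinus m q ^ 2 / (rPlus m q - rMinus m q) *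
        Real.log |r - rMinus m q| := by
      funext r
      rw [tortoise, if_neg he]
    rw [e3]
    simp only [Real.log_abs]
    have hd1 := (hasDerivAt_id r).sub_const (rPlus m q)
    have hd2 := (hasDerivAt_id r).sub_const (rMinus m q)
    refine (((hasDerivAt_id r).add ((hd1.log h3).const_mul
      (rPlus m q ^ 2 / (rPlus m q - rMinus m q)))).sub ((hd2.log h4).const_mul
      (rMinus m q ^ 2 / (rPlus m q - rMinus m q)))).congr_deriv ?_
    simp only [id]
    field_simp
    ring

theorem hasDerivAt_tortoise_of_gt (hm : 0 < m) (hqm : q ^ 2 ≤ m ^ 2) {r : ℝ}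
    (h : rPlus m q < r) : HasDerivAt (tortoise m q) (1 / D m q r) r :=
  hasDerivAt_tortoise hqm (by linarith [m_le_rPlus m q]) h.ne'
    (by linarith [rMinus_le_rPlus m q] : rMinus m q < r).ne'

end

/-! ### The oscillation of an infalling curve -/

/-- The radial motion of an infalling curve in terms of the phase `χ`: the radius oscillates between
`s` and `s - b`, the event horizon is at the phases `± α + n π`, and `k`, a function of `sin² χ`, is
the factor in the velocity `-k sin χ cos χ`. -/
structure Oscillation (m q s : ℝ) (r v χ k : ℝ → ℝ) (b α : ℝ) : Prop where
  motion : CongruenceMotion m q s r v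
  amplitude_pos : 0 < b
  amplitude_ge : s - b ≤ rMinus m q
  angle_pos : 0 < α
  angle_lt : α < Real.pi / 2
  phase_zero : χ 0 = 0
  phase_mono : StrictMono χ
  phase_surjective : Function.Surjective χ
  radius : ∀ t, r t = s - b * Real.sin (χ t) ^ 2
  horizon : rPlus m q = s - b * Real.sin α ^ 2
  velocity : ∀ t, v t = -(k (χ t) * (Real.sin (χ t) * Real.cos (χ t)))
  rate_pos : ∀ x, 0 < k x
  rate_periodic : ∀ x y, Real.sin x ^ 2 = Real.sin y ^ 2 → k x = k y
  exterior : ∀ t, -α < χ t → χ t < α → (t, s) ∈ exteriorDomain m q ∧ extRadius m q (t, s) = r t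

theorem exists_oscillation {m q s : ℝ} (hm : 0 < m) (hq : q ≠ 0) (hqm : q ^ 2 ≤ m ^ 2)
    (hs : rPlus m q < s) (hsc : s < rCrit m q) :
    ∃ (r v χ k : ℝ → ℝ) (b α : ℝ), Oscillation m q s r v χ k b α := by
  obtain ⟨r, v, χ, S, r₀, hmot, hr₀, hr₀m, hr₀p, hχ0, hS, hχ, hχm, hχt, hχb, hr, hv, hM, S', hS'⟩ :=
    exists_radialMotion_of_lt hm hq hqm hs hsc
  have hχc : Continuous χ := continuous_iff_continuousAt.2 fun t => (hχ t).continuousAt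
  have hsurj : Function.Surjective χ := hχc.surjective hχt hχb
  have hb : 0 < s - r₀ := by linarith
  have hy0 : 0 < (s - rPlus m q) / (s - r₀) := div_pos (by linarith) hb
  have hy1 : (s - rPlus m q) / (s - r₀) < 1 := (div_lt_one hb).2 (by linarith)
  set y := √((s - rPlus m q) / (s - r₀)) with hy
  have hypos : 0 < y := Real.sqrt_pos.2 hy0
  have hylt : y < 1 := by rw [hy, Real.sqrt_lt' one_pos]; simpa using hy1
  have hα0 : 0 < Real.arcsin y := Real.arcsin_pos.2 hypos
  have hα1 : Real.arcsin y < Real.pi / 2 := Real.arcsin_lt_pi_div_two.2 hylt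
  have hsin : Real.sin (Real.arcsin y) = y := Real.sin_arcsin (by linarith) hylt.le
  have hhor : rPlus m q = s - (s - r₀) * Real.sin (Real.arcsin y) ^ 2 := by
    rw [hsin, hy, Real.sq_sqrt hy0.le]
    field_simp
    ring
  have hSx : ∀ x, 0 < S' (Real.sin x ^ 2) := fun x => by
    obtain ⟨t, rfl⟩ := hsurj x
    rw [← hS']
    exact hS t
  refine ⟨r, v, χ, fun x => 2 * (s - r₀) * √(S' (Real.sin x ^ 2)), s - r₀, Real.arcsin y, hmot, hb,
    by linarith, hα0, hα1, hχ0, hχm, hsurj, hr, hhor, fun t => ?_,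
    fun x => ?_, fun x y h => ?_, fun t h1 h2 => ?_⟩
  · rw [hv, hS']; ring
  · have := Real.sqrt_pos.2 (hSx x)
    positivity
  · simp only [h]
  · obtain ⟨a, ha⟩ := hsurj (-Real.arcsin y)
    obtain ⟨c, hc⟩ := hsurj (Real.arcsin y)
    have hac : ∀ t ∈ Set.Ioo a c, -Real.arcsin y < χ t ∧ χ t < Real.arcsin y := fun t ht =>
      ⟨ha ▸ hχm ht.1, hc ▸ hχm ht.2⟩
    refine extRadius_of_lt hm hqm hs hsc hr₀ (by linarith) hχ0 hS hχ hr hM (a := a) (b := c) ?_ ?_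
      ?_
      ⟨hχm.lt_iff_lt.1 (by rw [ha]; exact h1), hχm.lt_iff_lt.1 (by rw [hc]; exact h2)⟩
    · constructor <;> refine hχm.lt_iff_lt.1 ?_
      · rw [ha, hχ0]; linarith
      · rw [hc, hχ0]; exact hα0
    · intro t ht
      obtain ⟨h1, h2⟩ := hac t ht
      have h3 : Real.sin (χ t) < Real.sin (Real.arcsin y) :=
        Real.sin_lt_sin_of_lt_of_le_pi_div_two (by linarith) hα1.le h2
      have h4 : Real.sin (-Real.arcsin y) < Real.sin (χ t) :=
        Real.sin_lt_sin_of_lt_of_le_pi_div_two (by linarith) (by linarith) h1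
      rw [Real.sin_neg] at h4
      have h5 : Real.sin (χ t) ^ 2 < Real.sin (Real.arcsin y) ^ 2 := sq_lt_sq' h4 h3
      rw [hhor, hr]
      have := mul_lt_mul_of_pos_left h5 hb
      linarith
    · intro t ht
      obtain ⟨h1, h2⟩ := hac t ht
      exact Real.cos_pos_of_mem_Ioo ⟨by linarith, by linarith⟩

namespace Oscillation

variable {m q s : ℝ} {r v χ k : ℝ → ℝ} {b α : ℝ}

theorem radius_sub (h : Oscillation m q s r v χ k b α) (t : ℝ) :
    r t - rPlus m q = b * (Real.sin (α - χ t) * Real.sin (α + χ t)) := by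
  rw [h.radius, h.horizon, Real.sin_sub, Real.sin_add]
  have h1 := Real.sin_sq_add_cos_sq α
  have h2 := Real.sin_sq_add_cos_sq (χ t)
  linear_combination b * Real.sin (χ t) ^ 2 * h1 - b * Real.sin α ^ 2 * h2

theorem start (h : Oscillation m q s r v χ k b α) : r 0 = s ∧ v 0 = 0 := by
  constructor
  · rw [h.radius, h.phase_zero]; simp
  · rw [h.velocity, h.phase_zero]; simp

theorem radius_gt (h : Oscillation m q s r v χ k b α) {t : ℝ} (h1 : -α < χ t) (h2 : χ t < α) :
    rPlus m q < r t := by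
  have h3 := h.angle_lt
  have h4 := h.radius_sub t
  have h5 : 0 < Real.sin (α - χ t) := Real.sin_pos_of_pos_of_lt_pi (by linarith) (by linarith)
  have h6 : 0 < Real.sin (α + χ t) := Real.sin_pos_of_pos_of_lt_pi (by linarith) (by linarith)
  have := h.amplitude_pos
  have : 0 < r t - rPlus m q := by rw [h4]; positivity
  linarith

theorem radius_lt (h : Oscillation m q s r v χ k b α) {t : ℝ} (h1 : α < χ t)
    (h2 : χ t < Real.pi - α) :
    r t < rPlus m q := by
  have h3 := h.angle_lt
  have h3' := h.angle_pos
  have h4 := h.radius_sub t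
  have h5 : Real.sin (α - χ t) < 0 := Real.sin_neg_of_neg_of_neg_pi_lt (by linarith) (by linarith)
  have h6 : 0 < Real.sin (α + χ t) := Real.sin_pos_of_pos_of_lt_pi (by linarith) (by linarith)
  have := mul_neg_of_pos_of_neg h.amplitude_pos (mul_neg_of_neg_of_pos h5 h6)
  linarith

theorem radius_eq (h : Oscillation m q s r v χ k b α) {t : ℝ} (h1 : χ t = α ∨ χ t = -α) :
    r t = rPlus m q := by
  have h4 := h.radius_sub t
  rcases h1 with h1 | h1 <;> rw [h1] at h4 <;> simp at h4 <;> linarith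

/-- Times whose phases differ by a multiple of `π` have the same radius and velocity. -/
theorem periodic (h : Oscillation m q s r v χ k b α) {t t' : ℝ} {n : ℤ}
    (ht : χ t = χ t' + n * Real.pi) : r t = r t' ∧ v t = v t' := by
  have h1 : Real.sin (χ t) ^ 2 = Real.sin (χ t') ^ 2 := by
    rw [ht, Real.sin_add_int_mul_pi]
    rcases Int.even_or_odd n with hn | hn <;> simp [hn.neg_one_zpow]
  have h2 : Real.sin (χ t) * Real.cos (χ t) = Real.sin (χ t') * Real.cos (χ t') := by
    rw [ht, Real.sin_add_int_mul_pi, Real.cos_add_int_mul_pi]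
    rcases Int.even_or_odd n with hn | hn <;> simp [hn.neg_one_zpow]
  exact ⟨by rw [h.radius, h.radius, h1], by rw [h.velocity, h.velocity, h2, h.rate_periodic _ _ h1]⟩

end Oscillation

/-! ### Base curves -/

/-- The exterior region in the quotient by the rotations. -/
def baseExterior (m q : ℝ) : Set (Base m q) :=
  {p | ∃ (t r : ℝ) (h : InPatch m q .static t r), p = Quot.mk _ ⟨.static, t, r, h⟩}

/-- The exterior region in terms of the coordinates of each patch. It lies in the strip `0`, in the
saddles `0` and `1` that adjoin this strip and, in the extremal case, in the strip `-1`, which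
overlaps the strip `0` in the block `r > m`. -/
def IsExterior (m q : ℝ) : Patch → ℝ → ℝ → Prop
  | .static, _, _ => True
  | .strip k, _, r => (k = 0 ∨ k = -1 ∧ q ^ 2 = m ^ 2) ∧ rPlus m q < r
  | .saddle k, X, Y => 0 < X ∧ (k = 0 ∧ 0 < Y ∨ k = 1 ∧ rPlus m q < rMinus m q + X * Y)

/-- `IsExterior` respects the identifications, so it is a property of points of the quotient. -/
theorem isExterior_of_mem {m q : ℝ} {P : Patch} {a b : ℝ} {h : InPatch m q P a b}
    (hp : (Quot.mk _ ⟨P, a, b, h⟩ : Base m q) ∈ baseExterior m q) : IsExterior m q P a b := by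
  have key : ∀ p p' : PatchPoint m q, Glue m q p p' →
      (IsExterior m q p.patch p.a p.b = IsExterior m q p'.patch p'.a p'.b) := by
    intro p p' hg
    apply propext
    cases hg with
    | static_strip t r h h' => exact ⟨fun _ => ⟨Or.inl rfl, h⟩, fun _ => trivial⟩
    | saddle_strip k j hj X Y hX hside h h' =>
      have hne : q ^ 2 ≠ m ^ 2 := h.1.ne
      simp only [IsExterior, hne, and_false, or_false]
      constructor
      · rintro ⟨h1, ⟨rfl, h2⟩ | ⟨rfl, h2⟩⟩
        · have he := hside.1 h1
          rcases hj with rfl | rfl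
          · exact absurd he (by decide)
          · refine ⟨rfl, ?_⟩
            have := mul_pos h1 h2
            simp only [saddleRadius, Even.zero, if_true]
            linarith
        · have he := hside.1 h1
          rcases hj with rfl | rfl
          · refine ⟨rfl, ?_⟩
            simpa [saddleRadius] using h2
          · exact absurd he (by decide)
      · rintro ⟨rfl, h2⟩
        have h1 : 0 < X := hside.2 Even.zero
        refine ⟨h1, ?_⟩
        rcases hj with hj | hj
        · obtain rfl : k = 1 := by omega
          exact Or.inr ⟨rfl, by simpa [saddleRadius] using h2⟩
        · subst hj
          refine Or.inl ⟨rfl, ?_⟩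
          simp only [saddleRadius, Even.zero, if_true] at h2
          by_contra hcon
          have := mul_nonpos_of_nonneg_of_nonpos h1.le (not_lt.1 hcon)
          linarith
    | strip_strip k v r hext hr h h' =>
      have hp : rPlus m q = m := by simp [rPlus, hext]
      simp only [IsExterior, hext, and_true, hp]
      constructor
      · rintro ⟨hk, h2⟩
        rcases hr with ⟨_, h3⟩ | ⟨h3, _⟩
        · linarith
        · rcases hk with rfl | rfl
          · exact absurd h3 (by decide)
          · exact ⟨Or.inl rfl, h2⟩
      · rintro ⟨hk, h2⟩
        rcases hr with ⟨_, h3⟩ | ⟨h3, _⟩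
        · linarith
        · rcases hk with hk | hk
          · exact ⟨Or.inr (by omega), h2⟩
          · obtain rfl : k = -2 := by omega
            exact absurd h3 (by decide)
  obtain ⟨t, r, h', he⟩ := hp
  have := congrArg (Quot.lift (fun p : PatchPoint m q => IsExterior m q p.patch p.a p.b) key) he
  exact this.mpr trivial

/-- The quotient by the rotations of the curve of the congruence that starts at the radius `s`, as
a function of the proper time, with the area radius `r` along it. In the exterior region it is the
curve of the smooth family, and once it has left this region it does not meet it again: an
oscillating curve comes out in other exterior regions. -/
structure IsBaseCurve (m q s : ℝ) (r : ℝ → ℝ) (x : ℝ → Base m q) : Prop where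
  chart : ∀ t, ∃ P a b, HasAccelChart m q (accel m q s) x P a b t
  radius : ∀ t, baseRadius m q (x t) = r t
  exterior : ∀ t, (t, s) ∈ exteriorDomain m q → ∃ h : InPatch m q .static _ _,
    x t = Quot.mk _ ⟨.static, extTime m q (t, s), extRadius m q (t, s), h⟩
  mem_exterior : ∀ t, x t ∈ baseExterior m q → (t, s) ∈ exteriorDomain m q

/-- The charts of a curve that stays in the exterior region. -/
theorem isBaseCurve_static {m q s : ℝ} {r v : ℝ → ℝ} (hm : 0 < m) (hqm : q ^ 2 ≤ m ^ 2)
    (h : CongruenceMotion m q s r v)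
    (hext : ∀ t, (t, s) ∈ exteriorDomain m q ∧ extRadius m q (t, s) = r t) :
    IsBaseCurve m q s r fun t => Quot.mk _ ⟨.static, extTime m q (t, s), extRadius m q (t, s),
      extRadius_gt hm hqm (hext t).1⟩ := by
  refine ⟨fun t => ?_, fun t => (hext t).2, fun t ht =>
    ⟨extRadius_gt hm hqm ht, rfl⟩, fun t _ => (hext t).1⟩
  obtain ⟨n, U, N, hN, _⟩ := h.hasAccelChart_static (t₀ := t) (a := fun t => extTime m q (t, s))
    (x := fun t => Quot.mk _ ⟨.static, extTime m q (t, s), extRadius m q (t, s),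
      extRadius_gt hm hqm (hext t).1⟩)
    (Eventually.of_forall fun t => by
      have := hasDerivAt_extTime hm hqm (hext t).1
      rwa [(hext t).2] at this)
    (by rw [← (hext t).2]; exact (D_pos hm hqm (extRadius_gt hm hqm (hext t).1)).ne')
    (Eventually.of_forall fun t => by
      simp only [← (hext t).2]
      exact ⟨extRadius_gt hm hqm (hext t).1, rfl⟩)
  exact ⟨_, _, _, n, U, N, hN⟩

/-! ### Gluing across the bifurcation spheres -/

theorem eq_of_hasDerivAt_eq {f g f' : ℝ → ℝ} {a b c t : ℝ}
    (hf : ∀ t ∈ Set.Ioo a b, HasDerivAt f (f' t) t)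
    (hg : ∀ t ∈ Set.Ioo a b, HasDerivAt g (f' t) t) (hc : c ∈ Set.Ioo a b) (h : f c = g c)
    (ht : t ∈ Set.Ioo a b) : f t = g t :=
  isOpen_Ioo.eqOn_of_deriv_eq isPreconnected_Ioo
    (fun x hx => (hf x hx).differentiableAt.differentiableWithinAt)
    (fun x hx => (hg x hx).differentiableAt.differentiableWithinAt)
    (fun x hx => by rw [(hf x hx).deriv, (hg x hx).deriv]) hc h ht

section

variable {m q : ℝ}

theorem saddleRadius_even {k : ℤ} (hk : Even k) :
    saddleRadius m q k = rPlus m q ∧ oppositeRadius m q k = rMinus m q := by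
  simp [saddleRadius, oppositeRadius, hk]

theorem saddleRadius_odd {k : ℤ} (hk : Odd k) :
    saddleRadius m q k = rMinus m q ∧ oppositeRadius m q k = rPlus m q := by
  simp [saddleRadius, oppositeRadius, Int.not_even_iff_odd.2 hk]

theorem saddleRadius_facts (hm : 0 < m) (hq : q ≠ 0) (hqm : q ^ 2 < m ^ 2) (k : ℤ) :
    0 < saddleRadius m q k ∧ saddleRadius m q k ≠ oppositeRadius m q k ∧
      saddleRadius m q k + oppositeRadius m q k = 2 * m ∧
      saddleRadius m q k * oppositeRadius m q k = q ^ 2 := by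
  have h1 := rPlus_add_rMinus m q
  have h2 := rPlus_mul_rMinus hqm.le
  have h3 := rMinus_pos hm hq hqm.le
  have h4 := m_le_rPlus m q
  have h5 : rMinus m q < rPlus m q := by
    have : 0 < √(m ^ 2 - q ^ 2) := Real.sqrt_pos.2 (sub_pos.2 hqm)
    simp only [rPlus, rMinus]
    linarith
  rcases Int.even_or_odd k with hk | hk
  · obtain ⟨e1, e2⟩ := saddleRadius_even (m := m) (q := q) hk
    rw [e1, e2]
    exact ⟨by linarith, h5.ne', h1, h2⟩
  · obtain ⟨e1, e2⟩ := saddleRadius_odd (m := m) (q := q) hk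
    rw [e1, e2]
    exact ⟨h3, h5.ne, by linarith, by linarith⟩

theorem surfaceGravity_ne_zero (hm : 0 < m) (hq : q ≠ 0) (hqm : q ^ 2 < m ^ 2) (k : ℤ) :
    surfaceGravity m q k ≠ 0 := by
  obtain ⟨h1, h2, _⟩ := saddleRadius_facts hm hq hqm k
  have := sub_ne_zero.2 h2
  unfold surfaceGravity
  positivity

/-- The defining property of `saddleK`: it is the quotient of `κ - D' / 2` by `r - ρ`. -/
theorem surfaceGravity_sub (hm : 0 < m) (hq : q ≠ 0) (hqm : q ^ 2 < m ^ 2) (k : ℤ) {r : ℝ}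
    (hr : r ≠ 0) : surfaceGravity m q k - dD m q r / 2 =
      (r - saddleRadius m q k) * saddleK (saddleRadius m q k) (oppositeRadius m q k) r := by
  obtain ⟨h1, h2, h3, h4⟩ := saddleRadius_facts hm hq hqm k
  have e : dD m q r = ((saddleRadius m q k + oppositeRadius m q k) * r
      - 2 * (saddleRadius m q k * oppositeRadius m q k)) / r ^ 3 := by
    rw [h3, h4, dD]
    field_simp
  rw [e, surfaceGravity, saddleK, dSaddleG, saddleG]
  field_simp
  ring

/-- A radial motion whose outgoing factor `w = E - v` vanishes exactly at the times `S k`, with the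
horizon radii in turn, is the radial part of a curve of the maximal extension. Near `S k` the curve
lies in the saddle patch `k`. The integration constants of the saddle coordinates are adjusted
recursively, such that neighbouring saddle patches give the same point of their common strip. -/
theorem RadialMotion.exists_saddle_curve {β γ : ℝ} {r v : ℝ → ℝ} (hm : 0 < m) (hq : q ≠ 0)
    (hqm : q ^ 2 < m ^ 2) (h : RadialMotion m q β γ r v) {S : ℤ → ℝ} (hS : StrictMono S)
    (hSt : Tendsto S atTop atTop) (hSb : Tendsto S atBot atBot)
    (hzero : ∀ k, γ + β * r (S k) - v (S k) = 0) (hrad : ∀ k, r (S k) = saddleRadius m q k)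
    (hpos : ∀ k, Even k → ∀ t ∈ Set.Ioo (S k) (S (k + 1)), 0 < γ + β * r t - v t)
    (hneg : ∀ k, Odd k → ∀ t ∈ Set.Ioo (S k) (S (k + 1)), γ + β * r t - v t < 0)
    (V₀ : ℝ) :
    ∃ (x : ℝ → Base m q) (V : ℝ → ℝ), (∀ t, ∃ P a b, HasAccelChart m q β x P a b t) ∧
      (∀ t, baseRadius m q (x t) = r t) ∧
      (∀ t ∈ Set.Ioo (S 0) (S 1), ∃ h : InPatch m q (.strip 0) (V t) (r t),
        x t = Quot.mk _ ⟨.strip 0, V t, r t, h⟩) ∧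
      V 0 = V₀ ∧ (∀ t ∈ Set.Ioo (S 0) (S 1), HasDerivAt V (1 / (γ + β * r t - v t)) t) ∧
      ∀ t, x t ∈ baseExterior m q → t ∈ Set.Ioo (S 0) (S 1) ∧ rPlus m q < r t := by
  set w : ℝ → ℝ := fun t => γ + β * r t - v t with hw
  set u : ℝ → ℝ := fun t => γ + β * r t + v t with hu
  set ρ := saddleRadius m q with hρ
  set ρ' := oppositeRadius m q with hρ'
  set κ := surfaceGravity m q with hκ
  have hfacts := fun k => saddleRadius_facts hm hq hqm k
  have hκ0 := fun k => surfaceGravity_ne_zero hm hq hqm k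
  have hr0 : ∀ t, r t ≠ 0 := fun t => (h.pos t).ne'
  have hwu : ∀ k t, w t * u t * r t ^ 2 = (r t - ρ k) * (r t - ρ' k) := fun k t => by
    obtain ⟨_, _, e3, e4⟩ := hfacts k
    have := hr0 t
    rw [h.mul_eq t, D]
    field_simp
    linear_combination r t * e3 - e4
  have hwne : ∀ k, ∀ t ∈ Set.Ioo (S k) (S (k + 1)), w t ≠ 0 := fun k t ht => by
    rcases Int.even_or_odd k with hk | hk
    · exact (hpos k hk t ht).ne'
    · exact (hneg k hk t ht).ne
  have hsplit : ∀ k, ∀ t ∈ Set.Ioo (S (k - 1)) (S (k + 1)), t ≠ S k →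
      t ∈ Set.Ioo (S (k - 1)) (S (k - 1 + 1)) ∨ t ∈ Set.Ioo (S k) (S (k + 1)) :=
        fun k t ht hne => by
    rw [sub_add_cancel]
    rcases lt_or_gt_of_ne hne with hlt | hlt
    · exact Or.inl ⟨ht.1, hlt⟩
    · exact Or.inr ⟨hlt, ht.2⟩
  have hwS : ∀ k, ∀ t ∈ Set.Ioo (S (k - 1)) (S (k + 1)), w t = 0 → t = S k := fun k t ht hwt => by
    by_contra hne
    rcases hsplit k t ht hne with h1 | h1
    · exact hwne _ t h1 hwt
    · exact hwne _ t h1 hwt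
  have hwc : Continuous w :=
    (continuous_const.add (continuous_const.mul h.continuous_r)).sub h.continuous_v
  have hwsm : ∀ t, ContDiffAt ℝ 3 w t := fun t =>
    (contDiffAt_const.add (contDiffAt_const.mul (h.contDiff_nat 3).1.contDiffAt)).sub
      (h.contDiff_nat 3).2.contDiffAt
  have husm : ∀ t, ContDiffAt ℝ 3 u t := fun t =>
    (contDiffAt_const.add (contDiffAt_const.mul (h.contDiff_nat 3).1.contDiffAt)).add
      (h.contDiff_nat 3).2.contDiffAt
  have hrsm : ∀ t, ContDiffAt ℝ 3 r t := fun t => (h.contDiff_nat 3).1.contDiffAt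
  -- the function `(r - ρ) / w`, extended by `u r² / (r - ρ')`
  set Q : ℤ → ℝ → ℝ := fun k t =>
    if w t = 0 then u t * r t ^ 2 / (r t - ρ' k) else (r t - ρ k) / w t with hQ
  have hQw : ∀ k, ∀ t ∈ Set.Ioo (S (k - 1)) (S (k + 1)), Q k t * w t = r t - ρ k := fun k t ht => by
    by_cases hwt : w t = 0
    · rw [hwt, mul_zero, hwS k t ht hwt, hrad, sub_self]
    · simp only [hQ, if_neg hwt]
      field_simp
  have hQu : ∀ k, ∀ t ∈ Set.Ioo (S (k - 1)) (S (k + 1)), Q k t * (r t - ρ' k) = u t * r t ^ 2 := by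
    intro k t ht
    by_cases hwt : w t = 0
    · have : r t - ρ' k ≠ 0 := by
        rw [hwS k t ht hwt, hrad]
        exact sub_ne_zero.2 (hfacts k).2.1
      simp only [hQ, if_pos hwt]
      field_simp
    · simp only [hQ, if_neg hwt]
      rw [div_mul_eq_mul_div, ← hwu]
      field_simp
  have hI : ∀ k, ∀ t ∈ Set.Ioo (S (k - 1)) (S (k + 1)), ∀ᶠ t' in 𝓝 t,
      t' ∈ Set.Ioo (S (k - 1)) (S (k + 1)) := fun k t ht => isOpen_Ioo.mem_nhds ht
  have hreg : ∀ k, ∀ t ∈ Set.Ioo (S (k - 1)) (S (k + 1)), w t ≠ 0 ∨ r t ≠ ρ' k := fun k t ht => by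
    by_contra! hcon
    have := hrad k
    rw [← hwS k t ht hcon.1] at this
    exact (hfacts k).2.1 (this.symm.trans hcon.2)
  have hQsm : ∀ k, ∀ t ∈ Set.Ioo (S (k - 1)) (S (k + 1)), ContDiffAt ℝ 3 (Q k) t := fun k t ht => by
    rcases hreg k t ht with hwt | hrt
    · refine (((hrsm t).sub contDiffAt_const).div (hwsm t) hwt : ContDiffAt ℝ 3
        (fun t => (r t - ρ k) / w t) t).congr_of_eventuallyEq ?_
      filter_upwards [hwc.continuousAt.eventually_ne hwt] with t' ht'
      simp only [hQ, if_neg ht', Pi.div_apply]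
    · refine (((husm t).mul ((hrsm t).pow 2)).div ((hrsm t).sub contDiffAt_const)
        (sub_ne_zero.2 hrt) : ContDiffAt ℝ 3
        (fun t => u t * r t ^ 2 / (r t - ρ' k)) t).congr_of_eventuallyEq ?_
      filter_upwards [hI k t ht, h.continuous_r.continuousAt.eventually_ne hrt] with t' ht' hrt'
      rw [Pi.div_apply, eq_div_iff (sub_ne_zero.2 hrt')]
      exact hQu k t' ht'
  have hSk : ∀ k, S k ∈ Set.Ioo (S (k - 1)) (S (k + 1)) := fun k => ⟨hS (by omega), hS (by omega)⟩
  have hprim := fun k => exists_primitive_Ioo (f := fun t => β + Q k t * saddleK (ρ k) (ρ' k) (r t))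
    (hSk k) (fun t ht => by
      have h1 := (hQsm k t ht).continuousAt
      have h2 : ContinuousAt (fun t => saddleK (ρ k) (ρ' k) (r t)) t :=
        (contDiffAt_saddleK (n := 0) (ρ' k) (hfacts k).1.ne' (hr0 t)).continuousAt.comp
          h.continuous_r.continuousAt
      exact (continuousAt_const.add (h1.mul h2)).continuousWithinAt)
  choose F hF0 hF using hprim
  -- the null coordinate of the strips, up to its integration constant
  set L : ℤ → ℝ → ℝ := fun k t => F k t / κ k + Real.log (w t) / κ k with hL
  have hLd : ∀ k, ∀ t ∈ Set.Ioo (S (k - 1)) (S (k + 1)), w t ≠ 0 →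
      HasDerivAt (L k) (1 / w t) t := fun k t ht hwt => by
    have h1 := ((h.deriv_outgoing t).log hwt).div_const (κ k)
    refine (((hF k t ht).div_const (κ k)).add h1).congr_deriv ?_
    have h2 := surfaceGravity_sub hm hq hqm k (hr0 t)
    have h3 := hQw k t ht
    have h4 := hκ0 k
    change (β + Q k t * saddleK (ρ k) (ρ' k) (r t)) / κ k + (-(β * w t) + dD m q (r t) / 2) / w t /
      κ k
      = 1 / w t
    change κ k - dD m q (r t) / 2 = (r t - ρ k) * saddleK (ρ k) (ρ' k) (r t) at h2
    change κ k ≠ 0 at h4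
    rw [← h3] at h2
    field_simp
    linear_combination -2 * h2
  obtain ⟨c, hc0, hc⟩ := exists_int_recursion
    (fun k => L k ((S k + S (k + 1)) / 2) - L (k + 1) ((S k + S (k + 1)) / 2)) (V₀ - L 0 0)
  have hmid : ∀ k, (S k + S (k + 1)) / 2 ∈ Set.Ioo (S k) (S (k + 1)) := fun k => by
    have := hS (show k < k + 1 by omega)
    constructor <;> linarith
  have hLc : ∀ k, ∀ t ∈ Set.Ioo (S k) (S (k + 1)), L k t + c k = L (k + 1) t + c (k + 1) := by
    intro k t ht
    refine eq_of_hasDerivAt_eq (f := fun t => L k t + c k) (g := fun t => L (k + 1) t + c (k + 1))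
      (f' := fun t => 1 / w t) (fun t ht => ?_) (fun t ht => ?_) (hmid k) ?_ ht
    · exact (hLd k t ⟨(hS (by omega : k - 1 < k)).trans ht.1, ht.2⟩ (hwne k t ht)).add_const _
    · refine (hLd (k + 1) t ⟨?_, ht.2.trans (hS (by omega))⟩ (hwne k t ht)).add_const _
      rw [add_sub_cancel_right]
      exact ht.1
    · rw [hc]; ring
  set G : ℤ → ℝ → ℝ := fun k t => F k t + κ k * c k with hG
  set X : ℤ → ℝ → ℝ := fun k t => Real.exp (G k t) * w t with hX
  set Y : ℤ → ℝ → ℝ := fun k t => Q k t * Real.exp (-G k t) with hY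
  have hXY :
      ∀ k, ∀ t ∈ Set.Ioo (S (k - 1)) (S (k + 1)), ρ k + X k t * Y k t = r t := fun k t ht => by
    have h1 := hQw k t ht
    have h2 : X k t * Y k t = Q k t * w t := by
      simp only [hX, hY, Real.exp_neg]
      field_simp
    rw [h2, h1]
    ring
  have hin : ∀ k, ∀ t ∈ Set.Ioo (S (k - 1)) (S (k + 1)), InPatch m q (.saddle k) (X k t) (Y k t) :=
    fun k t ht => ⟨hqm, by have := hXY k t ht; rw [hρ] at this; rw [this]; exact h.pos t⟩
  have hlog : ∀ k t, w t ≠ 0 → Real.log |X k t| / κ k = L k t + c k := fun k t hwt => by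
    have := hκ0 k
    change κ k ≠ 0 at this
    simp only [hX, hL, hG, Real.log_abs]
    rw [Real.log_mul (Real.exp_pos _).ne' hwt, Real.log_exp]
    field_simp
    ring
  have hXsign : ∀ k, ∀ t, 0 < X k t ↔ 0 < w t := fun k t => mul_pos_iff_of_pos_left (Real.exp_pos _)
  have hside : ∀ j, ∀ t ∈ Set.Ioo (S j) (S (j + 1)), (0 < w t ↔ Even j) := fun j t ht => by
    rcases Int.even_or_odd j with hj | hj
    · exact ⟨fun _ => hj, fun _ => hpos j hj t ht⟩
    · exact ⟨fun h1 => absurd h1 (not_lt.2 (hneg j hj t ht).le),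
        fun h1 => absurd h1 (Int.not_even_iff_odd.2 hj)⟩
  have hglue : ∀ k j, (j = k - 1 ∨ j = k) → ∀ t ∈ Set.Ioo (S j) (S (j + 1)),
      ∀ ht : t ∈ Set.Ioo (S (k - 1)) (S (k + 1)),
      (Quot.mk _ ⟨.saddle k, X k t, Y k t, hin k t ht⟩ : Base m q) =
        Quot.mk _ ⟨.strip j, L k t + c k, r t, h.pos t⟩ := by
    intro k j hj t htj ht
    have hwt := hwne j t htj
    have hX0 : X k t ≠ 0 := mul_ne_zero (Real.exp_pos _).ne' hwt
    have e1 : Real.log |X k t| / surfaceGravity m q k = L k t + c k := hlog k t hwt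
    have e2 : saddleRadius m q k + X k t * Y k t = r t := hXY k t ht
    have hp : InPatch m q (.strip j) (Real.log |X k t| / surfaceGravity m q k)
      (saddleRadius m q k + X k t * Y k t) := by rw [e2]; exact h.pos t
    rw [Quot.sound (Glue.saddle_strip k j hj (X k t) (Y k t) hX0
      ((hXsign k t).trans (hside j t htj)) (hin k t ht) hp)]
    congr 2
  -- the curve in the saddle patch `k`; the value outside of the interval plays no role
  set f : ℤ → ℝ → Base m q := fun k t =>
    open Classical in
    if hk : InPatch m q (.saddle k) (X k t) (Y k t) then Quot.mk _ ⟨.saddle k, X k t, Y k t, hk⟩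
    else Quot.mk _ ⟨.strip 0, 0, 1, one_pos⟩ with hf
  have hfe : ∀ k t, ∀ ht : t ∈ Set.Ioo (S (k - 1)) (S (k + 1)),
      f k t = Quot.mk _ ⟨.saddle k, X k t, Y k t, hin k t ht⟩ := fun k t ht => dif_pos (hin k t ht)
  have hS1 : StrictMono fun k : ℤ => S (k - 1) := fun a b hab => hS (by omega)
  have e1 : ∀ k : ℤ, k + 2 - 1 = k + 1 := fun k => by ring
  obtain ⟨x, hx⟩ := exists_glued hS1
    (hSt.comp (tendsto_atTop_add_const_right _ (-1) tendsto_id))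
    (hSb.comp (tendsto_atBot_add_const_right _ (-1) tendsto_id)) f (by
      intro k t ht
      simp only [add_sub_cancel_right, e1] at ht
      have ht1 : t ∈ Set.Ioo (S (k - 1)) (S (k + 1)) := ⟨(hS (by omega)).trans ht.1, ht.2⟩
      have ht2 : t ∈ Set.Ioo (S (k + 1 - 1)) (S (k + 1 + 1)) := by
        rw [add_sub_cancel_right]
        exact ⟨ht.1, ht.2.trans (hS (by omega))⟩
      rw [hfe k t ht1, hfe (k + 1) t ht2, hglue k k (Or.inr rfl) t ht ht1,
        hglue (k + 1) k (Or.inl (by ring)) t ht ht2]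
      simp only [hLc k t ht]
      rfl)
  simp only [e1] at hx
  have hxe : ∀ k t, ∀ ht : t ∈ Set.Ioo (S (k - 1)) (S (k + 1)),
      x t = Quot.mk _ ⟨.saddle k, X k t, Y k t, hin k t ht⟩ := fun k t ht => by
    rw [hx k t ht, hfe k t ht]
  have hcover : ∀ t, ∃ k, t ∈ Set.Ioo (S (k - 1)) (S (k + 1)) := fun t => by
    obtain ⟨k, hk1, hk2⟩ := exists_int_lt_le hS hSt hSb t
    refine ⟨k + 1, ?_, hk2.trans_lt (hS (by omega))⟩
    rwa [add_sub_cancel_right]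
  have h01 : ∀ t ∈ Set.Ioo (S 0) (S 1), t ∈ Set.Ioo (S (0 - 1)) (S (0 + 1)) := fun t ht =>
    ⟨(hS (by omega)).trans ht.1, by simpa using ht.2⟩
  refine ⟨x, fun t => L 0 t + c 0, fun t => ?_, fun t => ?_, fun t ht => ⟨h.pos t, ?_⟩, ?_, fun t
    ht => ?_,
    fun t ht => ?_⟩
  · obtain ⟨k, hk⟩ := hcover t
    obtain ⟨e1, e2, e3, e4⟩ := hfacts k
    have hJ := hI k t hk
    refine ⟨.saddle k, X k, Y k, h.hasAccelChart_saddle k (Q := Q k) (F := G k) rfl rfl rfl e1.ne'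
      rfl
      (hκ0 k) e3.symm e4.symm (hQsm k t hk) ?_ ?_ ?_ ?_ ?_⟩
    · filter_upwards [hJ] with t' ht' using (hF k t' ht').add_const _
    · filter_upwards [hJ] with t' ht' using hQw k t' ht'
    · filter_upwards [hJ] with t' ht' using hQu k t' ht'
    · filter_upwards [hJ] with t' ht' using hreg k t' ht'
    · filter_upwards [hJ] with t' ht' using ⟨hin k t' ht', hxe k t' ht'⟩
  · obtain ⟨k, hk⟩ := hcover t
    rw [hxe k t hk]
    exact hXY k t hk
  · rw [hxe 0 t (h01 t ht), hglue 0 0 (Or.inr rfl) t (by simpa using ht) (h01 t ht)]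
  · rw [hc0]; ring
  · exact (hLd 0 t (h01 t ht) (hwne 0 t (by simpa using ht))).add_const _
  · obtain ⟨k, hk⟩ := hcover t
    rw [hxe k t hk] at ht
    obtain ⟨hX0, h2⟩ := isExterior_of_mem ht
    have hw0 := (hXsign k t).1 hX0
    have hne : t ≠ S k := fun he => by
      rw [he] at hw0
      exact absurd (hzero k) hw0.ne'
    rcases h2 with ⟨rfl, hY0⟩ | ⟨rfl, h3⟩
    · have h4 := hXY 0 t hk
      have h5 : ρ 0 = rPlus m q := (saddleRadius_even Even.zero).1
      rw [h5] at h4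
      refine ⟨?_, by have := mul_pos hX0 hY0; linarith⟩
      rcases hsplit 0 t hk hne with h6 | h6
      · exact absurd ((hside _ t h6).1 hw0) (by decide)
      · simpa using h6
    · have h4 := hXY 1 t hk
      have h5 : ρ 1 = rMinus m q := (saddleRadius_odd odd_one).1
      rw [h5] at h4
      rw [h4] at h3
      refine ⟨?_, h3⟩
      rcases hsplit 1 t hk hne with h6 | h6
      · simpa using h6
      · exact absurd ((hside _ t h6).1 hw0) (by decide)

end

/-! ### Gluing across the extremal horizons -/

section

variable {m q : ℝ}

theorem hasDerivAt_tortoise_of_extremal (hq : q ^ 2 = m ^ 2) {r : ℝ} (hr : 0 < r) (h : r ≠ m) :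
    HasDerivAt (tortoise m q) (1 / D m q r) r :=
  hasDerivAt_tortoise hq.le hr (by simpa [rPlus, hq] using h) (by simpa [rMinus, hq] using h)

theorem D_ne_zero_of_extremal (hq : q ^ 2 = m ^ 2) {r : ℝ} (hr : 0 < r) (h : r ≠ m) : D m q r ≠
    0 := by
  have h1 := sub_ne_zero.2 h
  have e : D m q r = (r - m) ^ 2 / r ^ 2 := by
    rw [D, hq]
    field_simp
    ring
  rw [e]
  positivity

/-- In the extremal case, a radial motion whose outgoing factor `E - v` and ingoing factor `E + v`
are positive on the intervals `(S k, S (k + 2))` with `k` even and `k` odd is the radial part of a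
curve of the maximal extension, which lies in the strip `k` on `(S k, S (k + 2))`. The integration
constants of the null coordinates are adjusted recursively. -/
theorem RadialMotion.exists_strip_curve {β γ : ℝ} {r v : ℝ → ℝ} (hq : q ^ 2 = m ^ 2)
    (h : RadialMotion m q β γ r v) {S : ℤ → ℝ} (hS : StrictMono S)
    (hSt : Tendsto S atTop atTop) (hSb : Tendsto S atBot atBot)
    (hout : ∀ k, Even k → ∀ t ∈ Set.Ioo (S k) (S (k + 2)), 0 < γ + β * r t - v t)
    (hin : ∀ k, Odd k → ∀ t ∈ Set.Ioo (S k) (S (k + 2)), 0 < γ + β * r t + v t)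
    (hgt : ∀ k, Even k → ∀ t ∈ Set.Ioo (S k) (S (k + 1)), m < r t)
    (hlt : ∀ k, Odd k → ∀ t ∈ Set.Ioo (S k) (S (k + 1)), r t < m)
    (hrad : ∀ k, r (S k) = m) (V₀ : ℝ) :
    ∃ (x : ℝ → Base m q) (V : ℝ → ℝ), (∀ t, ∃ P a b, HasAccelChart m q β x P a b t) ∧
      (∀ t, baseRadius m q (x t) = r t) ∧
      (∀ t ∈ Set.Ioo (S 0) (S 1), ∃ h : InPatch m q (.strip 0) (V t) (r t),
        x t = Quot.mk _ ⟨.strip 0, V t, r t, h⟩) ∧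
      V 0 = V₀ ∧ (∀ t ∈ Set.Ioo (S 0) (S 1), HasDerivAt V (1 / (γ + β * r t - v t)) t) ∧
      ∀ t, x t ∈ baseExterior m q → t ∈ Set.Ioo (S 0) (S 1) ∧ rPlus m q < r t := by
  set w : ℝ → ℝ := fun t => γ + β * r t - v t with hw
  set u : ℝ → ℝ := fun t => γ + β * r t + v t with hu
  have hwc : Continuous w :=
    (continuous_const.add (continuous_const.mul h.continuous_r)).sub h.continuous_v
  have huc : Continuous u :=
    (continuous_const.add (continuous_const.mul h.continuous_r)).add h.continuous_v
  set g : ℤ → ℝ → ℝ := fun k t => open Classical in if Even k then 1 / w t else 1 / u t with hg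
  set ε : ℤ → ℝ := fun k => open Classical in if Even k then 1 else -1 with hε
  have hmid : ∀ k, S (k + 1) ∈ Set.Ioo (S k) (S (k + 2)) := fun k => ⟨hS (by omega), hS (by omega)⟩
  have hprim := fun k => exists_primitive_Ioo (f := g k) (hmid k) (fun t ht => by
    rcases Int.even_or_odd k with hk | hk
    · simp only [hg, hk, if_true]
      exact (continuousAt_const.div hwc.continuousAt (hout k hk t ht).ne').continuousWithinAt
    · simp only [hg, Int.not_even_iff_odd.2 hk, if_false]
      exact (continuousAt_const.div huc.continuousAt (hin k hk t ht).ne').continuousWithinAt)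
  choose L hL0 hL using hprim
  have hne : ∀ k, ∀ t ∈ Set.Ioo (S k) (S (k + 1)), r t ≠ m := fun k t ht => by
    rcases Int.even_or_odd k with hk | hk
    · exact (hgt k hk t ht).ne'
    · exact (hlt k hk t ht).ne
  have hεε : ∀ k, ε (k + 1) = -ε k := fun k => by
    rcases Int.even_or_odd k with hk | hk
    · simp [hε, hk, Int.not_even_iff_odd.2 hk.add_one]
    · simp [hε, Int.not_even_iff_odd.2 hk, hk.add_one]
  have hε2 : ∀ k, ε k * ε k = 1 := fun k => by
    by_cases hk : Even k <;> simp [hε, hk]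
  obtain ⟨c, hc0, hc⟩ := exists_int_recursion (fun k => L k ((S (k + 1) + S (k + 2)) / 2)
    - L (k + 1) ((S (k + 1) + S (k + 2)) / 2)
    - 2 * ε k * tortoise m q (r ((S (k + 1) + S (k + 2)) / 2))) (V₀ - L 0 0)
  have hLc : ∀ k, ∀ t ∈ Set.Ioo (S (k + 1)) (S (k + 2)), L k t + c k =
      L (k + 1) t + c (k + 1) + 2 * ε k * tortoise m q (r t) := by
    intro k t ht
    have hmid' : (S (k + 1) + S (k + 2)) / 2 ∈ Set.Ioo (S (k + 1)) (S (k + 2)) := by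
      have := hS (show k + 1 < k + 2 by omega)
      constructor <;> linarith
    have e2 : k + 1 + 1 = k + 2 := by ring
    refine eq_of_hasDerivAt_eq (f := fun t => L k t + c k)
      (g := fun t => L (k + 1) t + c (k + 1) + 2 * ε k * tortoise m q (r t))
      (f' := g k) (fun t ht => ?_) (fun t ht => ?_) hmid' (by simp only [hc]; ring) ht
    · exact (hL k t ⟨(hS (by omega : k < k + 1)).trans ht.1, ht.2⟩).add_const _
    · have hrm := hne (k + 1) t (by rw [e2]; exact ht)
      have ht1 : t ∈ Set.Ioo (S k) (S (k + 2)) := ⟨(hS (by omega : k < k + 1)).trans ht.1, ht.2⟩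
      have ht2 : t ∈ Set.Ioo (S (k + 1)) (S (k + 1 + 2)) := ⟨ht.1, ht.2.trans (hS (by omega))⟩
      refine (((hL (k + 1) t ht2).add_const _).add
        (((hasDerivAt_tortoise_of_extremal hq (h.pos t) hrm).comp t (h.deriv_r t)).const_mul
          (2 * ε k))).congr_deriv ?_
      have hD := D_ne_zero_of_extremal hq (h.pos t) hrm
      have hwu : w t * u t = D m q (r t) := h.mul_eq t
      have hw0 : w t ≠ 0 := fun h0 => by rw [h0, zero_mul] at hwu; exact hD hwu.symm
      have hu0 : u t ≠ 0 := fun h0 => by rw [h0, mul_zero] at hwu; exact hD hwu.symm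
      rw [← hwu]
      have hv : v t = (u t - w t) / 2 := by simp only [hu, hw]; ring
      rw [hv]
      rcases Int.even_or_odd k with hk | hk
      · simp only [hg, hε, hk, Int.not_even_iff_odd.2 hk.add_one, if_true, if_false]
        field_simp
        ring
      · simp only [hg, hε, hk.add_one, Int.not_even_iff_odd.2 hk, if_true, if_false]
        field_simp
        ring
  set V : ℤ → ℝ → ℝ := fun k t => ε k * (L k t + c k) with hV
  have hVd : ∀ k, ∀ t ∈ Set.Ioo (S k) (S (k + 2)), HasDerivAt (V k) (ε k * g k t) t := fun k t ht =>
    ((hL k t ht).add_const _).const_mul _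
  obtain ⟨x, hx⟩ := exists_glued hS hSt hSb
    (fun k t => (Quot.mk _ ⟨.strip k, V k t, r t, h.pos t⟩ : Base m q)) (by
      intro k t ht
      have hp : InPatch m q (.strip (k + 1)) (2 * tortoise m q (r t) - V k t) (r t) := h.pos t
      have e2 : k + 1 + 1 = k + 2 := by ring
      have hr : Even k ∧ r t < m ∨ Odd k ∧ m < r t := by
        rw [← e2] at ht
        rcases Int.even_or_odd k with hk | hk
        · exact Or.inl ⟨hk, hlt _ hk.add_one t ht⟩
        · exact Or.inr ⟨hk, hgt _ hk.add_one t ht⟩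
      have h1 : 2 * tortoise m q (r t) - V k t = V (k + 1) t := by
        simp only [hV, hεε]
        linear_combination -ε k * hLc k t ht - 2 * tortoise m q (r t) * hε2 k
      rw [Quot.sound (Glue.strip_strip k (V k t) (r t) hq hr (h.pos t) hp)]
      congr 2)
  have hcover : ∀ t, ∃ k, t ∈ Set.Ioo (S k) (S (k + 2)) := fun t => by
    obtain ⟨k, hk1, hk2⟩ := exists_int_lt_le hS hSt hSb t
    exact ⟨k, hk1, hk2.trans_lt (hS (by omega))⟩
  have h01 : ∀ t ∈ Set.Ioo (S 0) (S 1), t ∈ Set.Ioo (S 0) (S (0 + 2)) := fun t ht =>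
    ⟨ht.1, ht.2.trans (hS (by omega))⟩
  have hp : rPlus m q = m := by simp [rPlus, hq]
  have hε0 : ε 0 = 1 := by simp [hε]
  refine ⟨x, V 0, fun t => ?_, fun t => ?_, fun t ht => ⟨h.pos t, hx 0 t (h01 t ht)⟩, ?_, fun t
    ht => ?_,
    fun t ht => ?_⟩
  · obtain ⟨k, hk⟩ := hcover t
    have hJ : ∀ᶠ t' in 𝓝 t, t' ∈ Set.Ioo (S k) (S (k + 2)) := isOpen_Ioo.mem_nhds hk
    have hxJ : ∀ᶠ t' in 𝓝 t, ∃ hp : InPatch m q (.strip k) (V k t') (r t'),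
        x t' = Quot.mk _ ⟨.strip k, V k t', r t', hp⟩ := by
      filter_upwards [hJ] with t' ht' using ⟨h.pos t', hx k t' ht'⟩
    refine ⟨.strip k, V k, r, ?_⟩
    rcases Int.even_or_odd k with hk' | hk'
    · refine h.hasAccelChart_strip k ?_ (hout k hk' t hk).ne' hxJ
      filter_upwards [hJ] with t' ht'
      refine (hVd k t' ht').congr_deriv ?_
      simp only [hε, hg, hk', if_true, one_mul, hw]
    · refine h.hasAccelChart_strip_ingoing k ?_ (hin k hk' t hk).ne' hxJ
      filter_upwards [hJ] with t' ht'
      refine (hVd k t' ht').congr_deriv ?_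
      simp only [hε, hg, Int.not_even_iff_odd.2 hk', if_false, hu]
      ring
  · obtain ⟨k, hk⟩ := hcover t
    rw [hx k t hk]
    rfl
  · simp only [hV, hε0, hc0]; ring
  · refine (hVd 0 t (h01 t ht)).congr_deriv ?_
    simp only [hε0, one_mul, hg, Even.zero, if_true, hw]
  · obtain ⟨k, hk⟩ := hcover t
    rw [hx k t hk] at ht
    obtain ⟨hk0, hrt⟩ := isExterior_of_mem ht
    refine ⟨?_, hrt⟩
    rw [hp] at hrt
    have hcase : ∀ j, Odd j → t ∉ Set.Icc (S j) (S (j + 1)) := fun j hj hmem => by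
      rcases eq_or_lt_of_le hmem.1 with h1 | h1
      · rw [← h1, hrad] at hrt
        exact hrt.false
      rcases eq_or_lt_of_le hmem.2 with h2 | h2
      · rw [h2, hrad] at hrt
        exact hrt.false
      · exact (hlt j hj t ⟨h1, h2⟩).not_gt hrt
    rcases hk0 with rfl | ⟨rfl, _⟩
    · refine ⟨hk.1, ?_⟩
      by_contra hcon
      exact hcase 1 odd_one ⟨not_lt.1 hcon, hk.2.le⟩
    · refine ⟨?_, hk.2⟩
      by_contra hcon
      exact hcase (-1) (by decide) ⟨hk.1.le, not_lt.1 hcon⟩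

end

/-! ### Horizon crossings of an infalling curve -/

section

variable {m q s : ℝ}

/-- The exterior part of a curve is an interval of proper times around the initial slice. -/
theorem exteriorDomain_of_between (hm : 0 < m) (hqm : q ^ 2 ≤ m ^ 2) {t t' : ℝ}
    (h : (t, s) ∈ exteriorDomain m q) (ht : t' ∈ Set.uIcc 0 t) : (t', s) ∈ exteriorDomain m q := by
  obtain ⟨h1, h2⟩ := chartZ_mem hm hqm h
  set z := chartZ m q (t, s)
  have hmem : ∀ σ ∈ Set.Icc (0 : ℝ) 1, (σ * z, s) ∈ chartDomain m q :=
    fun σ hσ => chartDomain_star _ h1 σ hσ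
  have hc : ContinuousOn (fun σ : ℝ => travelTime m q (σ * z, s)) (Set.uIcc 0 1) := by
    rw [Set.uIcc_of_le zero_le_one]
    exact fun σ hσ => (ContinuousAt.comp (g := fun z => travelTime m q (z, s))
      (f := fun σ : ℝ => σ * z) (hasDerivAt_travelTime hm hqm (hmem σ hσ)).continuousAt
      (by fun_prop)).continuousWithinAt
  have h3 := intermediate_value_uIcc hc
  have h4 : travelTime m q (0, s) = 0 := slicePrimitive_zero _ _
  simp only [zero_mul, one_mul, h2, h4] at h3
  obtain ⟨σ, hσ, hσ'⟩ := h3 ht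
  rw [Set.uIcc_of_le zero_le_one] at hσ
  exact ⟨(σ * z, s), hmem σ hσ, by simp only [← hσ']⟩

/-- The exterior part of an infalling curve ends where its radius reaches that of the event horizon.
-/
theorem mem_Ioo_of_mem_exteriorDomain (hm : 0 < m) (hqm : q ^ 2 ≤ m ^ 2) {r : ℝ → ℝ}
    (hr : Continuous r) {a b : ℝ} (ha0 : a < 0) (hb0 : 0 < b) (ha : r a = rPlus m q)
      (hb : r b = rPlus m q)
    (hab : ∀ t ∈ Set.Ioo a b, (t, s) ∈ exteriorDomain m q ∧ extRadius m q (t, s) = r t)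
    {t : ℝ} (ht : (t, s) ∈ exteriorDomain m q) : t ∈ Set.Ioo a b := by
  have hcont : ∀ c, (c, s) ∈ exteriorDomain m q → ContinuousAt (fun t => extRadius m q (t, s)) c :=
    fun c hc => ContinuousAt.comp (f := fun t : ℝ => (t, s))
      (contDiffAt_extRadius hm hqm hc 0).continuousAt (by fun_prop)
  -- an endpoint in the exterior region would have a radius larger than that of the horizon
  have key : ∀ c, c ∈ closure (Set.Ioo a b) → r c = rPlus m q → (c, s) ∉ exteriorDomain m q := by
    intro c hcl hc hmem
    have h1 := extRadius_gt hm hqm hmem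
    have h2 : {t | extRadius m q (t, s) = r t} ∈ 𝓝[Set.Ioo a b] c := by
      filter_upwards [self_mem_nhdsWithin] with t ht using (hab t ht).2
    have h3 : (𝓝[Set.Ioo a b] c).NeBot := mem_closure_iff_nhdsWithin_neBot.1 hcl
    have h4 := ((hcont c hmem).tendsto.mono_left (nhdsWithin_le_nhds (s := Set.Ioo a b))).congr' h2
    have h5 := tendsto_nhds_unique h4 (hr.continuousAt.tendsto.mono_left nhdsWithin_le_nhds)
    rw [hc] at h5
    linarith
  rw [closure_Ioo (by linarith : a ≠ b)] at key
  by_contra hcon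
  rw [Set.mem_Ioo, not_and_or, not_lt, not_lt] at hcon
  rcases hcon with h1 | h1
  · exact key a ⟨le_rfl, by linarith⟩ ha (exteriorDomain_of_between hm hqm ht
      (by rw [Set.uIcc_of_ge (by linarith)]; exact ⟨h1, ha0.le⟩))
  · exact key b ⟨by linarith, le_rfl⟩ hb (exteriorDomain_of_between hm hqm ht
      (by rw [Set.uIcc_of_le (by linarith)]; exact ⟨hb0.le, h1⟩))

end

namespace Oscillation

variable {m q s : ℝ} {r v χ k : ℝ → ℝ} {b α : ℝ}

theorem energy_pos (hm : 0 < m) (hqm : q ^ 2 ≤ m ^ 2) (hs : rPlus m q < s) (hsc : s < rCrit m q)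
    {r : ℝ} (hr : rPlus m q ≤ r) : 0 < energy m q s r := by
  have h1 := energy_rPlus_pos hm hqm hs hsc
  have h2 := mul_nonneg (accel_pos hm hqm hs).le (sub_nonneg.2 hr)
  rw [energy] at h1 ⊢
  linarith

/-- Both null components of the velocity are positive in the exterior region. -/
theorem factors_pos (h : Oscillation m q s r v χ k b α) (hm : 0 < m) (hqm : q ^ 2 ≤ m ^ 2)
    (hs : rPlus m q < s) (hsc : s < rCrit m q) {t : ℝ} (h1 : -α < χ t) (h2 : χ t < α) :
    0 < -√(D m q s) + accel m q s * r t - v t ∧ 0 < -√(D m q s) + accel m q s * r t + v t := by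
  have h3 := h.radius_gt h1 h2
  have h4 := energy_pos hm hqm hs hsc h3.le
  have h5 := D_pos hm hqm h3
  rw [← h.motion.mul_eq t] at h5
  rw [energy] at h4
  rcases mul_pos_iff.1 h5 with h6 | h6
  · exact h6
  · linarith

/-- At the event horizon, `E + v` vanishes on the way in and `E - v` on the way out. -/
theorem factors_horizon (h : Oscillation m q s r v χ k b α) (hm : 0 < m) (hqm : q ^ 2 ≤ m ^ 2)
    (hs : rPlus m q < s) (hsc : s < rCrit m q) {t : ℝ} :
    (χ t = α → 0 < -√(D m q s) + accel m q s * r t - v t ∧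
      -√(D m q s) + accel m q s * r t + v t = 0) ∧
    (χ t = -α → -√(D m q s) + accel m q s * r t - v t = 0 ∧
      0 < -√(D m q s) + accel m q s * r t + v t) := by
  have h1 := h.angle_pos
  have h2 := h.angle_lt
  have hsin : 0 < Real.sin α := Real.sin_pos_of_pos_of_lt_pi h1 (by linarith)
  have hcos : 0 < Real.cos α := Real.cos_pos_of_mem_Ioo ⟨by linarith, h2⟩
  have hk := h.rate_pos (χ t)
  have hmul := h.motion.mul_eq t
  have hD : D m q (rPlus m q) = 0 := by
    rw [D_eq hqm (by linarith [m_le_rPlus m q] : rPlus m q ≠ 0)]; simp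
  have hv := h.velocity t
  constructor
  · intro ht
    have hr := h.radius_eq (Or.inl ht)
    have h4 := energy_pos hm hqm hs hsc hr.ge
    have h5 : v t < 0 := by
      rw [hv]
      rw [ht] at hk ⊢
      have : 0 < k α * (Real.sin α * Real.cos α) := by positivity
      linarith
    rw [energy] at h4
    rw [hr, hD] at hmul
    rw [← hr] at hmul
    have h6 : 0 < -√(D m q s) + accel m q s * r t - v t := by linarith
    exact ⟨h6, (mul_eq_zero.1 hmul).resolve_left h6.ne'⟩
  · intro ht
    have hr := h.radius_eq (Or.inr ht)
    have h4 := energy_pos hm hqm hs hsc hr.ge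
    have h5 : 0 < v t := by
      rw [hv]
      rw [ht] at hk ⊢
      have : 0 < k (-α) * (Real.sin α * Real.cos α) := by positivity
      rw [Real.sin_neg, Real.cos_neg]
      linarith
    rw [energy] at h4
    rw [hr, hD] at hmul
    rw [← hr] at hmul
    have h6 : 0 < -√(D m q s) + accel m q s * r t + v t := by linarith
    exact ⟨(mul_eq_zero.1 hmul).resolve_right h6.ne', h6⟩

/-- In each period the outgoing factor has, besides its zero at the event horizon, exactly one zero,
which lies at the Cauchy horizon: there the derivative of the factor is `D' / 2 < 0`. -/
theorem exists_inner_zero (h : Oscillation m q s r v χ k b α) (hm : 0 < m) (hq : q ≠ 0)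
    (hqm : q ^ 2 < m ^ 2) (hs : rPlus m q < s) (hsc : s < rCrit m q) :
    ∃ c, α < c ∧ c < Real.pi - α ∧
      (∀ t, χ t = c → -√(D m q s) + accel m q s * r t - v t = 0 ∧ r t = rMinus m q) ∧
      (∀ t, -α < χ t → χ t < c → 0 < -√(D m q s) + accel m q s * r t - v t) ∧
      ∀ t, c < χ t → χ t < Real.pi - α → -√(D m q s) + accel m q s * r t - v t < 0 := by
  have hα0 := h.angle_pos
  have hα1 := h.angle_lt
  have hmono := h.phase_mono
  have hrm := rMinus_pos hm hq hqm.le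
  have hrr : rMinus m q < rPlus m q := by
    have : 0 < √(m ^ 2 - q ^ 2) := Real.sqrt_pos.2 (sub_pos.2 hqm)
    simp only [rPlus, rMinus]
    linarith
  obtain ⟨ta, hta⟩ := h.phase_surjective (-α)
  obtain ⟨tb, htb⟩ := h.phase_surjective (Real.pi - α)
  have hI : ∀ t, t ∈ Set.Ioo ta tb ↔ -α < χ t ∧ χ t < Real.pi - α := fun t => by
    rw [Set.mem_Ioo, ← hmono.lt_iff_lt, ← hmono.lt_iff_lt (a := t), hta, htb]
  have hD0 :
      ∀ t, -√(D m q s) + accel m q s * r t - v t = 0 → r t = rPlus m q ∨ r t = rMinus m q := by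
    intro t ht
    have h1 := h.motion.mul_eq t
    rw [ht, zero_mul, D_eq hqm.le (h.motion.pos t).ne'] at h1
    rcases div_eq_zero_iff.1 h1.symm with h2 | h2
    · rcases mul_eq_zero.1 h2 with h3 | h3
      · exact Or.inl (sub_eq_zero.1 h3)
      · exact Or.inr (sub_eq_zero.1 h3)
    · exact absurd h2 (pow_ne_zero 2 (h.motion.pos t).ne')
  have hrplus : ∀ t ∈ Set.Ioo ta tb, -√(D m q s) + accel m q s * r t - v t = 0 → α < χ t ∧
      r t = rMinus m q := by
    intro t ht hw
    rw [hI] at ht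
    have h1 : α < χ t := by
      by_contra hcon
      rcases lt_or_eq_of_le (not_lt.1 hcon) with h2 | h2
      · exact (h.factors_pos hm hqm.le hs hsc ht.1 h2).1.ne' hw
      · exact ((h.factors_horizon hm hqm.le hs hsc).1 h2).1.ne' hw
    refine ⟨h1, (hD0 t hw).resolve_left (h.radius_lt h1 ht.2).ne⟩
  -- a point between the two horizons on the way out
  obtain ⟨d, hd, hdw⟩ : ∃ d ∈ Set.Ioo ta tb, -√(D m q s) + accel m q s * r d - v d < 0 := by
    have hb := h.amplitude_pos
    have hbm := h.amplitude_ge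
    have hhor := h.horizon
    set y := √((s - (rMinus m q + rPlus m q) / 2) / b) with hy
    have hy0 : 0 ≤ (s - (rMinus m q + rPlus m q) / 2) / b := div_nonneg (by linarith) hb.le
    have hysq : y ^ 2 = (s - (rMinus m q + rPlus m q) / 2) / b := Real.sq_sqrt hy0
    have hylt : y < 1 := by
      rw [hy, Real.sqrt_lt' one_pos, div_lt_iff₀ hb]
      linarith
    have hysin : Real.sin α < y := by
      have hsin : 0 < Real.sin α := Real.sin_pos_of_pos_of_lt_pi hα0 (by linarith)
      refine lt_of_pow_lt_pow_left₀ 2 (Real.sqrt_nonneg _) ?_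
      rw [hysq, lt_div_iff₀ hb]
      linarith
    have hypos : 0 < y := (Real.sin_pos_of_pos_of_lt_pi hα0 (by linarith)).trans hysin
    have hsiny : Real.sin (Real.arcsin y) = y := Real.sin_arcsin (by linarith) hylt.le
    have hay : α < Real.arcsin y := by
      rw [Real.lt_arcsin_iff_sin_lt ⟨by linarith, by linarith⟩ ⟨by linarith, hylt.le⟩]
      exact hysin
    have hay' : Real.arcsin y < Real.pi / 2 := Real.arcsin_lt_pi_div_two.2 hylt
    obtain ⟨d, hd⟩ := h.phase_surjective (Real.pi - Real.arcsin y)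
    refine ⟨d, (hI d).2 ⟨by linarith, by linarith⟩, ?_⟩
    have hrd : r d = (rMinus m q + rPlus m q) / 2 := by
      rw [h.radius, hd, Real.sin_pi_sub, hsiny, hysq]
      field_simp
      ring
    have hDd : D m q (r d) < 0 := by
      rw [D_eq hqm.le (h.motion.pos d).ne', hrd]
      refine div_neg_of_neg_of_pos (mul_neg_of_neg_of_pos (by linarith) (by linarith)) ?_
      have : 0 < (rMinus m q + rPlus m q) / 2 := by linarith
      positivity
    have hvd : 0 < v d := by
      rw [h.velocity, hd, Real.sin_pi_sub, Real.cos_pi_sub, hsiny]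
      have h1 := h.rate_pos (Real.pi - Real.arcsin y)
      have h2 : 0 < Real.cos (Real.arcsin y) := Real.cos_pos_of_mem_Ioo ⟨by linarith, hay'⟩
      have := mul_pos h1 (mul_pos hypos h2)
      linarith
    rw [← h.motion.mul_eq d] at hDd
    rcases mul_neg_iff.1 hDd with h1 | h1
    · linarith
    · exact h1.1
  have h0 : (0 : ℝ) ∈ Set.Ioo ta tb := (hI 0).2 (by rw [h.phase_zero]; constructor <;> linarith)
  obtain ⟨z, hz, hwz, _, hzpos, hzneg⟩ := exists_unique_downcrossing
    (w := fun t => -√(D m q s) + accel m q s * r t - v t)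
    (fun t _ => h.motion.deriv_outgoing t) (fun t ht hw => by
      have h1 := (hrplus t ht hw).2
      rw [hw, h1, mul_zero, neg_zero, zero_add, dD]
      have h2 := rPlus_mul_rMinus hqm.le
      have h3 := rPlus_add_rMinus m q
      have h4 : 2 * m / rMinus m q ^ 2 - 2 * q ^ 2 / rMinus m q ^ 3 =
          -((rPlus m q - rMinus m q) / rMinus m q ^ 2) := by
        rw [← h2, ← h3]
        field_simp
        ring
      rw [h4]
      have : 0 < (rPlus m q - rMinus m q) / rMinus m q ^ 2 := div_pos (by linarith) (by positivity)
      linarith) h0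
    (h.factors_pos hm hqm.le hs hsc (by rw [h.phase_zero]; linarith)
      (by rw [h.phase_zero]; exact hα0)).1 hd hdw
  obtain ⟨hz1, hz2⟩ := hrplus z hz hwz
  refine ⟨χ z, hz1, ((hI z).1 hz).2, fun t ht => ?_, fun t h1 h2 => ?_, fun t h1 h2 => ?_⟩
  · rw [hmono.injective ht]
    exact ⟨hwz, hz2⟩
  · exact hzpos t ⟨hmono.lt_iff_lt.1 (by rw [hta]; exact h1), hmono.lt_iff_lt.1 h2⟩
  · exact hzneg t ⟨hmono.lt_iff_lt.1 h1, hmono.lt_iff_lt.1 (by rw [htb]; exact h2)⟩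

/-- The times at which the phase is `-α + k π` or `c + k π`, in increasing order. -/
theorem exists_times (h : Oscillation m q s r v χ k b α) {c : ℝ} (h1 : -α < c)
    (h2 : c < Real.pi - α) :
    ∃ S : ℤ → ℝ, StrictMono S ∧ Tendsto S atTop atTop ∧ Tendsto S atBot atBot ∧
      ∀ n : ℤ, χ (S (2 * n)) = -α + n * Real.pi ∧ χ (S (2 * n + 1)) = c + n * Real.pi := by
  choose ψ hψ using h.phase_surjective
  have hψm : StrictMono ψ := fun x y hxy => h.phase_mono.lt_iff_lt.1 (by rwa [hψ, hψ])
  have hψs : Function.Surjective ψ := fun t => ⟨χ t, h.phase_mono.injective (by rw [hψ])⟩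
  let e := hψm.orderIsoOfSurjective ψ hψs
  set p : ℤ → ℝ := fun j => open Classical in
    (if Even j then -α else c) + ((j / 2 : ℤ) : ℝ) * Real.pi with hp
  have hp0 : ∀ n : ℤ, p (2 * n) = -α + n * Real.pi := fun n => by
    simp [hp]
  have hp1 : ∀ n : ℤ, p (2 * n + 1) = c + n * Real.pi := fun n => by
    have : (2 * n + 1) / 2 = n := by omega
    simp [hp, this]
  have hpi := Real.pi_pos
  have hpm : StrictMono p := by
    refine strictMono_int_of_lt_succ fun j => ?_
    rcases Int.even_or_odd' j with ⟨n, rfl | rfl⟩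
    · rw [hp0, hp1]; linarith
    · have e1 : 2 * n + 1 + 1 = 2 * (n + 1) := by ring
      rw [e1, hp0, hp1]
      push_cast
      linarith
  have hpb : ∀ j : ℤ, |p j - j * (Real.pi / 2)| ≤ Real.pi + α := fun j => by
    have := h.angle_pos
    rcases Int.even_or_odd' j with ⟨n, rfl | rfl⟩
    · rw [hp0, abs_le]
      push_cast
      constructor <;> linarith
    · rw [hp1, abs_le]
      push_cast
      constructor <;> linarith
  have hpt : Tendsto p atTop atTop := by
    refine tendsto_atTop_mono (f := fun j : ℤ => (j : ℝ) * (Real.pi / 2) + -(Real.pi + α))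
      (fun j => by have := (abs_le.1 (hpb j)).1; linarith) ?_
    exact tendsto_atTop_add_const_right _ _
      ((tendsto_intCast_atTop_atTop).atTop_mul_const (by positivity))
  have hpbot : Tendsto p atBot atBot := by
    refine tendsto_atBot_mono (fun j => (by have := (abs_le.1 (hpb j)).2; linarith :
      p j ≤ (j : ℝ) * (Real.pi / 2) + (Real.pi + α))) ?_
    exact tendsto_atBot_add_const_right _ _
      ((tendsto_intCast_atBot_iff.2 tendsto_id).atBot_mul_const (by positivity))
  exact ⟨fun j => ψ (p j), hψm.comp hpm, (OrderIso.tendsto_atTop e).comp hpt,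
    (OrderIso.tendsto_atBot e).comp hpbot, fun n => ⟨by rw [hψ, hp0], by rw [hψ, hp1]⟩⟩

/-- Assembly of a base curve from a curve whose part in the exterior region lies in the strip `0`.
-/
theorem isBaseCurve (h : Oscillation m q s r v χ k b α) (hm : 0 < m)
    (hqm : q ^ 2 ≤ m ^ 2) (hs : rPlus m q < s) {S₀ S₁ : ℝ}
    (hS₀ : χ S₀ = -α) (hS₁ : α ≤ χ S₁) (hS₁' : χ S₁ < Real.pi - α) {x : ℝ → Base m q} {V : ℝ → ℝ}
    (hchart : ∀ t, ∃ P a b, HasAccelChart m q (accel m q s) x P a b t)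
    (hrad : ∀ t, baseRadius m q (x t) = r t)
    (hx : ∀ t ∈ Set.Ioo S₀ S₁, ∃ h : InPatch m q (.strip 0) (V t) (r t),
        x t = Quot.mk _ ⟨.strip 0, V t, r t, h⟩)
    (hV0 : V 0 = tortoise m q s)
    (hV : ∀ t ∈ Set.Ioo S₀ S₁, HasDerivAt V (1 / (-√(D m q s) + accel m q s * r t - v t)) t)
    (hext : ∀ t, x t ∈ baseExterior m q → t ∈ Set.Ioo S₀ S₁ ∧ rPlus m q < r t) :
    IsBaseCurve m q s r x ∧ (∀ t, (t, s) ∈ exteriorDomain m q → extRadius m q (t, s) = r t) ∧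
      ∃ a b, a < 0 ∧ 0 < b ∧ (∀ t ∈ Set.Ioo a b, (t, s) ∈ exteriorDomain m q) ∧
        r a = rPlus m q ∧ r b = rPlus m q := by
  have hα0 := h.angle_pos
  have hmono := h.phase_mono
  obtain ⟨b', hb'⟩ := h.phase_surjective α
  have ha0 : S₀ < 0 := hmono.lt_iff_lt.1 (by rw [hS₀, h.phase_zero]; linarith)
  have hb0 : 0 < b' := hmono.lt_iff_lt.1 (by rw [hb', h.phase_zero]; exact hα0)
  have hbS : b' ≤ S₁ := hmono.le_iff_le.1 (by rw [hb']; exact hS₁)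
  have hI : ∀ t ∈ Set.Ioo S₀ b', -α < χ t ∧ χ t < α := fun t ht =>
    ⟨hS₀ ▸ hmono ht.1, hb' ▸ hmono ht.2⟩
  have hab : ∀ t ∈ Set.Ioo S₀ b', (t, s) ∈ exteriorDomain m q ∧ extRadius m q (t, s) = r t :=
    fun t ht => h.exterior t (hI t ht).1 (hI t ht).2
  have hra := h.radius_eq (Or.inr hS₀)
  have hrb := h.radius_eq (Or.inl hb')
  have hmem : ∀ t, (t, s) ∈ exteriorDomain m q → t ∈ Set.Ioo S₀ b' := fun t ht =>
    mem_Ioo_of_mem_exteriorDomain hm hqm h.motion.continuous_r ha0 hb0 hra hrb hab ht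
  have hsub : ∀ t ∈ Set.Ioo S₀ b', t ∈ Set.Ioo S₀ S₁ := fun t ht => ⟨ht.1, ht.2.trans_le hbS⟩
  refine ⟨⟨hchart, hrad, fun t ht => ?_, fun t ht => ?_⟩, fun t ht => (hab t (hmem t ht)).2, S₀, b',
    ha0, hb0, fun t ht => (hab t ht).1, hra, hrb⟩
  · have htI := hmem t ht
    refine ⟨extRadius_gt hm hqm ht, ?_⟩
    obtain ⟨hp, hxt⟩ := hx t (hsub t htI)
    have h1 : V t = extTime m q (t, s) + tortoise m q (r t) := by
      refine eq_of_hasDerivAt_eq (g := fun t => extTime m q (t, s) + tortoise m q (r t))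
        (fun t ht => hV t (hsub t ht)) (fun t ht => ?_) (⟨ha0, hb0⟩ : (0 : ℝ) ∈ Set.Ioo S₀ b') ?_
          htI
      · obtain ⟨h2, h3⟩ := hab t ht
        have h4 : rPlus m q < r t := by rw [← h3]; exact extRadius_gt hm hqm h2
        refine ((hasDerivAt_extTime hm hqm h2).add
          ((hasDerivAt_tortoise_of_gt hm hqm h4).comp t (h.motion.deriv_r t))).congr_deriv ?_
        have h5 := D_pos hm hqm h4
        have h6 := h.motion.mul_eq t
        rw [h3, energy, ← h6]
        rw [← h6] at h5
        have h7 := left_ne_zero_of_mul h5.ne'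
        have h8 := right_ne_zero_of_mul h5.ne'
        field_simp
      · simp only [hV0, extTime_zero hm hqm hs, h.start.1, zero_add]
    rw [hxt]
    have h2 := (hab t htI).2
    have hg := Quot.sound (Glue.static_strip (extTime m q (t, s)) (extRadius m q (t, s))
      (extRadius_gt hm hqm ht) (by rw [h2]; exact h.motion.pos t))
    rw [hg]
    congr 2
    · rw [h1, h2]
    · exact h2.symm
  · obtain ⟨h1, h2⟩ := hext t ht
    refine (hab t ⟨h1.1, ?_⟩).1
    by_contra hcon
    have h3 : α ≤ χ t := by rw [← hb']; exact hmono.monotone (not_lt.1 hcon)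
    have h4 : χ t < Real.pi - α := (hmono h1.2).trans hS₁'
    rcases eq_or_lt_of_le h3 with h5 | h5
    · rw [h.radius_eq (Or.inl h5.symm)] at h2
      exact h2.false
    · exact (h.radius_lt h5 h4).not_gt h2

end Oscillation

/-! ### Infalling curves in the maximal extension -/

section

variable {m q s : ℝ}

/-- An infalling curve of the congruence, in the maximal extension. -/
theorem exists_baseCurve_of_lt (hm : 0 < m) (hq : q ≠ 0) (hqm : q ^ 2 ≤ m ^ 2)
    (hs : rPlus m q < s) (hsc : s < rCrit m q) :
    ∃ (r v : ℝ → ℝ) (x : ℝ → Base m q), CongruenceMotion m q s r v ∧ r 0 = s ∧ v 0 = 0 ∧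
      IsBaseCurve m q s r x ∧ (∀ t, (t, s) ∈ exteriorDomain m q → extRadius m q (t, s) = r t) ∧
      ∃ a b, a < 0 ∧ 0 < b ∧ (∀ t ∈ Set.Ioo a b, (t, s) ∈ exteriorDomain m q) ∧
        r a = rPlus m q ∧ r b = rPlus m q := by
  obtain ⟨r, v, χ, k, b, α, h⟩ := exists_oscillation hm hq hqm hs hsc
  have hα0 := h.angle_pos
  have hα1 := h.angle_lt
  have hmono := h.phase_mono
  refine ⟨r, v, ?_⟩
  suffices hx : ∃ (c S₀ S₁ : ℝ) (x : ℝ → Base m q) (V : ℝ → ℝ), α ≤ c ∧ c < Real.pi - α ∧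
      χ S₀ = -α ∧ χ S₁ = c ∧ (∀ t, ∃ P a b, HasAccelChart m q (accel m q s) x P a b t) ∧
      (∀ t, baseRadius m q (x t) = r t) ∧
      (∀ t ∈ Set.Ioo S₀ S₁, ∃ h : InPatch m q (.strip 0) (V t) (r t),
        x t = Quot.mk _ ⟨.strip 0, V t, r t, h⟩) ∧
      V 0 = tortoise m q s ∧
      (∀ t ∈ Set.Ioo S₀ S₁, HasDerivAt V (1 / (-√(D m q s) + accel m q s * r t - v t)) t) ∧
      ∀ t, x t ∈ baseExterior m q → t ∈ Set.Ioo S₀ S₁ ∧ rPlus m q < r t by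
    obtain ⟨c, S₀, S₁, x, V, h1, h2, h3, h4, h5, h6, h7, h8, h9, h10⟩ := hx
    exact ⟨x, h.motion, h.start.1, h.start.2, h.isBaseCurve hm hqm hs h3 (by rw [h4]; exact h1)
      (by rw [h4]; exact h2) h5 h6 h7 h8 h9 h10⟩
  -- reduction to the basic period of the phase
  have hper : ∀ t (n : ℤ), ∃ t', χ t' = χ t - n * Real.pi ∧ r t = r t' ∧ v t = v t' := by
    intro t n
    obtain ⟨t', ht'⟩ := h.phase_surjective (χ t - n * Real.pi)
    exact ⟨t', ht', h.periodic (n := n) (by rw [ht']; ring)⟩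
  rcases lt_or_eq_of_le hqm with hlt | he
  · obtain ⟨c, hc1, hc2, hz, hp, hn⟩ := h.exists_inner_zero hm hq hlt hs hsc
    obtain ⟨S, hS, hSt, hSb, hSe⟩ := h.exists_times (by linarith : -α < c) hc2
    have he0 : χ (S 0) = -α := by simpa using (hSe 0).1
    have he1 : χ (S 1) = c := by simpa using (hSe 0).2
    obtain ⟨x, V, hx1, hx2, hx3, hx4, hx5, hx6⟩ := h.motion.exists_saddle_curve hm hq hlt hS hSt hSb
      (fun j => by
        rcases Int.even_or_odd' j with ⟨n, rfl | rfl⟩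
        · obtain ⟨t', h1, h2, h3⟩ := hper (S (2 * n)) n
          rw [h2, h3]
          exact ((h.factors_horizon hm hqm hs hsc).2 (by rw [h1, (hSe n).1]; ring)).1
        · obtain ⟨t', h1, h2, h3⟩ := hper (S (2 * n + 1)) n
          rw [h2, h3]
          exact (hz t' (by rw [h1, (hSe n).2]; ring)).1)
      (fun j => by
        rcases Int.even_or_odd' j with ⟨n, rfl | rfl⟩
        · obtain ⟨t', h1, h2, h3⟩ := hper (S (2 * n)) n
          rw [h2, (saddleRadius_even (even_two_mul n)).1]
          exact h.radius_eq (Or.inr (by rw [h1, (hSe n).1]; ring))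
        · obtain ⟨t', h1, h2, h3⟩ := hper (S (2 * n + 1)) n
          rw [h2, (saddleRadius_odd (odd_two_mul_add_one n)).1]
          exact (hz t' (by rw [h1, (hSe n).2]; ring)).2)
      (fun j hj t ht => by
        rcases Int.even_or_odd' j with ⟨n, rfl | rfl⟩
        · obtain ⟨t', h1, h2, h3⟩ := hper t n
          rw [h2, h3]
          have h4 := hmono ht.1
          have h5 := hmono ht.2
          rw [(hSe n).1] at h4
          rw [(hSe n).2] at h5
          exact hp t' (by rw [h1]; linarith) (by rw [h1]; linarith)
        · exact absurd hj (Int.not_even_iff_odd.2 (odd_two_mul_add_one n)))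
      (fun j hj t ht => by
        rcases Int.even_or_odd' j with ⟨n, rfl | rfl⟩
        · exact absurd hj (Int.not_odd_iff_even.2 (even_two_mul n))
        · obtain ⟨t', h1, h2, h3⟩ := hper t n
          rw [h2, h3]
          have h4 := hmono ht.1
          have h5 := hmono ht.2
          have e1 : 2 * n + 1 + 1 = 2 * (n + 1) := by ring
          rw [(hSe n).2] at h4
          rw [e1, (hSe (n + 1)).1] at h5
          push_cast at h5
          exact hn t' (by rw [h1]; linarith) (by rw [h1]; linarith))
      (tortoise m q s)
    exact ⟨c, S 0, S 1, x, V, hc1.le, hc2, he0, he1, hx1, hx2, hx3, hx4, hx5, hx6⟩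
  · have hrm : rPlus m q = m := by simp [rPlus, he]
    obtain ⟨S, hS, hSt, hSb, hSe⟩ := h.exists_times (by linarith : -α < α)
      (by linarith : α < Real.pi - α)
    have he0 : χ (S 0) = -α := by simpa using (hSe 0).1
    have he1 : χ (S 1) = α := by simpa using (hSe 0).2
    -- at a zero of the energy `D = -v² ≤ 0`, hence `r = m`, where the energy is positive
    have hE : ∀ t, 0 < -√(D m q s) + accel m q s * r t := by
      have hne : ∀ t, -√(D m q s) + accel m q s * r t ≠ 0 := by
        intro t h0
        have h1 := h.motion.sq t
        have hr := h.motion.pos t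
        rw [h0] at h1
        have h2 : D m q (r t) ≤ 0 := by
          have := sq_nonneg (v t)
          linarith
        have h3 : D m q (r t) = (r t - m) ^ 2 / r t ^ 2 := by
          rw [D, he]
          field_simp
          ring
        have h4 : 0 ≤ (r t - m) ^ 2 / r t ^ 2 := by positivity
        have h5 : (r t - m) ^ 2 / r t ^ 2 = 0 := le_antisymm (h3 ▸ h2) h4
        rcases div_eq_zero_iff.1 h5 with h6 | h6
        · have h7 := Oscillation.energy_pos hm hqm hs hsc (r := r t)
            (by rw [hrm]; linarith [pow_eq_zero_iff (two_ne_zero) |>.1 h6])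
          rw [energy] at h7
          exact h7.ne' h0
        · exact absurd h6 (pow_ne_zero 2 hr.ne')
      have h0 : 0 < -√(D m q s) + accel m q s * r 0 := by
        have := Oscillation.energy_pos hm hqm hs hsc hs.le
        rw [h.start.1]
        exact this
      intro t
      by_contra hcon
      have hc : Continuous fun t => -√(D m q s) + accel m q s * r t :=
        continuous_const.add (continuous_const.mul h.motion.continuous_r)
      obtain ⟨t', ht'⟩ := mem_range_of_exists_le_of_exists_ge hc ⟨t, not_lt.1 hcon⟩ ⟨0, h0.le⟩
      exact hne t' ht'
    have hfac : ∀ t, r t ≠ m → 0 < -√(D m q s) + accel m q s * r t - v t ∧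
        0 < -√(D m q s) + accel m q s * r t + v t := by
      intro t hr
      have h1 : 0 < D m q (r t) := by
        have h3 : D m q (r t) = (r t - m) ^ 2 / r t ^ 2 := by
          have := h.motion.pos t
          rw [D, he]
          field_simp
          ring
        have := h.motion.pos t
        have := sub_ne_zero.2 hr
        rw [h3]
        positivity
      rw [← h.motion.mul_eq t] at h1
      rcases mul_pos_iff.1 h1 with h2 | h2
      · exact h2
      · linarith [hE t]
    have hgt : ∀ j, Even j → ∀ t ∈ Set.Ioo (S j) (S (j + 1)), m < r t := by
      intro j hj t ht
      rcases Int.even_or_odd' j with ⟨n, rfl | rfl⟩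
      · obtain ⟨t', h1, h2, h3⟩ := hper t n
        have h4 := hmono ht.1
        have h5 := hmono ht.2
        rw [(hSe n).1] at h4
        rw [(hSe n).2] at h5
        rw [h2, ← hrm]
        exact h.radius_gt (by rw [h1]; linarith) (by rw [h1]; linarith)
      · exact absurd hj (Int.not_even_iff_odd.2 (odd_two_mul_add_one n))
    have hlt : ∀ j, Odd j → ∀ t ∈ Set.Ioo (S j) (S (j + 1)), r t < m := by
      intro j hj t ht
      rcases Int.even_or_odd' j with ⟨n, rfl | rfl⟩
      · exact absurd hj (Int.not_odd_iff_even.2 (even_two_mul n))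
      · obtain ⟨t', h1, h2, h3⟩ := hper t n
        have h4 := hmono ht.1
        have h5 := hmono ht.2
        have e1 : 2 * n + 1 + 1 = 2 * (n + 1) := by ring
        rw [(hSe n).2] at h4
        rw [e1, (hSe (n + 1)).1] at h5
        push_cast at h5
        rw [h2, ← hrm]
        exact h.radius_lt (by rw [h1]; linarith) (by rw [h1]; linarith)
    have hfacI : ∀ j, ∀ t ∈ Set.Ioo (S j) (S (j + 1)), 0 < -√(D m q s) + accel m q s * r t - v t ∧
        0 < -√(D m q s) + accel m q s * r t + v t := fun j t ht => by
      rcases Int.even_or_odd j with hj | hj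
      · exact hfac t (hgt j hj t ht).ne'
      · exact hfac t (hlt j hj t ht).ne
    have hcases : ∀ j t, t ∈ Set.Ioo (S j) (S (j + 2)) →
        t ∈ Set.Ioo (S j) (S (j + 1)) ∨ t = S (j + 1) ∨
          t ∈ Set.Ioo (S (j + 1)) (S (j + 1 + 1)) := by
      intro j t ht
      have e2 : j + 1 + 1 = j + 2 := by ring
      rw [e2]
      rcases lt_trichotomy t (S (j + 1)) with h1 | h1 | h1
      · exact Or.inl ⟨ht.1, h1⟩
      · exact Or.inr (Or.inl h1)
      · exact Or.inr (Or.inr ⟨h1, ht.2⟩)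
    obtain ⟨x, V, hx1, hx2, hx3, hx4, hx5, hx6⟩ := h.motion.exists_strip_curve he hS hSt hSb
      (fun j hj t ht => by
        rcases hcases j t ht with h1 | h1 | h1
        · exact (hfacI _ t h1).1
        · rcases Int.even_or_odd' j with ⟨n, rfl | rfl⟩
          · obtain ⟨t', h2, h3, h4⟩ := hper t n
            rw [h3, h4]
            exact ((h.factors_horizon hm hqm hs hsc).1 (by rw [h2, h1, (hSe n).2]; ring)).1
          · exact absurd hj (Int.not_even_iff_odd.2 (odd_two_mul_add_one n))
        · exact (hfacI _ t h1).1)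
      (fun j hj t ht => by
        rcases hcases j t ht with h1 | h1 | h1
        · exact (hfacI _ t h1).2
        · rcases Int.even_or_odd' j with ⟨n, rfl | rfl⟩
          · exact absurd hj (Int.not_odd_iff_even.2 (even_two_mul n))
          · have e1 : 2 * n + 1 + 1 = 2 * (n + 1) := by ring
            obtain ⟨t', h2, h3, h4⟩ := hper t (n + 1)
            rw [h3, h4]
            exact ((h.factors_horizon hm hqm hs hsc).2
              (by rw [h2, h1, e1, (hSe (n + 1)).1]; ring)).2
        · exact (hfacI _ t h1).2)
      hgt hlt
      (fun j => by
        rcases Int.even_or_odd' j with ⟨n, rfl | rfl⟩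
        · obtain ⟨t', h1, h2, h3⟩ := hper (S (2 * n)) n
          rw [h2, ← hrm]
          exact h.radius_eq (Or.inr (by rw [h1, (hSe n).1]; ring))
        · obtain ⟨t', h1, h2, h3⟩ := hper (S (2 * n + 1)) n
          rw [h2, ← hrm]
          exact h.radius_eq (Or.inl (by rw [h1, (hSe n).2]; ring)))
      (tortoise m q s)
    exact ⟨α, S 0, S 1, x, V, le_rfl, by linarith, he0, he1, hx1, hx2, hx3, hx4, hx5, hx6⟩

end

/-! ### Asymptotic behaviour in the exterior region -/

/-- An outgoing accelerated motion in the exterior region has a finite retarded time: with `u = a -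
tortoise r`, the rate `u' = 1 / (E + v)` is bounded by a multiple of `v / r² = (-1 / r)'`. -/
theorem RadialMotion.exists_tendsto_retarded {m q β γ : ℝ} {r v a : ℝ → ℝ} (hm : 0 < m)
    (hqm : q ^ 2 ≤ m ^ 2) (h : RadialMotion m q β γ r v) (hβ : 0 < β) (hr : Tendsto r atTop atTop)
    (hv : ∀ t, 0 ≤ t → 0 ≤ v t)
    (ha : ∀ t, HasDerivAt a ((γ + β * r t) / D m q (r t)) t) :
    ∃ u, Tendsto (fun t => a t - tortoise m q (r t)) atTop (𝓝 u) := by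
  have hev : ∀ᶠ t in atTop, 0 ≤ t ∧ rPlus m q < r t ∧ -2 * γ / β ≤ r t ∧ 4 / β ≤ r t :=
    (eventually_ge_atTop 0).and ((hr.eventually_gt_atTop _).and
      ((hr.eventually_ge_atTop _).and (hr.eventually_ge_atTop _)))
  obtain ⟨t₁, ht₁⟩ := eventually_atTop.1 hev
  have hfacts : ∀ t, t₁ ≤ t → β * r t / 2 ≤ γ + β * r t ∧ (γ + β * r t) / 2 ≤ v t ∧
      0 < D m q (r t) ∧ rPlus m q < r t := by
    intro t ht
    obtain ⟨h0, h1, h2, h3⟩ := ht₁ t ht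
    rw [div_le_iff₀ hβ] at h2 h3
    have h4 : β * r t / 2 ≤ γ + β * r t := by linarith
    have h5 : 2 ≤ γ + β * r t := by linarith
    have h6 : D m q (r t) ≤ 1 := by
      have hr0 := h.pos t
      have h7 : D m q (r t) = 1 - (2 * m * r t - q ^ 2) / r t ^ 2 := by
        rw [D]; field_simp; ring
      have h8 : 0 ≤ 2 * m * r t - q ^ 2 := by
        have := m_le_rPlus m q
        nlinarith
      have := div_nonneg h8 (sq_nonneg (r t))
      linarith
    refine ⟨h4, ?_, D_pos hm hqm h1, h1⟩
    have h7 := h.sq t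
    refine le_of_sq_le_sq ?_ (hv t h0)
    nlinarith
  have hud : ∀ t, t₁ ≤ t → HasDerivAt (fun t => a t - tortoise m q (r t))
      (1 / (γ + β * r t + v t)) t := fun t ht => by
    obtain ⟨h1, h2, h3, h4⟩ := hfacts t ht
    refine ((ha t).sub ((hasDerivAt_tortoise_of_gt hm hqm h4).comp t (h.deriv_r t))).congr_deriv ?_
    have h5 := h.mul_eq t
    rw [← h5] at h3 ⊢
    have h6 := left_ne_zero_of_mul h3.ne'
    have h7 := right_ne_zero_of_mul h3.ne'
    field_simp
  have hgd : ∀ t, t₁ ≤ t → HasDerivAt (fun t => a t - tortoise m q (r t) + 8 / β ^ 2 * (r t)⁻¹)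
      (1 / (γ + β * r t + v t) + 8 / β ^ 2 * (-v t / r t ^ 2)) t := fun t ht =>
    (hud t ht).add (((h.deriv_r t).inv (h.pos t).ne').const_mul _)
  have hint : interior (Set.Ici t₁) = Set.Ioi t₁ := interior_Ici
  have hmono : MonotoneOn (fun t => a t - tortoise m q (r t)) (Set.Ici t₁) := by
    refine monotoneOn_of_deriv_nonneg (convex_Ici _)
      (fun t ht => (hud t ht).continuousAt.continuousWithinAt)
      (fun t ht => (hud t (interior_subset ht)).differentiableAt.differentiableWithinAt)
      fun t ht => ?_
    have ht' := interior_subset ht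
    rw [(hud t ht').deriv]
    obtain ⟨h1, h2, h3, h4⟩ := hfacts t ht'
    have := mul_pos hβ (h.pos t)
    refine one_div_nonneg.2 ?_
    linarith
  have hanti :
      AntitoneOn (fun t => a t - tortoise m q (r t) + 8 / β ^ 2 * (r t)⁻¹) (Set.Ici t₁) := by
    refine antitoneOn_of_deriv_nonpos (convex_Ici _)
      (fun t ht => (hgd t ht).continuousAt.continuousWithinAt)
      (fun t ht => (hgd t (interior_subset ht)).differentiableAt.differentiableWithinAt)
      fun t ht => ?_
    have ht' := interior_subset ht
    rw [(hgd t ht').deriv]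
    obtain ⟨h1, h2, h3, h4⟩ := hfacts t ht'
    have hr0 := h.pos t
    have h5 := mul_pos hβ hr0
    have h6 : 1 / (γ + β * r t + v t) ≤ 2 / (β * r t) := by
      rw [div_le_div_iff₀ (by linarith) h5]
      linarith
    have h7 : 2 / (β * r t) ≤ 8 / β ^ 2 * (v t / r t ^ 2) := by
      have h8 : 8 / β ^ 2 * (v t / r t ^ 2) = 8 * v t / (β * r t * (β * r t)) := by
        field_simp
      rw [h8, div_le_div_iff₀ h5 (by positivity)]
      nlinarith
    rw [neg_div]
    linarith
  have hbdd : ∀ t, t₁ ≤ t → a t - tortoise m q (r t) ≤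
      a t₁ - tortoise m q (r t₁) + 8 / β ^ 2 * (r t₁)⁻¹ := fun t ht => by
    have h1 := hanti (Set.mem_Ici.2 le_rfl) (Set.mem_Ici.2 ht) ht
    have h2 : 0 ≤ 8 / β ^ 2 * (r t)⁻¹ := by
      have := h.pos t
      positivity
    simp only at h1
    linarith
  have hmono' : Monotone fun t => a (max t₁ t) - tortoise m q (r (max t₁ t)) := fun x y hxy =>
    hmono (Set.mem_Ici.2 (le_max_left _ _)) (Set.mem_Ici.2 (le_max_left _ _))
      (max_le_max le_rfl hxy)
  have hbdd' : BddAbove (Set.range fun t => a (max t₁ t) - tortoise m q (r (max t₁ t))) := by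
    refine ⟨a t₁ - tortoise m q (r t₁) + 8 / β ^ 2 * (r t₁)⁻¹, ?_⟩
    rintro _ ⟨t, rfl⟩
    exact hbdd _ (le_max_left _ _)
  refine ⟨_, (tendsto_atTop_ciSup hmono' hbdd').congr' ?_⟩
  filter_upwards [eventually_ge_atTop t₁] with t ht
  rw [max_eq_right ht]

section

variable {m q s : ℝ}

theorem initialForce_nonneg (hm : 0 < m) (hqm : q ^ 2 ≤ m ^ 2) (hs : rPlus m q < s)
    (hsc : rCrit m q ≤ s) : 0 ≤ initialForce m q s := by
  rcases eq_or_lt_of_le hsc with h | h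
  · rw [← h, initialForce_rCrit hqm]
  · exact (initialForce_pos hm hqm hs h).le

/-- A curve of the congruence that stays in the exterior region. -/
theorem exists_baseCurve_of_ge (hm : 0 < m) (hqm : q ^ 2 ≤ m ^ 2)
    (hs : rPlus m q < s) (hsc : rCrit m q ≤ s) :
    ∃ (r v : ℝ → ℝ) (x : ℝ → Base m q), CongruenceMotion m q s r v ∧ r 0 = s ∧ v 0 = 0 ∧
      IsBaseCurve m q s r x ∧ (∀ t, (t, s) ∈ exteriorDomain m q → extRadius m q (t, s) = r t) ∧
      (∀ t, (t, s) ∈ exteriorDomain m q) ∧ (∀ t, 0 ≤ t → 0 ≤ v t) ∧ (∀ t, t ≤ 0 → v t ≤ 0) ∧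
      (rCrit m q < s → Tendsto r atTop atTop ∧ Tendsto r atBot atTop) ∧
      (s = rCrit m q → ∀ t, r t = s) := by
  obtain ⟨r, v, Z, h, hZ0, hZ, hZm, hZt, hZb, hr, hv⟩ :=
    exists_radialMotion_of_ge hm hqm hs (initialForce_nonneg hm hqm hs hsc)
  have hc := initialForce_nonneg hm hqm hs hsc
  have hext := extRadius_of_ge hm hqm hs hc hZ0 hZ hr
  have hsp : ∀ t, 0 ≤ chartSpeed m q (Z t) s := fun t => by unfold chartSpeed; positivity
  refine ⟨r, v, _, h, by simp [hr, hZ0], by simp [hv, hZ0], isBaseCurve_static hm hqm h hext,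
    fun t _ => (hext t).2, fun t => (hext t).1, fun t ht => ?_, fun t ht => ?_, fun hlt => ?_,
    fun he t => ?_⟩
  · have h1 : 0 ≤ Z t := hZ0 ▸ hZm.monotone ht
    have := hsp t
    rw [hv]
    positivity
  · have h1 : Z t ≤ 0 := hZ0 ▸ hZm.monotone ht
    have := hsp t
    rw [hv, mul_assoc, mul_assoc]
    exact mul_nonpos_of_nonneg_of_nonpos (by norm_num)
      (mul_nonpos_of_nonneg_of_nonpos hc (mul_nonpos_of_nonpos_of_nonneg h1 this))
  · have hc' := initialForce_pos hm hqm hs hlt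
    have hfun : r = fun t => s + initialForce m q s * Z t ^ 2 := funext hr
    rw [hfun]
    constructor
    · exact tendsto_atTop_add_const_left _ _
        (((tendsto_pow_atTop two_ne_zero).comp hZt).const_mul_atTop hc')
    · refine tendsto_atTop_add_const_left _ _ (Tendsto.const_mul_atTop hc' ?_)
      have := (tendsto_pow_atTop two_ne_zero).comp (tendsto_neg_atBot_atTop.comp hZb)
      refine this.congr fun t => ?_
      simp
  · rw [hr, he, initialForce_rCrit hqm]
    ring

/-- The retarded time at future null infinity and the advanced time at past null infinity of a curve
that stays in the exterior region. -/
theorem exists_tendsto_null_coordinates (hm : 0 < m) (hqm : q ^ 2 ≤ m ^ 2) (hs : rPlus m q < s)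
    {r v : ℝ → ℝ} (h : CongruenceMotion m q s r v)
    (hext : ∀ t, (t, s) ∈ exteriorDomain m q)
    (hr : ∀ t, extRadius m q (t, s) = r t) (hv : ∀ t, 0 ≤ t → 0 ≤ v t) (hv' : ∀ t, t ≤ 0 → v t ≤ 0)
    (ht : Tendsto r atTop atTop) (hb : Tendsto r atBot atTop) :
    (∃ u, Tendsto (fun t => extTime m q (t, s) - tortoise m q (extRadius m q (t, s))) atTop (𝓝 u)) ∧
    ∃ u, Tendsto (fun t => extTime m q (t, s) + tortoise m q (extRadius m q (t, s))) atBot (𝓝 u) :=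
      by
  have hd : ∀ t, HasDerivAt (fun t => extTime m q (t, s))
      ((-√(D m q s) + accel m q s * r t) / D m q (r t)) t := fun t => by
    have := hasDerivAt_extTime hm hqm (hext t)
    rwa [hr] at this
  have hβ := accel_pos hm hqm hs
  simp only [hr]
  refine ⟨h.exists_tendsto_retarded hm hqm hβ ht hv hd, ?_⟩
  obtain ⟨u, hu⟩ := h.reverse.exists_tendsto_retarded (a := fun t => -extTime m q (-t, s)) hm hqm hβ
    (hb.comp tendsto_neg_atTop_atBot) (fun t ht => by
      have := hv' (-t) (by linarith)
      linarith) (fun t => by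
      have := ((hd (-t)).comp t (hasDerivAt_neg t)).neg
      exact this.congr_deriv (by ring))
  refine ⟨-u, ((hu.comp tendsto_neg_atBot_atTop).neg).congr fun t => ?_⟩
  simp only [Function.comp, neg_neg]
  ring

/-- The static time of the curve of constant radius. -/
theorem extTime_of_static (hm : 0 < m) (hqm : q ^ 2 ≤ m ^ 2) (hs : rPlus m q < s)
    (hext : ∀ t, (t, s) ∈ exteriorDomain m q) (hr : ∀ t, extRadius m q (t, s) = s) (t : ℝ) :
    extTime m q (t, s) = t / √(D m q s) := by
  have hD := D_pos hm hqm hs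
  have hsq := Real.sq_sqrt hD.le
  have hsp := Real.sqrt_pos.2 hD
  have h4 : 0 < s := by linarith [m_le_rPlus m q]
  refine eq_of_hasDerivAt_eq (f := fun t => extTime m q (t, s)) (g := fun t => t / √(D m q s))
    (a := -(|t| + 1)) (b := |t| + 1)
    (c := 0) (fun t _ => hasDerivAt_extTime hm hqm (hext t)) (fun x _ => ?_) ?_ ?_ ?_
  · refine ((hasDerivAt_id x).div_const (√(D m q s))).congr_deriv ?_
    have e : 2 * √(D m q s) / s * s = 2 * √(D m q s) := by field_simp
    rw [hr, energy, accel, e, div_eq_div_iff hsp.ne' hD.ne']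
    linear_combination -hsq
  · have := abs_nonneg t
    constructor <;> linarith
  · simp [extTime_zero hm hqm hs]
  · have := abs_le.1 (le_refl |t|)
    constructor <;> linarith

end

/-! ### The deviation of the congruence -/

/-- Mixed partial derivatives: `∂_t ∂_s f = ∂_s g` for `g = ∂_t f`. -/
theorem hasDerivAt_fderiv_snd {f g : ℝ × ℝ → ℝ} {t s g' : ℝ} (hf : ContDiffAt ℝ 2 f (t, s))
    (hg : ∀ᶠ p in 𝓝 (t, s), HasDerivAt (fun t => f (t, p.2)) (g p) p.1)
    (hg' : HasDerivAt (fun s => g (t, s)) g' s) :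
    HasDerivAt (fun t => fderiv ℝ f (t, s) (0, 1)) g' t := by
  have hd : HasFDerivAt (fderiv ℝ f) (fderiv ℝ (fderiv ℝ f) (t, s)) (t, s) :=
    ((hf.fderiv_right (m := 1) (by norm_num)).differentiableAt (by simp)).hasFDerivAt
  have hsymm : IsSymmSndFDerivAt ℝ f (t, s) := hf.isSymmSndFDerivAt (by simp)
  have key : ∀ (c : ℝ → ℝ × ℝ) (c' y : ℝ × ℝ) (x : ℝ), HasDerivAt c c' x → c x = (t, s) →
      HasDerivAt (fun x => fderiv ℝ f (c x) y) (fderiv ℝ (fderiv ℝ f) (t, s) c' y) x := by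
    intro c c' y x hc hcx
    rw [← hcx] at hd ⊢
    have h := ((ContinuousLinearMap.apply ℝ ℝ y).hasFDerivAt
      (x := fderiv ℝ f (c x))).comp_hasDerivAt x
      (hd.comp_hasDerivAt x hc)
    exact h
  have h1 := key (fun t => (t, s)) (1, 0) (0, 1) t
    ((hasDerivAt_id t).prodMk (hasDerivAt_const t s)) rfl
  have h2 := key (fun s => (t, s)) (0, 1) (1, 0) s
    ((hasDerivAt_const s t).prodMk (hasDerivAt_id s)) rfl
  have h3 : ∀ᶠ p in 𝓝 (t, s), g p = fderiv ℝ f p (1, 0) := by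
    filter_upwards [hg, hf.eventually (by simp)] with p hp hfp
    have h4 : HasFDerivAt f (fderiv ℝ f p) (p.1, p.2) :=
      (hfp.differentiableAt (by simp)).hasFDerivAt
    exact hp.unique (h4.comp_hasDerivAt p.1 ((hasDerivAt_id p.1).prodMk (hasDerivAt_const p.1 p.2)))
  have h4 : ∀ᶠ s' in 𝓝 s, g (t, s') = fderiv ℝ f (t, s') (1, 0) :=
    (Continuous.prodMk_right t).continuousAt.eventually h3
  have h5 := hg'.unique (h2.congr_of_eventuallyEq h4)
  rw [h5, hsymm.eq]
  exact h1

/-- The second derivative of `D`. -/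
def ddD (m q r : ℝ) : ℝ := -4 * m / r ^ 3 + 6 * q ^ 2 / r ^ 4

theorem hasDerivAt_dD (m q : ℝ) {r : ℝ} (hr : r ≠ 0) : HasDerivAt (dD m q) (ddD m q r) r := by
  have h := ((hasDerivAt_const r (2 * m)).div ((hasDerivAt_id r).pow 2) (pow_ne_zero 2 hr)).sub
    ((hasDerivAt_const r (2 * q ^ 2)).div ((hasDerivAt_id r).pow 3) (pow_ne_zero 3 hr))
  refine h.congr_deriv ?_
  simp only [ddD, id, Pi.pow_apply]
  field_simp
  ring

/-- The derivative of `accel` with respect to the starting radius. -/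
def dAccel (m q s : ℝ) : ℝ := -2 * (s ^ 2 - 3 * m * s + 2 * q ^ 2) / (√(D m q s) * s ^ 4)

theorem hasDerivAt_sqrt_D {m q s : ℝ} (hs : s ≠ 0) (hD : 0 < D m q s) :
    HasDerivAt (fun s => √(D m q s)) (dD m q s / (2 * √(D m q s))) s :=
  (hasDerivAt_D m q hs).sqrt hD.ne'

theorem hasDerivAt_accel {m q s : ℝ} (hs : s ≠ 0) (hD : 0 < D m q s) :
    HasDerivAt (accel m q) (dAccel m q s) s := by
  refine (((hasDerivAt_sqrt_D hs hD).const_mul 2).div (hasDerivAt_id s) hs).congr_deriv ?_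
  have h1 := Real.sqrt_pos.2 hD
  have h2 := Real.sq_sqrt hD.le
  simp only [dAccel, id]
  have h3 : √(D m q s) ^ 2 * s ^ 2 = s ^ 2 - 2 * m * s + q ^ 2 := by
    rw [h2, D]; field_simp
  rw [dD]
  field_simp
  linear_combination -h3

section

variable {m q : ℝ}

/-- The radial velocity of the smooth family `extRadius`. -/
def extVelocity (m q : ℝ) (w : ℝ × ℝ) : ℝ := fderiv ℝ (extRadius m q) w (1, 0)

/-- Every curve of the congruence has a radial motion, defined for all proper times and equal to the
smooth family `extRadius` in the exterior region. -/
def HasRadialMotions (m q : ℝ) : Prop := ∀ s, rPlus m q < s → ∃ r v : ℝ → ℝ,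
  CongruenceMotion m q s r v ∧ r 0 = s ∧ v 0 = 0 ∧
    ∀ t, (t, s) ∈ exteriorDomain m q → extRadius m q (t, s) = r t

theorem fst_mem_nhds {t s : ℝ} (hm : 0 < m) (hqm : q ^ 2 ≤ m ^ 2) (h : (t, s) ∈ exteriorDomain m q)
    :
    ∀ᶠ t' in 𝓝 t, (t', s) ∈ exteriorDomain m q :=
  ((isOpen_exteriorDomain hm hqm).preimage (f := fun t : ℝ => (t, s)) (by fun_prop)).mem_nhds h

theorem snd_mem_nhds {t s : ℝ} (hm : 0 < m) (hqm : q ^ 2 ≤ m ^ 2) (h : (t, s) ∈ exteriorDomain m q)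
    :
    ∀ᶠ s' in 𝓝 s, (t, s') ∈ exteriorDomain m q :=
  ((isOpen_exteriorDomain hm hqm).preimage (f := fun s : ℝ => (t, s)) (by fun_prop)).mem_nhds h

theorem exteriorDomain_snd {w : ℝ × ℝ} (h : w ∈ exteriorDomain m q) : rPlus m q < w.2 := by
  obtain ⟨p, hp, rfl⟩ := h
  exact hp.1

theorem hasDerivAt_fst {f : ℝ × ℝ → ℝ} {w : ℝ × ℝ} (hf : DifferentiableAt ℝ f w) :
    HasDerivAt (fun t => f (t, w.2)) (fderiv ℝ f w (1, 0)) w.1 :=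
  hf.hasFDerivAt.comp_hasDerivAt w.1 ((hasDerivAt_id w.1).prodMk (hasDerivAt_const w.1 w.2))

theorem hasDerivAt_snd {f : ℝ × ℝ → ℝ} {w : ℝ × ℝ} (hf : DifferentiableAt ℝ f w) :
    HasDerivAt (fun s => f (w.1, s)) (fderiv ℝ f w (0, 1)) w.2 :=
  hf.hasFDerivAt.comp_hasDerivAt w.2 ((hasDerivAt_const w.2 w.1).prodMk (hasDerivAt_id w.2))

theorem differentiableAt_extRadius (hm : 0 < m) (hqm : q ^ 2 ≤ m ^ 2) {w : ℝ × ℝ}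
    (hw : w ∈ exteriorDomain m q) : DifferentiableAt ℝ (extRadius m q) w :=
  (contDiffAt_extRadius hm hqm hw 1).differentiableAt (by simp)

theorem contDiffAt_extVelocity (hm : 0 < m) (hqm : q ^ 2 ≤ m ^ 2) {w : ℝ × ℝ}
    (hw : w ∈ exteriorDomain m q) : ContDiffAt ℝ 2 (extVelocity m q) w :=
  ((contDiffAt_extRadius hm hqm hw 3).fderiv_right (m := 2) (by norm_num)).clm_apply
    contDiffAt_const

theorem HasRadialMotions.velocity_eq (hM : HasRadialMotions m q) (hm : 0 < m) (hqm : q ^ 2 ≤ m ^ 2)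
    {s : ℝ} (hs : rPlus m q < s) : ∃ r v : ℝ → ℝ, CongruenceMotion m q s r v ∧ r 0 = s ∧ v 0 = 0 ∧
      ∀ t, (t, s) ∈ exteriorDomain m q →
        extRadius m q (t, s) = r t ∧ extVelocity m q (t, s) = v t := by
  obtain ⟨r, v, h, h0, h1, h2⟩ := hM s hs
  refine ⟨r, v, h, h0, h1, fun t ht => ⟨h2 t ht, ?_⟩⟩
  have h3 := hasDerivAt_fst (differentiableAt_extRadius hm hqm ht)
  refine h3.unique ((h.deriv_r t).congr_of_eventuallyEq ?_)
  filter_upwards [fst_mem_nhds hm hqm ht] with t' ht' using h2 t' ht'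

/-- The equations of motion of the smooth family. -/
theorem HasRadialMotions.equations (hM : HasRadialMotions m q) (hm : 0 < m) (hqm : q ^ 2 ≤ m ^ 2)
    {w : ℝ × ℝ} (hw : w ∈ exteriorDomain m q) :
    HasDerivAt (fun t => extRadius m q (t, w.2)) (extVelocity m q w) w.1 ∧
    HasDerivAt (fun t => extVelocity m q (t, w.2))
      (accel m q w.2 * energy m q w.2 (extRadius m q w) - dD m q (extRadius m q w) / 2) w.1 ∧
    extVelocity m q w ^ 2 = energy m q w.2 (extRadius m q w) ^ 2 - D m q (extRadius m q w) := by
  obtain ⟨t, s⟩ := w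
  obtain ⟨r, v, h, h0, h1, h2⟩ := hM.velocity_eq hm hqm (exteriorDomain_snd hw)
  refine ⟨hasDerivAt_fst (differentiableAt_extRadius hm hqm hw), ?_, ?_⟩
  · have h3 := h.deriv_v t
    rw [← (h2 t hw).1] at h3
    refine h3.congr_of_eventuallyEq ?_
    filter_upwards [fst_mem_nhds hm hqm hw] with t' ht' using (h2 t' ht').2
  · rw [(h2 t hw).1, (h2 t hw).2]
    exact h.sq t

/-- The Jacobian determinant of the static coordinates with respect to the proper time and the
starting radius. -/
def deviation (m q : ℝ) (w : ℝ × ℝ) : ℝ :=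
  fderiv ℝ (extTime m q) w (1, 0) * fderiv ℝ (extRadius m q) w (0, 1)
    - fderiv ℝ (extRadius m q) w (1, 0) * fderiv ℝ (extTime m q) w (0, 1)

/-- The derivative of the energy with respect to the starting radius, at a fixed radius `r`. -/
def dEnergy (m q s r : ℝ) : ℝ := -(dD m q s / (2 * √(D m q s))) + dAccel m q s * r

/-- The derivative of `deviation` with respect to the proper time. -/
def deviationRate (m q : ℝ) (w : ℝ × ℝ) : ℝ :=
  energy m q w.2 (extRadius m q w) / D m q (extRadius m q w) * fderiv ℝ (extVelocity m q) w (0, 1)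
    - (accel m q w.2 * energy m q w.2 (extRadius m q w) - dD m q (extRadius m q w) / 2) *
      fderiv ℝ (extTime m q) w (0, 1)
    - extVelocity m q w * dEnergy m q w.2 (extRadius m q w) / D m q (extRadius m q w)

theorem fderiv_extTime_fst (hm : 0 < m) (hqm : q ^ 2 ≤ m ^ 2) {w : ℝ × ℝ}
    (hw : w ∈ exteriorDomain m q) : fderiv ℝ (extTime m q) w (1, 0) =
      energy m q w.2 (extRadius m q w) / D m q (extRadius m q w) :=
  (hasDerivAt_fst ((contDiffAt_extTime hm hqm hw 1).differentiableAt (by simp))).unique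
    (hasDerivAt_extTime hm hqm (t := w.1) (s := w.2) hw)

theorem hasDerivAt_energy_snd (hm : 0 < m) (hqm : q ^ 2 ≤ m ^ 2) {s : ℝ} (hs : rPlus m q < s)
    {R : ℝ → ℝ} {R' : ℝ} (hR : HasDerivAt R R' s) :
    HasDerivAt (fun s => energy m q s (R s)) (dEnergy m q s (R s) + accel m q s * R') s := by
  have h4 : s ≠ 0 := by linarith [m_le_rPlus m q]
  have hD := D_pos hm hqm hs
  refine ((hasDerivAt_sqrt_D h4 hD).neg.add ((hasDerivAt_accel h4 hD).mul hR)).congr_deriv ?_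
  rw [dEnergy]
  ring

theorem hasDerivAt_energy_fst {s t : ℝ} {R : ℝ → ℝ} {R' : ℝ} (hR : HasDerivAt R R' t) :
    HasDerivAt (fun t => energy m q s (R t)) (accel m q s * R') t :=
  (hR.const_mul (accel m q s)).const_add _

/-- The first variations with respect to the starting radius. -/
theorem HasRadialMotions.variations (hM : HasRadialMotions m q) (hm : 0 < m) (hqm : q ^ 2 ≤ m ^ 2)
    {t s : ℝ} (hw : (t, s) ∈ exteriorDomain m q) :
    HasDerivAt (fun t => fderiv ℝ (extRadius m q) (t, s) (0, 1))
      (fderiv ℝ (extVelocity m q) (t, s) (0, 1)) t ∧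
    HasDerivAt (fun t => fderiv ℝ (extVelocity m q) (t, s) (0, 1))
      (dAccel m q s * energy m q s (extRadius m q (t, s)) + accel m q s *
        (dEnergy m q s (extRadius m q (t, s)) + accel m q s *
          fderiv ℝ (extRadius m q) (t, s) (0, 1))
        - ddD m q (extRadius m q (t, s)) * fderiv ℝ (extRadius m q) (t, s) (0, 1) / 2) t ∧
    HasDerivAt (fun t => fderiv ℝ (extTime m q) (t, s) (0, 1))
      (((dEnergy m q s (extRadius m q (t, s)) + accel m q s *
          fderiv ℝ (extRadius m q) (t, s) (0, 1)) * D m q (extRadius m q (t, s))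
        - energy m q s (extRadius m q (t, s)) * (dD m q (extRadius m q (t, s)) *
          fderiv ℝ (extRadius m q) (t, s) (0, 1))) / D m q (extRadius m q (t, s)) ^ 2) t ∧
    2 * extVelocity m q (t, s) * fderiv ℝ (extVelocity m q) (t, s) (0, 1) =
      2 * energy m q s (extRadius m q (t, s)) *
        (dEnergy m q s (extRadius m q (t, s)) + accel m q s *
          fderiv ℝ (extRadius m q) (t, s) (0, 1))
        - dD m q (extRadius m q (t, s)) * fderiv ℝ (extRadius m q) (t, s) (0, 1) := by
  have hs := exteriorDomain_snd hw
  have hR0 := extRadius_gt hm hqm hw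
  have hr0 : extRadius m q (t, s) ≠ 0 := by linarith [m_le_rPlus m q]
  have h4 : s ≠ 0 := by simp only at hs; linarith [m_le_rPlus m q]
  have hevent : ∀ᶠ p in 𝓝 (t, s), p ∈ exteriorDomain m q :=
    (isOpen_exteriorDomain hm hqm).mem_nhds hw
  have hR : HasDerivAt (fun s => extRadius m q (t, s)) (fderiv ℝ (extRadius m q) (t, s) (0, 1)) s :=
    hasDerivAt_snd (differentiableAt_extRadius hm hqm hw)
  have hV : HasDerivAt (fun s => extVelocity m q (t, s))
      (fderiv ℝ (extVelocity m q) (t, s) (0, 1)) s :=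
    hasDerivAt_snd ((contDiffAt_extVelocity hm hqm hw).differentiableAt (by simp))
  have hE := hasDerivAt_energy_snd hm hqm hs hR
  have hDR : HasDerivAt (fun s => D m q (extRadius m q (t, s)))
      (dD m q (extRadius m q (t, s)) * fderiv ℝ (extRadius m q) (t, s) (0, 1)) s :=
    HasDerivAt.comp (h₂ := D m q) s (hasDerivAt_D m q hr0) hR
  have hdDR : HasDerivAt (fun s => dD m q (extRadius m q (t, s)))
      (ddD m q (extRadius m q (t, s)) * fderiv ℝ (extRadius m q) (t, s) (0, 1)) s :=
    HasDerivAt.comp (h₂ := dD m q) s (hasDerivAt_dD m q hr0) hR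
  refine ⟨?_, ?_, ?_, ?_⟩
  · refine hasDerivAt_fderiv_snd (g := extVelocity m q) (contDiffAt_extRadius hm hqm hw 2) ?_ hV
    filter_upwards [hevent] with p hp using (hM.equations hm hqm hp).1
  · refine hasDerivAt_fderiv_snd (g := fun w => accel m q w.2 * energy m q w.2 (extRadius m q w)
      - dD m q (extRadius m q w) / 2) (contDiffAt_extVelocity hm hqm hw) ?_ ?_
    · filter_upwards [hevent] with p hp using (hM.equations hm hqm hp).2.1
    · exact ((hasDerivAt_accel h4 (D_pos hm hqm hs)).mul hE).sub (hdDR.div_const 2)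
  · refine hasDerivAt_fderiv_snd (g := fun w => energy m q w.2 (extRadius m q w)
      / D m q (extRadius m q w)) (contDiffAt_extTime hm hqm hw 2) ?_ ?_
    · filter_upwards [hevent] with p hp using hasDerivAt_extTime hm hqm (t := p.1) (s := p.2) hp
    · exact hE.div hDR (D_pos hm hqm hR0).ne'
  · have h5 := (hV.pow 2).congr_of_eventuallyEq
      (f₁ := fun s => energy m q s (extRadius m q (t, s)) ^ 2
      - D m q (extRadius m q (t, s))) (by
        filter_upwards [snd_mem_nhds hm hqm hw] with s' hs'
        exact ((hM.equations hm hqm hs').2.2).symm)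
    have h6 := h5.unique ((hE.pow 2).sub hDR)
    push_cast at h6
    simp only [pow_one] at h6
    exact h6

/-- The deviation satisfies a second-order linear equation along each curve; the inhomogeneity is
the derivative of the acceleration with respect to the starting radius. -/
theorem HasRadialMotions.hasDerivAt_deviation (hM : HasRadialMotions m q) (hm : 0 < m)
    (hqm : q ^ 2 ≤ m ^ 2) {t s : ℝ} (hw : (t, s) ∈ exteriorDomain m q) :
    HasDerivAt (fun t => deviation m q (t, s)) (deviationRate m q (t, s)) t ∧
    HasDerivAt (fun t => deviationRate m q (t, s))
      ((accel m q s ^ 2 - ddD m q (extRadius m q (t, s)) / 2) * deviation m q (t, s)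
        + dAccel m q s) t := by
  obtain ⟨hη, hν, hT, hsq⟩ := hM.variations hm hqm hw
  obtain ⟨hR, hV, he⟩ := hM.equations hm hqm hw
  simp only at hR hV he
  have hR0 := extRadius_gt hm hqm hw
  have hr0 : extRadius m q (t, s) ≠ 0 := by linarith [m_le_rPlus m q]
  have hDpos := D_pos hm hqm hR0
  have hE := hasDerivAt_energy_fst (m := m) (q := q) (s := s) hR
  have hDR : HasDerivAt (fun t => D m q (extRadius m q (t, s)))
      (dD m q (extRadius m q (t, s)) * extVelocity m q (t, s)) t :=
    HasDerivAt.comp (h₂ := D m q) t (hasDerivAt_D m q hr0) hR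
  have hdDR : HasDerivAt (fun t => dD m q (extRadius m q (t, s)))
      (ddD m q (extRadius m q (t, s)) * extVelocity m q (t, s)) t :=
    HasDerivAt.comp (h₂ := dD m q) t (hasDerivAt_dD m q hr0) hR
  have hEs : HasDerivAt (fun t => dEnergy m q s (extRadius m q (t, s)))
      (dAccel m q s * extVelocity m q (t, s)) t := (hR.const_mul _).const_add _
  have hfst := fderiv_extTime_fst hm hqm hw
  simp only at hfst
  constructor
  · have h1 : HasDerivAt (fun t => energy m q s (extRadius m q (t, s)) / D m q
      (extRadius m q (t, s)) *
        fderiv ℝ (extRadius m q) (t, s) (0, 1)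
        - extVelocity m q (t, s) * fderiv ℝ (extTime m q) (t, s) (0, 1)) _ t :=
      (((hE.div hDR hDpos.ne').mul hη).sub (hV.mul hT))
    refine (h1.congr_of_eventuallyEq ?_).congr_deriv ?_
    · filter_upwards [fst_mem_nhds hm hqm hw] with t' ht'
      rw [deviation, fderiv_extTime_fst hm hqm ht']
      rfl
    · simp only [deviationRate]
      have := hDpos.ne'
      simp only [Pi.div_apply]
      field_simp
      ring
  · have h1 := ((((hE.div hDR hDpos.ne').mul hν).sub
      (((hE.const_mul (accel m q s)).sub (hdDR.div_const 2)).mul hT)).sub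
      ((hV.mul hEs).div hDR hDpos.ne'))
    refine HasDerivAt.congr_deriv h1 ?_
    rw [deviation, hfst]
    change _ = (accel m q s ^ 2 - ddD m q (extRadius m q (t, s)) / 2) *
      (energy m q s (extRadius m q (t, s)) / D m q (extRadius m q (t, s)) *
        fderiv ℝ (extRadius m q) (t, s) (0, 1) -
        extVelocity m q (t, s) * fderiv ℝ (extTime m q) (t, s) (0, 1)) + dAccel m q s
    simp only [Pi.div_apply, Pi.mul_apply, Pi.sub_apply]
    generalize fderiv ℝ (extRadius m q) (t, s) (0, 1) = η at *
    generalize fderiv ℝ (extVelocity m q) (t, s) (0, 1) = ν at *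
    generalize fderiv ℝ (extTime m q) (t, s) (0, 1) = τ at *
    generalize extVelocity m q (t, s) = V at *
    generalize energy m q s (extRadius m q (t, s)) = E at *
    generalize dEnergy m q s (extRadius m q (t, s)) = E' at *
    generalize D m q (extRadius m q (t, s)) = d at *
    generalize dD m q (extRadius m q (t, s)) = d' at *
    generalize ddD m q (extRadius m q (t, s)) = d'' at *
    have hd := hDpos.ne'
    field_simp
    linear_combination (accel m q s * d - E * d') * hsq
      + (2 * d' * E' - 2 * d * dAccel m q s) * he

theorem deviation_zero (hm : 0 < m) (hqm : q ^ 2 ≤ m ^ 2) (hM : HasRadialMotions m q) {s : ℝ}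
    (hs : rPlus m q < s) :
    extVelocity m q (0, s) = 0 ∧ deviation m q (0, s) = 1 / √(D m q s) ∧
      deviationRate m q (0, s) = 0 := by
  have hw := mem_exteriorDomain_zero (m := m) (q := q) hs
  have hev : ∀ᶠ s' in 𝓝 s, rPlus m q < s' := lt_mem_nhds hs
  have hV0 : ∀ s', rPlus m q < s' → extVelocity m q (0, s') = 0 := fun s' hs' => by
    obtain ⟨r, v, h, h0, h1, h2⟩ := hM.velocity_eq hm hqm hs'
    rw [(h2 0 (mem_exteriorDomain_zero hs')).2, h1]
  have h1 : fderiv ℝ (extRadius m q) (0, s) (0, 1) = 1 := by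
    refine (hasDerivAt_snd (differentiableAt_extRadius hm hqm hw)).unique
      ((hasDerivAt_id s).congr_of_eventuallyEq ?_)
    filter_upwards [hev] with s' hs' using extRadius_zero hm hqm hs'
  have h2 : fderiv ℝ (extTime m q) (0, s) (0, 1) = 0 := by
    refine (hasDerivAt_snd ((contDiffAt_extTime hm hqm hw 1).differentiableAt (by simp))).unique
      ((hasDerivAt_const s (0 : ℝ)).congr_of_eventuallyEq ?_)
    filter_upwards [hev] with s' hs' using extTime_zero hm hqm hs'
  have h3 : fderiv ℝ (extVelocity m q) (0, s) (0, 1) = 0 := by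
    refine (hasDerivAt_snd ((contDiffAt_extVelocity hm hqm hw).differentiableAt (by simp))).unique
      ((hasDerivAt_const s (0 : ℝ)).congr_of_eventuallyEq ?_)
    filter_upwards [hev] with s' hs' using hV0 s' hs'
  refine ⟨hV0 s hs, ?_, ?_⟩
  · have hD := D_pos hm hqm hs
    have h5 := Real.sq_sqrt hD.le
    have h6 := Real.sqrt_pos.2 hD
    have h4 : s ≠ 0 := by linarith [m_le_rPlus m q]
    have h7 : energy m q s s = √(D m q s) := by
      rw [energy, accel]
      field_simp
      ring
    rw [deviation, h1, h2, fderiv_extTime_fst hm hqm hw, extRadius_zero hm hqm hs, h7, mul_zero,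
      sub_zero, mul_one, div_eq_div_iff hD.ne' h6.ne']
    linear_combination h5
  · simp only [deviationRate, h2, h3, hV0 s hs]
    simp

end

/-! ### Positivity of the deviation -/

/-- The deviation `W` along the outward continuation of the radial motion `R`, on `[0, b]`, with the
initial values at the time symmetric slice. -/
structure DeviationMotion (m q s b : ℝ) (R V W W' : ℝ → ℝ) : Prop where
  radius_gt : ∀ t ∈ Set.Icc 0 b, rPlus m q < R t
  deriv_R : ∀ t ∈ Set.Icc 0 b, HasDerivAt R (V t) t
  deriv_V : ∀ t ∈ Set.Icc 0 b,
    HasDerivAt V (accel m q s * energy m q s (R t) - dD m q (R t) / 2) t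
  deriv_W : ∀ t ∈ Set.Icc 0 b, HasDerivAt W (W' t) t
  deriv_W' : ∀ t ∈ Set.Icc 0 b,
    HasDerivAt W' ((accel m q s ^ 2 - ddD m q (R t) / 2) * W t + dAccel m q s) t
  R_zero : R 0 = s
  V_zero : V 0 = 0
  W_zero : W 0 = 1 / √(D m q s)
  W'_zero : W' 0 = 0

namespace DeviationMotion

variable {m q s b : ℝ} {R V W W' : ℝ → ℝ}

theorem mono (h : DeviationMotion m q s b R V W W') {b' : ℝ} (hb : b' ≤ b) :
    DeviationMotion m q s b' R V W W' := by
  have hsub : ∀ t ∈ Set.Icc 0 b', t ∈ Set.Icc 0 b := fun t ht => ⟨ht.1, ht.2.trans hb⟩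
  exact ⟨fun t ht => h.radius_gt t (hsub t ht), fun t ht => h.deriv_R t (hsub t ht),
    fun t ht => h.deriv_V t (hsub t ht), fun t ht => h.deriv_W t (hsub t ht),
    fun t ht => h.deriv_W' t (hsub t ht), h.R_zero, h.V_zero, h.W_zero, h.W'_zero⟩

theorem ddD_nonpos {r : ℝ} (hr : 0 < r) (h : 3 * q ^ 2 ≤ 2 * m * r) : ddD m q r ≤ 0 := by
  have e : ddD m q r = -(2 * (2 * m * r - 3 * q ^ 2) / r ^ 4) := by
    rw [ddD]
    field_simp
    ring
  rw [e]
  have : 0 ≤ 2 * (2 * m * r - 3 * q ^ 2) / r ^ 4 := div_nonneg (by linarith) (by positivity)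
  linarith

/-- Where `D'' ≤ 0`, the deviation is convex as long as it is at least its initial value. -/
theorem pos_of_radius_ge (h : DeviationMotion m q s b R V W W') (hm : 0 < m) (hqm : q ^ 2 ≤ m ^ 2)
    (hs : rPlus m q < s) (hb : 0 ≤ b) (h3 : ∀ t ∈ Set.Icc 0 b, 3 * q ^ 2 ≤ 2 * m * R t) : 0 < W
      b := by
  have hmr := m_le_rPlus m q
  have hD := D_pos hm hqm hs
  have hsp := Real.sqrt_pos.2 hD
  have hs0 : 0 < s := by linarith
  have hW0 : 0 < 1 / √(D m q s) := by positivity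
  have hβ : 0 < accel m q s ^ 2 * (1 / √(D m q s)) + dAccel m q s := by
    have e : accel m q s ^ 2 * (1 / √(D m q s)) + dAccel m q s =
        2 * (s - m) / (√(D m q s) * s ^ 3) := by
      have h4 : √(D m q s) ^ 2 * s ^ 2 = s ^ 2 - 2 * m * s + q ^ 2 := by
        rw [Real.sq_sqrt hD.le, D]; field_simp
      rw [accel, dAccel]
      field_simp
      linear_combination 2 * h4
    rw [e]
    have : 0 < s - m := by linarith
    positivity
  have h5 := le_of_second_deriv_pos (f₀ := 1 / √(D m q s)) h.W_zero.ge h.W'_zero.ge h.deriv_W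
    h.deriv_W' (fun t ht hWt => by
      have h6 := ddD_nonpos (by linarith [h.radius_gt t ht] : 0 < R t) (h3 t ht)
      have h7 : accel m q s ^ 2 * (1 / √(D m q s)) ≤
          (accel m q s ^ 2 - ddD m q (R t) / 2) * W t :=
        mul_le_mul (by linarith) hWt hW0.le (by nlinarith [sq_nonneg (accel m q s)])
      linarith) b ⟨hb, le_rfl⟩
  exact hW0.trans_le h5

/-- The equation for the deviation is the linearization of `V' = β E - D' / 2`, with a constant
source. The Wronskian of `W` with the solution `V` of the homogeneous equation integrates it once.
-/
theorem first_integral (h : DeviationMotion m q s b R V W W') (hm : 0 < m) {t : ℝ}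
    (ht : t ∈ Set.Icc 0 b) :
    W' t * V t - W t * (accel m q s * energy m q s (R t) - dD m q (R t) / 2) =
      dAccel m q s * (R t - s)
        - 1 / √(D m q s) * (accel m q s * energy m q s s - dD m q s / 2) := by
  have hd : ∀ t ∈ Set.Icc 0 b, HasDerivAt (fun t => W' t * V t
      - W t * (accel m q s * energy m q s (R t) - dD m q (R t) / 2) - dAccel m q s * (R t - s)) 0
        t := by
    intro t ht
    have hr0 : R t ≠ 0 := by linarith [h.radius_gt t ht, m_le_rPlus m q]
    have hdD : HasDerivAt (fun t => dD m q (R t)) (ddD m q (R t) * V t) t :=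
      HasDerivAt.comp (h₂ := dD m q) t (hasDerivAt_dD m q hr0) (h.deriv_R t ht)
    refine ((((h.deriv_W' t ht).mul (h.deriv_V t ht)).sub ((h.deriv_W t ht).mul
      (((hasDerivAt_energy_fst (h.deriv_R t ht)).const_mul (accel m q s)).sub
        (hdD.div_const 2)))).sub (((h.deriv_R t ht).sub_const s).const_mul _)).congr_deriv ?_
    simp only [Pi.sub_apply]
    ring
  have h1 := constant_of_has_deriv_right_zero (a := 0) (b := b)
    (fun t ht => (hd t ht).continuousAt.continuousWithinAt)
    (fun t ht => (hd t ⟨ht.1, ht.2.le⟩).hasDerivWithinAt) t ht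
  simp only [h.R_zero, h.V_zero, h.W_zero] at h1
  linear_combination h1

/-- The extremal case, for an infalling curve whose starting radius is more than `29 m / 20`. As
long as the radius is at least `13 m / 10`, the deviation is convex. After that, the first integral
shows that `W / (-V)` increases. -/
theorem pos_of_extremal (h : DeviationMotion m q s b R V W W') (hm : 0 < m) (hq : q ^ 2 = m ^ 2)
    (hs1 : 29 / 20 * m < s) (hs2 : s < 3 / 2 * m) (hb : 0 ≤ b)
    (hV : ∀ t ∈ Set.Ioc 0 b, V t < 0) : 0 < W b := by
  have hs0 : 0 < s := by linarith
  have hrp : rPlus m q = m := by simp [rPlus, hq]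
  have hsm : 0 < s - m := by linarith
  have hD : D m q s = ((s - m) / s) ^ 2 := by
    rw [D, hq]
    field_simp
    ring
  have hsq : √(D m q s) = (s - m) / s := by
    rw [hD, Real.sqrt_sq (by positivity)]
  have hβ : accel m q s = 2 * (s - m) / s ^ 2 := by
    rw [accel, hsq]
    field_simp
  have hE : energy m q s s = (s - m) / s := by
    rw [energy, hβ, hsq]
    field_simp
    ring
  have hdA : dAccel m q s = 2 * (2 * m - s) / s ^ 3 := by
    rw [dAccel, hsq, hq]
    field_simp
    ring
  have hdA0 : 0 < dAccel m q s := by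
    rw [hdA]
    have : 0 < 2 * m - s := by linarith
    positivity
  have hW0 : 0 < 1 / √(D m q s) := by rw [hsq]; positivity
  have phase1 : ∀ t ∈ Set.Icc 0 b, (∀ t' ∈ Set.Icc 0 t, 13 / 10 * m ≤ R t') →
      0 < W t := by
    intro t ht hR
    have h' := h.mono ht.2
    refine hW0.trans_le (le_of_second_deriv_pos (f₀ := 1 / √(D m q s)) h'.W_zero.ge h'.W'_zero.ge
      h'.deriv_W h'.deriv_W' (fun t' ht' hWt => ?_) t ⟨ht.1, le_rfl⟩)
    have hr := hR t' ht'
    have hr0 : 0 < R t' := by linarith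
    -- `m β ≥ 2 / 5` because `29 m / 20 < s < 3 m / 2`;
    -- `m² D'' / 2 ≤ 4 / 25` for `r ≥ 13 m / 10`
    have h1 : (2 / 5) ^ 2 ≤ (m * accel m q s) ^ 2 := by
      refine pow_le_pow_left₀ (by norm_num) ?_ 2
      rw [hβ, mul_div_assoc', le_div_iff₀ (by positivity)]
      nlinarith
    have h2 : -(2 / 5) ^ 2 ≤ m ^ 2 * (-(ddD m q (R t') / 2)) := by
      have e : m ^ 2 * (-(ddD m q (R t') / 2)) = m ^ 3 * (2 * R t' - 3 * m) / R t' ^ 4 := by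
        rw [ddD, hq]
        field_simp
        ring
      rw [e, le_div_iff₀ (by positivity)]
      have h4 : (13 / 10 * m) ^ 4 ≤ R t' ^ 4 := pow_le_pow_left₀ (by positivity) hr 4
      have h5 : m ^ 3 * (13 / 10 * m) ≤ m ^ 3 * R t' :=
        mul_le_mul_of_nonneg_left hr (by positivity)
      have h6 : 0 < m ^ 4 := by positivity
      linarith
    have h3 : 0 ≤ accel m q s ^ 2 - ddD m q (R t') / 2 := by
      have : 0 ≤ m ^ 2 * (accel m q s ^ 2 - ddD m q (R t') / 2) := by linarith
      exact nonneg_of_mul_nonneg_right this (by positivity)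
    have := mul_nonneg h3 (hW0.le.trans hWt)
    linarith
  have hRc : ContinuousOn R (Set.Icc 0 b) := fun t ht =>
    (h.deriv_R t ht).continuousAt.continuousWithinAt
  have hRanti : AntitoneOn R (Set.Icc 0 b) := by
    refine antitoneOn_of_deriv_nonpos (convex_Icc _ _) hRc
      (fun t ht => (h.deriv_R t (interior_subset ht)).differentiableAt.differentiableWithinAt)
      fun t ht => ?_
    rw [(h.deriv_R t (interior_subset ht)).deriv]
    rw [interior_Icc] at ht
    exact (hV t ⟨ht.1, ht.2.le⟩).le
  rcases le_or_gt (13 / 10 * m) (R b) with hRb | hRb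
  · exact phase1 b ⟨hb, le_rfl⟩ fun t ht => hRb.trans (hRanti ht ⟨hb, le_rfl⟩ ht.2)
  obtain ⟨t₁, ht₁, hRt₁⟩ := intermediate_value_Icc' hb hRc
    (⟨hRb.le, by rw [h.R_zero]; linarith⟩ : 13 / 10 * m ∈ Set.Icc (R b) (R 0))
  have ht₁0 : 0 < t₁ := by
    rcases eq_or_lt_of_le ht₁.1 with h1 | h1
    · rw [← h1, h.R_zero] at hRt₁
      linarith
    · exact h1
  have hWt₁ : 0 < W t₁ := phase1 t₁ ht₁ fun t ht =>
    hRt₁.ge.trans (hRanti ⟨ht.1, ht.2.trans ht₁.2⟩ ht₁ ht.2)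
  -- by the first integral, the numerator of the derivative of `W / (-V)` is
  -- `(2 (2 m - s) (s - r) - s (3 m - 2 s)) / s³`, which is nonnegative for `r ≤ 13 m / 10` and
  -- `s ≥ 29 m / 20`
  have hqd : ∀ t ∈ Set.Icc t₁ b, HasDerivAt (fun t => W t / -V t)
      ((W' t * -V t - W t * -(accel m q s * energy m q s (R t) - dD m q (R t) / 2)) / (-V t) ^ 2)
        t := by
    intro t ht
    have ht' : t ∈ Set.Icc 0 b := ⟨ht₁0.le.trans ht.1, ht.2⟩
    exact (h.deriv_W t ht').div (h.deriv_V t ht').neg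
      (neg_ne_zero.2 (hV t ⟨ht₁0.trans_le ht.1, ht.2⟩).ne)
  have hqmono : MonotoneOn (fun t => W t / -V t) (Set.Icc t₁ b) := by
    refine monotoneOn_of_deriv_nonneg (convex_Icc _ _)
      (fun t ht => (hqd t ht).continuousAt.continuousWithinAt)
      (fun t ht => (hqd t (interior_subset ht)).differentiableAt.differentiableWithinAt)
      fun t ht => ?_
    have ht1 := interior_subset ht
    have ht' : t ∈ Set.Icc 0 b := ⟨ht₁0.le.trans ht1.1, ht1.2⟩
    rw [(hqd t ht1).deriv]
    refine div_nonneg ?_ (sq_nonneg _)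
    have h1 := h.first_integral hm ht'
    have h2 : R t ≤ 13 / 10 * m := hRt₁ ▸ hRanti ht₁ ht' ht1.1
    have h3 : dAccel m q s * (R t - s)
        - 1 / √(D m q s) * (accel m q s * energy m q s s - dD m q s / 2) =
        -((2 * (2 * m - s) * (s - R t) - s * (3 * m - 2 * s)) / s ^ 3) := by
      rw [hdA, hsq, hβ, hE, dD, hq]
      field_simp
      ring
    have h4 : 0 ≤ (2 * (2 * m - s) * (s - R t) - s * (3 * m - 2 * s)) / s ^ 3 := by
      refine div_nonneg ?_ (by positivity)
      have h5 : (2 * m - s) * (s - 13 / 10 * m) ≤ (2 * m - s) * (s - R t) :=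
        mul_le_mul_of_nonneg_left (by linarith) (by linarith)
      have h6 : 0 ≤ m * (s - 29 / 20 * m) := mul_nonneg hm.le (by linarith)
      nlinarith
    linarith
  have h1 := hqmono ⟨le_rfl, ht₁.2⟩ ⟨ht₁.2, le_rfl⟩ ht₁.2
  have hVb : 0 < -V b := neg_pos.2 (hV b ⟨ht₁0.trans_le ht₁.2, le_rfl⟩)
  have hVt : 0 < -V t₁ := neg_pos.2 (hV t₁ ⟨ht₁0, ht₁.2⟩)
  have h2 : 0 < W b / -V b := (div_pos hWt₁ hVt).trans_le h1
  exact (div_pos_iff_of_pos_right hVb).1 h2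

end DeviationMotion

section

variable {m q : ℝ}

/-- The deviation along a curve of the congruence, towards the future and towards the past. -/
theorem HasRadialMotions.deviationMotion (hM : HasRadialMotions m q) (hm : 0 < m)
    (hqm : q ^ 2 ≤ m ^ 2) {t s : ℝ} (ht : (t, s) ∈ exteriorDomain m q) :
    (0 ≤ t → DeviationMotion m q s t (fun t => extRadius m q (t, s))
      (fun t => extVelocity m q (t, s))
      (fun t => deviation m q (t, s)) (fun t => deviationRate m q (t, s))) ∧
    (t ≤ 0 → DeviationMotion m q s (-t) (fun t => extRadius m q (-t, s))
      (fun t => -extVelocity m q (-t, s))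
      (fun t => deviation m q (-t, s)) (fun t => -deviationRate m q (-t, s))) := by
  have hs := exteriorDomain_snd ht
  obtain ⟨z1, z2, z3⟩ := deviation_zero hm hqm hM hs
  have hR0 := extRadius_zero hm hqm hs
  simp only at z1 z2 z3 hR0
  constructor
  · intro h0
    have hmem : ∀ t' ∈ Set.Icc 0 t, (t', s) ∈ exteriorDomain m q := fun t' ht' =>
      exteriorDomain_of_between hm hqm ht (by rwa [Set.uIcc_of_le h0])
    exact ⟨fun t' h' => extRadius_gt hm hqm (hmem t' h'),
      fun t' h' => (hM.equations hm hqm (hmem t' h')).1,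
      fun t' h' => (hM.equations hm hqm (hmem t' h')).2.1,
      fun t' h' => (hM.hasDerivAt_deviation hm hqm (hmem t' h')).1,
      fun t' h' => (hM.hasDerivAt_deviation hm hqm (hmem t' h')).2, hR0, z1, z2, z3⟩
  · intro h0
    have hmem : ∀ t' ∈ Set.Icc 0 (-t), (-t', s) ∈ exteriorDomain m q := fun t' ht' =>
      exteriorDomain_of_between hm hqm ht (by
        rw [Set.uIcc_of_ge h0]; exact ⟨by linarith [ht'.2], by linarith [ht'.1]⟩)
    refine ⟨fun t' h' => extRadius_gt hm hqm (hmem t' h'), fun t' h' => ?_, fun t' h' => ?_,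
      fun t' h' => ?_, fun t' h' => ?_, ?_, ?_, ?_, ?_⟩
    · exact (HasDerivAt.comp (h₂ := fun t => extRadius m q (t, s)) t'
        (hM.equations hm hqm (hmem t' h')).1 (hasDerivAt_neg t')).congr_deriv (by ring)
    · exact (HasDerivAt.comp (h₂ := fun t => extVelocity m q (t, s)) t'
        (hM.equations hm hqm (hmem t' h')).2.1 (hasDerivAt_neg t')).neg.congr_deriv (by ring)
    · exact (HasDerivAt.comp (h₂ := fun t => deviation m q (t, s)) t'
        (hM.hasDerivAt_deviation hm hqm (hmem t' h')).1 (hasDerivAt_neg t')).congr_deriv (by ring)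
    · exact (HasDerivAt.comp (h₂ := fun t => deviationRate m q (t, s)) t'
        (hM.hasDerivAt_deviation hm hqm (hmem t' h')).2 (hasDerivAt_neg t')).neg.congr_deriv
          (by ring)
    all_goals simp [hR0, z1, z2, z3]

theorem extVelocity_eq (hm : 0 < m) (hqm : q ^ 2 ≤ m ^ 2) {t s : ℝ}
    (h : (t, s) ∈ exteriorDomain m q) : extVelocity m q (t, s) =
      2 * initialForce m q s * chartZ m q (t, s) * chartSpeed m q (chartZ m q (t, s)) s := by
  refine (hasDerivAt_fst (differentiableAt_extRadius hm hqm h)).unique ?_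
  have h1 := (((hasDerivAt_chartZ hm hqm h).pow 2).const_mul (initialForce m q s)).const_add s
  refine HasDerivAt.congr_deriv h1 ?_
  push_cast
  ring

/-- The parameter `z` has the sign of the proper time. -/
theorem chartZ_sign (hm : 0 < m) (hqm : q ^ 2 ≤ m ^ 2) {t s : ℝ} (h : (t, s) ∈ exteriorDomain m q) :
    (0 < t → 0 < chartZ m q (t, s)) ∧ (t < 0 → chartZ m q (t, s) < 0) := by
  have hs := exteriorDomain_snd h
  have h0 := chartZ_zero hm hqm hs
  have hmem : ∀ t' ∈ Set.uIcc 0 t, (t', s) ∈ exteriorDomain m q := fun t' ht' =>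
    exteriorDomain_of_between hm hqm h ht'
  have hmono : StrictMonoOn (fun t => chartZ m q (t, s)) (Set.uIcc 0 t) := by
    refine strictMonoOn_of_deriv_pos (convex_uIcc 0 t) (fun t' ht' =>
      (hasDerivAt_chartZ hm hqm (hmem t' ht')).continuousAt.continuousWithinAt) fun t' ht' => ?_
    have h1 := hmem t' (interior_subset ht')
    rw [(hasDerivAt_chartZ hm hqm h1).deriv]
    exact chartSpeed_pos hm hqm (chartZ_mem hm hqm h1).1
  constructor
  · intro ht
    have := hmono Set.left_mem_uIcc Set.right_mem_uIcc ht
    simpa only [h0] using this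
  · intro ht
    have := hmono Set.right_mem_uIcc Set.left_mem_uIcc ht
    simpa only [h0] using this

/-- The deviation is positive in the exterior region if `q² ≤ 8 m² / 9`, and in the extremal case if
the starting radius is large enough. The condition `3 q² ≤ 2 m r` for `D'' ≤ 0` holds outside the
event horizon in the first case, and on the curves with `s ≥ r_⊛ = 3 m / 2` in the second. -/
theorem HasRadialMotions.deviation_pos (hM : HasRadialMotions m q) (hm : 0 < m)
    (hqm : q ^ 2 ≤ m ^ 2) {t s : ℝ} (h : (t, s) ∈ exteriorDomain m q)
    (hc : q ^ 2 ≤ 8 / 9 * m ^ 2 ∨ q ^ 2 = m ^ 2 ∧ 29 / 20 * m < s) : 0 < deviation m q (t, s) := by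
  have hs : rPlus m q < s := exteriorDomain_snd h
  obtain ⟨hfut, hpast⟩ := hM.deviationMotion hm hqm h
  have hrc := rCrit_ge hqm
  by_cases hmid : q ^ 2 = m ^ 2 ∧ s < 3 / 2 * m
  · obtain ⟨hq, hs2⟩ := hmid
    have hs1 : 29 / 20 * m < s := by
      rcases hc with h1 | h1
      · nlinarith
      · exact h1.2
    have hforce := initialForce_neg hm hqm hs (by linarith)
    have hvel : ∀ t', (t', s) ∈ exteriorDomain m q → (0 < t' → extVelocity m q (t', s) < 0) ∧
        (t' < 0 → 0 < extVelocity m q (t', s)) := fun t' ht' => by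
      have h1 := extVelocity_eq hm hqm ht'
      have h2 := chartSpeed_pos hm hqm (chartZ_mem hm hqm ht').1
      obtain ⟨h3, h4⟩ := chartZ_sign hm hqm ht'
      simp only at h2
      rw [h1]
      exact ⟨fun h0 => mul_neg_of_neg_of_pos (mul_neg_of_neg_of_pos (by linarith) (h3 h0)) h2,
        fun h0 => mul_pos (mul_pos_of_neg_of_neg (by linarith) (h4 h0)) h2⟩
    rcases le_total 0 t with h0 | h0
    · refine (hfut h0).pos_of_extremal hm hq hs1 hs2 h0 fun t' ht' => ?_
      exact (hvel t' (exteriorDomain_of_between hm hqm h (by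
        rw [Set.uIcc_of_le h0]; exact ⟨ht'.1.le, ht'.2⟩))).1 ht'.1
    · have h5 := (hpast h0).pos_of_extremal hm hq hs1 hs2 (by linarith) fun t' ht' => by
        have := (hvel (-t') (exteriorDomain_of_between hm hqm h (by
          rw [Set.uIcc_of_ge h0]; exact ⟨by linarith [ht'.2], by linarith [ht'.1]⟩))).2
          (by linarith [ht'.1])
        linarith
      simpa using h5
  · have key : ∀ t', (t', s) ∈ exteriorDomain m q → 3 * q ^ 2 ≤ 2 * m * extRadius m q (t', s) := by
      intro t' ht'
      have hR := extRadius_gt hm hqm ht'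
      rcases hc with h1 | ⟨h1, _⟩
      · have h2 : m / 3 ≤ √(m ^ 2 - q ^ 2) := by
          apply Real.le_sqrt_of_sq_le
          linarith
        have h3 : 4 / 3 * m ≤ extRadius m q (t', s) := by
          rw [rPlus] at hR
          linarith
        have := mul_le_mul_of_nonneg_left h3 hm.le
        linarith
      · have h2 : 3 / 2 * m ≤ s := by
          by_contra hcon
          exact hmid ⟨h1, not_le.1 hcon⟩
        have hcrit : rCrit m q = 3 / 2 * m := by
          have : 25 * m ^ 2 - 24 * q ^ 2 = m ^ 2 := by rw [h1]; ring
          rw [rCrit, this, Real.sqrt_sq hm.le]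
          ring
        have h3 : s ≤ extRadius m q (t', s) := by
          have := mul_nonneg (initialForce_nonneg hm hqm hs (by rw [hcrit]; exact h2))
            (sq_nonneg (chartZ m q (t', s)))
          simp only [extRadius, chartRadius]
          linarith
        have := mul_le_mul_of_nonneg_left (h2.trans h3) hm.le
        rw [h1]
        linarith
    rcases le_total 0 t with h0 | h0
    · refine (hfut h0).pos_of_radius_ge hm hqm hs h0 fun t' ht' => key t' ?_
      exact exteriorDomain_of_between hm hqm h (by rwa [Set.uIcc_of_le h0])
    · have h5 := (hpast h0).pos_of_radius_ge hm hqm hs (by linarith) fun t' ht' => key (-t') (by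
        refine exteriorDomain_of_between hm hqm h ?_
        rw [Set.uIcc_of_ge h0]; exact ⟨by linarith [ht'.2], by linarith [ht'.1]⟩)
      simpa using h5

end

/-! ### The congruence -/

/-- The bound `T = 1 / (s √D(s))` of conformal proper time for the starting radius `s`. -/
def lifetime (m q s : ℝ) : ℝ := 1 / (s * √(D m q s))

section

variable {m q s : ℝ}

theorem lifetime_pos (hm : 0 < m) (hqm : q ^ 2 ≤ m ^ 2) (hs : rPlus m q < s) :
    0 < lifetime m q s := by
  have h1 := m_le_rPlus m q
  have h2 := Real.sqrt_pos.2 (D_pos hm hqm hs)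
  have h5 : 0 < s := by linarith
  unfold lifetime
  positivity

theorem rPlus_lt_rCrit (hm : 0 < m) (hqm : q ^ 2 ≤ m ^ 2) : rPlus m q < rCrit m q := by
  have h0 := Real.sqrt_nonneg (m ^ 2 - q ^ 2)
  have h1 : √(m ^ 2 - q ^ 2) ^ 2 = m ^ 2 - q ^ 2 := Real.sq_sqrt (by linarith)
  have h2 : 4 * √(m ^ 2 - q ^ 2) ≤ √(25 * m ^ 2 - 24 * q ^ 2) :=
    Real.le_sqrt_of_sq_le (by nlinarith)
  unfold rPlus rCrit
  linarith

/-- The curve of the congruence from the radius `s`, as a curve in the quotient parametrized by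
proper time; if it falls in, it meets the event horizon at the ends of its exterior part. -/
theorem exists_baseCurve (hm : 0 < m) (hq : q ≠ 0) (hqm : q ^ 2 ≤ m ^ 2) (hs : rPlus m q < s) :
    ∃ (r : ℝ → ℝ) (x : ℝ → Base m q), IsBaseCurve m q s r x ∧
      (s < rCrit m q → ∃ a b, a < 0 ∧ 0 < b ∧ (∀ t ∈ Set.Ioo a b, (t, s) ∈ exteriorDomain m q) ∧
        r a = rPlus m q ∧ r b = rPlus m q) := by
  rcases lt_or_ge s (rCrit m q) with h | h
  · obtain ⟨r, v, x, -, -, -, hx, -, hab⟩ := exists_baseCurve_of_lt hm hq hqm hs h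
    exact ⟨r, x, hx, fun _ => hab⟩
  · obtain ⟨r, v, x, -, -, -, hx, -⟩ := exists_baseCurve_of_ge hm hqm hs h
    exact ⟨r, x, hx, fun h' => absurd h' h.not_gt⟩

theorem hasRadialMotions (hm : 0 < m) (hq : q ≠ 0) (hqm : q ^ 2 ≤ m ^ 2) :
    HasRadialMotions m q := by
  intro s hs
  rcases lt_or_ge s (rCrit m q) with h | h
  · obtain ⟨r, v, x, h1, h2, h3, -, h4, -⟩ := exists_baseCurve_of_lt hm hq hqm hs h
    exact ⟨r, v, h1, h2, h3, h4⟩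
  · obtain ⟨r, v, x, h1, h2, h3, -, h4, -⟩ := exists_baseCurve_of_ge hm hqm hs h
    exact ⟨r, v, h1, h2, h3, h4⟩

/-- The physical proper time along the curve of the congruence from the radius `s`. -/
def congruenceTime (m q s : ℝ) : ℝ → ℝ := properTime (accel m q s) (lifetime m q s)

/-- The bound `T` and the acceleration `β` match the initial data: at the start `-β E / D = -2 / s`
is the radial component of the 1-form, and `dσ/dτ = 2 / (β T) = s²` is the inverse of the conformal
factor. -/
theorem IsBaseCurve.isCongruenceCurve {r : ℝ → ℝ} {x : ℝ → Base m q} (hx : IsBaseCurve m q s r x)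
    (hM : HasRadialMotions m q) (hm : 0 < m) (hqm : q ^ 2 ≤ m ^ 2) (hs : rPlus m q < s) (ω : S2) :
    IsCongruenceCurve m q s ω (lifetime m q s) (fun τ => (x (congruenceTime m q s τ), ω))
      (congruenceTime m q s) := by
  have hT := lifetime_pos hm hqm hs
  have hβ := accel_pos hm hqm hs
  have hD := D_pos hm hqm hs
  have hD' := Real.sqrt_pos.2 hD
  have hs0 : 0 < s := by linarith [m_le_rPlus m q]
  obtain ⟨R, hR⟩ := exists_axes ω
  refine ⟨hT, fun τ hτ => ?_, properTime_zero _ _, rfl, ?_⟩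
  · obtain ⟨P, a, b, n, U, N, h⟩ := hx.chart (congruenceTime m q s τ)
    exact ⟨P, R, _, _, HasAccelChart.localConformalCurve hβ hτ.1 hτ.2 h hR⟩
  · obtain ⟨ρ, v, hρ, hρ0, hv0, hext⟩ := hM s hs
    have h0 := mem_exteriorDomain_zero (q := q) hs
    have hev := fst_mem_nhds hm hqm h0
    have hd : ∀ᶠ t in 𝓝 (0 : ℝ), HasDerivAt (fun t => extTime m q (t, s))
        ((-√(D m q s) + accel m q s * ρ t) / D m q (ρ t)) t := by
      filter_upwards [hev] with t ht
      have := hasDerivAt_extTime hm hqm ht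
      rwa [hext t ht] at this
    obtain ⟨n, U, N, hN, hN0⟩ := RadialMotion.hasAccelChart_static (x := x) hρ hd
      (by rw [hρ0]; exact hD.ne') (by
        filter_upwards [hev] with t ht
        obtain ⟨h, hx'⟩ := hx.exterior t ht
        exact ⟨by rw [← hext t ht]; exact h, by simp only [← hext t ht]; exact hx'⟩)
    have e0 : properTime (accel m q s) (lifetime m q s) 0 = 0 := properTime_zero _ _
    have hen : (-√(D m q s) + accel m q s * s) / D m q s = 1 / √(D m q s) := by
      have : accel m q s * s = 2 * √(D m q s) := by unfold accel; field_simp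
      rw [this, div_eq_div_iff hD.ne' hD'.ne']
      nlinarith [Real.sq_sqrt hD.le]
    refine ⟨R, _, _, HasAccelChart.localConformalCurve (T := lifetime m q s) (τ := 0) hβ
      (by linarith) hT (by rw [e0]; exact hN) hR, ?_, ?_, ?_, ?_⟩
    · simp [planarCurve, e0, extTime_zero hm hqm hs]
    · simp [planarCurve, e0, hρ0]
    · have h1 := hasDerivAt_planarCurve (Real.pi / 2) 0 hd.self_of_nhds (hρ.deriv_r 0)
      have h2 := hasDerivAt_properTime (τ := 0) hβ (by linarith) hT
      have h3 : HasDerivAt (fun τ => planarCurve (fun t => extTime m q (t, s)) ρ (Real.pi / 2) 0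
        (properTime (accel m q s) (lifetime m q s) τ)) _ 0 := h1.scomp_of_eq 0 h2 e0.symm
      rw [h3.deriv, hρ0, hv0, hen, smul_smul]
      have : initialConformalFactor s * properTimeRate (accel m q s) (lifetime m q s) 0 = 1 := by
        unfold initialConformalFactor properTimeRate lifetime accel
        field_simp
        norm_num
      rw [this, one_smul]
    · simp only [e0, hN0, hρ0, hv0, hen]
      have : accel m q s * (1 / √(D m q s)) = 2 / s := by unfold accel; field_simp
      ext i
      fin_cases i <;> simp [← this]

/-! ### Asymptotics -/

theorem tendsto_congruenceTime (hm : 0 < m) (hqm : q ^ 2 ≤ m ^ 2) (hs : rPlus m q < s) :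
    Tendsto (congruenceTime m q s) (𝓝[<] lifetime m q s) atTop ∧
      Tendsto (congruenceTime m q s) (𝓝[>] (-lifetime m q s)) atBot :=
  ⟨tendsto_properTime_right (accel_pos hm hqm hs) (lifetime_pos hm hqm hs),
    tendsto_properTime_left (accel_pos hm hqm hs) (lifetime_pos hm hqm hs)⟩

theorem IsBaseCurve.hasStaticCoordsAlong {r : ℝ → ℝ} {x : ℝ → Base m q}
    (hx : IsBaseCurve m q s r x) (hext : ∀ t, (t, s) ∈ exteriorDomain m q) (σ : ℝ → ℝ) (ω : S2)
    (l : Filter ℝ) : HasStaticCoordsAlong m q (fun τ => (x (σ τ), ω)) l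
      (fun τ => extTime m q (σ τ, s)) fun τ => extRadius m q (σ τ, s) :=
  Eventually.of_forall fun _ => hx.exterior _ (hext _)

theorem IsBaseCurve.reachesNullInfinity {r : ℝ → ℝ} {x : ℝ → Base m q}
    (hx : IsBaseCurve m q s r x) (hm : 0 < m) (hqm : q ^ 2 ≤ m ^ 2) (hs : rCrit m q < s) (ω : S2) :
    ReachesFutureNullInfinity m q (fun τ => (x (congruenceTime m q s τ), ω))
      (𝓝[<] lifetime m q s) ∧
    ReachesPastNullInfinity m q (fun τ => (x (congruenceTime m q s τ), ω))
      (𝓝[>] (-lifetime m q s)) := by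
  have hs' := (rPlus_lt_rCrit hm hqm).trans hs
  obtain ⟨ρ, v, -, hρ, -, -, -, hr, hext, hv, hv', ht, -⟩ := exists_baseCurve_of_ge hm hqm hs' hs.le
  obtain ⟨ht, hb⟩ := ht hs
  have hr' : ∀ t, extRadius m q (t, s) = ρ t := fun t => hr t (hext t)
  obtain ⟨⟨u, hu⟩, w, hw⟩ :=
    exists_tendsto_null_coordinates hm hqm hs' hρ hext hr' hv hv' ht hb
  obtain ⟨h1, h2⟩ := tendsto_congruenceTime hm hqm hs'
  refine ⟨⟨_, _, hx.hasStaticCoordsAlong hext _ ω _, ?_, ⟨u, hu.comp h1⟩, ω, tendsto_const_nhds⟩,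
    ⟨_, _, hx.hasStaticCoordsAlong hext _ ω _, ?_, ⟨w, hw.comp h2⟩, ω, tendsto_const_nhds⟩⟩
  · simp only [hr']; exact ht.comp h1
  · simp only [hr']; exact hb.comp h2

theorem IsBaseCurve.reachesTimelikeInfinity {r : ℝ → ℝ} {x : ℝ → Base m q}
    (hx : IsBaseCurve m q s r x) (hm : 0 < m) (hqm : q ^ 2 ≤ m ^ 2) (hs : s = rCrit m q) (ω : S2) :
    ReachesFutureTimelikeInfinity m q (fun τ => (x (congruenceTime m q s τ), ω))
      (𝓝[<] lifetime m q s) ∧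
    ReachesPastTimelikeInfinity m q (fun τ => (x (congruenceTime m q s τ), ω))
      (𝓝[>] (-lifetime m q s)) := by
  have hs' : rPlus m q < s := hs ▸ rPlus_lt_rCrit hm hqm
  obtain ⟨ρ, v, -, -, -, -, -, hr, hext, -, -, -, hconst⟩ :=
    exists_baseCurve_of_ge hm hqm hs' hs.ge
  have hr' : ∀ t, extRadius m q (t, s) = s := fun t => (hr t (hext t)).trans (hconst hs t)
  have hD := Real.sqrt_pos.2 (D_pos hm hqm hs')
  have ht := extTime_of_static hm hqm hs' hext hr'
  obtain ⟨h1, h2⟩ := tendsto_congruenceTime hm hqm hs'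
  have h3 := h1.atTop_div_const hD
  have h4 := h2.atBot_div_const hD
  refine ⟨⟨_, _, hx.hasStaticCoordsAlong hext _ ω _, ?_, ?_⟩,
    ⟨_, _, hx.hasStaticCoordsAlong hext _ ω _, ?_, ?_⟩⟩ <;> simp only [hr', ht]
  · exact tendsto_atTop_add_const_right _ (-tortoise m q s) h3
  · exact tendsto_atTop_add_const_right _ _ h3
  · exact tendsto_atBot_add_const_right _ (-tortoise m q s) h4
  · exact tendsto_atBot_add_const_right _ _ h4

theorem mem_domainOfOuterCommunication_iff (p : Base m q) (ω : S2) :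
    ((p, ω) : Spacetime m q) ∈ domainOfOuterCommunication m q ↔ p ∈ baseExterior m q := Iff.rfl

theorem IsBaseCurve.reachesHorizon {r : ℝ → ℝ} {x : ℝ → Base m q}
    (hx : IsBaseCurve m q s r x) (hm : 0 < m) (hqm : q ^ 2 ≤ m ^ 2) (hs : rPlus m q < s)
    {a b : ℝ} (ha : a < 0) (hb : 0 < b) (hext : ∀ t ∈ Set.Ioo a b, (t, s) ∈ exteriorDomain m q)
    (hra : r a = rPlus m q) (hrb : r b = rPlus m q) (ω : S2) :
    ∃ τ₁ ∈ Set.Ioo (-lifetime m q s) 0, ∃ τ₂ ∈ Set.Ioo 0 (lifetime m q s),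
      (∀ τ ∈ Set.Ioo τ₁ τ₂, ((x (congruenceTime m q s τ), ω) : Spacetime m q) ∈
        domainOfOuterCommunication m q) ∧
      RN.radius m q (x (congruenceTime m q s τ₁), ω) = rPlus m q ∧
      RN.radius m q (x (congruenceTime m q s τ₂), ω) = rPlus m q := by
  have hT := lifetime_pos hm hqm hs
  have hβ := accel_pos hm hqm hs
  have hmono : StrictMonoOn (congruenceTime m q s) (Set.Ioo (-lifetime m q s) (lifetime m q s)) :=
    strictMonoOn_properTime hβ
  have hz : (0 : ℝ) ∈ Set.Ioo (-lifetime m q s) (lifetime m q s) := ⟨by linarith, hT⟩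
  have h0 : congruenceTime m q s 0 = 0 := properTime_zero _ _
  obtain ⟨τ₁, h1, rfl⟩ := (bijOn_properTime hβ hT).surjOn (Set.mem_univ a)
  obtain ⟨τ₂, h2, rfl⟩ := (bijOn_properTime hβ hT).surjOn (Set.mem_univ b)
  have h3 : τ₁ < 0 := (hmono.lt_iff_lt h1 hz).1 (by rw [h0]; exact ha)
  have h4 : 0 < τ₂ := (hmono.lt_iff_lt hz h2).1 (by rw [h0]; exact hb)
  refine ⟨τ₁, ⟨h1.1, h3⟩, τ₂, ⟨h4, h2.2⟩, fun τ hτ => ?_, (hx.radius _).trans hra,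
    (hx.radius _).trans hrb⟩
  have hτ' : τ ∈ Set.Ioo (-lifetime m q s) (lifetime m q s) :=
    ⟨h1.1.trans hτ.1, hτ.2.trans h2.2⟩
  obtain ⟨h, hx'⟩ := hx.exterior (congruenceTime m q s τ)
    (hext _ ⟨hmono h1 hτ' hτ.1, hmono hτ' h2 hτ.2⟩)
  exact ⟨_, _, h, hx'⟩

/-! ### Conjugate points -/

theorem contDiffAt_sqrt_D (hm : 0 < m) (hqm : q ^ 2 ≤ m ^ 2) (hs : rPlus m q < s) (n : ℕ) :
    ContDiffAt ℝ n (fun s => √(D m q s)) s := by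
  have h1 : s ≠ 0 := by linarith [m_le_rPlus m q]
  refine ContDiffAt.sqrt ?_ (D_pos hm hqm hs).ne'
  unfold D
  fun_prop (disch := simp [h1])

theorem contDiffAt_congruenceTime (hm : 0 < m) (hqm : q ^ 2 ≤ m ^ 2) (hs : rPlus m q < s) {τ : ℝ}
    (hτ : τ ∈ Set.Ioo (-lifetime m q s) (lifetime m q s)) (n : ℕ) :
    ContDiffAt ℝ n (fun w : ℝ × ℝ => congruenceTime m q w.2 w.1) (τ, s) := by
  have h1 : s ≠ 0 := by linarith [m_le_rPlus m q]
  have hD := Real.sqrt_pos.2 (D_pos hm hqm hs)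
  have c1 : ContDiffAt ℝ n (fun w : ℝ × ℝ => √(D m q w.2)) (τ, s) :=
    ContDiffAt.comp (g := fun s => √(D m q s)) (τ, s) (contDiffAt_sqrt_D hm hqm hs n) contDiffAt_snd
  have c2 : ContDiffAt ℝ n (fun w : ℝ × ℝ => lifetime m q w.2) (τ, s) :=
    contDiffAt_const.div (contDiffAt_snd.mul c1) (mul_ne_zero h1 hD.ne')
  have c3 : ContDiffAt ℝ n (fun w : ℝ × ℝ => accel m q w.2) (τ, s) :=
    (contDiffAt_const.mul c1).div contDiffAt_snd h1
  refine (((c2.add contDiffAt_fst).log ?_).sub ((c2.sub contDiffAt_fst).log ?_)).div c3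
    (accel_pos hm hqm hs).ne'
  · have := hτ.1; dsimp only; linarith
  · have := hτ.2; dsimp only; linarith

/-- The congruence in static coordinates, as a function of `(τ, s, θ, φ)`. -/
def congruenceCoords (m q : ℝ) (p : Coord) : Coord :=
  ![extTime m q (congruenceTime m q (p 1) (p 0), p 1),
    extRadius m q (congruenceTime m q (p 1) (p 0), p 1), p 2, p 3]

/-- In static coordinates the tangent and deviation vectors form a block triangular matrix, whose
determinant is the product of the lapse `dσ/dτ` with the deviation in the `(t, r)` plane. -/
theorem linearIndependent_congruenceCoords (hm : 0 < m) (hqm : q ^ 2 ≤ m ^ 2) (hs : rPlus m q < s)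
    {τ : ℝ} (hτ : τ ∈ Set.Ioo (-lifetime m q s) (lifetime m q s))
    (hw : (congruenceTime m q s τ, s) ∈ exteriorDomain m q)
    (hdev : deviation m q (congruenceTime m q s τ, s) ≠ 0) {p : Coord} (h0 : p 0 = τ)
    (h1 : p 1 = s) : ContDiffAt ℝ 1 (congruenceCoords m q) p ∧
      LinearIndependent ℝ fun i : Fin 4 => fderiv ℝ (congruenceCoords m q) p (Pi.single i 1) := by
  subst h0 h1
  have cσ := contDiffAt_congruenceTime hm hqm hs hτ 1
  have ct := contDiffAt_extTime hm hqm hw 1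
  have cr := contDiffAt_extRadius hm hqm hw 1
  have cp : ContDiffAt ℝ 1 (fun p : Coord => (p 0, p 1)) p := by fun_prop
  have cσp : ContDiffAt ℝ 1 (fun p : Coord => (congruenceTime m q (p 1) (p 0), p 1)) p :=
    ContDiffAt.prodMk (ContDiffAt.comp (g := fun w : ℝ × ℝ => congruenceTime m q w.2 w.1) p cσ cp)
      (by fun_prop)
  have c0 : ContDiffAt ℝ 1
      (fun p : Coord => extTime m q (congruenceTime m q (p 1) (p 0), p 1)) p :=
    ContDiffAt.comp (g := extTime m q) p (by exact_mod_cast ct) cσp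
  have c1 : ContDiffAt ℝ 1
      (fun p : Coord => extRadius m q (congruenceTime m q (p 1) (p 0), p 1)) p :=
    ContDiffAt.comp (g := extRadius m q) p (by exact_mod_cast cr) cσp
  have hc : ContDiffAt ℝ 1 (congruenceCoords m q) p := by
    rw [contDiffAt_pi]
    intro i
    fin_cases i
    · exact c0
    · exact c1
    · exact (contDiff_apply ℝ ℝ (2 : Fin 4)).contDiffAt
    · exact (contDiff_apply ℝ ℝ (3 : Fin 4)).contDiffAt
  refine ⟨hc, ?_⟩
  have hL := (hc.differentiableAt (by simp)).hasFDerivAt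
  -- the columns of the Jacobian matrix are partial derivatives
  have hcol : ∀ i k : Fin 4, fderiv ℝ (congruenceCoords m q) p (Pi.single i 1) k =
      deriv (fun h => congruenceCoords m q (Function.update p i h) k) (p i) := by
    intro i k
    have hu : HasDerivAt (Function.update p i) (Pi.single i 1) (p i) := hasDerivAt_update p i (p i)
    have hL' : HasFDerivAt (congruenceCoords m q) (fderiv ℝ (congruenceCoords m q) p)
      (Function.update p i (p i)) := by rwa [Function.update_eq_self]
    have := hasDerivAt_pi.1 (hL'.comp_hasDerivAt (p i) hu) k
    exact this.deriv.symm
  set w : ℝ × ℝ := (congruenceTime m q (p 1) (p 0), p 1) with hwdef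
  have dσ := cσ.differentiableAt (by simp)
  have hσ0 : HasDerivAt (congruenceTime m q (p 1))
      (properTimeRate (accel m q (p 1)) (lifetime m q (p 1)) (p 0)) (p 0) :=
    hasDerivAt_properTime (accel_pos hm hqm hs) hτ.1 hτ.2
  set ν := properTimeRate (accel m q (p 1)) (lifetime m q (p 1)) (p 0)
  set μ := fderiv ℝ (fun w : ℝ × ℝ => congruenceTime m q w.2 w.1) (p 0, p 1) (0, 1)
  have hσ1 : HasDerivAt (fun s => congruenceTime m q s (p 0)) μ (p 1) := hasDerivAt_snd dσ
  have hν : 0 < ν := properTimeRate_pos (accel_pos hm hqm hs) hτ.1 hτ.2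
  have d0 : ∀ f : ℝ × ℝ → ℝ, DifferentiableAt ℝ f w →
      deriv (fun h => f (congruenceTime m q (p 1) h, p 1)) (p 0) = ν * fderiv ℝ f w (1, 0) := by
    intro f hf
    have := hf.hasFDerivAt.comp_hasDerivAt (p 0) (hσ0.prodMk (hasDerivAt_const (p 0) (p 1)))
    rw [show (ν, (0 : ℝ)) = ν • ((1 : ℝ), (0 : ℝ)) by simp, map_smul, smul_eq_mul] at this
    exact this.deriv
  have d1 : ∀ f : ℝ × ℝ → ℝ, DifferentiableAt ℝ f w →
      deriv (fun h => f (congruenceTime m q h (p 0), h)) (p 1) =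
        μ * fderiv ℝ f w (1, 0) + fderiv ℝ f w (0, 1) := by
    intro f hf
    have := HasFDerivAt.comp_hasDerivAt (f := fun h => (congruenceTime m q h (p 0), h)) (p 1)
      hf.hasFDerivAt (hσ1.prodMk (hasDerivAt_id (p 1)))
    rw [show (μ, (1 : ℝ)) = μ • ((1 : ℝ), (0 : ℝ)) + (0, 1) by simp, map_add, map_smul,
      smul_eq_mul] at this
    exact this.deriv
  have dt := ct.differentiableAt (by simp)
  have dr := cr.differentiableAt (by simp)
  rw [Fintype.linearIndependent_iff]
  intro g hg
  have key : ∀ k : Fin 4,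
      ∑ i, g i * deriv (fun h => congruenceCoords m q (Function.update p i h) k) (p i) = 0 := by
    intro k
    have := congrFun hg k
    simpa only [Finset.sum_apply, Pi.smul_apply, hcol, smul_eq_mul, Pi.zero_apply] using this
  have k0 := key 0
  have k1 := key 1
  have k2 := key 2
  have k3 := key 3
  simp [Fin.sum_univ_four, congruenceCoords, Function.update] at k0 k1 k2 k3
  rw [d0 _ dt, d1 _ dt] at k0
  rw [d0 _ dr, d1 _ dr] at k1
  unfold deviation at hdev
  set t₀ := fderiv ℝ (extTime m q) w (1, 0)
  set t₁ := fderiv ℝ (extTime m q) w (0, 1)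
  set r₀ := fderiv ℝ (extRadius m q) w (1, 0)
  set r₁ := fderiv ℝ (extRadius m q) w (0, 1)
  have g1 : g 1 = 0 := by
    refine (mul_eq_zero.1 ?_).resolve_right hdev
    linear_combination t₀ * k1 - r₀ * k0
  have g0 : g 0 = 0 := by
    refine (mul_eq_zero.1 ?_).resolve_right (mul_ne_zero hν.ne' hdev)
    rw [g1] at k0 k1
    linear_combination r₁ * k0 - t₁ * k1
  intro i
  fin_cases i
  exacts [g0, g1, k2, k3]

/-- In the exterior region the curves have the static coordinates `congruenceCoords`, in a
neighbourhood of the parameters, so that conjugate points are zeros of the deviation. -/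
theorem notConjugateAt {r : ℝ → ℝ → ℝ} {x : ℝ → ℝ → Base m q}
    (hx : ∀ s, rPlus m q < s → IsBaseCurve m q s (r s) (x s))
    (hm : 0 < m) (hqm : q ^ 2 ≤ m ^ 2) (hs : rPlus m q < s)
    {τ : ℝ} (hτ : τ ∈ Set.Ioo (-lifetime m q s) (lifetime m q s))
    (hw : (congruenceTime m q s τ, s) ∈ exteriorDomain m q)
    (hdev : deviation m q (congruenceTime m q s τ, s) ≠ 0) (ω : S2) :
    NotConjugateAt m q (fun s ω τ => (x s (congruenceTime m q s τ), ω)) s ω τ := by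
  obtain ⟨R, hR⟩ := exists_axes ω
  obtain ⟨h1, h2⟩ := linearIndependent_congruenceCoords hm hqm hs hτ hw hdev
    (p := ![τ, s, Real.pi / 2, 0]) rfl rfl
  have hpi := Real.pi_pos
  refine ⟨.static, R, congruenceCoords m q, ![τ, s, Real.pi / 2, 0], rfl, rfl, ?_, ?_, hR, ?_,
    h1, h2⟩
  · simpa using hpi
  · simpa using hpi
  have e1 : ∀ᶠ p' : Coord in 𝓝 ![τ, s, Real.pi / 2, 0], 0 < p' 2 ∧ p' 2 < Real.pi := by
    have hc : ContinuousAt (fun p' : Coord => p' 2) ![τ, s, Real.pi / 2, 0] :=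
      (continuous_apply 2).continuousAt
    exact (hc.eventually (lt_mem_nhds (by simpa using hpi))).and
      (hc.eventually (gt_mem_nhds (by simpa using hpi)))
  have e2 : ∀ᶠ p' : Coord in 𝓝 ![τ, s, Real.pi / 2, 0],
      (congruenceTime m q (p' 1) (p' 0), p' 1) ∈ exteriorDomain m q := by
    have hc : ContinuousAt (fun p' : Coord => (congruenceTime m q (p' 1) (p' 0), p' 1))
        ![τ, s, Real.pi / 2, 0] := by
      refine ContinuousAt.prodMk ?_ (continuous_apply 1).continuousAt
      exact (contDiffAt_congruenceTime hm hqm hs hτ 1).continuousAt.comp_of_eq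
        (f := fun p' : Coord => (p' 0, p' 1))
        ((continuous_apply 0).prodMk (continuous_apply 1)).continuousAt rfl
    exact hc.eventually ((isOpen_exteriorDomain hm hqm).mem_nhds hw)
  filter_upwards [e1, e2] with p' ⟨h3, h4⟩ h5 ω' hω'
  exact ⟨(hx (p' 1) (exteriorDomain_snd h5)).exterior _ h5, h3, h4, hω'⟩

end

end RN

end

theorem mainTheorem1 (m q : ℝ) (hm : 0 < m) (hq : q ≠ 0) (hqm : q ^ 2 ≤ m ^ 2) :
    ∃ (T : ℝ → ℝ) (x : ℝ → RN.S2 → ℝ → RN.Spacetime m q) (σ : ℝ → ℝ → ℝ),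
      -- `x rStar ω` is the curve of the congruence from `(rStar, ω)`, with conformal proper time
      -- in `(-T rStar, T rStar)`, and `σ rStar` is its physical proper time
      (∀ rStar, RN.rPlus m q < rStar → ∀ ω : RN.S2,
        RN.IsCongruenceCurve m q rStar ω (T rStar) (x rStar ω) (σ rStar)) ∧
      -- (a)
      (∀ rStar, RN.rPlus m q < rStar →
        Set.BijOn (σ rStar) (Set.Ioo (-T rStar) (T rStar)) Set.univ) ∧
      (∀ rStar, RN.rCrit m q < rStar → ∀ ω : RN.S2,
        RN.ReachesFutureNullInfinity m q (x rStar ω) (𝓝[<] T rStar) ∧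
        RN.ReachesPastNullInfinity m q (x rStar ω) (𝓝[>] (-T rStar)) ∧
        Tendsto (σ rStar) (𝓝[<] T rStar) atTop ∧
        Tendsto (σ rStar) (𝓝[>] (-T rStar)) atBot) ∧
      (∀ rStar, rStar = RN.rCrit m q → ∀ ω : RN.S2,
        RN.ReachesFutureTimelikeInfinity m q (x rStar ω) (𝓝[<] T rStar) ∧
        RN.ReachesPastTimelikeInfinity m q (x rStar ω) (𝓝[>] (-T rStar)) ∧
        Tendsto (σ rStar) (𝓝[<] T rStar) atTop ∧
        Tendsto (σ rStar) (𝓝[>] (-T rStar)) atBot) ∧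
      (∀ rStar, RN.rPlus m q < rStar → rStar < RN.rCrit m q → ∀ ω : RN.S2,
        ∃ τ₁ ∈ Set.Ioo (-T rStar) 0, ∃ τ₂ ∈ Set.Ioo 0 (T rStar),
          (∀ τ ∈ Set.Ioo τ₁ τ₂, x rStar ω τ ∈ RN.domainOfOuterCommunication m q) ∧
          RN.radius m q (x rStar ω τ₁) = RN.rPlus m q ∧
          RN.radius m q (x rStar ω τ₂) = RN.rPlus m q) ∧
      -- (b)
      (q ^ 2 ≤ 8 / 9 * m ^ 2 →
        ∀ rStar, RN.rPlus m q < rStar → ∀ ω : RN.S2, ∀ τ ∈ Set.Ioo (-T rStar) (T rStar),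
          x rStar ω τ ∈ RN.domainOfOuterCommunication m q →
            RN.NotConjugateAt m q x rStar ω τ) ∧
      (q ^ 2 = m ^ 2 →
        ∃ r₀ ∈ Set.Ioo (RN.rPlus m q) (RN.rCrit m q),
          ∀ rStar, r₀ < rStar → ∀ ω : RN.S2, ∀ τ ∈ Set.Ioo (-T rStar) (T rStar),
            x rStar ω τ ∈ RN.domainOfOuterCommunication m q →
              RN.NotConjugateAt m q x rStar ω τ) := by
  have hM := RN.hasRadialMotions hm hq hqm
  choose r x hx hhor using fun (s : Set.Ioi (RN.rPlus m q)) => RN.exists_baseCurve hm hq hqm s.2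
  have hne : Nonempty (RN.Base m q) := ⟨x ⟨_, RN.rPlus_lt_rCrit hm hqm⟩ 0⟩
  classical
  -- the values for `s ≤ r₊` play no role
  let r' : ℝ → ℝ → ℝ := fun s => if h : RN.rPlus m q < s then r ⟨s, h⟩ else fun _ => 0
  let x' : ℝ → ℝ → RN.Base m q := fun s =>
    if h : RN.rPlus m q < s then x ⟨s, h⟩ else fun _ => hne.some
  have hx' : ∀ s, RN.rPlus m q < s → RN.IsBaseCurve m q s (r' s) (x' s) := by
    intro s h
    simp only [r', x', h, dif_pos]
    exact hx ⟨s, h⟩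
  have hhor' : ∀ s, RN.rPlus m q < s → s < RN.rCrit m q → ∃ a b, a < 0 ∧ 0 < b ∧
      (∀ t ∈ Set.Ioo a b, (t, s) ∈ RN.exteriorDomain m q) ∧
      r' s a = RN.rPlus m q ∧ r' s b = RN.rPlus m q := by
    intro s h hc
    simp only [r', h, dif_pos]
    exact hhor ⟨s, h⟩ hc
  have hnc : ∀ s, RN.rPlus m q < s →
      (q ^ 2 ≤ 8 / 9 * m ^ 2 ∨ q ^ 2 = m ^ 2 ∧ 29 / 20 * m < s) →
      ∀ ω : RN.S2, ∀ τ ∈ Set.Ioo (-RN.lifetime m q s) (RN.lifetime m q s),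
      ((x' s (RN.congruenceTime m q s τ), ω) : RN.Spacetime m q) ∈
        RN.domainOfOuterCommunication m q →
      RN.NotConjugateAt m q (fun s ω τ => (x' s (RN.congruenceTime m q s τ), ω)) s ω τ := by
    intro s hs hc ω τ hτ hd
    have hw := (hx' s hs).mem_exterior _ ((RN.mem_domainOfOuterCommunication_iff _ ω).1 hd)
    exact RN.notConjugateAt hx' hm hqm hs hτ hw (hM.deviation_pos hm hqm hw hc).ne' ω
  refine ⟨RN.lifetime m q, fun s ω τ => (x' s (RN.congruenceTime m q s τ), ω),
    RN.congruenceTime m q, fun s hs ω => (hx' s hs).isCongruenceCurve hM hm hqm hs ω,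
    fun s hs => RN.bijOn_properTime (RN.accel_pos hm hqm hs) (RN.lifetime_pos hm hqm hs),
    fun s hs ω => ?_, fun s hs ω => ?_, fun s hs hc ω => ?_, fun hc s hs => hnc s hs (Or.inl hc),
    fun hc => ?_⟩
  · have hs' := (RN.rPlus_lt_rCrit hm hqm).trans hs
    obtain ⟨h1, h2⟩ := (hx' s hs').reachesNullInfinity hm hqm hs ω
    exact ⟨h1, h2, RN.tendsto_congruenceTime hm hqm hs'⟩
  · have hs' : RN.rPlus m q < s := hs ▸ RN.rPlus_lt_rCrit hm hqm
    obtain ⟨h1, h2⟩ := (hx' s hs').reachesTimelikeInfinity hm hqm hs ω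
    exact ⟨h1, h2, RN.tendsto_congruenceTime hm hqm hs'⟩
  · obtain ⟨a, b, ha, hb, hext, hra, hrb⟩ := hhor' s hs hc
    exact (hx' s hs).reachesHorizon hm hqm hs ha hb hext hra hrb ω
  · -- here `r₊ = m` and `r_⊛ = 3 m / 2`
    have hp : RN.rPlus m q = m := by simp [RN.rPlus, hc]
    have hcr := RN.rCrit_ge (m := m) (q := q) hqm
    refine ⟨29 / 20 * m, ⟨by rw [hp]; linarith, by linarith⟩, fun s hs => ?_⟩
    exact hnc s (by rw [hp]; linarith) (Or.inr ⟨hc, hs⟩)
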